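/- **Model.** Algorithms are deterministic programs on a word RAM with unit-cost word operations (arithmetic, comparison, bitwise operations, indirect addressing) and words of $O(\log(\text{input size}))$ bits. The *APSP conjecture* states that for every $\varepsilon>0$ there is a constant $c$ such that no algorithm computes all pairwise distances in $n$-node directed graphs with integer edge weights in $[-n^c,n^c]$ and no negative cycles in time $O(n^{3-\varepsilon})$. In the *dynamic maximum weight matching problem* for a class of embedded graphs, a fixed embedded graph $H$ of the class on $N$ nodes is given (the nodes are placed at distinct integer points with coordinates in $\{0,\dots,N\}$, and edges are straight-line segments). The algorithm may preprocess $H$ in time $O(N^p)$ for a constant $p$. It then maintains a weighted subgraph $G$ of $H$ on the same nodes, initially without edges, under insertions of edges of $H$ with integer weights in $[0,N^c]$ and deletions of edges; a query asks for the maximum weight of a matching of $G$. It has amortized update time $u(N)$ and query time $q(N)$ if every sequence of $a$ updates and $b$ queries, together with the preprocessing, takes total time at most $a\,u(N)+b\,q(N)+O(N^p)$. **Theorem 3.** Assume the APSP conjecture. Consider either of the following two classes: bipartite plane graphs (straight-line planar embeddings of bipartite graphs), or grid graphs (subgraphs of the infinite grid $\mathbb Z^2$). For every $\varepsilon>0$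 and every preprocessing exponent $p$ there is a constant $c$ such that no algorithm solves dynamic maximum weight matching for this class, with edge weights at most $N^c$, with amortized query time $q(N)$ and amortized update time $u(N)$ such that $$\max(q(N),u(N))=O(N^{1/2-\varepsilon}).$$ Likewise, no such algorithm has $q(N)\ge u(N)$ for all sufficiently large $N$ and $$q(N)\cdot u(N)=O(N^{1-\varepsilon}).$$ In particular this holds although the planar embedding never changes. -/

import Mathlib

open Filter Asymptotics

namespace FineGrained

/-! ### The machine: a random access machine with unit-cost word instructions

A state has registers and arrays of words, addressed by words; a program mentions only finitely many
registers and arrays. A word is an integer, and a run with word bound `W` may only compute integers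
of absolute value at most `W`. The word length `O(log n)` of the word RAM is the requirement
`W ≤ (n + 2) ^ C` for a constant `C`, made where algorithms are specified below. -/

/-- The binary instructions on words (comparisons give `0` or `1`; bitwise operations are in two's
complement; shifts are by the number in the second operand). -/
inductive BinOp
  | add | sub | mul | div | mod | lt | eq | and | or | xor | shl | shr

/-- The value computed by a binary instruction. -/
def BinOp.val : BinOp → ℤ → ℤ → ℤ
  | .add, a, b => a + b
  | .sub, a, b => a - b
  | .mul, a, b => a * b
  | .div, a, b => a / b
  | .mod, a, b => a % b
  | .lt, a, b => if a < b then 1 else 0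
  | .eq, a, b => if a = b then 1 else 0
  | .and, a, b => Int.land a b
  | .or, a, b => Int.lor a b
  | .xor, a, b => Int.xor a b
  | .shl, a, b => a * 2 ^ b.toNat
  | .shr, a, b => a / 2 ^ b.toNat

/-- Memory of the machine: registers `reg r` and arrays `arr A`, `arr A a` being the cell of array
`A` with address `a`. -/
structure State where
  reg : ℕ → ℤ
  arr : ℕ → ℤ → ℤ

/-- The state after writing `v` to register `r`. -/
def State.setReg (σ : State) (r : ℕ) (v : ℤ) : State :=
  { σ with reg := Function.update σ.reg r v }

/-- The state after writing `v` to cell `a` of array `A`. -/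
def State.setCell (σ : State) (A : ℕ) (a v : ℤ) : State :=
  { σ with arr := Function.update σ.arr A (Function.update (σ.arr A) a v) }

/-- Programs. -/
inductive Prog
  /-- do nothing -/
  | skip
  /-- `reg r := k` -/
  | const (r : ℕ) (k : ℤ)
  /-- `reg r := reg a ∘ reg b` -/
  | bin (o : BinOp) (r a b : ℕ)
  /-- `reg r := A[reg a]` -/
  | load (r A a : ℕ)
  /-- `A[reg a] := reg b` -/
  | store (A a b : ℕ)
  /-- run the first program, then the second -/
  | seq (P Q : Prog)
  /-- `if reg r ≠ 0 then P else Q` -/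
  | cond (r : ℕ) (P Q : Prog)
  /-- `while reg r ≠ 0 do P` -/
  | loop (r : ℕ) (P : Prog)

/-- `Run W P σ t σ'`: started in state `σ`, the program `P` halts after exactly `t` steps in state
`σ'`, and every word computed on the way has absolute value at most `W`. Each executed instruction
and each test costs one step. -/
inductive Run (W : ℕ) : Prog → State → ℕ → State → Prop
  | skip (σ : State) : Run W .skip σ 1 σ
  | const (σ : State) (r : ℕ) (k : ℤ) : |k| ≤ W → Run W (.const r k) σ 1 (σ.setReg r k)
  | bin (σ : State) (o : BinOp) (r a b : ℕ) : |o.val (σ.reg a) (σ.reg b)| ≤ W →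
      Run W (.bin o r a b) σ 1 (σ.setReg r (o.val (σ.reg a) (σ.reg b)))
  | load (σ : State) (r A a : ℕ) : Run W (.load r A a) σ 1 (σ.setReg r (σ.arr A (σ.reg a)))
  | store (σ : State) (A a b : ℕ) :
      Run W (.store A a b) σ 1 (σ.setCell A (σ.reg a) (σ.reg b))
  | seq {P Q : Prog} {σ σ₁ σ₂ : State} {t₁ t₂ : ℕ} : Run W P σ t₁ σ₁ → Run W Q σ₁ t₂ σ₂ →
      Run W (.seq P Q) σ (t₁ + t₂) σ₂
  | cond_true {r : ℕ} {P Q : Prog} {σ σ' : State} {t : ℕ} : σ.reg r ≠ 0 → Run W P σ t σ' →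
      Run W (.cond r P Q) σ (t + 1) σ'
  | cond_false {r : ℕ} {P Q : Prog} {σ σ' : State} {t : ℕ} : σ.reg r = 0 → Run W Q σ t σ' →
      Run W (.cond r P Q) σ (t + 1) σ'
  | loop_done {r : ℕ} {P : Prog} {σ : State} : σ.reg r = 0 → Run W (.loop r P) σ 1 σ
  | loop_step {r : ℕ} {P : Prog} {σ σ₁ σ₂ : State} {t₁ t₂ : ℕ} : σ.reg r ≠ 0 →
      Run W P σ t₁ σ₁ → Run W (.loop r P) σ₁ t₂ σ₂ → Run W (.loop r P) σ (t₁ + t₂ + 1) σ₂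

/-- The contents of an array that holds the vector `v` in cells `0, …, k - 1` and `0` elsewhere. -/
def vecArr {k : ℕ} (v : Fin k → ℤ) : ℤ → ℤ :=
  fun a => if h : 0 ≤ a ∧ a.toNat < k then v ⟨a.toNat, h.2⟩ else 0

/-- The contents of an array that holds the matrix `M` row by row: `M i j` is in cell `n * i + j`. -/
def matArr {m n : ℕ} (M : Fin m → Fin n → ℤ) : ℤ → ℤ :=
  vecArr fun k : Fin (m * n) => M (finProdFinEquiv.symm k).1 (finProdFinEquiv.symm k).2

/-! ### All pairs shortest paths -/

/-- A directed graph on `n` nodes with integer edge weights; `none` means that there is no edge. -/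
abbrev WDigraph (n : ℕ) := Fin n → Fin n → Option ℤ

/-- `IsWalk w i j x`: there is a walk from `i` to `j` of total weight `x`. -/
inductive IsWalk {n : ℕ} (w : WDigraph n) : Fin n → Fin n → ℤ → Prop
  | nil (i : Fin n) : IsWalk w i i 0
  | cons {i k j : Fin n} {a x : ℤ} : w i k = some a → IsWalk w k j x → IsWalk w i j (a + x)

/-- The weights are at most `n ^ c` in absolute value, and there is no cycle of negative weight. -/
def APSPInstance {n : ℕ} (c : ℕ) (w : WDigraph n) : Prop :=
  (∀ i j a, w i j = some a → |a| ≤ (n : ℤ) ^ c) ∧ ∀ i x, IsWalk w i i x → 0 ≤ x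

/-- The input: register `0` holds `n`, array `0` the adjacency matrix, array `1` the weights. -/
def apspInput {n : ℕ} (w : WDigraph n) : State where
  reg := Function.update (fun _ => 0) 0 (n : ℤ)
  arr A :=
    if A = 0 then matArr (fun i j => if (w i j).isSome then 1 else 0)
    else if A = 1 then matArr (fun i j => (w i j).getD 0)
    else fun _ => 0

/-- The output: in cell `n * i + j`, array `2` holds `0` if there is no walk from `i` to `j`;
otherwise it holds `1`, and array `3` holds the distance from `i` to `j`. -/
def APSPOutput {n : ℕ} (w : WDigraph n) (σ : State) : Prop :=
  ∀ i j : Fin n,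
    (σ.arr 2 (n * i + j) = 0 ∧ ∀ x, ¬ IsWalk w i j x) ∨
    (σ.arr 2 (n * i + j) = 1 ∧ IsLeast {x | IsWalk w i j x} (σ.arr 3 (n * i + j)))

/-- `P` solves APSP on `n` nodes with integer weights in `[-n ^ c, n ^ c]` and words of `O(log n)`
bits in time `T n`. -/
def SolvesAPSP (c : ℕ) (P : Prog) (T : ℕ → ℝ) : Prop :=
  ∃ C : ℕ, ∀ (n : ℕ) (w : WDigraph n), APSPInstance c w →
    ∃ (t : ℕ) (σ : State), Run ((n + 2) ^ C) P (apspInput w) t σ ∧ (t : ℝ) ≤ T n ∧ APSPOutput w σ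

/-- The APSP conjecture: for no `ε > 0` can APSP with polynomially bounded integer weights be solved
in time `O(n ^ (3 - ε))`. -/
def APSPConjecture : Prop :=
  ∀ ε : ℝ, 0 < ε → ∃ c : ℕ, ∀ (P : Prog) (T : ℕ → ℝ), SolvesAPSP c P T →
    ¬ T =O[atTop] fun n : ℕ => (n : ℝ) ^ (3 - ε)

/-! ### Graphs drawn in the plane -/

/-- A graph on `N` nodes that are placed at integer points of the plane; its edges are the straight
line segments between adjacent nodes. -/
structure Drawing (N : ℕ) where
  pos : Fin N → ℕ × ℕ
  graph : SimpleGraph (Fin N)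

/-- The position of a node as a point of the real plane. -/
def Drawing.pt {N : ℕ} (D : Drawing N) (i : Fin N) : ℝ × ℝ := ((D.pos i).1, (D.pos i).2)

/-- Distinct nodes have distinct positions, with coordinates at most `N`. -/
def Drawing.Placed {N : ℕ} (D : Drawing N) : Prop :=
  Function.Injective D.pos ∧ ∀ i, (D.pos i).1 ≤ N ∧ (D.pos i).2 ≤ N

/-- The drawing is a planar embedding: edges contain no nodes other than their ends, and distinct
edges have no interior points in common. -/
def Drawing.Planar {N : ℕ} (D : Drawing N) : Prop :=
  (∀ i j k, D.graph.Adj i j → D.pt k ∉ openSegment ℝ (D.pt i) (D.pt j)) ∧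
  ∀ i j k l, D.graph.Adj i j → D.graph.Adj k l → s(i, j) ≠ s(k, l) →
    Disjoint (openSegment ℝ (D.pt i) (D.pt j)) (openSegment ℝ (D.pt k) (D.pt l))

/-- A class of drawn graphs. -/
abbrev DrawingClass := (N : ℕ) → Drawing N → Prop

/-- Bipartite plane graphs. -/
def bipartitePlane : DrawingClass :=
  fun _ D => D.Placed ∧ D.Planar ∧ D.graph.IsBipartite

/-- Grid graphs, that is, subgraphs of the infinite grid. -/
def gridGraphs : DrawingClass :=
  fun _ D => D.Placed ∧ ∀ i j, D.graph.Adj i j →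
    |((D.pos i).1 : ℤ) - (D.pos j).1| + |((D.pos i).2 : ℤ) - (D.pos j).2| = 1

/-! ### Dynamic maximum weight matching -/

/-- A weighted graph on `N` nodes; `none` means that there is no edge. -/
abbrev WGraph (N : ℕ) := Sym2 (Fin N) → Option ℕ

/-- The underlying graph. -/
def WGraph.toGraph {N : ℕ} (G : WGraph N) : SimpleGraph (Fin N) :=
  SimpleGraph.fromEdgeSet {e | (G e).isSome}

open Classical in
/-- The weight of a subgraph. -/
noncomputable def WGraph.weight {N : ℕ} (G : WGraph N) (M : G.toGraph.Subgraph) : ℕ :=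
  ∑ e with e ∈ M.edgeSet, (G e).getD 0

/-- `v` is the maximum weight of a matching of `G`. -/
def WGraph.IsMaxMatchingWeight {N : ℕ} (G : WGraph N) (v : ℤ) : Prop :=
  IsGreatest {x : ℤ | ∃ M : G.toGraph.Subgraph, M.IsMatching ∧ x = G.weight M} v

/-- The operations on a dynamic graph on `N` nodes. -/
inductive Op (N : ℕ)
  /-- insert an edge between `i` and `j` of weight `w` -/
  | insert (i j : Fin N) (w : ℕ)
  /-- delete the edge between `i` and `j` -/
  | delete (i j : Fin N)
  /-- ask for the maximum weight of a matching -/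
  | query

/-- Whether an operation is a query. -/
def Op.isQuery {N : ℕ} : Op N → Bool
  | .query => true
  | _ => false

/-- `Legal H c G ops`: starting from `G`, the operations `ops` only insert edges that are absent,
lie in `H` and have weight at most `N ^ c`, and only delete edges that are present. -/
def Legal {N : ℕ} (H : SimpleGraph (Fin N)) (c : ℕ) : WGraph N → List (Op N) → Prop
  | _, [] => True
  | G, .insert i j w :: ops => H.Adj i j ∧ G s(i, j) = none ∧ w ≤ N ^ c ∧
      Legal H c (Function.update G s(i, j) (some w)) ops
  | G, .delete i j :: ops => G s(i, j) ≠ none ∧ Legal H c (Function.update G s(i, j) none) ops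
  | G, .query :: ops => Legal H c G ops

/-- A dynamic algorithm: a program for preprocessing and one for each kind of operation. They work
on a common memory that persists between the operations. -/
structure DynamicAlgorithm where
  init : Prog
  insert : Prog
  delete : Prog
  query : Prog

open Classical in
/-- The input of the preprocessing, which is the fixed embedded graph to which all edges will belong:
register `0` holds `N`, arrays `0` and `1` the coordinates of the nodes, array `2` the adjacency
matrix. -/
noncomputable def Drawing.input {N : ℕ} (D : Drawing N) : State where
  reg := Function.update (fun _ => 0) 0 (N : ℤ)
  arr A :=
    if A = 0 then vecArr (fun i => ((D.pos i).1 : ℤ))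
    else if A = 1 then vecArr (fun i => ((D.pos i).2 : ℤ))
    else if A = 2 then matArr (fun i j => if D.graph.Adj i j then 1 else 0)
    else fun _ => 0

/-- `Serves W P σ G ops t`: when the memory is `σ` and the current graph is `G`, the algorithm `P`
performs the operations `ops` one after the other in `t` steps in total, answering all queries
correctly. The arguments of an operation are passed in registers `0`, `1`, `2`, and the answer to a
query is returned in register `0`. -/
inductive Serves {N : ℕ} (W : ℕ) (P : DynamicAlgorithm) :
    State → WGraph N → List (Op N) → ℕ → Prop
  | nil (σ : State) (G : WGraph N) : Serves W P σ G [] 0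
  | insert {σ σ' : State} {G : WGraph N} {i j : Fin N} {w : ℕ} {ops : List (Op N)} {t t' : ℕ} :
      Run W P.insert (((σ.setReg 0 (i : ℕ)).setReg 1 (j : ℕ)).setReg 2 w) t σ' →
      Serves W P σ' (Function.update G s(i, j) (some w)) ops t' →
      Serves W P σ G (.insert i j w :: ops) (t + t')
  | delete {σ σ' : State} {G : WGraph N} {i j : Fin N} {ops : List (Op N)} {t t' : ℕ} :
      Run W P.delete ((σ.setReg 0 (i : ℕ)).setReg 1 (j : ℕ)) t σ' →
      Serves W P σ' (Function.update G s(i, j) none) ops t' →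
      Serves W P σ G (.delete i j :: ops) (t + t')
  | query {σ σ' : State} {G : WGraph N} {ops : List (Op N)} {t t' : ℕ} :
      Run W P.query σ t σ' → G.IsMaxMatchingWeight (σ'.reg 0) →
      Serves W P σ' G ops t' →
      Serves W P σ G (.query :: ops) (t + t')

/-- `P` solves dynamic maximum weight matching for the class `𝒞` with amortized query time `q N` and
amortized update time `u N`, after preprocessing in time `O(N ^ p)`: for every embedded graph `D` in
`𝒞` on `N` nodes and every legal sequence of operations on subgraphs of `D` with weights at most
`N ^ c`, starting from the graph without edges, it answers all queries correctly, in a total time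
bounded by the preprocessing time plus `u N` per update and `q N` per query. Words have
`O(log (N + m))` bits, where `m` is the number of operations. -/
def SolvesDynamicMWM (𝒞 : DrawingClass) (c p : ℕ) (P : DynamicAlgorithm) (q u : ℕ → ℝ) : Prop :=
  ∃ K C : ℕ, ∀ (N : ℕ) (D : Drawing N), 𝒞 N D →
    ∀ ops : List (Op N), Legal D.graph c (fun _ => none) ops →
      ∃ (t₀ t : ℕ) (σ : State),
        Run ((N + ops.length + 2) ^ C) P.init D.input t₀ σ ∧
        Serves ((N + ops.length + 2) ^ C) P σ (fun _ => none) ops t ∧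
        ((t₀ + t : ℕ) : ℝ) ≤ K * (N + 1 : ℝ) ^ p +
          ops.countP (fun o => !o.isQuery) * u N + ops.countP (fun o => o.isQuery) * q N

end FineGrained

open FineGrained

namespace FineGrained

/-! ### Runs: monotonicity, determinism, renaming -/

/-! A fast dynamic matching algorithm on grids yields a fast min-plus product of matrices, and
repeated min-plus squaring solves APSP. The grid lies in both classes (`gridDrawing_mem`), and the
reduction only inserts and deletes edges of a fixed grid.

The gadget. Take an `r × 2m` array of cells in which a path moves right or down, with a price for
each move. In the grid each cell becomes a horizontal edge of a large weight `L`; these edges,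
together with those of the rows in between, form a matching `M`. The moves become the remaining
edges, of weight `L` minus the price. Attaching a source node above column `c0` and a sink node
below column `c1` creates augmenting paths for `M`, which correspond to the monotone paths from the
top of column `c0` to the bottom of column `c1`. So the maximum weight of a matching is a known
constant minus the price of a cheapest path. `Gadget.isMax` proves this by linear programming
duality: a potential on the cells gives node values whose sum bounds every matching and is attained
by the matching along one explicit path (`WGraph.isMaxMatchingWeight_of_dual`).

Reading a minimum. To find the minimum of `a k + b k j` over `k`, let the moves to the right in row
`k` be free up to column `m - 1`, let the next one cost `a k + b k 0` and the later ones `b k (j +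
1) - b k j`, all raised by `2V` to make them nonnegative. By telescoping, row `k` up to column `m +
j` costs `a k + b k j` plus known terms. Moves down have the prices `4V i (2m - 1 - i)`, which agree
in the columns `m - 1 - j` and `m + j` and are so much higher in between that changing rows there
never pays. One source and sink thus read the minimum for one `j` (`block_isMax`).

Counting. The `np × np` product is cut into `np² / (rm)` blocks `b` of size `r × m`. A block takes
`O(rm)` updates; for each of the `np` rows `a` come `O(r)` updates and `m` queries with four updates
each. With times `U ≤ Q` per update and query the total is of order `np³ (U / m + Q / r)`. If `U Q`
is polynomially smaller than the grid, the shape of the grid can be chosen so that `U / m` and `Q /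
r` are at most `b⁻³`, where `b` is about `n^(1/g)` (`exists_shape`). This beats cubic time even
after `g b` squarings.

Unknown running times. The functions `q` and `u` need not be computable, so the program cannot know
the right shape. It tries all shapes `r = b^(k+2)`, `m = b^(d+2-k)` with `k ≤ d`, each with its own
copy of the dynamic algorithm under a budget of about `np³ / b` steps (`Run.budget`). Answers given
within the budget are always correct, so a shape writes its output only if the budget lasted, and
for at least one shape it does.

The reduction is a program of the machine. The calculus `Env.WP` tracks its memory, a potential that
pays for budgeted steps, and the weight of the operations made so far; determinism (`Run.det`) turns
the promise about whole sequences of operations into one about single calls. -/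

theorem Run.mono {W W' : ℕ} (h : W ≤ W') {P : Prog} {σ σ' : State} {t : ℕ}
    (r : Run W P σ t σ') : Run W' P σ t σ' := by
  have hc : (W : ℤ) ≤ W' := by exact_mod_cast h
  induction r with
  | skip σ => exact .skip σ
  | const σ r k hk => exact .const σ r k (hk.trans hc)
  | bin σ o r a b hk => exact .bin σ o r a b (hk.trans hc)
  | load σ r A a => exact .load σ r A a
  | store σ A a b => exact .store σ A a b
  | seq _ _ ih₁ ih₂ => exact .seq ih₁ ih₂
  | cond_true h _ ih => exact .cond_true h ih
  | cond_false h _ ih => exact .cond_false h ih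
  | loop_done h => exact .loop_done h
  | loop_step h _ _ ih₁ ih₂ => exact .loop_step h ih₁ ih₂

/-- Determinism makes the run for a first operation independent of the operations that follow. The
word bounds of the two runs may differ, because the bound granted to a dynamic algorithm depends on
the length of the whole sequence. -/
theorem Run.det {W W' : ℕ} {P : Prog} {σ σ₁ σ₂ : State} {t₁ t₂ : ℕ}
    (r₁ : Run W P σ t₁ σ₁) (r₂ : Run W' P σ t₂ σ₂) : t₁ = t₂ ∧ σ₁ = σ₂ := by
  induction r₁ generalizing t₂ σ₂ with
  | skip σ => cases r₂; exact ⟨rfl, rfl⟩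
  | const σ r k hk => cases r₂; exact ⟨rfl, rfl⟩
  | bin σ o r a b hk => cases r₂; exact ⟨rfl, rfl⟩
  | load σ r A a => cases r₂; exact ⟨rfl, rfl⟩
  | store σ A a b => cases r₂; exact ⟨rfl, rfl⟩
  | seq _ _ ih₁ ih₂ =>
    cases r₂ with
    | seq a b =>
      obtain ⟨rfl, rfl⟩ := ih₁ a
      obtain ⟨rfl, rfl⟩ := ih₂ b
      exact ⟨rfl, rfl⟩
  | cond_true h _ ih =>
    cases r₂ with
    | cond_true _ a => obtain ⟨rfl, rfl⟩ := ih a; exact ⟨rfl, rfl⟩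
    | cond_false h' _ => exact absurd h' h
  | cond_false h _ ih =>
    cases r₂ with
    | cond_true h' _ => exact absurd h h'
    | cond_false _ a => obtain ⟨rfl, rfl⟩ := ih a; exact ⟨rfl, rfl⟩
  | loop_done h =>
    cases r₂ with
    | loop_done _ => exact ⟨rfl, rfl⟩
    | loop_step h' _ _ => exact absurd h h'
  | loop_step h _ _ ih₁ ih₂ =>
    cases r₂ with
    | loop_done h' => exact absurd h' h
    | loop_step _ a b =>
      obtain ⟨rfl, rfl⟩ := ih₁ a
      obtain ⟨rfl, rfl⟩ := ih₂ b
      exact ⟨rfl, rfl⟩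

theorem Run.one_le {W : ℕ} {P : Prog} {σ σ' : State} {t : ℕ} (r : Run W P σ t σ') : 1 ≤ t := by
  induction r <;> omega

/-- The program obtained by renaming registers along `f` and arrays along `g`. -/
def Prog.rename (f g : ℕ → ℕ) : Prog → Prog
  | .skip => .skip
  | .const r k => .const (f r) k
  | .bin o r a b => .bin o (f r) (f a) (f b)
  | .load r A a => .load (f r) (g A) (f a)
  | .store A a b => .store (g A) (f a) (f b)
  | .seq P Q => .seq (P.rename f g) (Q.rename f g)
  | .cond r P Q => .cond (f r) (P.rename f g) (Q.rename f g)
  | .loop r P => .loop (f r) (P.rename f g)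

/-- The part of the memory seen through a renaming. -/
def State.pull (f g : ℕ → ℕ) (σ : State) : State :=
  ⟨fun r => σ.reg (f r), fun A => σ.arr (g A)⟩

@[simp] theorem State.pull_reg (f g : ℕ → ℕ) (σ : State) (r : ℕ) :
    (σ.pull f g).reg r = σ.reg (f r) := rfl

@[simp] theorem State.pull_arr (f g : ℕ → ℕ) (σ : State) (A : ℕ) :
    (σ.pull f g).arr A = σ.arr (g A) := rfl

@[simp] theorem State.setReg_reg (σ : State) (r : ℕ) (v : ℤ) (x : ℕ) :
    (σ.setReg r v).reg x = if x = r then v else σ.reg x := by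
  simp [State.setReg, Function.update_apply]

@[simp] theorem State.setReg_arr (σ : State) (r : ℕ) (v : ℤ) : (σ.setReg r v).arr = σ.arr := rfl

@[simp] theorem State.setCell_reg (σ : State) (A : ℕ) (a v : ℤ) :
    (σ.setCell A a v).reg = σ.reg := rfl

@[simp] theorem State.setCell_arr (σ : State) (A : ℕ) (a v : ℤ) (A' : ℕ) (a' : ℤ) :
    (σ.setCell A a v).arr A' a' = if A' = A ∧ a' = a then v else σ.arr A' a' := by
  by_cases h : A' = A
  · subst h; simp [State.setCell, Function.update_apply]
  · simp [State.setCell, h]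

theorem State.ext' {σ τ : State} (h₁ : ∀ r, σ.reg r = τ.reg r)
    (h₂ : ∀ A a, σ.arr A a = τ.arr A a) : σ = τ := by
  cases σ; cases τ
  simp only [State.mk.injEq]
  exact ⟨funext h₁, funext fun A => funext (h₂ A)⟩

theorem State.pull_setReg {f : ℕ → ℕ} (hf : f.Injective) (g : ℕ → ℕ) (σ : State) (r : ℕ) (v : ℤ) :
    (σ.setReg (f r) v).pull f g = (σ.pull f g).setReg r v := by
  refine State.ext' (fun x => ?_) fun A a => rfl
  simp [hf.eq_iff]

theorem State.pull_setCell (f : ℕ → ℕ) {g : ℕ → ℕ} (hg : g.Injective) (σ : State) (A : ℕ)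
    (a v : ℤ) : (σ.setCell (g A) a v).pull f g = (σ.pull f g).setCell A a v := by
  refine State.ext' (fun x => rfl) fun A a => ?_
  simp [hg.eq_iff]

/-- `σ` and `τ` agree outside the ranges of `f` and `g`. -/
def State.AgreeOff (f g : ℕ → ℕ) (σ τ : State) : Prop :=
  (∀ r, (∀ x, f x ≠ r) → τ.reg r = σ.reg r) ∧ ∀ A, (∀ x, g x ≠ A) → τ.arr A = σ.arr A

theorem State.AgreeOff.refl (f g : ℕ → ℕ) (σ : State) : σ.AgreeOff f g σ :=
  ⟨fun _ _ => rfl, fun _ _ => rfl⟩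

theorem State.AgreeOff.trans {f g : ℕ → ℕ} {σ τ υ : State} (h₁ : σ.AgreeOff f g τ)
    (h₂ : τ.AgreeOff f g υ) : σ.AgreeOff f g υ :=
  ⟨fun r h => (h₂.1 r h).trans (h₁.1 r h), fun A h => (h₂.2 A h).trans (h₁.2 A h)⟩

theorem State.AgreeOff.setReg (f g : ℕ → ℕ) (σ : State) (r : ℕ) (v : ℤ) :
    σ.AgreeOff f g (σ.setReg (f r) v) := by
  refine ⟨fun x hx => ?_, fun _ _ => rfl⟩
  simp [Ne.symm (hx r)]

theorem State.AgreeOff.setCell (f g : ℕ → ℕ) (σ : State) (A : ℕ) (a v : ℤ) :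
    σ.AgreeOff f g (σ.setCell (g A) a v) := by
  refine ⟨fun _ _ => rfl, fun x hx => ?_⟩
  funext y
  simp [Ne.symm (hx A)]

/-- This embeds the dynamic algorithm into the memory of a larger program. Injectivity makes every
write visible at exactly one place through the renaming; `AgreeOff` is the frame condition for the
rest. -/
theorem Run.rename {W : ℕ} {f g : ℕ → ℕ} (hf : f.Injective) (hg : g.Injective) {P : Prog}
    {σ σ' : State} {t : ℕ} (r : Run W P σ t σ') :
    ∀ τ : State, τ.pull f g = σ →
      ∃ τ', Run W (P.rename f g) τ t τ' ∧ τ'.pull f g = σ' ∧ τ.AgreeOff f g τ' := by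
  induction r with
  | skip σ => rintro τ rfl; exact ⟨τ, .skip τ, rfl, .refl _ _ _⟩
  | const σ r k hk =>
    rintro τ rfl
    exact ⟨_, .const τ (f r) k hk, State.pull_setReg hf g τ r k, .setReg _ _ _ _ _⟩
  | bin σ o r a b hk =>
    rintro τ rfl
    exact ⟨_, .bin τ o (f r) (f a) (f b) hk, State.pull_setReg hf g τ r _, .setReg _ _ _ _ _⟩
  | load σ r A a =>
    rintro τ rfl
    exact ⟨_, .load τ (f r) (g A) (f a), State.pull_setReg hf g τ r _, .setReg _ _ _ _ _⟩
  | store σ A a b =>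
    rintro τ rfl
    exact ⟨_, .store τ (g A) (f a) (f b), State.pull_setCell f hg τ A _ _, .setCell _ _ _ _ _ _⟩
  | seq _ _ ih₁ ih₂ =>
    intro τ h
    obtain ⟨τ₁, r₁, h₁, a₁⟩ := ih₁ τ h
    obtain ⟨τ₂, r₂, h₂, a₂⟩ := ih₂ τ₁ h₁
    exact ⟨τ₂, .seq r₁ r₂, h₂, a₁.trans a₂⟩
  | cond_true h _ ih =>
    rintro τ rfl
    obtain ⟨τ₁, r₁, h₁, a₁⟩ := ih τ rfl
    exact ⟨τ₁, .cond_true h r₁, h₁, a₁⟩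
  | cond_false h _ ih =>
    rintro τ rfl
    obtain ⟨τ₁, r₁, h₁, a₁⟩ := ih τ rfl
    exact ⟨τ₁, .cond_false h r₁, h₁, a₁⟩
  | loop_done h =>
    rintro τ rfl
    exact ⟨τ, .loop_done h, rfl, .refl _ _ _⟩
  | loop_step h _ _ ih₁ ih₂ =>
    rintro τ rfl
    obtain ⟨τ₁, r₁, h₁, a₁⟩ := ih₁ τ rfl
    obtain ⟨τ₂, r₂, h₂, a₂⟩ := ih₂ τ₁ h₁
    exact ⟨τ₂, .loop_step h r₁ r₂, h₂, a₁.trans a₂⟩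

/-! ### Programs with a step budget

The budgeted program uses register `0` for the number of steps left and register `1` for a flag that
is cleared when the budget is exhausted, register `2` as scratch, and register `r + 3` for the
original register `r`. -/

/-- Spend one unit of the budget, or clear the flag. -/
def tick : Prog :=
  .cond 1 (.seq (.const 2 0) (.seq (.bin .lt 1 2 0) (.seq (.const 2 1) (.bin .sub 0 0 2)))) .skip

/-- Put into the scratch register whether the loop on register `r` goes on. -/
def guard (r : ℕ) : Prog :=
  .cond 1 (.cond (r + 3) (.const 2 1) (.const 2 0)) (.const 2 0)

/-- The budgeted version of a program. -/
def Prog.budget : Prog → Prog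
  | .cond r P Q => .seq tick (.cond 1 (.cond (r + 3) P.budget Q.budget) .skip)
  | .loop r P => .seq tick (.seq (guard r) (.loop 2 (.seq P.budget (.seq tick (guard r)))))
  | .seq P Q => .seq P.budget Q.budget
  | .skip => .seq tick (.cond 1 .skip .skip)
  | .const r k => .seq tick (.cond 1 (.const (r + 3) k) .skip)
  | .bin o r a b => .seq tick (.cond 1 (.bin o (r + 3) (a + 3) (b + 3)) .skip)
  | .load r A a => .seq tick (.cond 1 (.load (r + 3) A (a + 3)) .skip)
  | .store A a b => .seq tick (.cond 1 (.store A (a + 3) (b + 3)) .skip)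

/-- A bound for the time that a budgeted program takes without budget. -/
def Prog.deadTime : Prog → ℕ
  | .seq P Q => P.deadTime + Q.deadTime
  | .cond _ P Q => P.deadTime + Q.deadTime + 20
  | .loop _ P => P.deadTime + 20
  | _ => 20

/-- The original memory inside the memory of the budgeted program. -/
def State.core (τ : State) : State := τ.pull (· + 3) id

theorem State.core_setReg (τ : State) (r : ℕ) (v : ℤ) :
    (τ.setReg (r + 3) v).core = τ.core.setReg r v :=
  State.pull_setReg (add_left_injective 3) id τ r v

theorem State.core_setCell (τ : State) (A : ℕ) (a v : ℤ) :
    (τ.setCell A a v).core = τ.core.setCell A a v :=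
  State.pull_setCell (· + 3) Function.injective_id τ A a v

theorem State.core_setReg_lt (τ : State) {r : ℕ} (hr : r < 3) (v : ℤ) :
    (τ.setReg r v).core = τ.core := by
  refine State.ext' (fun x => ?_) fun A a => rfl
  have : x + 3 ≠ r := by omega
  simp [State.core, this]

/-- The budgeted state `τ` represents `σ` with `k` steps left. -/
structure Alive (τ σ : State) (k : ℕ) : Prop where
  core : τ.core = σ
  cnt : τ.reg 0 = k
  live : τ.reg 1 = 1

theorem tick_dead {W : ℕ} {τ : State} (h : τ.reg 1 = 0) : Run W tick τ 2 τ :=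
  .cond_false h (.skip τ)

theorem tick_alive {W : ℕ} {τ σ : State} {k : ℕ} (h : Alive τ σ (k + 1)) (hW : k + 1 ≤ W) :
    ∃ τ', Run W tick τ 5 τ' ∧ Alive τ' σ k := by
  refine ⟨_, .cond_true (by simp [h.live]) (.seq (t₁ := 1) (t₂ := 3) (.const _ _ _ (by simp))
    (.seq (t₁ := 1) (t₂ := 2) (.bin _ _ _ _ _ ?_) (.seq (t₁ := 1) (t₂ := 1)
      (.const _ _ _ ?_) (.bin _ _ _ _ _ ?_)))), ?_, ?_, ?_⟩
  · simp [BinOp.val]; split_ifs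
    · simp; omega
    · simp
  · simp; omega
  · simp [BinOp.val, h.cnt]; omega
  · rw [State.core_setReg_lt _ (by norm_num), State.core_setReg_lt _ (by norm_num),
      State.core_setReg_lt _ (by norm_num), State.core_setReg_lt _ (by norm_num), h.core]
  · simp [BinOp.val, h.cnt]
  · simp [BinOp.val, h.cnt]

/-- The test `0 < 0` clears the flag. The counter drops to `-1`, and nothing is claimed about it. -/
theorem tick_dies {W : ℕ} {τ σ : State} (h : Alive τ σ 0) (hW : 1 ≤ W) :
    ∃ τ', Run W tick τ 5 τ' ∧ τ'.reg 1 = 0 := by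
  refine ⟨_, .cond_true (by simp [h.live]) (.seq (t₁ := 1) (t₂ := 3) (.const _ _ _ (by simp))
    (.seq (t₁ := 1) (t₂ := 2) (.bin _ _ _ _ _ ?_) (.seq (t₁ := 1) (t₂ := 1)
      (.const _ _ _ ?_) (.bin _ _ _ _ _ ?_)))), ?_⟩
  · simp [BinOp.val]; split_ifs
    · simp; omega
    · simp
  · simp; omega
  · simp [BinOp.val, h.cnt]; omega
  · simp [BinOp.val, h.cnt]

theorem guard_dead {W : ℕ} {τ : State} (r : ℕ) (h : τ.reg 1 = 0) :
    ∃ τ', Run W (guard r) τ 2 τ' ∧ τ'.reg 1 = 0 ∧ τ'.reg 2 = 0 :=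
  ⟨_, .cond_false h (.const _ _ _ (by simp)), by simp [h], by simp⟩

theorem guard_alive {W : ℕ} {τ σ : State} {k : ℕ} (r : ℕ) (h : Alive τ σ k) (hW : 1 ≤ W) :
    ∃ τ', Run W (guard r) τ 3 τ' ∧ Alive τ' σ k ∧ (τ'.reg 2 = 0 ↔ σ.reg r = 0) := by
  have hr : τ.reg (r + 3) = σ.reg r := by rw [← h.core]; rfl
  by_cases h0 : σ.reg r = 0
  · refine ⟨_, .cond_true (by simp [h.live]) (.cond_false (by rw [hr, h0])
      (.const _ _ _ (by simp))), ⟨?_, by simp [h.cnt], by simp [h.live]⟩, by simp [h0]⟩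
    rw [State.core_setReg_lt _ (by norm_num), h.core]
  · refine ⟨_, .cond_true (by simp [h.live]) (.cond_true (by rwa [hr])
      (.const _ _ _ ?_)), ⟨?_, by simp [h.cnt], by simp [h.live]⟩, by simp [h0]⟩
    · simp; omega
    · rw [State.core_setReg_lt _ (by norm_num), h.core]

/-- With the flag cleared, all original instructions are skipped and every loop is left at its
guard. So the time is bounded by the text of the program, whatever the memory contains. -/
theorem Prog.budget_dead {W : ℕ} (P : Prog) :
    ∀ τ : State, τ.reg 1 = 0 → ∃ t τ', Run W P.budget τ t τ' ∧ t ≤ P.deadTime ∧ τ'.reg 1 = 0 := by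
  have leaf (I : Prog) (τ : State) (h : τ.reg 1 = 0) :
      ∃ t τ', Run W (.seq tick (.cond 1 I .skip)) τ t τ' ∧ t ≤ 20 ∧ τ'.reg 1 = 0 :=
    ⟨_, τ, .seq (tick_dead h) (.cond_false h (.skip τ)), by norm_num, h⟩
  induction P with
  | skip => exact leaf _
  | const r k => exact leaf _
  | bin o r a b => exact leaf _
  | load r A a => exact leaf _
  | store A a b => exact leaf _
  | seq P Q ihP ihQ =>
    intro τ h
    obtain ⟨t₁, τ₁, r₁, l₁, h₁⟩ := ihP τ h
    obtain ⟨t₂, τ₂, r₂, l₂, h₂⟩ := ihQ τ₁ h₁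
    exact ⟨_, τ₂, .seq r₁ r₂, by simp only [Prog.deadTime]; omega, h₂⟩
  | cond r P Q ihP ihQ =>
    intro τ h
    obtain ⟨t, τ', r, l, h'⟩ := leaf (.cond (r + 3) P.budget Q.budget) τ h
    exact ⟨t, τ', r, by simp only [Prog.deadTime]; omega, h'⟩
  | loop r P ihP =>
    intro τ h
    obtain ⟨τ', r', h', h''⟩ := guard_dead (W := W) r h
    exact ⟨_, τ', .seq (tick_dead h) (.seq r' (.loop_done h'')), by simp only [Prog.deadTime]; omega, h'⟩

/-- The two possible outcomes of a budgeted run of a program that takes `t` steps in all and ends in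
`σ'`, when there are `k` steps left. -/
def BudgetRun (W : ℕ) (P : Prog) (τ : State) (k t : ℕ) (σ' : State) (D : ℕ) : Prop :=
  (t ≤ k → ∃ t' τ', Run W P τ t' τ' ∧ t' ≤ 10 * t ∧ Alive τ' σ' (k - t)) ∧
  (k < t → ∃ t' τ', Run W P τ t' τ' ∧ t' ≤ 10 * k + D ∧ τ'.reg 1 = 0)

/-- Each step of the original run is simulated by one tick with at most a few tests, hence the
factor 10. Once the budget is exhausted, the rest of the program falls under `Prog.budget_dead`. The
bound `k ≤ W` keeps the counter within a word. -/
theorem Run.budget {W : ℕ} {P : Prog} {σ σ' : State} {t : ℕ} (r : Run W P σ t σ') :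
    ∀ (τ : State) (k : ℕ), Alive τ σ k → k ≤ W → 1 ≤ W →
      BudgetRun W P.budget τ k t σ' P.deadTime := by
  have leaf (I : Prog) (σ σ' τ : State) (k : ℕ) (h : Alive τ σ k) (hk : k ≤ W) (hW : 1 ≤ W)
      (hI : ∀ τ k, Alive τ σ k → ∃ τ', Run W I τ 1 τ' ∧ Alive τ' σ' k) :
      BudgetRun W (.seq tick (.cond 1 I .skip)) τ k 1 σ' 20 := by
    constructor
    · intro h1
      obtain ⟨k, rfl⟩ := Nat.exists_eq_add_of_le' h1
      obtain ⟨τ₁, r₁, h₁⟩ := tick_alive h hk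
      obtain ⟨τ₂, r₂, h₂⟩ := hI τ₁ k h₁
      exact ⟨_, τ₂, .seq r₁ (.cond_true (by simp [h₁.live]) r₂), by norm_num, by simpa using h₂⟩
    · intro h1
      obtain rfl : k = 0 := by omega
      obtain ⟨τ₁, r₁, h₁⟩ := tick_dies h hW
      exact ⟨_, τ₁, .seq r₁ (.cond_false h₁ (.skip _)), by norm_num, h₁⟩
  -- A conditional: after the tick, `I` takes one step more than the branch `J` that it selects.
  have leafc (I : Prog) (σ σ' τ : State) (k t D : ℕ) (h : Alive τ σ k) (hk : k ≤ W) (hW : 1 ≤ W)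
      (hI : ∀ τ k, Alive τ σ k → k ≤ W → ∃ τ₁ J, BudgetRun W J τ₁ k t σ' D ∧
        ∀ t' τ', Run W J τ₁ t' τ' → Run W I τ (t' + 1) τ') :
      BudgetRun W (.seq tick (.cond 1 I .skip)) τ k (t + 1) σ' (D + 10) := by
    rcases Nat.eq_zero_or_pos k with rfl | hk0
    · refine ⟨by omega, fun _ => ?_⟩
      obtain ⟨τ₁, r₁, h₁⟩ := tick_dies h hW
      exact ⟨_, τ₁, .seq r₁ (.cond_false h₁ (.skip _)), by omega, h₁⟩
    obtain ⟨k, rfl⟩ := Nat.exists_eq_add_of_le' hk0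
    obtain ⟨τ₁, r₁, h₁⟩ := tick_alive h hk
    obtain ⟨τ₂, J, ⟨b₁, b₂⟩, hJ⟩ := hI τ₁ k h₁ (by omega)
    constructor
    · intro h1
      obtain ⟨t', τ', r', l', a'⟩ := b₁ (by omega)
      refine ⟨_, τ', .seq r₁ (.cond_true (by simp [h₁.live]) (hJ _ _ r')), by omega, ?_⟩
      rwa [show k + 1 - (t + 1) = k - t by omega]
    · intro h1
      obtain ⟨t', τ', r', l', a'⟩ := b₂ (by omega)
      exact ⟨_, τ', .seq r₁ (.cond_true (by simp [h₁.live]) (hJ _ _ r')), by omega, a'⟩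
  have seqb (P Q : Prog) (σ₁ σ₂ τ : State) (k t₁ t₂ D₁ D₂ : ℕ) (hk : k ≤ W)
      (hP : BudgetRun W P τ k t₁ σ₁ D₁)
      (hQ : ∀ τ k, Alive τ σ₁ k → k ≤ W → BudgetRun W Q τ k t₂ σ₂ D₂)
      (hd : ∀ τ : State, τ.reg 1 = 0 → ∃ t τ', Run W Q τ t τ' ∧ t ≤ D₂ ∧ τ'.reg 1 = 0) :
      BudgetRun W (.seq P Q) τ k (t₁ + t₂) σ₂ (D₁ + D₂) := by
    by_cases h1 : t₁ ≤ k
    · obtain ⟨t', τ', r', l', a'⟩ := hP.1 h1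
      obtain ⟨b₁, b₂⟩ := hQ τ' _ a' (by omega)
      constructor
      · intro h2
        obtain ⟨t'', τ'', r'', l'', a''⟩ := b₁ (by omega)
        refine ⟨_, τ'', .seq r' r'', by omega, ?_⟩
        rwa [← Nat.sub_sub]
      · intro h2
        obtain ⟨t'', τ'', r'', l'', a''⟩ := b₂ (by omega)
        exact ⟨_, τ'', .seq r' r'', by omega, a''⟩
    · refine ⟨by omega, fun h2 => ?_⟩
      obtain ⟨t', τ', r', l', a'⟩ := hP.2 (by omega)
      obtain ⟨t'', τ'', r'', l'', a''⟩ := hd τ' a'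
      exact ⟨_, τ'', .seq r' r'', by omega, a''⟩
  induction r with
  | skip σ =>
    intro τ k h hk hW
    exact leaf _ σ _ τ k h hk hW fun τ k h => ⟨τ, .skip τ, h⟩
  | const σ r v hv =>
    intro τ k h hk hW
    refine leaf _ σ _ τ k h hk hW fun τ k h => ⟨_, .const _ _ _ hv, ?_, ?_, ?_⟩
    · rw [State.core_setReg, h.core]
    · simp [h.cnt]
    · simp [h.live]
  | bin σ o r a b hv =>
    intro τ k h hk hW
    have e : ∀ τ k, Alive τ σ k → o.val (τ.reg (a + 3)) (τ.reg (b + 3)) =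
        o.val (σ.reg a) (σ.reg b) := by rintro τ k h; rw [← h.core]; rfl
    refine leaf _ σ _ τ k h hk hW fun τ k h => ⟨_, .bin _ _ _ _ _ (by rwa [e τ k h]), ?_, ?_, ?_⟩
    · rw [State.core_setReg, h.core, e τ k h]
    · simp [h.cnt]
    · simp [h.live]
  | load σ r A a =>
    intro τ k h hk hW
    refine leaf _ σ _ τ k h hk hW fun τ k h => ⟨_, .load _ _ _ _, ?_, ?_, ?_⟩
    · rw [State.core_setReg, h.core, ← h.core]; rfl
    · simp [h.cnt]
    · simp [h.live]
  | store σ A a b =>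
    intro τ k h hk hW
    refine leaf _ σ _ τ k h hk hW fun τ k h => ⟨_, .store _ _ _ _, ?_, ?_, ?_⟩
    · rw [State.core_setCell, h.core, ← h.core]; rfl
    · simp [h.cnt]
    · simp [h.live]
  | @seq P Q σ σ₁ σ₂ t₁ t₂ _ _ ih₁ ih₂ =>
    intro τ k h hk hW
    exact seqb _ _ σ₁ σ₂ τ k _ _ _ _ hk (ih₁ τ k h hk hW) (fun τ k h hk => ih₂ τ k h hk hW)
      Q.budget_dead
  | @cond_true r P Q σ σ' t hr _ ih =>
    intro τ k h hk hW
    have := leafc (.cond (r + 3) P.budget Q.budget) σ σ' τ k t P.deadTime h hk hW ?_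
    · refine ⟨this.1, fun h => ?_⟩
      obtain ⟨t', τ', r', l', a'⟩ := this.2 h
      exact ⟨t', τ', r', by simp only [Prog.deadTime]; omega, a'⟩
    · intro τ k h hk
      have hr' : τ.reg (r + 3) ≠ 0 := by rw [← h.core] at hr; exact hr
      exact ⟨τ, P.budget, ih τ k h hk hW, fun _ _ r => .cond_true hr' r⟩
  | @cond_false r P Q σ σ' t hr _ ih =>
    intro τ k h hk hW
    have := leafc (.cond (r + 3) P.budget Q.budget) σ σ' τ k t Q.deadTime h hk hW ?_
    · refine ⟨this.1, fun h => ?_⟩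
      obtain ⟨t', τ', r', l', a'⟩ := this.2 h
      exact ⟨t', τ', r', by simp only [Prog.deadTime]; omega, a'⟩
    · intro τ k h hk
      have hr' : τ.reg (r + 3) = 0 := by rw [← h.core] at hr; exact hr
      exact ⟨τ, Q.budget, ih τ k h hk hW, fun _ _ r => .cond_false hr' r⟩
  | @loop_done r P σ hr =>
    intro τ k h hk hW
    constructor
    · intro h1
      obtain ⟨k, rfl⟩ := Nat.exists_eq_add_of_le' h1
      obtain ⟨τ₁, r₁, h₁⟩ := tick_alive h hk
      obtain ⟨τ₂, r₂, h₂, e₂⟩ := guard_alive r h₁ hW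
      exact ⟨_, τ₂, .seq r₁ (.seq r₂ (.loop_done (e₂.2 hr))), by norm_num, by simpa using h₂⟩
    · intro h1
      obtain rfl : k = 0 := by omega
      obtain ⟨τ₁, r₁, h₁⟩ := tick_dies h hW
      obtain ⟨τ₂, r₂, h₂, e₂⟩ := guard_dead (W := W) r h₁
      exact ⟨_, τ₂, .seq r₁ (.seq r₂ (.loop_done e₂)), by simp only [Prog.deadTime]; omega, h₂⟩
  | @loop_step r P σ σ₁ σ₂ t₁ t₂ hr _ _ ih₁ ih₂ =>
    intro τ k h hk hW
    rcases Nat.eq_zero_or_pos k with rfl | hk0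
    · refine ⟨by omega, fun _ => ?_⟩
      obtain ⟨τ₁, r₁, h₁⟩ := tick_dies h hW
      obtain ⟨τ₂, r₂, h₂, e₂⟩ := guard_dead (W := W) r h₁
      exact ⟨_, τ₂, .seq r₁ (.seq r₂ (.loop_done e₂)), by simp only [Prog.deadTime]; omega, h₂⟩
    obtain ⟨k, rfl⟩ := Nat.exists_eq_add_of_le' hk0
    obtain ⟨τ₁, r₁, h₁⟩ := tick_alive h hk
    obtain ⟨τ₂, r₂, h₂, e₂⟩ := guard_alive r h₁ hW
    have hne : τ₂.reg 2 ≠ 0 := fun h0 => hr (e₂.1 h0)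
    obtain ⟨b₁, b₂⟩ := ih₁ τ₂ k h₂ (by omega) hW
    by_cases hk1 : t₁ ≤ k
    · obtain ⟨t', τ', r', l', a'⟩ := b₁ hk1
      obtain ⟨c₁, c₂⟩ := ih₂ τ' _ a' (by omega) hW
      constructor
      · intro hk2
        obtain ⟨t'', τ'', r'', l'', a''⟩ := c₁ (by omega)
        -- The induction hypothesis speaks of a tick, a guard and a loop in this order. In the
        -- longer run, this tick and guard are the end of the loop body, so the run is taken apart
        -- and reassembled.
        rcases r'' with _ | _ | _ | _ | _ | ⟨ra, rb⟩
        rcases rb with _ | _ | _ | _ | _ | ⟨rb, rc⟩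
        refine ⟨_, τ'', .seq r₁ (.seq r₂ (.loop_step hne (.seq r' (.seq ra rb)) rc)), by omega, ?_⟩
        rwa [show k + 1 - (t₁ + t₂ + 1) = k - t₁ - t₂ by omega]
      · intro hk2
        obtain ⟨t'', τ'', r'', l'', a''⟩ := c₂ (by omega)
        rcases r'' with _ | _ | _ | _ | _ | ⟨ra, rb⟩
        rcases rb with _ | _ | _ | _ | _ | ⟨rb, rc⟩
        exact ⟨_, τ'', .seq r₁ (.seq r₂ (.loop_step hne (.seq r' (.seq ra rb)) rc)), by omega, a''⟩
    · refine ⟨by omega, fun _ => ?_⟩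
      obtain ⟨t', τ', r', l', a'⟩ := b₂ (by omega)
      obtain ⟨τ₃, r₃, h₃, e₃⟩ := guard_dead (W := W) r a'
      exact ⟨_, τ₃, .seq r₁ (.seq r₂ (.loop_step hne (.seq r' (.seq (tick_dead a') r₃))
        (.loop_done e₃))), by simp only [Prog.deadTime]; omega, h₃⟩

end FineGrained

namespace FineGrained

/-! ### Expressions

Register `2 * x` holds the variable `x`, the odd registers are scratch. -/

/-- Expressions over variables and arrays. -/
inductive Expr
  | var (x : ℕ)
  | cst (k : ℤ)
  | op (o : BinOp) (a b : Expr)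
  | ld (A : ℕ) (e : Expr)

instance : Add Expr := ⟨.op .add⟩
instance : Sub Expr := ⟨.op .sub⟩
instance : Mul Expr := ⟨.op .mul⟩
instance : Div Expr := ⟨.op .div⟩
instance : Mod Expr := ⟨.op .mod⟩
instance (n : ℕ) : OfNat Expr n := ⟨.cst n⟩

/-- The instructions allowed in expressions: those whose values are bounded by a polynomial. -/
def BinOp.Small : BinOp → Prop
  | .add | .sub | .mul | .div | .mod | .lt | .eq => True
  | _ => False

namespace Expr

def eval (s : State) : Expr → ℤ
  | var x => s.reg x
  | cst k => k
  | op o a b => o.val (a.eval s) (b.eval s)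
  | ld A e => s.arr A (e.eval s)

def size : Expr → ℕ
  | var _ => 1
  | cst _ => 1
  | op _ a b => a.size + b.size + 1
  | ld _ e => e.size + 1

/-- The expression only refers to the given variables and arrays, and to constants at most `B`. -/
def Ok (R A : ℕ → Prop) (B : ℕ) : Expr → Prop
  | var x => R x
  | cst k => |k| ≤ B
  | op o a b => o.Small ∧ a.Ok R A B ∧ b.Ok R A B
  | ld X e => A X ∧ e.Ok R A B

/-- Code that evaluates an expression into scratch register `d`. -/
def comp : Expr → ℕ → Prog
  | var x, d => .seq (.const (2 * d + 1) 0) (.bin .add (2 * d + 1) (2 * x) (2 * d + 1))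
  | cst k, d => .const (2 * d + 1) k
  | op o a b, d => .seq (a.comp d) (.seq (b.comp (d + 1))
      (.bin o (2 * d + 1) (2 * d + 1) (2 * (d + 1) + 1)))
  | ld A e, d => .seq (e.comp d) (.load (2 * d + 1) A (2 * d + 1))

variable (s : State)
@[simp] theorem eval_var (x : ℕ) : (var x).eval s = s.reg x := rfl
@[simp] theorem eval_cst (k : ℤ) : (cst k).eval s = k := rfl
@[simp] theorem eval_ofNat (n : ℕ) [n.AtLeastTwo] : (OfNat.ofNat n : Expr).eval s = n := rfl
@[simp] theorem eval_zero : (0 : Expr).eval s = 0 := rfl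
@[simp] theorem eval_one : (1 : Expr).eval s = 1 := rfl
@[simp] theorem eval_ld (A : ℕ) (e : Expr) : (ld A e).eval s = s.arr A (e.eval s) := rfl
@[simp] theorem eval_add (a b : Expr) : (a + b).eval s = a.eval s + b.eval s := rfl
@[simp] theorem eval_sub (a b : Expr) : (a - b).eval s = a.eval s - b.eval s := rfl
@[simp] theorem eval_mul (a b : Expr) : (a * b).eval s = a.eval s * b.eval s := rfl
@[simp] theorem eval_div (a b : Expr) : (a / b).eval s = a.eval s / b.eval s := rfl
@[simp] theorem eval_mod (a b : Expr) : (a % b).eval s = a.eval s % b.eval s := rfl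
@[simp] theorem eval_lt (a b : Expr) :
    (op .lt a b).eval s = if a.eval s < b.eval s then 1 else 0 := rfl
@[simp] theorem eval_eq (a b : Expr) :
    (op .eq a b).eval s = if a.eval s = b.eval s then 1 else 0 := rfl

theorem one_le_size (e : Expr) : 1 ≤ e.size := by cases e <;> simp [size]

theorem eval_congr {R A : ℕ → Prop} {B : ℕ} {s s' : State} (hR : ∀ x, R x → s.reg x = s'.reg x)
    (hA : ∀ X, A X → s.arr X = s'.arr X) {e : Expr} (h : e.Ok R A B) : e.eval s = e.eval s' := by
  induction e with
  | var x => exact hR x h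
  | cst k => rfl
  | op o a b iha ihb => simp only [eval, iha h.2.1, ihb h.2.2]
  | ld X e ih => simp only [eval, ih h.2, hA X h.1]

/-- All values computed during the evaluation are at most `W`. -/
def Bdd (W : ℕ) (s : State) : Expr → Prop
  | var x => |s.reg x| ≤ W
  | cst k => |k| ≤ W
  | op o a b => a.Bdd W s ∧ b.Bdd W s ∧ |o.val (a.eval s) (b.eval s)| ≤ W
  | ld _ e => e.Bdd W s

end Expr

/-- The exponents add up in the same way as the sizes of expressions, so that a value is bounded by
`B` to the size. Multiplication is the worst case; for division and remainder by zero the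
conventions of `ℤ` matter. -/
theorem BinOp.Small.abs_val_le {o : BinOp} (h : o.Small) {a b : ℤ} {B i j : ℕ} (hB : 2 ≤ B)
    (hi : 1 ≤ i) (hj : 1 ≤ j) (ha : |a| ≤ (B : ℤ) ^ i) (hb : |b| ≤ (B : ℤ) ^ j) :
    |o.val a b| ≤ (B : ℤ) ^ (i + j + 1) := by
  have hB' : (2 : ℤ) ≤ B := by exact_mod_cast hB
  have hi' : (B : ℤ) ≤ (B : ℤ) ^ i := le_self_pow₀ (by omega) (by omega)
  have hj' : (B : ℤ) ≤ (B : ℤ) ^ j := le_self_pow₀ (by omega) (by omega)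
  have hm : (B : ℤ) ^ i * (B : ℤ) ^ j ≤ (B : ℤ) ^ (i + j + 1) := by
    rw [← pow_add]; exact pow_le_pow_right₀ (by omega) (by omega)
  generalize (B : ℤ) ^ i = p at *
  generalize (B : ℤ) ^ j = q at *
  have hpq : p + q ≤ p * q := by nlinarith
  have ha0 := abs_nonneg a
  have hb0 := abs_nonneg b
  refine le_trans ?_ hm
  cases o <;> simp only [BinOp.Small] at h <;> simp only [BinOp.val]
  · exact (abs_add_le a b).trans (by linarith)
  · exact (abs_sub a b).trans (by linarith)
  · rw [abs_mul]
    exact mul_le_mul ha hb hb0 (by linarith)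
  · calc |a / b| ≤ |a| := Int.abs_ediv_le_abs a b
      _ ≤ p * q := by nlinarith
  · rcases eq_or_ne b 0 with rfl | hb'
    · simp; nlinarith
    · rw [abs_of_nonneg (Int.emod_nonneg _ hb')]
      have := Int.emod_lt_abs a hb'
      nlinarith
  · split_ifs <;> simp <;> nlinarith
  · split_ifs <;> simp <;> nlinarith

theorem Expr.Ok.bdd {R A : ℕ → Prop} {B W : ℕ} {s : State} (hB : 2 ≤ B)
    (hR : ∀ x, R x → |s.reg x| ≤ B) (hA : ∀ X, A X → ∀ a, |s.arr X a| ≤ B) {e : Expr}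
    (h : e.Ok R A B) (hW : B ^ e.size ≤ W) : e.Bdd W s ∧ |e.eval s| ≤ (B : ℤ) ^ e.size := by
  have hB0 : 0 < B := by omega
  have cast {x : ℤ} {k : ℕ} (hx : |x| ≤ (B : ℤ) ^ k) (hk : B ^ k ≤ W) : |x| ≤ (W : ℤ) :=
    hx.trans (by exact_mod_cast hk)
  induction e with
  | var x =>
    have : |s.reg x| ≤ (B : ℤ) ^ 1 := by simpa using hR x h
    exact ⟨cast this hW, this⟩
  | cst k =>
    have : |k| ≤ (B : ℤ) ^ 1 := by rw [pow_one]; exact h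
    exact ⟨cast this hW, this⟩
  | op o a b iha ihb =>
    obtain ⟨a₁, a₂⟩ := iha h.2.1 ((Nat.pow_le_pow_right hB0 (by simp only [size]; omega)).trans hW)
    obtain ⟨b₁, b₂⟩ := ihb h.2.2 ((Nat.pow_le_pow_right hB0 (by simp only [size]; omega)).trans hW)
    have := h.1.abs_val_le hB a.one_le_size b.one_le_size a₂ b₂
    exact ⟨⟨a₁, b₁, cast this hW⟩, this⟩
  | ld X e ih =>
    obtain ⟨e₁, e₂⟩ := ih h.2 ((Nat.pow_le_pow_right hB0 (by simp only [size]; omega)).trans hW)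
    refine ⟨e₁, (hA X h.1 _).trans ?_⟩
    exact_mod_cast Nat.le_self_pow (by simp [size]) B

/-- The variables and arrays of a state of the machine. -/
def State.vars (σ : State) : State := σ.pull (2 * ·) id

@[simp] theorem State.vars_reg (σ : State) (x : ℕ) : σ.vars.reg x = σ.reg (2 * x) := rfl
@[simp] theorem State.vars_arr (σ : State) : σ.vars.arr = σ.arr := rfl

theorem State.vars_setReg (σ : State) (x : ℕ) (v : ℤ) :
    (σ.setReg (2 * x) v).vars = σ.vars.setReg x v :=
  State.pull_setReg (mul_right_injective₀ (by norm_num)) id σ x v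

theorem State.vars_setReg_odd (σ : State) (x : ℕ) (v : ℤ) :
    (σ.setReg (2 * x + 1) v).vars = σ.vars := by
  refine State.ext' (fun y => ?_) fun A a => rfl
  have : 2 * y ≠ 2 * x + 1 := by omega
  simp [this]

theorem State.vars_setCell (σ : State) (A : ℕ) (a v : ℤ) :
    (σ.setCell A a v).vars = σ.vars.setCell A a v :=
  State.pull_setCell _ Function.injective_id σ A a v

/-- The number `d` acts as the height of a stack: scratch registers below it survive, so the left
operand is still there when the right one has been evaluated. -/
theorem Expr.comp_run {W : ℕ} (e : Expr) : ∀ (d : ℕ) (σ : State), e.Bdd W σ.vars →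
    ∃ t σ', Run W (e.comp d) σ t σ' ∧ t ≤ 2 * e.size ∧ σ'.vars = σ.vars ∧
      σ'.reg (2 * d + 1) = e.eval σ.vars ∧ ∀ d' < d, σ'.reg (2 * d' + 1) = σ.reg (2 * d' + 1) := by
  induction e with
  | var x =>
    intro d σ h
    have hx : 2 * x ≠ 2 * d + 1 := by omega
    refine ⟨_, _, .seq (.const _ _ _ (by simp)) (.bin _ _ _ _ _ ?_), by simp [size], ?_, ?_, ?_⟩
    · have h' : |σ.reg (2 * x)| ≤ W := h
      simpa [BinOp.val, hx] using h'
    · rw [State.vars_setReg_odd, State.vars_setReg_odd]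
    · simp [BinOp.val, hx]
    · intro d' hd
      have : d' ≠ d := by omega
      simp [this]
  | cst k =>
    intro d σ h
    refine ⟨_, _, .const _ _ _ h, by simp [size], State.vars_setReg_odd _ _ _, by simp, ?_⟩
    intro d' hd
    have : d' ≠ d := by omega
    simp [this]
  | op o a b iha ihb =>
    rintro d σ ⟨h₁, h₂, h₃⟩
    obtain ⟨t₁, σ₁, r₁, l₁, v₁, e₁, k₁⟩ := iha d σ h₁
    obtain ⟨t₂, σ₂, r₂, l₂, v₂, e₂, k₂⟩ := ihb (d + 1) σ₁ (by rwa [v₁])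
    have e₁' : σ₂.reg (2 * d + 1) = a.eval σ.vars := by rw [k₂ d (by omega), e₁]
    rw [v₁] at e₂
    refine ⟨_, _, .seq r₁ (.seq r₂ (.bin _ _ _ _ _ (by rwa [e₁', e₂]))), by simp only [size]; omega,
      ?_, ?_, ?_⟩
    · rw [State.vars_setReg_odd, v₂, v₁]
    · simp only [State.setReg_reg, if_true, e₁', e₂, eval]
    · intro d' hd
      have : d' ≠ d := by omega
      simp only [State.setReg_reg, add_left_inj, mul_eq_mul_left_iff, this, false_or]
      simp only [OfNat.ofNat_ne_zero, if_false]
      rw [k₂ d' (by omega), k₁ d' hd]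
  | ld A e ih =>
    intro d σ h
    obtain ⟨t₁, σ₁, r₁, l₁, v₁, e₁, k₁⟩ := ih d σ h
    refine ⟨_, _, .seq r₁ (.load _ _ _ _), by simp only [size]; omega, ?_, ?_, ?_⟩
    · rw [State.vars_setReg_odd, v₁]
    · simp only [State.setReg_reg, if_true, e₁, eval]
      rw [← State.vars_arr σ₁, v₁]
    · intro d' hd
      have : d' ≠ d := by omega
      simp only [State.setReg_reg, add_left_inj, mul_eq_mul_left_iff, this, false_or]
      simp only [OfNat.ofNat_ne_zero, if_false]
      exact k₁ d' hd

/-! ### Structured programs -/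

/-- Evaluate an expression and write its value to variable `x`. -/
def asg (x : ℕ) (e : Expr) : Prog :=
  .seq (e.comp 0) (.seq (.const 3 0) (.bin .add (2 * x) 1 3))

/-- Write the value of `e₂` to the cell of array `A` with address `e₁`. -/
def sto (A : ℕ) (e₁ e₂ : Expr) : Prog :=
  .seq (e₁.comp 0) (.seq (e₂.comp 1) (.store A 1 3))

/-- `if e ≠ 0 then P else Q` -/
def ite' (e : Expr) (P Q : Prog) : Prog := .seq (e.comp 0) (.cond 1 P Q)

/-- Run `P` for the values `0, …, e - 1` of variable `x`; variable `y` holds the bound. -/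
def for' (x y : ℕ) (e : Expr) (P : Prog) : Prog :=
  .seq (asg y e) (.seq (asg x 0) (.seq ((Expr.op .lt (.var x) (.var y)).comp 0)
    (.loop 1 (.seq P (.seq (asg x (.var x + 1)) ((Expr.op .lt (.var x) (.var y)).comp 0))))))

theorem asg_run {W : ℕ} {x : ℕ} {e : Expr} {σ : State} (h : e.Bdd W σ.vars)
    (h' : |e.eval σ.vars| ≤ W) :
    ∃ t σ', Run W (asg x e) σ t σ' ∧ t ≤ 2 * e.size + 2 ∧
      σ'.vars = σ.vars.setReg x (e.eval σ.vars) := by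
  obtain ⟨t₁, σ₁, r₁, l₁, v₁, e₁, k₁⟩ := e.comp_run 0 σ h
  simp only [Nat.mul_zero, Nat.zero_add] at e₁
  refine ⟨_, _, .seq r₁ (.seq (.const _ _ _ (by simp)) (.bin _ _ _ _ _ ?_)), by omega, ?_⟩
  · simpa [BinOp.val, e₁] using h'
  · rw [State.vars_setReg, State.vars_setReg_odd σ₁ 1, v₁]
    simp [BinOp.val, e₁]

/-- A setting for reasoning about programs: a word bound `W`, a bound `B` for the values of the
variables and arrays that the program works with directly, a bound `S` for the size of expressions,
and a description `Dyn` of the rest of the memory in terms of abstract states; its numerical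
arguments are the length of a history, a potential that pays for steps, and a weight. -/
structure Env where
  W : ℕ
  B : ℕ
  S : ℕ
  κ : ℕ
  ownR : ℕ → Prop
  ownA : ℕ → Prop
  Γ : Type
  Dyn : State → Γ → ℕ → ℕ → ℕ → Prop
  Lmax : ℕ
  le_B : 100 ≤ B
  le_S : 10 ≤ S
  le_κ : 10 * S + 20 ≤ κ
  pow_le : B ^ S ≤ W
  frame : ∀ {m m' : State} {γ : Γ} {l p w : ℕ}, Dyn m γ l p w →
    (∀ x, ¬ ownR x → m'.reg x = m.reg x) → (∀ A, ¬ ownA A → m'.arr A = m.arr A) →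
    Dyn m' γ l p w

namespace Env
variable {E : Env}

/-- The own part of the state is bounded. -/
def Bounded (E : Env) (s : State) : Prop :=
  (∀ x, E.ownR x → |s.reg x| ≤ E.B) ∧ ∀ A, E.ownA A → ∀ a, |s.arr A a| ≤ E.B

/-- The machine state `σ` is described by `s` and `γ`. -/
structure Rep (E : Env) (σ s : State) (γ : E.Γ) (l p w : ℕ) : Prop where
  reg : ∀ x, E.ownR x → σ.reg (2 * x) = s.reg x
  arr : ∀ A, E.ownA A → σ.arr A = s.arr A
  bdd : E.Bounded s
  dyn : E.Dyn σ.vars γ l p w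

/-- Total correctness of `P` from `s` and `γ`, with amortized time `c` and weight `d`. -/
def WP (E : Env) (P : Prog) (c d : ℕ) (s : State) (γ : E.Γ) (Q : State → E.Γ → Prop) : Prop :=
  ∀ σ l p w, E.Rep σ s γ l p w → l + c ≤ E.Lmax →
    ∃ t σ' s' γ' l' p' w', Run E.W P σ t σ' ∧ E.Rep σ' s' γ' l' p' w' ∧ l' ≤ l + c ∧
      t + p' ≤ p + c ∧ w' ≤ w + d ∧ Q s' γ'

/-- The expression is admissible in `E`. -/
def Adm (E : Env) (e : Expr) : Prop := e.Ok E.ownR E.ownA E.B ∧ e.size ≤ E.S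

variable {P P' : Prog} {c c' d d' : ℕ} {s : State} {γ : E.Γ} {Q Q' : State → E.Γ → Prop}

theorem Rep.eval {σ : State} {l p w : ℕ} (h : E.Rep σ s γ l p w) {e : Expr} (he : E.Adm e) :
    e.Bdd E.W σ.vars ∧ |e.eval s| ≤ E.W ∧ e.eval σ.vars = e.eval s := by
  have hc : e.eval σ.vars = e.eval s :=
    Expr.eval_congr (s := σ.vars) (R := E.ownR) (A := E.ownA) (fun x hx => h.reg x hx) (fun X hX => h.arr X hX) he.1
  have hB := E.le_B
  have hp : E.B ^ e.size ≤ E.W := (Nat.pow_le_pow_right (by omega) he.2).trans E.pow_le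
  obtain ⟨h₁, h₂⟩ := he.1.bdd (s := σ.vars) (W := E.W) (by omega)
    (fun x hx => by rw [State.vars_reg, h.reg x hx]; exact h.bdd.1 x hx)
    (fun X hX a => by rw [State.vars_arr, h.arr X hX]; exact h.bdd.2 X hX a) hp
  refine ⟨h₁, ?_, hc⟩
  rw [← hc]
  exact h₂.trans (by exact_mod_cast hp)

theorem Rep.of_vars {σ σ' : State} {l p w : ℕ} (h : E.Rep σ s γ l p w) (hv : σ'.vars = σ.vars) :
    E.Rep σ' s γ l p w := by
  have hr : ∀ x, σ'.reg (2 * x) = σ.reg (2 * x) := fun x => congrArg (fun m => m.reg x) hv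
  have ha : σ'.vars.arr = σ.vars.arr := congrArg State.arr hv
  simp only [State.vars_arr] at ha
  exact ⟨fun x hx => (hr x).trans (h.reg x hx), fun A hA => by rw [ha]; exact h.arr A hA, h.bdd,
    by rw [hv]; exact h.dyn⟩

theorem WP.weaken (h : E.WP P c d s γ Q) (hc : c ≤ c') (hd : d ≤ d')
    (hQ : ∀ s' γ', Q s' γ' → Q' s' γ') : E.WP P c' d' s γ Q' := by
  intro σ l p w hr hl
  obtain ⟨t, σ', s', γ', l', p', w', h₁, h₂, h₃, h₄, h₅, h₆⟩ := h σ l p w hr (by omega)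
  exact ⟨t, σ', s', γ', l', p', w', h₁, h₂, by omega, by omega, by omega, hQ _ _ h₆⟩

theorem WP.mono (h : E.WP P c d s γ Q) (hQ : ∀ s' γ', Q s' γ' → Q' s' γ') : E.WP P c d s γ Q' :=
  h.weaken le_rfl le_rfl hQ

theorem WP.seq {R : State → E.Γ → Prop} (h : E.WP P c d s γ R)
    (h' : ∀ s' γ', R s' γ' → E.WP P' c' d' s' γ' Q) :
    E.WP (.seq P P') (c + c') (d + d') s γ Q := by
  intro σ l p w hr hl
  obtain ⟨t, σ₁, s₁, γ₁, l₁, p₁, w₁, h₁, h₂, h₃, h₄, h₅, h₆⟩ := h σ l p w hr (by omega)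
  obtain ⟨t', σ₂, s₂, γ₂, l₂, p₂, w₂, k₁, k₂, k₃, k₄, k₅, k₆⟩ :=
    h' s₁ γ₁ h₆ σ₁ l₁ p₁ w₁ h₂ (by omega)
  exact ⟨_, σ₂, s₂, γ₂, l₂, p₂, w₂, .seq h₁ k₁, k₂, by omega, by omega, by omega, k₆⟩

theorem WP.skip (h : Q s γ) : E.WP .skip E.κ 0 s γ Q := by
  intro σ l p w hr hl
  have := E.le_κ
  exact ⟨1, σ, s, γ, l, p, w, .skip σ, hr, by omega, by omega, by omega, h⟩

theorem Bounded.setReg {x : ℕ} {v : ℤ} (h : E.Bounded s) (hv : |v| ≤ E.B) :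
    E.Bounded (s.setReg x v) := by
  refine ⟨fun y hy => ?_, h.2⟩
  rw [State.setReg_reg]
  split_ifs
  · exact hv
  · exact h.1 y hy

theorem Bounded.setCell {A : ℕ} {a v : ℤ} (h : E.Bounded s) (hv : |v| ≤ E.B) :
    E.Bounded (s.setCell A a v) := by
  refine ⟨h.1, fun X hX b => ?_⟩
  rw [State.setCell_arr]
  split_ifs
  · exact hv
  · exact h.2 X hX b

theorem Rep.setReg {σ σ' : State} {l p w x : ℕ} {v : ℤ} (h : E.Rep σ s γ l p w) (hx : E.ownR x)
    (hv : |v| ≤ E.B) (hσ : σ'.vars = σ.vars.setReg x v) : E.Rep σ' (s.setReg x v) γ l p w := by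
  have hr : ∀ y, σ'.reg (2 * y) = if y = x then v else σ.reg (2 * y) := fun y => by
    have := congrArg (fun m => m.reg y) hσ
    simpa using this
  have ha : σ'.vars.arr = σ.vars.arr := by rw [hσ]; rfl
  simp only [State.vars_arr] at ha
  refine ⟨fun y hy => ?_, fun A hA => ?_, h.bdd.setReg hv, E.frame h.dyn ?_ ?_⟩
  · rw [hr, State.setReg_reg, h.reg y hy]
  · rw [ha]; exact h.arr A hA
  · intro y hy
    have : y ≠ x := by rintro rfl; exact hy hx
    rw [State.vars_reg, hr, if_neg this, State.vars_reg]
  · intro A _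
    rw [State.vars_arr, ha, State.vars_arr]

theorem Rep.setCell {σ σ' : State} {l p w A : ℕ} {a v : ℤ} (h : E.Rep σ s γ l p w) (hA : E.ownA A)
    (hv : |v| ≤ E.B) (hσ : σ'.vars = σ.vars.setCell A a v) :
    E.Rep σ' (s.setCell A a v) γ l p w := by
  have hr : ∀ y, σ'.reg (2 * y) = σ.reg (2 * y) := fun y => congrArg (fun m => m.reg y) hσ
  have ha : ∀ X b, σ'.arr X b = if X = A ∧ b = a then v else σ.arr X b := fun X b => by
    have := congrArg (fun m => m.arr X b) hσ
    simpa using this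
  refine ⟨fun y hy => ?_, fun X hX => ?_, h.bdd.setCell hv, E.frame h.dyn ?_ ?_⟩
  · rw [hr, h.reg y hy]; rfl
  · funext b
    rw [ha, State.setCell_arr, h.arr X hX]
  · intro y hy
    rw [State.vars_reg, hr, State.vars_reg]
  · intro X hX
    funext b
    have : X ≠ A := by rintro rfl; exact hX hA
    simp [ha, this]

theorem WP.asg {x : ℕ} {e : Expr} (hx : E.ownR x) (he : E.Adm e) (hv : |e.eval s| ≤ E.B)
    (hQ : Q (s.setReg x (e.eval s)) γ) : E.WP (asg x e) E.κ 0 s γ Q := by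
  intro σ l p w hr hl
  obtain ⟨h₁, h₂, h₃⟩ := hr.eval he
  obtain ⟨t, σ', r, ht, hσ⟩ := asg_run (x := x) h₁ (by rwa [h₃])
  rw [h₃] at hσ
  have := E.le_κ
  have := he.2
  exact ⟨t, σ', _, γ, l, p, w, r, hr.setReg hx hv hσ, by omega, by omega, by omega, hQ⟩

theorem WP.sto {A : ℕ} {e₁ e₂ : Expr} (hA : E.ownA A) (h₁ : E.Adm e₁) (h₂ : E.Adm e₂)
    (hv : |e₂.eval s| ≤ E.B) (hQ : Q (s.setCell A (e₁.eval s) (e₂.eval s)) γ) :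
    E.WP (sto A e₁ e₂) E.κ 0 s γ Q := by
  intro σ l p w hr hl
  obtain ⟨a₁, a₂, a₃⟩ := hr.eval h₁
  obtain ⟨t₁, σ₁, r₁, l₁, v₁, k₁, -⟩ := e₁.comp_run 0 σ a₁
  have hr₁ := hr.of_vars v₁
  obtain ⟨b₁, b₂, b₃⟩ := hr₁.eval h₂
  obtain ⟨t₂, σ₂, r₂, l₂, v₂, k₂, q₂⟩ := e₂.comp_run 1 σ₁ b₁
  have hr₂ := hr₁.of_vars v₂
  have i₁ : σ₂.reg 1 = e₁.eval s := by rw [← a₃, ← k₁]; exact q₂ 0 (by norm_num)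
  have i₂ : σ₂.reg 3 = e₂.eval s := by rw [← b₃]; exact k₂
  have := E.le_κ
  have := h₁.2
  have := h₂.2
  refine ⟨_, _, _, γ, l, p, w, .seq r₁ (.seq r₂ (.store σ₂ A 1 3)),
    hr₂.setCell hA hv ?_, by omega, by omega, by omega, hQ⟩
  rw [i₁, i₂, State.vars_setCell]

theorem WP.ite {e : Expr} (he : E.Adm e) (h₁ : e.eval s ≠ 0 → E.WP P c d s γ Q)
    (h₂ : e.eval s = 0 → E.WP P' c d s γ Q) : E.WP (ite' e P P') (E.κ + c) d s γ Q := by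
  intro σ l p w hr hl
  obtain ⟨a₁, a₂, a₃⟩ := hr.eval he
  obtain ⟨t₁, σ₁, r₁, l₁, v₁, k₁, -⟩ := e.comp_run 0 σ a₁
  simp only [Nat.mul_zero, Nat.zero_add] at k₁
  have := E.le_κ
  have := he.2
  by_cases h0 : e.eval s = 0
  · obtain ⟨t, σ', s', γ', l', p', w', q₁, q₂, q₃, q₄, q₅, q₆⟩ :=
      h₂ h0 σ₁ l p w (hr.of_vars v₁) (by omega)
    exact ⟨_, σ', s', γ', l', p', w', .seq r₁ (.cond_false (by rw [k₁, a₃, h0]) q₁), q₂, by omega,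
      by omega, by omega, q₆⟩
  · obtain ⟨t, σ', s', γ', l', p', w', q₁, q₂, q₃, q₄, q₅, q₆⟩ :=
      h₁ h0 σ₁ l p w (hr.of_vars v₁) (by omega)
    exact ⟨_, σ', s', γ', l', p', w', .seq r₁ (.cond_true (by rw [k₁, a₃]; exact h0) q₁), q₂,
      by omega, by omega, by omega, q₆⟩

/-- The invariant at `i + 1` is required of the state after the counter has been advanced. Each
round pays `2κ` for the increment and the test, and `4κ` covers the initialisation. -/
theorem WP.for {x y : ℕ} {e : Expr} {k : ℕ} {I : ℕ → State → E.Γ → Prop} (hx : E.ownR x)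
    (hy : E.ownR y) (hxy : x ≠ y) (he : E.Adm e) (hk : e.eval s = k) (hkB : k ≤ E.B)
    (h0 : I 0 ((s.setReg y k).setReg x 0) γ)
    (hstep : ∀ i < k, ∀ s γ, I i s γ → s.reg x = i → s.reg y = k →
      E.WP P c d s γ fun s' γ' => s'.reg x = i ∧ s'.reg y = k ∧ I (i + 1) (s'.setReg x (i + 1)) γ') :
    E.WP (for' x y e P) (4 * E.κ + k * (c + 2 * E.κ)) (k * d) s γ
      fun s' γ' => s'.reg x = k ∧ s'.reg y = k ∧ I k s' γ' := by
  have hκ := E.le_κ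
  have hS := E.le_S
  have hB := E.le_B
  have hkB' : |(k : ℤ)| ≤ E.B := by simpa using hkB
  have hlt : E.Adm (.op .lt (.var x) (.var y)) := ⟨⟨trivial, hx, hy⟩, by simp [Expr.size]; omega⟩
  have hinc : E.Adm (.var x + 1) := by
    refine ⟨⟨trivial, hx, ?_⟩, ?_⟩
    · change |(1 : ℤ)| ≤ E.B
      simp; omega
    · change 3 ≤ E.S
      omega
  -- Induction on the number `j` of rounds that remain; scratch register 1 holds the outcome of the
  -- loop test.
  have key : ∀ j i s γ, i + j = k → I i s γ → s.reg x = i → s.reg y = k →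
      ∀ σ l p w, E.Rep σ s γ l p w → σ.reg 1 = (if i < k then 1 else 0) →
      l + j * (c + 2 * E.κ) ≤ E.Lmax →
      ∃ t σ' s' γ' l' p' w', Run E.W (.loop 1 (.seq P (.seq (FineGrained.asg x (.var x + 1))
          ((Expr.op .lt (.var x) (.var y)).comp 0)))) σ t σ' ∧ E.Rep σ' s' γ' l' p' w' ∧
        l' ≤ l + j * (c + 2 * E.κ) ∧ t + p' ≤ p + j * (c + 2 * E.κ) + 1 ∧ w' ≤ w + j * d ∧
        s'.reg x = k ∧ s'.reg y = k ∧ I k s' γ' := by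
    intro j
    induction j with
    | zero =>
      intro i s γ hij hI hsx hsy σ l p w hr h1 hl
      obtain rfl : i = k := by omega
      exact ⟨1, σ, s, γ, l, p, w, .loop_done (by simpa using h1), hr, by omega, by omega, by omega,
        hsx, hsy, hI⟩
    | succ j ih =>
      intro i s γ hij hI hsx hsy σ l p w hr h1 hl
      have hik : i < k := by omega
      have hm : (j + 1) * (c + 2 * E.κ) = j * (c + 2 * E.κ) + (c + 2 * E.κ) := by ring
      have hd : (j + 1) * d = j * d + d := by ring
      obtain ⟨t₁, σ₁, s₁, γ₁, l₁, p₁, w₁, a₁, a₂, a₃, a₄, a₅, a₆, a₇, a₈⟩ :=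
        hstep i hik s γ hI hsx hsy σ l p w hr (by omega)
      have hev : (Expr.var x + 1).eval s₁ = (i + 1 : ℕ) := by simp [a₆]
      obtain ⟨b₁, b₂, b₃⟩ := a₂.eval hinc
      obtain ⟨t₂, σ₂, r₂, l₂, v₂⟩ := asg_run (x := x) b₁ (by rwa [b₃])
      rw [b₃, hev] at v₂
      have hr₂ := a₂.setReg hx (by rw [abs_of_nonneg (by positivity)]; exact_mod_cast (by omega)) v₂
      obtain ⟨c₁, c₂, c₃⟩ := hr₂.eval hlt
      obtain ⟨t₃, σ₃, r₃, l₃, v₃, k₃, -⟩ := Expr.comp_run _ 0 σ₂ c₁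
      have hr₃ := hr₂.of_vars v₃
      have hsz : (Expr.var x + 1).size = 3 := rfl
      have hsz' : (Expr.op .lt (.var x) (.var y)).size = 3 := rfl
      obtain ⟨t₄, σ₄, s₄, γ₄, l₄, p₄, w₄, d₁, d₂, d₃, d₄, d₅, d₆⟩ :=
        ih (i + 1) _ γ₁ (by omega) (by exact_mod_cast a₈) (by simp)
          (by rw [State.setReg_reg, if_neg (Ne.symm hxy), a₇]) σ₃ l₁ p₁ w₁ hr₃ (by
            rw [Nat.mul_zero, Nat.zero_add, c₃] at k₃
            rw [k₃]
            simp [Ne.symm hxy, a₇]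
            norm_cast) (by omega)
      refine ⟨_, σ₄, s₄, γ₄, l₄, p₄, w₄, .loop_step (by simp [h1, hik])
        (.seq a₁ (.seq r₂ r₃)) d₁, d₂, by omega, by omega, by omega, d₆⟩
  intro σ l p w hr hl
  obtain ⟨b₁, b₂, b₃⟩ := hr.eval he
  obtain ⟨t₁, σ₁, r₁, l₁, v₁⟩ := asg_run (x := y) b₁ (by rwa [b₃])
  rw [b₃, hk] at v₁
  have hr₁ := hr.setReg hy hkB' v₁
  have h0' : E.Adm 0 := ⟨by change |(0 : ℤ)| ≤ E.B; simp, by change 1 ≤ E.S; omega⟩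
  obtain ⟨c₁, c₂, c₃⟩ := hr₁.eval h0'
  obtain ⟨t₂, σ₂, r₂, l₂, v₂⟩ := asg_run (x := x) c₁ (by rwa [c₃])
  rw [c₃, Expr.eval_zero] at v₂
  have hr₂ := hr₁.setReg hx (by simp) v₂
  obtain ⟨d₁, d₂, d₃⟩ := hr₂.eval hlt
  obtain ⟨t₃, σ₃, r₃, l₃, v₃, k₃, -⟩ := Expr.comp_run _ 0 σ₂ d₁
  have hr₃ := hr₂.of_vars v₃
  obtain ⟨t₄, σ₄, s₄, γ₄, l₄, p₄, w₄, f₁, f₂, f₃, f₄, f₅, f₆⟩ :=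
    key k 0 _ γ (by omega) h0 (by simp) (by simp [Ne.symm hxy]) σ₃ l p w hr₃ (by
      rw [Nat.mul_zero, Nat.zero_add, d₃] at k₃
      rw [k₃]
      simp [Ne.symm hxy]) (by omega)
  have hsz : (0 : Expr).size = 1 := rfl
  have hsz' : (Expr.op .lt (.var x) (.var y)).size = 3 := rfl
  have := he.2
  exact ⟨_, σ₄, s₄, γ₄, l₄, p₄, w₄, .seq r₁ (.seq r₂ (.seq r₃ f₁)), f₂, by omega, by omega,
    by omega, f₆⟩

end Env
end FineGrained

namespace FineGrained

/-! ### Certificates for maximum weight matchings -/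

theorem WGraph.toGraph_adj {N : ℕ} {G : WGraph N} {i j : Fin N} :
    G.toGraph.Adj i j ↔ (G s(i, j)).isSome ∧ i ≠ j := by
  simp [WGraph.toGraph]

open Classical in
theorem WGraph.sum_ite_mem_edge {N : ℕ} (y : Fin N → ℤ) {i j : Fin N} (h : i ≠ j) :
    ∑ v, (if v ∈ s(i, j) then y v else 0) = y i + y j := by
  rw [← Finset.sum_filter]
  have : (Finset.univ.filter fun v => v ∈ s(i, j)) = {i, j} := by ext v; simp
  rw [this, Finset.sum_pair h]

open Classical in
theorem WGraph.card_edges_le_one {N : ℕ} {G : WGraph N} {M : G.toGraph.Subgraph} (hM : M.IsMatching)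
    (v : Fin N) : ((Finset.univ.filter fun e => e ∈ M.edgeSet).filter fun e => v ∈ e).card ≤ 1 := by
  rw [Finset.card_le_one]
  intro e he e' he'
  simp only [Finset.mem_filter, Finset.mem_univ, true_and] at he he'
  obtain ⟨a, rfl⟩ := Sym2.mem_iff_exists.1 he.2
  obtain ⟨b, rfl⟩ := Sym2.mem_iff_exists.1 he'.2
  have ha : M.Adj v a := he.1
  have hb : M.Adj v b := he'.1
  rw [(hM (M.edge_vert ha)).unique ha hb]

open Classical in
/-- Weak duality, and optimality of tight matchings. -/
theorem WGraph.isMaxMatchingWeight_of_dual {N : ℕ} {G : WGraph N} {y : Fin N → ℤ}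
    (hy : ∀ v, 0 ≤ y v) (hG : ∀ i j c, G s(i, j) = some c → (c : ℤ) ≤ y i + y j)
    {R : Fin N → Fin N → Prop} (hsymm : ∀ i j, R i j → R j i)
    (huniq : ∀ i j k, R i j → R i k → j = k)
    (htight : ∀ i j, R i j → i ≠ j ∧ ∃ c, G s(i, j) = some c ∧ (c : ℤ) = y i + y j)
    (hcov : ∀ v, y v ≠ 0 → ∃ a, R v a) : G.IsMaxMatchingWeight (∑ v, y v) := by
  have weight_eq (M : G.toGraph.Subgraph) : ((G.weight M : ℕ) : ℤ) =
      ∑ e with e ∈ M.edgeSet, (((G e).getD 0 : ℕ) : ℤ) := by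
    simp only [WGraph.weight, Nat.cast_sum]
  -- Double counting: summing `y` over the ends of all matching edges counts `y v` once for each
  -- matching edge at `v`.
  have swap (M : G.toGraph.Subgraph) :
      ∑ e with e ∈ M.edgeSet, ∑ v, (if v ∈ e then y v else 0) =
      ∑ v, (((Finset.univ.filter fun e => e ∈ M.edgeSet).filter fun e => v ∈ e).card : ℤ) * y v := by
    rw [Finset.sum_comm]
    refine Finset.sum_congr rfl fun v _ => ?_
    rw [← Finset.sum_filter, Finset.sum_const, nsmul_eq_mul]
  constructor
  -- The relation `R` is a matching. Its edges are tight, and every node that it misses has the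
  -- value 0, so its weight is the full sum of `y`.
  · let M : G.toGraph.Subgraph :=
      { verts := {v | ∃ a, R v a}
        Adj := R
        adj_sub := fun {i j} h => by
          obtain ⟨h₁, c, h₂, -⟩ := htight i j h
          exact WGraph.toGraph_adj.2 ⟨by simp [h₂], h₁⟩
        edge_vert := fun {i j} h => ⟨j, h⟩
        symm := ⟨fun i j h => hsymm i j h⟩ }
    have hM : M.IsMatching := by
      rintro v ⟨a, ha⟩
      exact ⟨a, ha, fun b hb => huniq v b a hb ha⟩
    refine ⟨M, hM, ?_⟩
    rw [weight_eq]
    have : ∀ e ∈ Finset.univ.filter (fun e => e ∈ M.edgeSet), (((G e).getD 0 : ℕ) : ℤ) =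
        ∑ v, (if v ∈ e then y v else 0) := by
      intro e he
      induction e using Sym2.ind with
      | _ i j =>
        have hR : R i j := by simpa using he
        obtain ⟨h₁, c, h₂, h₃⟩ := htight i j hR
        rw [WGraph.sum_ite_mem_edge y h₁, h₂, ← h₃]
        rfl
    rw [Finset.sum_congr rfl this, swap]
    refine Finset.sum_congr rfl fun v _ => ?_
    by_cases h0 : y v = 0
    · simp [h0]
    · obtain ⟨a, ha⟩ := hcov v h0
      have h1 := WGraph.card_edges_le_one hM v
      have h2 : 0 < ((Finset.univ.filter fun e => e ∈ M.edgeSet).filter fun e => v ∈ e).card := by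
        refine Finset.card_pos.2 ⟨s(v, a), ?_⟩
        simp only [Finset.mem_filter, Finset.mem_univ, true_and, SimpleGraph.Subgraph.mem_edgeSet,
          Sym2.mem_iff, true_or, and_true]
        exact ha
      rw [show ((Finset.univ.filter fun e => e ∈ M.edgeSet).filter fun e => v ∈ e).card = 1 by omega]
      simp
  -- Weak duality: an edge weighs at most the sum of `y` over its ends, and a matching meets each
  -- node at most once.
  · rintro x ⟨M, hM, rfl⟩
    rw [weight_eq]
    calc ∑ e with e ∈ M.edgeSet, (((G e).getD 0 : ℕ) : ℤ)
        ≤ ∑ e with e ∈ M.edgeSet, ∑ v, (if v ∈ e then y v else 0) := by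
          refine Finset.sum_le_sum fun e he => ?_
          induction e using Sym2.ind with
          | _ i j =>
            have hR : M.Adj i j := by simpa using he
            obtain ⟨h₁, h₂⟩ := WGraph.toGraph_adj.1 hR.adj_sub
            obtain ⟨c, hc⟩ := Option.isSome_iff_exists.1 h₁
            rw [WGraph.sum_ite_mem_edge y h₂, hc]
            exact hG i j c hc
      _ = _ := swap M
      _ ≤ ∑ v, y v := by
          refine Finset.sum_le_sum fun v _ => ?_
          have h1 : ((((Finset.univ.filter fun e => e ∈ M.edgeSet).filter
              fun e => v ∈ e).card : ℕ) : ℤ) ≤ 1 := by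
            exact_mod_cast WGraph.card_edges_le_one hM v
          nlinarith [hy v]

theorem WGraph.IsMaxMatchingWeight.unique {N : ℕ} {G : WGraph N} {v v' : ℤ}
    (h : G.IsMaxMatchingWeight v) (h' : G.IsMaxMatchingWeight v') : v = v' :=
  IsGreatest.unique h h'

/-! ### Weighted subgraphs of a grid

The nodes of a grid of width `w` are numbered row by row. Slot `2 * v` is the place of the edge from
`v` to the right, slot `2 * v + 1` that of the edge down from `v`. -/

def slotWeight (w : ℕ) (E : ℕ → Option ℕ) (a b : ℕ) : Option ℕ :=
  if b = a + 1 then E (2 * a) else if b = a + w then E (2 * a + 1) else none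

/-- The weighted graph with the given weights in the slots. -/
def slotGraph (N w : ℕ) (E : ℕ → Option ℕ) : WGraph N :=
  Sym2.lift ⟨fun i j => slotWeight w E (min i j : Fin N) (max i j : Fin N), fun i j => by
    simp only [min_comm, max_comm]⟩

theorem slotGraph_mk {N w : ℕ} {E : ℕ → Option ℕ} (i j : Fin N) :
    slotGraph N w E s(i, j) = slotWeight w E (min i j : ℕ) (max i j : ℕ) := by
  simp [slotGraph]

theorem slotGraph_of_le {N w : ℕ} {E : ℕ → Option ℕ} {i j : Fin N} (h : (i : ℕ) ≤ j) :
    slotGraph N w E s(i, j) = slotWeight w E i j := by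
  rw [slotGraph_mk, min_eq_left h, max_eq_right h]

/-- The second end of an edge in slot `e`. -/
def slotEnd (w e : ℕ) : ℕ := e / 2 + if e % 2 = 0 then 1 else w

/-- In a grid of width 1 the neighbours to the right and below would have the same number; `1 < w`
keeps the two slots of a node apart. -/
theorem slotGraph_slot {N w : ℕ} (hw : 1 < w) {E : ℕ → Option ℕ} {e : ℕ} {i j : Fin N}
    (hi : (i : ℕ) = e / 2) (hj : (j : ℕ) = slotEnd w e) : slotGraph N w E s(i, j) = E e := by
  have hle : (i : ℕ) ≤ j := by rw [hi, hj]; simp [slotEnd]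
  rw [slotGraph_of_le hle, slotWeight, hi, hj, slotEnd]
  rcases Nat.mod_two_eq_zero_or_one e with h | h
  · simp [h, show 2 * (e / 2) = e by omega]
  · simp only [h, one_ne_zero, if_false, add_right_inj, if_true, show 2 * (e / 2) + 1 = e by omega]
    rw [if_neg (by omega)]

theorem slotGraph_update {N w : ℕ} (hw : 1 < w) {E : ℕ → Option ℕ} {e : ℕ} {i j : Fin N}
    (hi : (i : ℕ) = e / 2) (hj : (j : ℕ) = slotEnd w e) (x : Option ℕ) :
    Function.update (slotGraph N w E) s(i, j) x = slotGraph N w (Function.update E e x) := by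
  have hle : (i : ℕ) ≤ j := by rw [hi, hj]; simp [slotEnd]
  have key : ∀ a b : Fin N, (a : ℕ) ≤ b → Function.update (slotGraph N w E) s(i, j) x s(a, b) =
      slotGraph N w (Function.update E e x) s(a, b) := by
    intro a b hab
    by_cases h : a = i ∧ b = j
    · obtain ⟨rfl, rfl⟩ := h
      rw [Function.update_self, slotGraph_slot hw hi hj, Function.update_self]
    · have hne : s(a, b) ≠ s(i, j) := by
        intro he
        rcases Sym2.eq_iff.1 he with h' | ⟨rfl, rfl⟩
        · exact h h'
        · have : b = a := Fin.ext (by omega)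
          subst this
          exact h ⟨rfl, rfl⟩
      rw [Function.update_of_ne hne, slotGraph_of_le hab, slotGraph_of_le hab, slotWeight, slotWeight]
      have h' : ¬ ((a : ℕ) = e / 2 ∧ (b : ℕ) = slotEnd w e) := by
        rintro ⟨h₁, h₂⟩
        exact h ⟨Fin.ext (by omega), Fin.ext (by omega)⟩
      rw [slotEnd] at h'
      split_ifs with h₁ h₂
      · rw [Function.update_of_ne]
        rintro rfl
        apply h'
        simp [h₁]
      · rw [Function.update_of_ne]
        rintro rfl
        apply h'
        have e1 : (2 * (a : ℕ) + 1) % 2 = 1 := by omega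
        have e2 : (2 * (a : ℕ) + 1) / 2 = a := by omega
        simp [h₂, e1, e2]
      · rfl
  funext p
  induction p using Sym2.ind with
  | _ a b =>
    rcases le_total (a : ℕ) b with h | h
    · exact key a b h
    · rw [Sym2.eq_swap (a := a) (b := b)]; exact key b a h

theorem slotGraph_none {N w : ℕ} : slotGraph N w (fun _ => none) = fun _ => none := by
  funext p
  induction p using Sym2.ind with
  | _ a b => rw [slotGraph_mk, slotWeight]; split_ifs <;> rfl

theorem grid_div_mod {w y x : ℕ} (hx : x < w) : (w * y + x) / w = y ∧ (w * y + x) % w = x := by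
  constructor
  · rw [Nat.mul_add_div (by omega), Nat.div_eq_of_lt hx, add_zero]
  · rw [Nat.mul_add_mod, Nat.mod_eq_of_lt hx]

theorem grid_right {w v : ℕ} (h : v % w + 1 < w) :
    (v + 1) / w = v / w ∧ (v + 1) % w = v % w + 1 := by
  have := grid_div_mod (w := w) (y := v / w) h
  rwa [← add_assoc, Nat.div_add_mod] at this

theorem grid_down {w v : ℕ} (hw : 0 < w) : (v + w) / w = v / w + 1 ∧ (v + w) % w = v % w :=
  ⟨Nat.add_div_right v hw, Nat.add_mod_right v w⟩

/-- Matchings of weighted subgraphs of a grid: a dual solution `D` and a matching given by its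
horizontal edges `MH` and vertical edges `MV` that are tight. -/
theorem slotGraph_isMax {R w : ℕ} (hw : 1 < w) {E : ℕ → Option ℕ} {EH EV : ℕ → ℕ → Option ℕ}
    (hH : ∀ v, E (2 * v) = EH (v / w) (v % w)) (hV : ∀ v, E (2 * v + 1) = EV (v / w) (v % w))
    {D : ℕ → ℕ → ℤ} {MH MV : ℕ → ℕ → Prop}
    (hD : ∀ y x, 0 ≤ D y x)
    (hEH : ∀ y x c, x < w → EH y x = some c → x + 1 < w ∧ (c : ℤ) ≤ D y x + D y (x + 1))
    (hEV : ∀ y x c, x < w → EV y x = some c → (c : ℤ) ≤ D y x + D (y + 1) x)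
    (hMH : ∀ y x, x < w → MH y x → x + 1 < w ∧ y < R ∧
      ∃ c, EH y x = some c ∧ (c : ℤ) = D y x + D y (x + 1))
    (hMV : ∀ y x, x < w → MV y x → y + 1 < R ∧
      ∃ c, EV y x = some c ∧ (c : ℤ) = D y x + D (y + 1) x)
    (h1 : ∀ y x, MH y x → ¬ MH y (x + 1)) (h2 : ∀ y x, MV y x → ¬ MV (y + 1) x)
    (h3 : ∀ y x, MH y x → ¬ MV y x) (h4 : ∀ y x, MH y x → ¬ MV y (x + 1))
    (h5 : ∀ y x, MV y x → ¬ MH (y + 1) x) (h6 : ∀ y x, MV y (x + 1) → ¬ MH (y + 1) x)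
    (hcov : ∀ y x, x < w → D y x ≠ 0 → MH y x ∨ MV y x ∨ (∃ x', x = x' + 1 ∧ MH y x') ∨
      (∃ y', y = y' + 1 ∧ MV y' x)) :
    (slotGraph (R * w) w E).IsMaxMatchingWeight (∑ v : Fin (R * w), D (v / w) (v % w)) := by
  have hw0 : 0 < w := by omega
  -- Adjacency in the matching, in coordinates: right, left, down, up.
  let A : ℕ → ℕ → ℕ → ℕ → Prop := fun y x y' x' =>
    (y' = y ∧ x' = x + 1 ∧ MH y x) ∨ (y = y' ∧ x = x' + 1 ∧ MH y' x') ∨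
    (x' = x ∧ y' = y + 1 ∧ MV y x) ∨ (x = x' ∧ y = y' + 1 ∧ MV y' x')
  -- Of the sixteen pairs of directions, the four equal ones give the same neighbour, and `h1` to
  -- `h6` exclude the others: they list the ways in which two matching edges can share a node.
  have hA : ∀ y x y' x' y'' x'', A y x y' x' → A y x y'' x'' → y' = y'' ∧ x' = x'' := by
    rintro y x y' x' y'' x'' (⟨rfl, rfl, h⟩ | ⟨rfl, rfl, h⟩ | ⟨rfl, rfl, h⟩ | ⟨rfl, rfl, h⟩)
      (⟨e, e', h'⟩ | ⟨e, e', h'⟩ | ⟨e, e', h'⟩ | ⟨e, e', h'⟩)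
    · exact ⟨e.symm, e'.symm⟩
    · subst e e'; exact absurd h (h1 _ _ h')
    · subst e e'; exact absurd h' (h3 _ _ h)
    · subst e e'; exact absurd h (h5 _ _ h')
    · subst e e'; exact absurd h' (h1 _ _ h)
    · exact ⟨e, by omega⟩
    · subst e e'; exact absurd h' (h4 _ _ h)
    · subst e e'; exact absurd h (h6 _ _ h')
    · subst e e'; exact absurd h (h3 _ _ h')
    · subst e e'; exact absurd h (h4 _ _ h')
    · exact ⟨e'.symm, e.symm⟩
    · subst e e'; exact absurd h (h2 _ _ h')
    · subst e e'; exact absurd h' (h5 _ _ h)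
    · subst e e'; exact absurd h' (h6 _ _ h)
    · subst e e'; exact absurd h' (h2 _ _ h)
    · exact ⟨by omega, e⟩
  have hlt (v : Fin (R * w)) : (v : ℕ) / w < R := Nat.div_lt_of_lt_mul (by have := v.2; rwa [mul_comm w R])
  refine WGraph.isMaxMatchingWeight_of_dual
    (y := fun v : Fin (R * w) => D ((v : ℕ) / w) ((v : ℕ) % w))
    (R := fun i j => A ((i : ℕ) / w) ((i : ℕ) % w) ((j : ℕ) / w) ((j : ℕ) % w))
    (fun v => hD _ _) ?_ ?_ ?_ ?_ ?_
  · have key : ∀ (i j : Fin (R * w)) c, (i : ℕ) ≤ j → slotGraph (R * w) w E s(i, j) = some c →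
        (c : ℤ) ≤ D ((i : ℕ) / w) ((i : ℕ) % w) + D ((j : ℕ) / w) ((j : ℕ) % w) := by
      intro i j c hij h
      rw [slotGraph_of_le hij, slotWeight] at h
      split_ifs at h with e₁ e₂
      · rw [hH] at h
        obtain ⟨a, b⟩ := hEH _ _ _ (Nat.mod_lt _ hw0) h
        rw [e₁, (grid_right a).1, (grid_right a).2]
        exact b
      · rw [hV] at h
        rw [e₂, (grid_down hw0).1, (grid_down hw0).2]
        exact hEV _ _ _ (Nat.mod_lt _ hw0) h
    intro i j c h
    rcases le_total (i : ℕ) j with hij | hij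
    · exact key i j c hij h
    · rw [Sym2.eq_swap] at h
      rw [add_comm]
      exact key j i c hij h
  · rintro i j (⟨h, h', h''⟩ | ⟨h, h', h''⟩ | ⟨h, h', h''⟩ | ⟨h, h', h''⟩)
    · exact .inr (.inl ⟨h, h', h''⟩)
    · exact .inl ⟨h, h', h''⟩
    · exact .inr (.inr (.inr ⟨h, h', h''⟩))
    · exact .inr (.inr (.inl ⟨h, h', h''⟩))
  · intro i j k hij hik
    obtain ⟨a, b⟩ := hA _ _ _ _ _ _ hij hik
    refine Fin.ext ?_
    rw [← Nat.div_add_mod (j : ℕ) w, ← Nat.div_add_mod (k : ℕ) w, a, b]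
  · have key : ∀ i j : Fin (R * w), ((j : ℕ) / w = (i : ℕ) / w ∧ (j : ℕ) % w = (i : ℕ) % w + 1 ∧
        MH ((i : ℕ) / w) ((i : ℕ) % w)) ∨ ((j : ℕ) % w = (i : ℕ) % w ∧
        (j : ℕ) / w = (i : ℕ) / w + 1 ∧ MV ((i : ℕ) / w) ((i : ℕ) % w)) →
        i ≠ j ∧ ∃ c, slotGraph (R * w) w E s(i, j) = some c ∧
          (c : ℤ) = D ((i : ℕ) / w) ((i : ℕ) % w) + D ((j : ℕ) / w) ((j : ℕ) % w) := by
      rintro i j (⟨a, b, h⟩ | ⟨a, b, h⟩)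
      · obtain ⟨-, -, c, h', h''⟩ := hMH _ _ (Nat.mod_lt _ hw0) h
        have hj : (j : ℕ) = i + 1 := by
          rw [← Nat.div_add_mod (j : ℕ) w, ← Nat.div_add_mod (i : ℕ) w, a, b, add_assoc]
        refine ⟨fun h => by rw [h] at hj; omega, c, ?_, ?_⟩
        · rw [slotGraph_of_le (by omega), slotWeight, if_pos hj, hH, h']
        · rw [a, b, h'']
      · obtain ⟨-, c, h', h''⟩ := hMV _ _ (Nat.mod_lt _ hw0) h
        have hj : (j : ℕ) = i + w := by
          rw [← Nat.div_add_mod (j : ℕ) w, ← Nat.div_add_mod (i : ℕ) w, a, b]; ring_nf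
        refine ⟨fun h => by rw [h] at hj; omega, c, ?_, ?_⟩
        · rw [slotGraph_of_le (by omega), slotWeight, if_neg (by omega), if_pos hj, hV, h']
        · rw [a, b, h'']
    rintro i j (h | h | h | h)
    · exact key i j (.inl h)
    · obtain ⟨a, c, b, b'⟩ := key j i (.inl h)
      exact ⟨a.symm, c, by rw [Sym2.eq_swap, b], by rw [b', add_comm]⟩
    · exact key i j (.inr h)
    · obtain ⟨a, c, b, b'⟩ := key j i (.inr h)
      exact ⟨a.symm, c, by rw [Sym2.eq_swap, b], by rw [b', add_comm]⟩
  · intro v hv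
    have hx := Nat.mod_lt (v : ℕ) hw0
    have mk : ∀ y x, y < R → x < w → A ((v : ℕ) / w) ((v : ℕ) % w) y x →
        ∃ a : Fin (R * w), A ((v : ℕ) / w) ((v : ℕ) % w) ((a : ℕ) / w) ((a : ℕ) % w) := by
      intro y x hy hx h
      obtain ⟨e₁, e₂⟩ := grid_div_mod (y := y) hx
      refine ⟨⟨w * y + x, ?_⟩, ?_⟩
      · calc w * y + x < w * y + w := by omega
          _ = (y + 1) * w := by ring
          _ ≤ R * w := Nat.mul_le_mul_right _ hy
      · simpa only [e₁, e₂] using h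
    rcases hcov _ _ hx hv with h | h | ⟨x', e, h⟩ | ⟨y', e, h⟩
    · exact mk _ _ (hlt v) (hMH _ _ hx h).1 (.inl ⟨rfl, rfl, h⟩)
    · exact mk _ _ (hMV _ _ hx h).1 hx (.inr (.inr (.inl ⟨rfl, rfl, h⟩)))
    · exact mk _ x' (hlt v) (by omega) (.inr (.inl ⟨rfl, e, h⟩))
    · exact mk y' _ (by have := hlt v; omega) hx (.inr (.inr (.inr ⟨rfl, e, h⟩)))

theorem sum_grid (R w : ℕ) (D : ℕ → ℕ → ℤ) :
    ∑ v : Fin (R * w), D (v / w) (v % w) = ∑ y ∈ Finset.range R, ∑ x ∈ Finset.range w, D y x := by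
  rw [Fin.sum_univ_eq_sum_range (fun v => D (v / w) (v % w))]
  induction R with
  | zero => simp
  | succ R ih =>
    rw [Finset.sum_range_succ, ← ih, Nat.succ_mul, Finset.sum_range_add]
    congr 1
    refine Finset.sum_congr rfl fun x hx => ?_
    obtain ⟨e₁, e₂⟩ := grid_div_mod (y := R) (Finset.mem_range.1 hx)
    rw [mul_comm R w, e₁, e₂]

end FineGrained

namespace FineGrained

/-! ### A grid whose maximum weight matchings compute a minimum of sums -/

/-- In rows `1` to `2r - 1` the edges at even columns pair up all nodes; these dominoes have weight
`L`. Row `2k + 1` contains the cells `(k, i)` and the steps between them. An even row only turns the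
alternating path around: a path that leaves cell `(k, i)` downwards in column `2i + 1` runs back
along the domino below and enters `(k + 1, i)` in column `2i`. -/
def slotH (r m L : ℕ) (hr : ℕ → ℕ → Option ℕ) (y x : ℕ) : Option ℕ :=
  if 0 < y ∧ y < 2 * r then
    if x % 2 = 0 then some L
    else if y % 2 = 1 then
      if x + 1 < 2 * m then some L else if x + 1 < 4 * m then hr (y / 2) (x / 2) else none
    else none
  else none

/-- The parity condition leaves, under a cell, one priced edge in column `2i + 1` and, one row
lower, one free edge in column `2i`. The source is a node of row 0 and the sink a node of row `2r`;
without `src` and `snk` those rows have no edges. -/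
def slotV (r L : ℕ) (v : ℕ → ℕ) (src snk : Option ℕ) (y x : ℕ) : Option ℕ :=
  if 0 < y ∧ y + 1 < 2 * r then
    if (x + y) % 2 = 0 then some (if y % 2 = 1 then L - v (x / 2) else L) else none
  else if y = 0 then if src = some x then some L else none
  else if y + 1 = 2 * r then if snk = some x then some L else none
  else none

/-- The weights in the slots of the grid of width `4 * m`. Cell `(k, i)` of an `r × 2m` array is the
horizontal edge in row `2 * k + 1` and columns `2 * i`, `2 * i + 1`, and the step from cell `(k, i)`
to cell `(k, i + 1)` has weight `hr k i` for `m - 1 ≤ i`; the step from `(k, i)` to `(k + 1, i)`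
costs `v i`. -/
def gridSlots (r m L : ℕ) (v : ℕ → ℕ) (hr : ℕ → ℕ → Option ℕ) (src snk : Option ℕ) (e : ℕ) :
    Option ℕ :=
  if e % 2 = 0 then slotH r m L hr (e / 2 / (4 * m)) (e / 2 % (4 * m))
  else slotV r L v src snk (e / 2 / (4 * m)) (e / 2 % (4 * m))

/-- The data of the construction: the path from the source enters column `c0` and leaves column
`c1`; `Bt k i` is the cost of the first `i` steps in row `k`. -/
structure Gadget where
  (r m c0 c1 ks Lh : ℕ)
  v : ℕ → ℕ
  Bt : ℕ → ℕ → ℤ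
  hc : c0 + c1 + 1 = 2 * m
  hc0 : c0 < m
  hks : ks < r
  v_eq : v c1 = v c0
  v_left : ∀ i, c0 ≤ i → i < m → v c0 ≤ v i
  v_right : ∀ k i, k + 1 < r → m ≤ i → i ≤ c1 →
    (Bt k c1 - Bt k i) - (Bt (k + 1) c1 - Bt (k + 1) i) + v c0 ≤ v i
  v_le : ∀ i < 2 * m, v i ≤ 2 * Lh
  Bt_zero : ∀ k i, i < m → Bt k i = 0
  Bt_mono : ∀ k i i', k < r → i ≤ i' → i' < 2 * m → Bt k i ≤ Bt k i'
  min : ∀ k < r, Bt ks c1 ≤ Bt k c1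
  big : ∀ k < r, ((r - 1 : ℕ) : ℤ) * v c0 + Bt k c1 ≤ Lh

namespace Gadget
variable (G : Gadget)

/-- The price of all `r - 1` descents when they are made in the end columns `c0` and `c1`, where
each costs `v c0`. -/
def top : ℤ := ((G.r - 1 : ℕ) : ℤ) * G.v G.c0
def μ : ℤ := G.Bt G.ks G.c1

/-- A potential for the directed path problem: it rises along each move by at most the price, and by
exactly the price along the path that descends in column `c0`, crosses in row `ks` and descends in
column `c1`. Between `c0` and `m` it is the price of descending in column `c0`; from `m` to `c1` it
is the value at column `c1` minus what row `k` still costs. The constants outside `[c0, c1]` are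
chosen so that moves across these borders never raise it. -/
def pot (k i : ℕ) : ℤ :=
  if i < G.c0 then G.top else if i < G.m then (k : ℤ) * G.v G.c0
  else if i ≤ G.c1 then (k : ℤ) * G.v G.c0 + G.μ - G.Bt k G.c1 + G.Bt k i else G.μ

/-- The node values are half of the large weight plus or minus the potential, the sign depending on
the side of the bipartition. The signs cancel on a domino, which is therefore tight, and on a move
they leave the difference of the potentials of two cells. The sink value makes the sink edge tight.
-/
def dual (y x : ℕ) : ℤ :=
  if y = 0 then if x = 2 * G.c0 then (G.Lh : ℤ) else 0
  else if y < 2 * G.r then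
    if (x + y) % 2 = 0 then G.Lh + G.pot (y / 2) (x / 2) else G.Lh - G.pot (y / 2) (x / 2)
  else if y = 2 * G.r ∧ x = 2 * G.c1 + 1 then G.Lh - (G.top + G.μ) else 0

theorem k_bound {k : ℕ} (hk : k < G.r) :
    0 ≤ (k : ℤ) * G.v G.c0 ∧ (k : ℤ) * G.v G.c0 ≤ G.top := by
  refine ⟨by positivity, ?_⟩
  rw [top]
  gcongr
  omega

theorem k_succ (k : ℕ) : ((k + 1 : ℕ) : ℤ) * G.v G.c0 = k * G.v G.c0 + G.v G.c0 := by
  push_cast; ring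

theorem Bt_nonneg {k i : ℕ} (hk : k < G.r) (hi : i < 2 * G.m) : 0 ≤ G.Bt k i := by
  have := G.Bt_mono k 0 i hk (Nat.zero_le _) hi
  rwa [G.Bt_zero k 0 (by have := G.hc0; omega)] at this

theorem μ_nonneg : 0 ≤ G.μ := G.Bt_nonneg G.hks (by have := G.hc; omega)

theorem pot_bound {k : ℕ} (i : ℕ) (hk : k < G.r) : |G.pot k i| ≤ G.Lh := by
  have h1 := G.k_bound hk
  have h2 := G.μ_nonneg
  have h3 := G.big k hk
  have h4 := G.big G.ks G.hks
  have h5 := G.min k hk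
  have hc := G.hc
  have h0 : 0 ≤ G.top := (G.k_bound hk).1.trans (G.k_bound hk).2
  change G.top + _ ≤ _ at h3
  change G.top + G.μ ≤ _ at h4
  change G.μ ≤ _ at h5
  rw [abs_le, pot]
  split_ifs with a b c
  · constructor <;> linarith
  · constructor <;> linarith
  · have h6 := G.Bt_mono k i G.c1 hk c (by omega)
    have h7 := G.Bt_nonneg hk (i := i) (by omega)
    constructor <;> linarith
  · constructor <;> linarith

/-- The step into column `m` uses the minimality of row `ks`. Inside `[m, c1]` there is equality,
and to the left of `m` both sides vanish except at the border `c0`, where the potential falls from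
`top`. -/
theorem pot_h {k i : ℕ} (hk : k < G.r) (hi : i + 1 < 2 * G.m) :
    G.pot k (i + 1) - G.pot k i ≤ G.Bt k (i + 1) - G.Bt k i := by
  have h1 := G.k_bound hk
  have h2 := G.μ_nonneg
  have h5 := G.min k hk
  change G.μ ≤ _ at h5
  have hc := G.hc
  have hc0 := G.hc0
  have h6 := G.Bt_mono k i (i + 1) hk (by omega) hi
  have h7 := G.Bt_zero k i
  simp only [pot]
  split_ifs with a b c d e f g <;> first | omega | skip
  all_goals first
    | linarith
    | (obtain rfl : i = G.c1 := by omega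
       linarith)

/-- Between `m` and `c1` this is exactly `v_right`: changing to a cheaper row in the middle saves no
more than the descent costs beyond `v c0`. -/
theorem pot_v {k : ℕ} (i : ℕ) (hk : k + 1 < G.r) :
    G.pot (k + 1) i - G.pot k i ≤ G.v i := by
  have h3 := G.v_left i
  have h4 := G.v_right k i hk
  have hv : (0 : ℤ) ≤ G.v i := by positivity
  simp only [pot, k_succ]
  split_ifs with a b c
  · linarith
  · have := h3 (by omega) b
    have : (G.v G.c0 : ℤ) ≤ G.v i := by exact_mod_cast this
    linarith
  · have := h4 (by omega) c
    linarith
  · linarith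

/-- In row `ks` the defining term `μ - Bt ks c1` vanishes, so the potential has the same increments
as `Bt ks`. -/
theorem pot_h_tight {i : ℕ} (h0 : G.c0 ≤ i) (h1 : i < G.c1) :
    G.pot G.ks (i + 1) - G.pot G.ks i = G.Bt G.ks (i + 1) - G.Bt G.ks i := by
  have hc := G.hc
  have hc0 := G.hc0
  have h7 := G.Bt_zero G.ks i
  have h8 := G.Bt_zero G.ks (i + 1)
  simp only [pot, μ]
  split_ifs <;> omega

theorem pot_v_tight {k i : ℕ} (h : i = G.c0 ∨ i = G.c1) :
    G.pot (k + 1) i - G.pot k i = G.v i := by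
  have hc := G.hc
  have hc0 := G.hc0
  have hv := G.v_eq
  simp only [pot, k_succ]
  rcases h with rfl | rfl
  · rw [if_neg (by omega), if_pos hc0, if_neg (by omega), if_pos hc0]; ring
  · rw [if_neg (by omega), if_neg (by omega), if_pos le_rfl, if_neg (by omega), if_neg (by omega),
      if_pos le_rfl, hv]; ring

theorem pot_source : G.pot 0 G.c0 = 0 := by
  have hc0 := G.hc0
  simp [pot, hc0]

theorem pot_sink : G.pot (G.r - 1) G.c1 = G.top + G.μ := by
  have hc0 := G.hc0
  have hc := G.hc
  rw [pot, if_neg (by omega), if_neg (by omega), if_pos le_rfl, top]; ring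

/-- The field `big` is what makes half of the large weight dominate all potentials and the price
`top + μ` of the whole path. -/
theorem dual_nonneg (y x : ℕ) : 0 ≤ G.dual y x := by
  have h4 := G.big G.ks G.hks
  change G.top + G.μ ≤ _ at h4
  rw [dual]
  split_ifs with a b c d e
  · positivity
  · rfl
  · have := abs_le.1 (G.pot_bound (x / 2) (show y / 2 < G.r by omega)); linarith
  · have := abs_le.1 (G.pot_bound (x / 2) (show y / 2 < G.r by omega)); linarith
  · linarith
  · rfl

theorem dual_mid {y x : ℕ} (hy : 0 < y) (hy' : y < 2 * G.r) : G.dual y x =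
    if (x + y) % 2 = 0 then G.Lh + G.pot (y / 2) (x / 2) else G.Lh - G.pot (y / 2) (x / 2) := by
  rw [dual, if_neg (by omega), if_pos hy']

/-- The horizontal edges of an optimal matching. -/
def MH (y x : ℕ) : Prop :=
  0 < y ∧ y < 2 * G.r ∧ x < 4 * G.m ∧
    ((x % 2 = 0 ∧ ¬ (x = 2 * G.c0 ∧ y ≤ 2 * G.ks + 1) ∧ ¬ (x = 2 * G.c1 ∧ 2 * G.ks + 1 ≤ y) ∧
      ¬ (y = 2 * G.ks + 1 ∧ 2 * G.c0 ≤ x ∧ x ≤ 2 * G.c1)) ∨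
    (x % 2 = 1 ∧ y = 2 * G.ks + 1 ∧ 2 * G.c0 + 1 ≤ x ∧ x < 2 * G.c1))

/-- The vertical edges of an optimal matching. -/
def MV (y x : ℕ) : Prop :=
  (x = 2 * G.c0 ∧ y % 2 = 0 ∧ y ≤ 2 * G.ks) ∨
  (x = 2 * G.c0 + 1 ∧ y % 2 = 1 ∧ y < 2 * G.ks + 1) ∨
  (x = 2 * G.c1 + 1 ∧ y % 2 = 1 ∧ 2 * G.ks + 1 ≤ y ∧ y < 2 * G.r) ∨
  (x = 2 * G.c1 ∧ y % 2 = 0 ∧ 2 * G.ks + 2 ≤ y ∧ y + 1 < 2 * G.r)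

/-- Augmenting along the path only exchanges partners: nodes on the path get vertical edges or
steps, and all others keep their domino. The case distinction locates a node relative to the two
descents and the crossing row. -/
theorem covered {y x : ℕ} (hy : 0 < y) (hy' : y < 2 * G.r) (hx : x < 4 * G.m) :
    G.MH y x ∨ G.MV y x ∨ (∃ x', x = x' + 1 ∧ G.MH y x') ∨ (∃ y', y = y' + 1 ∧ G.MV y' x) := by
  have hc0 := G.hc0
  have hc := G.hc
  have hks := G.hks
  have left (h0 : 0 < x) (h : G.MH y (x - 1)) : ∃ x', x = x' + 1 ∧ G.MH y x' :=
    ⟨x - 1, by omega, h⟩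
  have up (h : G.MV (y - 1) x) : ∃ y', y = y' + 1 ∧ G.MV y' x := ⟨y - 1, by omega, h⟩
  rcases Nat.mod_two_eq_zero_or_one x with hp | hp
  · by_cases q1 : x = 2 * G.c0 ∧ y ≤ 2 * G.ks + 1
    · by_cases hy2 : y % 2 = 0
      · exact .inr (.inl (.inl ⟨q1.1, hy2, by omega⟩))
      · exact .inr (.inr (.inr (up (.inl ⟨q1.1, by omega, by omega⟩))))
    by_cases q2 : x = 2 * G.c1 ∧ 2 * G.ks + 1 ≤ y
    · by_cases hy2 : y % 2 = 0
      · exact .inr (.inl (.inr (.inr (.inr ⟨q2.1, hy2, by omega, by omega⟩))))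
      by_cases hy3 : y = 2 * G.ks + 1
      · exact .inr (.inr (.inl (left (by omega) ⟨hy, hy', by omega, .inr ⟨by omega, hy3, by omega,
          by omega⟩⟩)))
      · exact .inr (.inr (.inr (up (.inr (.inr (.inr ⟨q2.1, by omega, by omega, by omega⟩))))))
    by_cases q3 : y = 2 * G.ks + 1 ∧ 2 * G.c0 ≤ x ∧ x ≤ 2 * G.c1
    · exact .inr (.inr (.inl (left (by omega) ⟨hy, hy', by omega, .inr ⟨by omega, q3.1, by omega,
        by omega⟩⟩)))
    · exact .inl ⟨hy, hy', hx, .inl ⟨hp, q1, q2, q3⟩⟩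
  · by_cases q1 : x = 2 * G.c0 + 1 ∧ y ≤ 2 * G.ks + 1
    · by_cases hy2 : y % 2 = 0
      · exact .inr (.inr (.inr (up (.inr (.inl ⟨q1.1, by omega, by omega⟩)))))
      by_cases hy3 : y = 2 * G.ks + 1
      · exact .inl ⟨hy, hy', hx, .inr ⟨hp, hy3, by omega, by omega⟩⟩
      · exact .inr (.inl (.inr (.inl ⟨q1.1, by omega, by omega⟩)))
    by_cases q2 : x = 2 * G.c1 + 1 ∧ 2 * G.ks + 1 ≤ y
    · by_cases hy2 : y % 2 = 0
      · exact .inr (.inr (.inr (up (.inr (.inr (.inl ⟨q2.1, by omega, by omega, by omega⟩))))))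
      · exact .inr (.inl (.inr (.inr (.inl ⟨q2.1, by omega, by omega, by omega⟩))))
    by_cases q3 : y = 2 * G.ks + 1 ∧ 2 * G.c0 + 1 ≤ x ∧ x < 2 * G.c1
    · exact .inl ⟨hy, hy', hx, .inr ⟨hp, q3⟩⟩
    · exact .inr (.inr (.inl (left (by omega) ⟨hy, hy', by omega, .inl ⟨by omega, by omega, by omega,
        by omega⟩⟩)))

/-- Each of the `(2r - 1) · 2m` dominoes contributes the full large weight. Source and sink together
contribute one more, less the price of the path. -/
theorem sum_dual : ∑ y ∈ Finset.range (3 * G.r), ∑ x ∈ Finset.range (4 * G.m), G.dual y x =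
    ((2 * G.r - 1 : ℕ) * (2 * G.m) + 1) * (2 * G.Lh) - G.top - G.μ := by
  have hc0 := G.hc0
  have hc := G.hc
  have hks := G.hks
  have e : 3 * G.r = 1 + (2 * G.r - 1) + 1 + (G.r - 1) := by omega
  have h0 : ∑ x ∈ Finset.range (4 * G.m), G.dual 0 x = G.Lh := by
    simp only [dual, if_true]
    rw [Finset.sum_ite_eq' (Finset.range (4 * G.m)) (2 * G.c0), if_pos]
    simp; omega
  have h1 (y : ℕ) (hy : y < 2 * G.r - 1) :
      ∑ x ∈ Finset.range (4 * G.m), G.dual (1 + y) x = 2 * G.m * (2 * G.Lh) := by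
    have : ∀ j, ∑ x ∈ Finset.range (2 * j), G.dual (1 + y) x = j * (2 * G.Lh) := by
      intro j
      induction j with
      | zero => simp
      | succ j ih =>
        rw [show 2 * (j + 1) = 2 * j + 1 + 1 by ring, Finset.sum_range_succ, Finset.sum_range_succ,
          ih, G.dual_mid (by omega) (by omega), G.dual_mid (by omega) (by omega), show (2 * j + 1) / 2 = j by omega, show 2 * j / 2 = j by omega]
        push_cast
        by_cases hp : (2 * j + (1 + y)) % 2 = 0
        · rw [if_pos hp, if_neg (by omega)]; ring
        · rw [if_neg hp, if_pos (by omega)]; ring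
    rw [show 4 * G.m = 2 * (2 * G.m) by ring, this]; push_cast; ring
  have h2 : ∑ x ∈ Finset.range (4 * G.m), G.dual (1 + (2 * G.r - 1)) x =
      G.Lh - (G.top + G.μ) := by
    have e2 : 1 + (2 * G.r - 1) = 2 * G.r := by omega
    have : ∀ x, G.dual (1 + (2 * G.r - 1)) x =
        if x = 2 * G.c1 + 1 then G.Lh - (G.top + G.μ) else 0 := by
      intro x
      rw [e2, dual, if_neg (by omega), if_neg (by omega)]
      simp
    simp only [this]
    rw [Finset.sum_ite_eq' (Finset.range (4 * G.m)) (2 * G.c1 + 1), if_pos]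
    simp; omega
  have h3 (y : ℕ) : ∑ x ∈ Finset.range (4 * G.m), G.dual (1 + (2 * G.r - 1) + 1 + y) x = 0 := by
    refine Finset.sum_eq_zero fun x _ => ?_
    rw [dual, if_neg (by omega), if_neg (by omega), if_neg (by omega)]
  rw [e, Finset.sum_range_add, Finset.sum_range_succ, Finset.sum_range_add, Finset.sum_range_one, h0,
    Finset.sum_congr rfl (fun y hy => h1 y (Finset.mem_range.1 hy)), h2,
    Finset.sum_eq_zero (fun y _ => h3 y)]
  simp only [Finset.sum_const, Finset.card_range, nsmul_eq_mul]
  ring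

/-- The matching `MH`, `MV` and the values `dual` certify each other: the inequalities for the edges
are those for the potential, and equality holds on the chosen path and on the remaining dominoes. -/
theorem isMax {hr : ℕ → ℕ → Option ℕ}
    (hhr : ∀ k i, k < G.r → G.m ≤ i + 1 → i + 1 < 2 * G.m →
      ∃ c : ℕ, hr k i = some c ∧ (c : ℤ) = 2 * G.Lh - (G.Bt k (i + 1) - G.Bt k i)) :
    (slotGraph (3 * G.r * (4 * G.m)) (4 * G.m) (gridSlots G.r G.m (2 * G.Lh) G.v hr
      (some (2 * G.c0)) (some (2 * G.c1 + 1)))).IsMaxMatchingWeight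
      (((2 * G.r - 1 : ℕ) * (2 * G.m) + 1) * (2 * G.Lh) - G.top - G.μ) := by
  have hc0 := G.hc0
  have hc := G.hc
  have hks := G.hks
  rw [← sum_dual, ← sum_grid]
  have par {y x : ℕ} (hy : 0 < y) (hy' : y < 2 * G.r) := G.dual_mid (x := x) hy hy'
  have hdom {y x : ℕ} (hy : 0 < y) (hy' : y < 2 * G.r) (hx : x % 2 = 0) :
      G.dual y x + G.dual y (x + 1) = 2 * G.Lh := by
    rw [par hy hy', par hy hy', show (x + 1) / 2 = x / 2 by omega]
    by_cases hp : (x + y) % 2 = 0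
    · rw [if_pos hp, if_neg (by omega)]; ring
    · rw [if_neg hp, if_pos (by omega)]; ring
  have hstep {y x : ℕ} (hy : y % 2 = 1) (hy' : y < 2 * G.r) (hx : x % 2 = 1) :
      G.dual y x + G.dual y (x + 1) =
        2 * G.Lh - (G.pot (y / 2) (x / 2 + 1) - G.pot (y / 2) (x / 2)) := by
    rw [par (by omega) hy', par (by omega) hy', show (x + 1) / 2 = x / 2 + 1 by omega,
      if_pos (by omega), if_neg (by omega)]; ring
  have hver {y x : ℕ} (hy : 0 < y) (hy' : y + 1 < 2 * G.r) (hx : (x + y) % 2 = 0) :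
      G.dual y x + G.dual (y + 1) x =
        2 * G.Lh - (G.pot ((y + 1) / 2) (x / 2) - G.pot (y / 2) (x / 2)) := by
    rw [par hy (by omega), par (by omega) hy', if_pos hx, if_neg (by omega)]; ring
  have hsrc : G.dual 0 (2 * G.c0) + G.dual 1 (2 * G.c0) = 2 * G.Lh := by
    rw [par (y := 1) (by omega) (by omega), dual, if_pos rfl, if_pos rfl, if_neg (by omega),
      show 2 * G.c0 / 2 = G.c0 by omega, show 1 / 2 = 0 by omega, pot_source]; ring
  have hsnk {y : ℕ} (hy : y + 1 = 2 * G.r) :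
      G.dual y (2 * G.c1 + 1) + G.dual (y + 1) (2 * G.c1 + 1) = 2 * G.Lh := by
    rw [par (y := y) (by omega) (by omega), if_pos (by omega), dual, if_neg (by omega),
      if_neg (by omega), if_pos ⟨hy, rfl⟩, show (2 * G.c1 + 1) / 2 = G.c1 by omega,
      show y / 2 = G.r - 1 by omega, pot_sink]; ring
  have hv2 {y x : ℕ} (hy' : y + 1 < 2 * G.r) (hy2 : y % 2 = 1) (hx : x < 4 * G.m) :
      ((2 * G.Lh - G.v (x / 2) : ℕ) : ℤ) = 2 * G.Lh - G.v (x / 2) := by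
    rw [Nat.cast_sub (G.v_le _ (by omega))]; push_cast; ring
  refine slotGraph_isMax (R := 3 * G.r) (w := 4 * G.m) (D := G.dual) (MH := G.MH) (MV := G.MV)
    (EH := slotH G.r G.m (2 * G.Lh) hr)
    (EV := slotV G.r (2 * G.Lh) G.v (some (2 * G.c0)) (some (2 * G.c1 + 1))) (by omega)
    (fun v => ?_) (fun v => ?_) G.dual_nonneg ?_ ?_ ?_ ?_ ?_ ?_ ?_ ?_ ?_ ?_ ?_
  · rw [gridSlots, if_pos (by omega), show 2 * v / 2 = v by omega]
  · rw [gridSlots, if_neg (by omega), show (2 * v + 1) / 2 = v by omega]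
  · intro y x c hx h
    rw [slotH] at h
    split_ifs at h with h1 h2 h3 h4 h5
    · cases h
      refine ⟨by omega, ?_⟩
      rw [hdom h1.1 h1.2 h2]; push_cast; rfl
    · cases h
      refine ⟨by omega, ?_⟩
      rw [hstep h3 h1.2 (by omega)]
      have := G.pot_h (k := y / 2) (i := x / 2) (by omega) (by omega)
      rw [G.Bt_zero _ _ (by omega), G.Bt_zero _ _ (by omega)] at this
      push_cast; linarith
    · refine ⟨h5, ?_⟩
      obtain ⟨c', h', h''⟩ := hhr (y / 2) (x / 2) (by omega) (by omega) (by omega)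
      rw [h] at h'
      cases h'
      rw [h'', hstep h3 h1.2 (by omega)]
      have := G.pot_h (k := y / 2) (i := x / 2) (by omega) (by omega)
      linarith
  · intro y x c hx h
    rw [slotV] at h
    split_ifs at h with h1 h2 h3 h4 h5 h6 h7
    · cases h
      rw [hver h1.1 h1.2 h2, hv2 h1.2 h3 hx, show (y + 1) / 2 = y / 2 + 1 by omega]
      have := G.pot_v (k := y / 2) (x / 2) (by omega)
      linarith
    · cases h
      rw [hver h1.1 h1.2 h2, show (y + 1) / 2 = y / 2 by omega]
      push_cast; linarith
    · cases h; cases h5; subst h4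
      rw [hsrc]; push_cast; rfl
    · cases h; cases h7
      rw [hsnk h6]; push_cast; rfl
  · rintro y x hx ⟨h1, h2, -, ⟨h3, h4, h5, h6⟩ | ⟨h3, h4, h5, h6⟩⟩
    · refine ⟨by omega, by omega, _, by rw [slotH, if_pos ⟨h1, h2⟩, if_pos h3], ?_⟩
      rw [hdom h1 h2 h3]; push_cast; rfl
    · refine ⟨by omega, by omega, ?_⟩
      have ht := G.pot_h_tight (i := x / 2) (by omega) (by omega)
      rw [slotH, if_pos ⟨h1, h2⟩, if_neg (by omega), if_pos (by omega)]
      split_ifs with h7 h8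
      · refine ⟨_, rfl, ?_⟩
        rw [hstep (by omega) h2 h3, show y / 2 = G.ks by omega, ht, G.Bt_zero _ _ (by omega),
          G.Bt_zero _ _ (by omega)]; push_cast; ring
      · obtain ⟨c', h', h''⟩ := hhr (y / 2) (x / 2) (by omega) (by omega) (by omega)
        refine ⟨c', h', ?_⟩
        rw [h'', hstep (by omega) h2 h3, show y / 2 = G.ks by omega, ht]
      · omega
  · have hmid : ∀ y x, 0 < y → y + 1 < 2 * G.r → (x + y) % 2 = 0 →
        (x / 2 = G.c0 ∨ x / 2 = G.c1) → x < 4 * G.m →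
        ∃ c, slotV G.r (2 * G.Lh) G.v (some (2 * G.c0)) (some (2 * G.c1 + 1)) y x = some c ∧
          (c : ℤ) = G.dual y x + G.dual (y + 1) x := by
      intro y x h1 h2 h3 h4 hx
      rw [slotV, if_pos ⟨h1, h2⟩, if_pos h3, hver h1 h2 h3]
      refine ⟨_, rfl, ?_⟩
      split_ifs with h5
      · rw [hv2 h2 h5 hx, show (y + 1) / 2 = y / 2 + 1 by omega, G.pot_v_tight h4]
      · rw [show (y + 1) / 2 = y / 2 by omega]; push_cast; ring
    rintro y x hx (⟨h1, h2, h3⟩ | ⟨h1, h2, h3⟩ | ⟨h1, h2, h3, h4⟩ | ⟨h1, h2, h3, h4⟩)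
    · refine ⟨by omega, ?_⟩
      rcases Nat.eq_zero_or_pos y with rfl | hy
      · subst h1
        refine ⟨_, by rw [slotV, if_neg (by omega), if_pos rfl, if_pos rfl], ?_⟩
        rw [hsrc]; push_cast; rfl
      · exact hmid y x hy (by omega) (by omega) (by omega) hx
    · exact ⟨by omega, hmid y x (by omega) (by omega) (by omega) (by omega) hx⟩
    · refine ⟨by omega, ?_⟩
      by_cases hy : y + 1 = 2 * G.r
      · subst h1
        refine ⟨_, by rw [slotV, if_neg (by omega), if_neg (by omega), if_pos hy, if_pos rfl], ?_⟩
        rw [hsnk hy]; push_cast; rfl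
      · exact hmid y x (by omega) (by omega) (by omega) (by omega) hx
    · exact ⟨by omega, hmid y x (by omega) (by omega) (by omega) (by omega) hx⟩
  · simp only [MH]; omega
  · simp only [MV]; omega
  · simp only [MH, MV]; omega
  · simp only [MH, MV]; omega
  · simp only [MH, MV]; omega
  · simp only [MH, MV]; omega
  · intro y x hx hD
    -- Only the nodes of rows `1` to `2r - 1`, the source and the sink can have nonzero values; the
    -- other nodes of the grid may stay unmatched.
    have hcase : (y = 0 ∧ x = 2 * G.c0) ∨ (0 < y ∧ y < 2 * G.r) ∨
        (y = 2 * G.r ∧ x = 2 * G.c1 + 1) := by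
      by_contra hcon
      apply hD
      rw [dual]
      split_ifs <;> first | rfl | omega
    rcases hcase with ⟨h1, h2⟩ | ⟨h1, h2⟩ | ⟨h1, h2⟩
    · right; left
      simp only [MV]; omega
    · exact G.covered h1 h2 hx
    · refine .inr (.inr (.inr ⟨y - 1, by omega, ?_⟩))
      simp only [MV]; omega

end Gadget
end FineGrained

namespace FineGrained

/-! ### Shortest walks by repeated squaring -/

/-- A walk with `ℓ` edges. -/
inductive WalkN {n : ℕ} (w : WDigraph n) : ℕ → Fin n → Fin n → ℤ → Prop
  | nil (i : Fin n) : WalkN w 0 i i 0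
  | cons {ℓ : ℕ} {i k j : Fin n} {a x : ℤ} : w i k = some a → WalkN w ℓ k j x →
      WalkN w (ℓ + 1) i j (a + x)

section
variable {n : ℕ} {w : WDigraph n}

theorem WalkN.isWalk {ℓ : ℕ} {i j : Fin n} {x : ℤ} (h : WalkN w ℓ i j x) : IsWalk w i j x := by
  induction h with
  | nil i => exact .nil i
  | cons h _ ih => exact .cons h ih

theorem IsWalk.exists_walkN {i j : Fin n} {x : ℤ} (h : IsWalk w i j x) : ∃ ℓ, WalkN w ℓ i j x := by
  induction h with
  | nil i => exact ⟨0, .nil i⟩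
  | cons h _ ih => obtain ⟨ℓ, ih⟩ := ih; exact ⟨ℓ + 1, .cons h ih⟩

theorem WalkN.append {ℓ ℓ' : ℕ} {i j k : Fin n} {x y : ℤ} (h : WalkN w ℓ i j x)
    (h' : WalkN w ℓ' j k y) : WalkN w (ℓ + ℓ') i k (x + y) := by
  induction h with
  | nil i => simpa using h'
  | cons h _ ih => convert WalkN.cons h (ih h') using 1 <;> ring

theorem IsWalk.append {i j k : Fin n} {x y : ℤ} (h : IsWalk w i j x) (h' : IsWalk w j k y) :
    IsWalk w i k (x + y) := by
  obtain ⟨ℓ, h⟩ := h.exists_walkN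
  obtain ⟨ℓ', h'⟩ := h'.exists_walkN
  exact (h.append h').isWalk

theorem WalkN.split {ℓ₁ ℓ₂ : ℕ} {i j : Fin n} {x : ℤ} (h : WalkN w (ℓ₁ + ℓ₂) i j x) :
    ∃ k y z, WalkN w ℓ₁ i k y ∧ WalkN w ℓ₂ k j z ∧ x = y + z := by
  induction ℓ₁ generalizing i x with
  | zero => exact ⟨i, 0, x, .nil i, by simpa using h, by simp⟩
  | succ ℓ ih =>
    rw [show ℓ + 1 + ℓ₂ = ℓ + ℓ₂ + 1 by ring] at h
    cases h with
    | cons h h' =>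
      obtain ⟨k, y, z, h₁, h₂, rfl⟩ := ih h'
      exact ⟨k, _, z, .cons h h₁, h₂, by ring⟩

theorem WalkN.abs_le {ℓ : ℕ} {i j : Fin n} {x b : ℤ} (hw : ∀ i j a, w i j = some a → |a| ≤ b)
    (h : WalkN w ℓ i j x) : |x| ≤ ℓ * b := by
  induction h with
  | nil i => simp
  | cons h _ ih =>
    have := hw _ _ _ h
    push_cast
    exact (abs_add_le _ _).trans (by linarith)

/-- The nodes visited by a walk. -/
theorem WalkN.exists_nodes {ℓ : ℕ} {i j : Fin n} {x : ℤ} (h : WalkN w ℓ i j x) :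
    ∃ p : ℕ → Fin n, ∀ t ≤ ℓ, ∃ y z, WalkN w t i (p t) y ∧ WalkN w (ℓ - t) (p t) j z ∧ x = y + z ∧
      ∀ s ≤ t, ∃ y₁ y₂, WalkN w s i (p s) y₁ ∧ WalkN w (t - s) (p s) (p t) y₂ ∧ y = y₁ + y₂ := by
  induction h with
  | nil i =>
    refine ⟨fun _ => i, fun t ht => ?_⟩
    obtain rfl : t = 0 := by omega
    refine ⟨0, 0, .nil i, .nil i, by simp, fun s hs => ?_⟩
    obtain rfl : s = 0 := by omega
    exact ⟨0, 0, .nil i, .nil i, by simp⟩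
  | @cons ℓ i k j a x h h' ih =>
    obtain ⟨p, hp⟩ := ih
    refine ⟨fun t => t.casesOn i p, fun t ht => ?_⟩
    cases t with
    | zero =>
      refine ⟨0, a + x, .nil i, .cons h h', by simp, fun s hs => ?_⟩
      obtain rfl : s = 0 := by omega
      exact ⟨0, 0, .nil i, .nil i, by simp⟩
    | succ t =>
      obtain ⟨y, z, h₁, h₂, h₃, h₄⟩ := hp t (by omega)
      refine ⟨a + y, z, .cons h h₁, by simpa using h₂, by rw [h₃]; ring, fun s hs => ?_⟩
      cases s with
      | zero => exact ⟨0, a + y, .nil i, .cons h h₁, by simp⟩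
      | succ s =>
        obtain ⟨y₁, y₂, k₁, k₂, k₃⟩ := h₄ s (by omega)
        exact ⟨a + y₁, y₂, .cons h k₁, by simpa using k₂, by rw [k₃]; ring⟩

/-- A walk with `n` or more edges visits some node twice, and cutting out the closed part does not
increase the weight, as there are no negative cycles. -/
theorem WalkN.shorten (hc : ∀ i x, IsWalk w i i x → 0 ≤ x) {ℓ : ℕ} {i j : Fin n} {x : ℤ}
    (h : WalkN w ℓ i j x) : ∃ ℓ' < n, ∃ x' ≤ x, WalkN w ℓ' i j x' := by
  induction ℓ using Nat.strong_induction_on generalizing x with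
  | _ ℓ ih =>
    by_cases hl : ℓ < n
    · exact ⟨ℓ, hl, x, le_rfl, h⟩
    obtain ⟨p, hp⟩ := h.exists_nodes
    obtain ⟨s, t, hst, hpst⟩ := Fintype.exists_ne_map_eq_of_card_lt
      (fun t : Fin (n + 1) => p t) (by simp)
    have key : ∀ s t : Fin (n + 1), s < t → p s = p t →
        ∃ ℓ' < n, ∃ x' ≤ x, WalkN w ℓ' i j x' := by
      intro s t hst he
      have hst' : (s : ℕ) < t := hst
      have htn := t.2
      obtain ⟨y, z, h₁, h₂, rfl, h₄⟩ := hp t (by omega)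
      obtain ⟨y₁, y₂, k₁, k₂, rfl⟩ := h₄ s hst'.le
      rw [← he] at k₂ h₂
      have h0 := hc _ _ k₂.isWalk
      obtain ⟨ℓ', hl', x', hx', hw'⟩ := ih (s + (ℓ - t)) (by omega) (k₁.append h₂)
      exact ⟨ℓ', hl', x', by linarith, hw'⟩
    rcases lt_or_gt_of_ne hst with h' | h'
    · exact key s t h' hpst
    · exact key t s h' hpst.symm

theorem exists_potential {c Y : ℕ} (h : APSPInstance c w) (hY : n * n ^ c ≤ Y) :
    ∃ φ : Fin n → ℤ, (∀ i, -(Y : ℤ) ≤ φ i ∧ φ i ≤ 0) ∧ ∀ i j a, w i j = some a → φ j ≤ φ i + a := by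
  have hY' : (n : ℤ) * (n : ℤ) ^ c ≤ Y := by exact_mod_cast hY
  have bound {ℓ : ℕ} {i j : Fin n} {x : ℤ} (hl : ℓ < n) (hw : WalkN w ℓ i j x) : |x| ≤ Y := by
    refine (hw.abs_le h.1).trans (le_trans ?_ hY')
    have : (ℓ : ℤ) ≤ n := by exact_mod_cast hl.le
    gcongr
  -- The potential of `j` is the least weight of a walk with fewer than `n` edges that ends at `j`
  -- and starts anywhere; the empty walk shows that it is at most 0.
  have hex : ∀ j, ∃ v : ℤ, (∃ ℓ < n, ∃ i, WalkN w ℓ i j v) ∧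
      ∀ z, (∃ ℓ < n, ∃ i, WalkN w ℓ i j z) → v ≤ z := fun j =>
    Int.exists_least_of_bdd ⟨-Y, fun z ⟨ℓ, hl, i, hw⟩ => (abs_le.1 (bound hl hw)).1⟩
      ⟨0, 0, by have := j.2; omega, j, .nil j⟩
  choose φ h₁ h₂ using hex
  refine ⟨φ, fun j => ⟨?_, h₂ j 0 ⟨0, by have := j.2; omega, j, .nil j⟩⟩, fun i j a ha => ?_⟩
  · obtain ⟨ℓ, hl, i, hw⟩ := h₁ j
    exact (abs_le.1 (bound hl hw)).1
  · obtain ⟨ℓ, hl, k, hw⟩ := h₁ i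
    have := hw.append (.cons ha (.nil j))
    rw [add_zero] at this
    obtain ⟨ℓ', hl', x', hx', hw'⟩ := this.shorten h.2
    exact (h₂ j x' ⟨ℓ', hl', k, hw'⟩).trans hx'

/-- The matrix of a weighted graph, with a large number `X` for missing edges. -/
def padMat (w : WDigraph n) (X : ℤ) (i j : ℕ) : ℤ :=
  if i = j then 0 else if h : i < n ∧ j < n then (w ⟨i, h.1⟩ ⟨j, h.2⟩).getD X else X

/-- The minimum of `X` and of the sums `D i k + D k j` over the first indices `k`. -/
def minSum (D : ℕ → ℕ → ℤ) (X : ℤ) (i j : ℕ) : ℕ → ℤ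
  | 0 => X
  | k + 1 => min (minSum D X i j k) (D i k + D k j)

theorem minSum_le_cap (D : ℕ → ℕ → ℤ) (X : ℤ) (i j k : ℕ) : minSum D X i j k ≤ X := by
  induction k with
  | zero => exact le_rfl
  | succ k ih => exact (min_le_left _ _).trans ih

theorem minSum_le (D : ℕ → ℕ → ℤ) (X : ℤ) (i j : ℕ) {k q : ℕ} (h : k < q) :
    minSum D X i j q ≤ D i k + D k j := by
  induction q with
  | zero => omega
  | succ q ih =>
    rcases Nat.lt_succ_iff_lt_or_eq.1 h with h | rfl
    · exact (min_le_left _ _).trans (ih h)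
    · exact min_le_right _ _

theorem minSum_cases (D : ℕ → ℕ → ℤ) (X : ℤ) (i j q : ℕ) :
    minSum D X i j q = X ∨ ∃ k < q, minSum D X i j q = D i k + D k j := by
  induction q with
  | zero => exact .inl rfl
  | succ q ih =>
    rw [minSum]
    rcases min_choice (minSum D X i j q) (D i q + D q j) with h | h
    · rw [h]
      rcases ih with ih | ⟨k, hk, ih⟩
      · exact .inl ih
      · exact .inr ⟨k, by omega, ih⟩
    · exact .inr ⟨q, by omega, h⟩

/-- A block of `r` consecutive indices enters through its minimum alone, and this is what a single
query delivers. -/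
theorem minSum_add {D : ℕ → ℕ → ℤ} {X : ℤ} {i j q r : ℕ} {μ : ℤ}
    (h₁ : ∀ k < r, μ ≤ D i (q + k) + D (q + k) j)
    (h₂ : ∃ k < r, μ = D i (q + k) + D (q + k) j) :
    minSum D X i j (q + r) = min (minSum D X i j q) μ := by
  have : ∀ r, ∀ μ, (∀ k < r, μ ≤ D i (q + k) + D (q + k) j) →
      min (minSum D X i j q) μ ≤ minSum D X i j (q + r) := by
    intro r
    induction r with
    | zero => intro μ _; exact min_le_left _ _
    | succ r ih =>
      intro μ h
      exact le_min (ih μ fun k hk => h k (by omega)) ((min_le_right _ _).trans (h r (by omega)))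
  refine le_antisymm (le_min ?_ ?_) (this r μ h₁)
  · clear this h₁ h₂
    induction r with
    | zero => exact le_rfl
    | succ r ih => exact (min_le_left _ _).trans ih
  · obtain ⟨k, hk, rfl⟩ := h₂
    exact minSum_le D X i j (by omega)

/-- The matrix after `q` squarings. -/
def squares (w : WDigraph n) (X : ℤ) (N : ℕ) : ℕ → ℕ → ℕ → ℤ
  | 0 => padMat w X
  | q + 1 => fun i j => minSum (squares w X N q) X i j N

/-- `v` is the weight of a walk from `i` to `j` that uses no missing edge. -/
def RealWalk (w : WDigraph n) (i j : ℕ) (v : ℤ) : Prop :=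
  (i = j ∧ v = 0) ∨ ∃ hi : i < n, ∃ hj : j < n, IsWalk w ⟨i, hi⟩ ⟨j, hj⟩ v

theorem RealWalk.append {i j k : ℕ} {u v : ℤ} (h : RealWalk w i k u) (h' : RealWalk w k j v) :
    RealWalk w i j (u + v) := by
  rcases h with ⟨rfl, rfl⟩ | ⟨hi, hk, h⟩
  · simpa using h'
  · rcases h' with ⟨rfl, rfl⟩ | ⟨hk, hj, h'⟩
    · exact .inr ⟨hi, hk, by simpa using h⟩
    · exact .inr ⟨hi, hj, h.append h'⟩

/-- In terms of the reduced value (entry minus `ψ j - ψ i`) all entries are nonnegative and reduced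
values add up in products. An entry that does not come from a walk has reduced value at least `3Y`,
and adding another entry keeps this; the cap `4Y` has the property itself, since `ψ` varies by at
most `Y`. -/
theorem squares_spec {c Y : ℕ} (h : APSPInstance c w) (hY : n * n ^ c ≤ Y) (hY1 : 1 ≤ Y)
    (hY2 : n ^ c ≤ Y) (N : ℕ) :
    ∃ ψ : ℕ → ℤ, (∀ i, -(Y : ℤ) ≤ ψ i ∧ ψ i ≤ 0) ∧ ∀ q i j, squares w (4 * Y) N q i j ≤ 4 * Y ∧
      ψ j - ψ i ≤ squares w (4 * Y) N q i j ∧ (RealWalk w i j (squares w (4 * Y) N q i j) ∨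
        3 * Y + (ψ j - ψ i) ≤ squares w (4 * Y) N q i j) := by
  obtain ⟨φ, hφ, hφw⟩ := exists_potential h hY
  have hY2' : (n : ℤ) ^ c ≤ Y := by exact_mod_cast hY2
  -- Padding nodes have no edges, so any value between `-Y` and 0 would do for them.
  let ψ : ℕ → ℤ := fun i => if h : i < n then φ ⟨i, h⟩ else 0
  have hψ : ∀ i, -(Y : ℤ) ≤ ψ i ∧ ψ i ≤ 0 := by
    intro i
    simp only [ψ]
    split_ifs
    · exact hφ _
    · constructor <;> omega
  refine ⟨ψ, hψ, fun q => ?_⟩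
  induction q with
  | zero =>
    intro i j
    have hi := hψ i
    have hj := hψ j
    simp only [squares, padMat]
    split_ifs with h1 h2
    · subst h1
      exact ⟨by omega, by omega, .inl (.inl ⟨rfl, rfl⟩)⟩
    · rcases hw : w ⟨i, h2.1⟩ ⟨j, h2.2⟩ with _ | a
      · simp only [Option.getD_none]
        exact ⟨by omega, by omega, .inr (by omega)⟩
      · simp only [Option.getD_some]
        have ha := abs_le.1 (h.1 _ _ _ hw)
        have := hφw _ _ _ hw
        have e₁ : ψ i = φ ⟨i, h2.1⟩ := by simp [ψ, h2.1]
        have e₂ : ψ j = φ ⟨j, h2.2⟩ := by simp [ψ, h2.2]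
        refine ⟨by omega, by omega, .inl (.inr ⟨h2.1, h2.2, ?_⟩)⟩
        simpa using IsWalk.cons hw (.nil _)
    · exact ⟨by omega, by omega, .inr (by omega)⟩
  | succ q ih =>
    intro i j
    have hi := hψ i
    have hj := hψ j
    simp only [squares]
    refine ⟨minSum_le_cap _ _ _ _ _, ?_⟩
    rcases minSum_cases (squares w (4 * Y) N q) (4 * Y) i j N with h' | ⟨k, hk, h'⟩
    · rw [h']
      exact ⟨by omega, .inr (by omega)⟩
    · rw [h']
      obtain ⟨a₁, a₂, a₃⟩ := ih i k
      obtain ⟨b₁, b₂, b₃⟩ := ih k j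
      refine ⟨by omega, ?_⟩
      rcases a₃ with a₃ | a₃
      · rcases b₃ with b₃ | b₃
        · exact .inl (a₃.append b₃)
        · exact .inr (by omega)
      · exact .inr (by omega)

/-- A walk with at most `2 ^ (q + 1)` edges splits into two with at most `2 ^ q` edges. The zero
diagonal of the padded matrix takes care of shorter walks. -/
theorem squares_le {c : ℕ} (h : APSPInstance c w) (X : ℤ) {N : ℕ} (hN : n ≤ N) {q ℓ : ℕ}
    {i j : Fin n} {x : ℤ} (hw : WalkN w ℓ i j x) (hl : ℓ ≤ 2 ^ q) : squares w X N q i j ≤ x := by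
  induction q generalizing ℓ i j x with
  | zero =>
    simp only [squares, padMat]
    rcases Nat.le_one_iff_eq_zero_or_eq_one.1 hl with rfl | rfl
    · cases hw; simp
    · rcases hw with _ | ⟨ha, hw⟩
      cases hw
      split_ifs with h1 h2
      · have : i = j := Fin.ext h1
        subst this
        exact h.2 _ _ (.cons ha (.nil _))
      · simp [ha]
      · exact absurd ⟨i.2, j.2⟩ h2
  | succ q ih =>
    rw [pow_succ] at hl
    have : ℓ = min ℓ (2 ^ q) + (ℓ - min ℓ (2 ^ q)) := by omega
    rw [this] at hw
    obtain ⟨k, y, z, h₁, h₂, rfl⟩ := hw.split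
    have e₁ := ih h₁ (by omega)
    have e₂ := ih h₂ (by omega)
    exact (minSum_le _ _ _ _ (k.2.trans_le hN)).trans (by linarith)

/-- Enough squarings compute all distances. -/
theorem squares_correct {c Y : ℕ} (h : APSPInstance c w) (hY : n * n ^ c ≤ Y) (hY1 : 1 ≤ Y)
    (hY2 : n ^ c ≤ Y) {N : ℕ} (hN : n ≤ N) {q : ℕ} (hq : n ≤ 2 ^ q) (i j : Fin n) :
    (squares w (4 * Y) N q i j ≤ Y → IsLeast {x | IsWalk w i j x} (squares w (4 * Y) N q i j)) ∧
    (¬ squares w (4 * Y) N q i j ≤ Y → ∀ x, ¬ IsWalk w i j x) := by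
  obtain ⟨ψ, hψ, hs⟩ := squares_spec h hY hY1 hY2 N
  have hle : ∀ x, IsWalk w i j x → squares w (4 * Y) N q i j ≤ x ∧
      squares w (4 * Y) N q i j ≤ Y := by
    intro x hx
    obtain ⟨ℓ, hx⟩ := hx.exists_walkN
    obtain ⟨ℓ', hl', x', hx', hw'⟩ := hx.shorten h.2
    have h1 := squares_le h (4 * Y) hN hw' (q := q) (by omega)
    refine ⟨h1.trans hx', h1.trans ?_⟩
    refine (le_abs_self _).trans ((hw'.abs_le h.1).trans ?_)
    have : (ℓ' : ℤ) ≤ n := by exact_mod_cast hl'.le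
    calc (ℓ' : ℤ) * (n : ℤ) ^ c ≤ n * (n : ℤ) ^ c := by gcongr
      _ ≤ Y := by exact_mod_cast hY
  constructor
  · intro hle'
    refine ⟨?_, fun x hx => (hle x hx).1⟩
    obtain ⟨-, -, h3⟩ := hs q i j
    have hi := hψ i
    have hj := hψ j
    rcases h3 with h3 | h3
    · rcases h3 with ⟨h3, h4⟩ | ⟨_, _, h3⟩
      · have : i = j := Fin.ext h3
        subst this
        rw [h4]
        exact .nil i
      · exact h3
    -- An entry that is not the weight of a walk is at least `3Y - Y`, and this exceeds `Y` because
    -- `1 ≤ Y`.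
    · omega
  · intro hle' x hx
    exact hle' (hle x hx).2

end
end FineGrained

namespace FineGrained

theorem Serves.mono {W W' : ℕ} (h : W ≤ W') {N : ℕ} {P : DynamicAlgorithm} {σ : State}
    {G : WGraph N} {ops : List (Op N)} {t : ℕ} (hs : Serves W P σ G ops t) :
    Serves W' P σ G ops t := by
  induction hs with
  | nil σ G => exact .nil σ G
  | insert r _ ih => exact .insert (r.mono h) ih
  | delete r _ ih => exact .delete (r.mono h) ih
  | query r hm _ ih => exact .query (r.mono h) hm ih

/-! ### The grid as a drawing -/

/-- The grid with `3 * r` rows and `4 * m` columns. -/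
def gridDrawing (r m : ℕ) : Drawing (3 * r * (4 * m)) where
  pos v := (v / (4 * m), v % (4 * m))
  graph :=
    { Adj := fun i j => (((i / (4 * m) : ℕ) : ℤ) - (j / (4 * m) : ℕ)) * ((i / (4 * m) : ℕ) -
        (j / (4 * m) : ℕ)) + (((i % (4 * m) : ℕ) : ℤ) - (j % (4 * m) : ℕ)) * ((i % (4 * m) : ℕ) -
        (j % (4 * m) : ℕ)) = 1
      symm := ⟨fun i j h => by rw [← h]; ring⟩
      loopless := ⟨fun i h => by simp at h⟩ }

/-- The slot belongs to an edge of the grid. -/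
def ValidSlot (r m e : ℕ) : Prop :=
  slotEnd (4 * m) e < 3 * r * (4 * m) ∧ (e % 2 = 0 → e / 2 % (4 * m) + 1 < 4 * m)

theorem ValidSlot.fst_lt {r m e : ℕ} (h : ValidSlot r m e) : e / 2 < 3 * r * (4 * m) :=
  lt_of_le_of_lt (Nat.le_add_right _ _) h.1

theorem ValidSlot.adj {r m e : ℕ} (h : ValidSlot r m e) :
    (gridDrawing r m).graph.Adj ⟨e / 2, h.fst_lt⟩ ⟨slotEnd (4 * m) e, h.1⟩ := by
  have hm : 0 < 4 * m := by
    rcases Nat.eq_zero_or_pos m with rfl | hm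
    · have := h.1; simp at this
    · omega
  change _ * _ + _ * _ = (1 : ℤ)
  rcases Nat.mod_two_eq_zero_or_one e with he | he
  · obtain ⟨h₁, h₂⟩ := grid_right (h.2 he)
    simp only [slotEnd, he, if_true, h₁, h₂]
    push_cast; ring
  · obtain ⟨h₁, h₂⟩ := grid_down (v := e / 2) hm
    simp only [slotEnd, he, one_ne_zero, if_false, h₁, h₂]
    push_cast; ring

/-! ### Calls of a dynamic algorithm -/

/-- The number of variables and of arrays that the main program works with. -/
abbrev ownVars : ℕ := 40
abbrev ownArrs : ℕ := 10

/-- Variable and array numbers of the `s`-th memory region. -/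
def regVar (s r : ℕ) : ℕ := ownVars + Nat.pair s r
def regArr (s A : ℕ) : ℕ := ownArrs + Nat.pair s A

theorem regVar_inj (s : ℕ) : (regVar s).Injective := fun a b h => by
  have : Nat.pair s a = Nat.pair s b := Nat.add_left_cancel h
  exact (Nat.pair_eq_pair.1 this).2

theorem regArr_inj (s : ℕ) : (regArr s).Injective := fun a b h => by
  have : Nat.pair s a = Nat.pair s b := Nat.add_left_cancel h
  exact (Nat.pair_eq_pair.1 this).2

theorem regVar_ne {s s' : ℕ} (h : s ≠ s') (r r' : ℕ) : regVar s r ≠ regVar s' r' := fun e => by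
  have : Nat.pair s r = Nat.pair s' r' := Nat.add_left_cancel e
  exact h (Nat.pair_eq_pair.1 this).1

theorem regArr_ne {s s' : ℕ} (h : s ≠ s') (r r' : ℕ) : regArr s r ≠ regArr s' r' := fun e => by
  have : Nat.pair s r = Nat.pair s' r' := Nat.add_left_cancel e
  exact h (Nat.pair_eq_pair.1 this).1

theorem le_regVar (s r : ℕ) : ownVars ≤ regVar s r := Nat.le_add_right _ _
theorem le_regArr (s r : ℕ) : ownArrs ≤ regArr s r := Nat.le_add_right _ _

/-- The contents of a memory region. -/
def region (s : ℕ) (m : State) : State := m.pull (regVar s) (regArr s)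

/-- Run a budgeted program in a memory region. -/
def call (s : ℕ) (P : Prog) : Prog := P.budget.rename (fun r => 2 * regVar s r) (regArr s)

def DynamicAlgorithm.maxDead (DA : DynamicAlgorithm) : ℕ :=
  DA.init.deadTime + DA.insert.deadTime + DA.delete.deadTime + DA.query.deadTime

def opsWeight {N : ℕ} (U Q : ℕ) (ops : List (Op N)) : ℕ :=
  ops.countP (fun o => !o.isQuery) * U + ops.countP (fun o => o.isQuery) * Q

/-- A dynamic algorithm that is run on a grid in region `s` with a budget of `bud` steps. -/
structure Ctx where
  DA : DynamicAlgorithm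
  (r m cw KN U Q W Lmax bud B S κ s : ℕ)
  hr : 0 < r
  hm : 0 < m
  le_B : 100 ≤ B
  le_S : 10 ≤ S
  le_κ : 10 * S + 40 + DA.maxDead ≤ κ
  pow_le : B ^ S ≤ W
  bud_le : bud ≤ W
  solves : ∀ ops : List (Op (3 * r * (4 * m))),
    Legal (gridDrawing r m).graph cw (fun _ => none) ops → ops.length ≤ Lmax →
    ∃ t₀ t σ, Run W DA.init (gridDrawing r m).input t₀ σ ∧ Serves W DA σ (fun _ => none) ops t ∧
      t₀ + t ≤ KN + opsWeight U Q ops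

namespace Ctx
variable (X : Ctx)

abbrev N : ℕ := 3 * X.r * (4 * X.m)
abbrev w : ℕ := 4 * X.m

/-- The algorithm serves all legal operations from memory `σ` and graph `G`; `tc` steps have been
made so far for operations of weight `w`. -/
def Future (σ : State) (G : WGraph X.N) (l w tc : ℕ) : Prop :=
  ∀ ops : List (Op X.N), Legal (gridDrawing X.r X.m).graph X.cw G ops → l + ops.length ≤ X.Lmax →
    ∃ t, Serves X.W X.DA σ G ops t ∧ tc + t ≤ X.KN + w + opsWeight X.U X.Q ops

variable {X}

/-- The sequence consisting of this operation alone fixes a run and bounds its cost. Every longer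
sequence starts with the same run by determinism, so one memory state serves all continuations. -/
theorem Future.insert {σ : State} {G : WGraph X.N} {l w tc : ℕ} (h : X.Future σ G l w tc)
    {i j : Fin X.N} {c : ℕ} (hadj : (gridDrawing X.r X.m).graph.Adj i j) (hG : G s(i, j) = none)
    (hc : c ≤ X.N ^ X.cw) (hl : l + 1 ≤ X.Lmax) :
    ∃ t σ', Run X.W X.DA.insert (((σ.setReg 0 (i : ℕ)).setReg 1 (j : ℕ)).setReg 2 c) t σ' ∧
      tc + t ≤ X.KN + (w + X.U) ∧
      X.Future σ' (Function.update G s(i, j) (some c)) (l + 1) (w + X.U) (tc + t) := by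
  obtain ⟨t, hs, ht⟩ := h [.insert i j c] ⟨hadj, hG, hc, trivial⟩ (by simpa using hl)
  cases hs with
  | insert hr hs =>
    cases hs
    refine ⟨_, _, hr, ?_, fun ops hops hlen => ?_⟩
    · simp [opsWeight, Op.isQuery] at ht
      omega
    · obtain ⟨t', hs', ht'⟩ := h (.insert i j c :: ops) ⟨hadj, hG, hc, hops⟩ (by
        simp only [List.length_cons]; omega)
      cases hs' with
      | insert hr' hs' =>
        obtain ⟨rfl, rfl⟩ := hr.det hr'
        refine ⟨_, hs', ?_⟩
        simp only [opsWeight, List.countP_cons, Op.isQuery, Bool.not_false, if_true,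
          Bool.false_eq_true, if_false, add_zero, add_mul, one_mul] at ht' ⊢
        omega

theorem Future.delete {σ : State} {G : WGraph X.N} {l w tc : ℕ} (h : X.Future σ G l w tc)
    {i j : Fin X.N} (hG : G s(i, j) ≠ none) (hl : l + 1 ≤ X.Lmax) :
    ∃ t σ', Run X.W X.DA.delete ((σ.setReg 0 (i : ℕ)).setReg 1 (j : ℕ)) t σ' ∧
      tc + t ≤ X.KN + (w + X.U) ∧
      X.Future σ' (Function.update G s(i, j) none) (l + 1) (w + X.U) (tc + t) := by
  obtain ⟨t, hs, ht⟩ := h [.delete i j] ⟨hG, trivial⟩ (by simpa using hl)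
  cases hs with
  | delete hr hs =>
    cases hs
    refine ⟨_, _, hr, ?_, fun ops hops hlen => ?_⟩
    · simp [opsWeight, Op.isQuery] at ht
      omega
    · obtain ⟨t', hs', ht'⟩ := h (.delete i j :: ops) ⟨hG, hops⟩ (by
        simp only [List.length_cons]; omega)
      cases hs' with
      | delete hr' hs' =>
        obtain ⟨rfl, rfl⟩ := hr.det hr'
        refine ⟨_, hs', ?_⟩
        simp only [opsWeight, List.countP_cons, Op.isQuery, Bool.not_false, if_true,
          Bool.false_eq_true, if_false, add_zero, add_mul, one_mul] at ht' ⊢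
        omega

theorem Future.query {σ : State} {G : WGraph X.N} {l w tc : ℕ} (h : X.Future σ G l w tc)
    (hl : l + 1 ≤ X.Lmax) :
    ∃ t σ', Run X.W X.DA.query σ t σ' ∧ G.IsMaxMatchingWeight (σ'.reg 0) ∧
      tc + t ≤ X.KN + (w + X.Q) ∧ X.Future σ' G (l + 1) (w + X.Q) (tc + t) := by
  obtain ⟨t, hs, ht⟩ := h [.query] trivial (by simpa using hl)
  cases hs with
  | query hr hm hs =>
    cases hs
    refine ⟨_, _, hr, hm, ?_, fun ops hops hlen => ?_⟩
    · simp [opsWeight, Op.isQuery] at ht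
      omega
    · obtain ⟨t', hs', ht'⟩ := h (.query :: ops) hops (by
        simp only [List.length_cons]; omega)
      cases hs' with
      | query hr' hm' hs' =>
        obtain ⟨rfl, rfl⟩ := hr.det hr'
        refine ⟨_, hs', ?_⟩
        simp only [opsWeight, List.countP_cons, Op.isQuery, Bool.not_true, if_true,
          Bool.false_eq_true, if_false, add_zero, add_mul, one_mul] at ht' ⊢
        omega

theorem exists_init (hl : 0 ≤ X.Lmax) : ∃ t σ, Run X.W X.DA.init (gridDrawing X.r X.m).input t σ ∧
    t ≤ X.KN ∧ X.Future σ (fun _ => none) 0 0 t := by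
  obtain ⟨t₀, t, σ, hr, hs, ht⟩ := X.solves [] trivial hl
  refine ⟨t₀, σ, hr, ?_, fun ops hops hlen => ?_⟩
  · simp [opsWeight] at ht; omega
  · obtain ⟨t₀', t', σ', hr', hs', ht'⟩ := X.solves ops hops (by omega)
    obtain ⟨rfl, rfl⟩ := hr.det hr'
    exact ⟨t', hs', by omega⟩

/-- Regions not used yet are empty. -/
def Fresh (s : ℕ) (m : State) : Prop :=
  ∀ s' > s, (∀ r, m.reg (regVar s' r) = 0) ∧ ∀ A a, m.arr (regArr s' A) a = 0

variable (X)

/-- The memory of the algorithm, with current weights `γ.1` in the slots; `γ.2` tells whether there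
is budget left. -/
def Dyn (m : State) (γ : (ℕ → Option ℕ) × Bool) (l p w : ℕ) : Prop :=
  (γ.2 = true → ∃ σ k tc, Alive (region X.s m) σ k ∧ X.Future σ (slotGraph X.N X.w γ.1) l w tc ∧
    k + tc = X.bud ∧ p = 10 * k) ∧
  (γ.2 = false → m.reg (regVar X.s 1) = 0 ∧ X.bud < X.KN + w) ∧ Fresh X.s m

theorem region_congr {s : ℕ} {m m' : State} (h₁ : ∀ x, ¬ x < ownVars → m'.reg x = m.reg x)
    (h₂ : ∀ A, ¬ A < ownArrs → m'.arr A = m.arr A) : region s m' = region s m := by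
  refine State.ext' (fun r => ?_) fun A a => ?_
  · exact h₁ _ (not_lt.2 (le_regVar s r))
  · exact congrFun (h₂ _ (not_lt.2 (le_regArr s A))) a

def env : Env where
  W := X.W
  B := X.B
  S := X.S
  κ := X.κ
  ownR x := x < ownVars
  ownA A := A < ownArrs
  Γ := (ℕ → Option ℕ) × Bool
  Dyn := X.Dyn
  Lmax := X.Lmax
  le_B := X.le_B
  le_S := X.le_S
  le_κ := by have := X.le_κ; omega
  pow_le := X.pow_le
  frame := by
    rintro m m' γ l p w ⟨ha, hd, hf⟩ h₁ h₂
    refine ⟨fun h => ?_, fun h => ?_, fun s' hs' => ⟨fun r => ?_, fun A a => ?_⟩⟩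
    · rw [region_congr h₁ h₂]; exact ha h
    · rw [h₁ _ (not_lt.2 (le_regVar _ _))]; exact hd h
    · rw [h₁ _ (not_lt.2 (le_regVar _ _))]; exact (hf s' hs').1 r
    · rw [h₂ _ (not_lt.2 (le_regArr _ _))]; exact (hf s' hs').2 A a

/-- The part of a description that does not depend on the region. -/
structure Own (σ s : State) : Prop where
  reg : ∀ x < ownVars, σ.reg (2 * x) = s.reg x
  arr : ∀ A < ownArrs, σ.arr A = s.arr A
  bdd : X.env.Bounded s

variable {X}

theorem Own.eval {σ s : State} (h : X.Own σ s) {e : Expr} (he : X.env.Adm e) :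
    e.Bdd X.W σ.vars ∧ |e.eval s| ≤ X.W ∧ e.eval σ.vars = e.eval s := by
  have hc : e.eval σ.vars = e.eval s :=
    Expr.eval_congr (s := σ.vars) (R := X.env.ownR) (A := X.env.ownA) (fun x hx => h.reg x hx)
      (fun Y hY => h.arr Y hY) he.1
  have hB := X.le_B
  have hp : X.B ^ e.size ≤ X.W := (Nat.pow_le_pow_right (by omega) he.2).trans X.pow_le
  obtain ⟨h₁, h₂⟩ := he.1.bdd (s := σ.vars) (W := X.W) (by exact le_trans (by norm_num) hB)
    (fun x hx => by rw [State.vars_reg, h.reg x hx]; exact h.bdd.1 x hx)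
    (fun Y hY a => by rw [State.vars_arr, h.arr Y hY]; exact h.bdd.2 Y hY a) hp
  refine ⟨h₁, ?_, hc⟩
  rw [← hc]
  exact h₂.trans (by exact_mod_cast hp)

/-- Passing an argument in register `r` of the region. -/
theorem Own.arg {σ s : State} (h : X.Own σ s) {e : Expr} (he : X.env.Adm e) (r : ℕ) :
    ∃ t σ', Run X.W (asg (regVar X.s r) e) σ t σ' ∧ t ≤ 2 * X.S + 2 ∧ X.Own σ' s ∧
      σ'.vars = σ.vars.setReg (regVar X.s r) (e.eval s) := by
  obtain ⟨h₁, h₂, h₃⟩ := h.eval he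
  obtain ⟨t, σ', hr, ht, hσ⟩ := asg_run (x := regVar X.s r) h₁ (by rwa [h₃])
  rw [h₃] at hσ
  have he2 : e.size ≤ X.S := he.2
  refine ⟨t, σ', hr, by omega, ⟨fun x hx => ?_, fun A hA => ?_, h.bdd⟩, hσ⟩
  · have := congrArg (fun m => m.reg x) hσ
    simp only [State.vars_reg, State.setReg_reg] at this
    rw [this, if_neg (by have := le_regVar X.s r; omega), h.reg x hx]
  · have : σ'.vars.arr = σ.vars.arr := by rw [hσ]; rfl
    simp only [State.vars_arr] at this
    rw [this, h.arr A hA]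

theorem region_setReg (s : ℕ) (m : State) (r : ℕ) (v : ℤ) :
    region s (m.setReg (regVar s r) v) = (region s m).setReg r v :=
  State.pull_setReg (regVar_inj s) _ m r v

theorem Fresh.setReg {s : ℕ} {m : State} (h : Fresh s m) (r : ℕ) (v : ℤ) :
    Fresh s (m.setReg (regVar s r) v) := by
  refine fun s' hs' => ⟨fun r' => ?_, (h s' hs').2⟩
  rw [State.setReg_reg, if_neg (regVar_ne (by omega) _ _), (h s' hs').1]

theorem pull_vars (s : ℕ) (σ : State) :
    σ.pull (fun r => 2 * regVar s r) (regArr s) = region s σ.vars := rfl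

/-- A call changes only the region. -/
theorem Own.call {P : Prog} {σ s : State} {t : ℕ} {τ : State} (h : X.Own σ s)
    (hf : Fresh X.s σ.vars) (hr : Run X.W P.budget (region X.s σ.vars) t τ) :
    ∃ σ', Run X.W (FineGrained.call X.s P) σ t σ' ∧ region X.s σ'.vars = τ ∧ X.Own σ' s ∧
      Fresh X.s σ'.vars := by
  have hinj : Function.Injective (fun r => 2 * regVar X.s r) := fun a b hab =>
    regVar_inj X.s (by simpa using hab)
  obtain ⟨σ', hr', hp, ha⟩ := hr.rename hinj (regArr_inj X.s) σ (pull_vars X.s σ)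
  refine ⟨σ', hr', hp, ⟨fun x hx => ?_, fun A hA => ?_, h.bdd⟩, fun s' hs' => ⟨fun r => ?_,
    fun A a => ?_⟩⟩
  · rw [ha.1 _ fun y => ?_, h.reg x hx]
    change 2 * regVar X.s y ≠ 2 * x
    have := le_regVar X.s y
    omega
  · rw [ha.2 _ fun y => ?_, h.arr A hA]
    have := le_regArr X.s y
    omega
  · rw [State.vars_reg, ha.1 _ fun y => ?_]
    · exact (hf s' hs').1 r
    · change 2 * regVar X.s y ≠ 2 * regVar s' r
      have := regVar_ne (s := X.s) (s' := s') (by omega) y r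
      omega
  · rw [State.vars_arr, ha.2 _ fun y => regArr_ne (by omega) y A]
    exact (hf s' hs').2 A a

theorem rep_own {σ s : State} {γ : X.env.Γ} {l p w : ℕ} (h : X.env.Rep σ s γ l p w) : X.Own σ s :=
  ⟨h.reg, h.arr, h.bdd⟩

/-- A budgeted run of an operation, in terms of `Dyn`. -/
theorem Own.op {P : Prog} {σ s : State} (h : X.Own σ s) (hf : Fresh X.s σ.vars)
    {E' : ℕ → Option ℕ} {al : Bool} {l p w u : ℕ} {Post : State → Prop}
    (hP : P.deadTime ≤ X.DA.maxDead)
    (halive : al = true → ∃ σd k tc, Alive (region X.s σ.vars) σd k ∧ k + tc = X.bud ∧ p = 10 * k ∧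
      ∃ t σ', Run X.W P σd t σ' ∧ tc + t ≤ X.KN + (w + u) ∧
        X.Future σ' (slotGraph X.N X.w E') (l + 1) (w + u) (tc + t) ∧ Post σ')
    (hdead : al = false → σ.vars.reg (regVar X.s 1) = 0 ∧ X.bud < X.KN + w) :
    ∃ t σ' al' p', Run X.W (FineGrained.call X.s P) σ t σ' ∧ X.Own σ' s ∧
      X.Dyn σ'.vars (E', al') (l + 1) p' (w + u) ∧ t + p' ≤ p + X.DA.maxDead ∧
      (al' = true → al = true ∧ ∃ σd k, Alive (region X.s σ'.vars) σd k ∧ Post σd) := by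
  have hW : 1 ≤ X.W := by
    have := X.pow_le
    have hB := X.le_B
    exact le_trans (Nat.one_le_pow _ _ (by omega)) this
  cases al with
  | false =>
    obtain ⟨h₁, h₂⟩ := hdead rfl
    obtain ⟨t, τ, hr, ht, hτ⟩ := P.budget_dead (W := X.W) (region X.s σ.vars) h₁
    obtain ⟨σ', hr', hp, ho, hf'⟩ := h.call hf hr
    refine ⟨t, σ', false, p, hr', ho, ⟨by simp, fun _ => ⟨?_, by omega⟩, hf'⟩, by omega, by simp⟩
    rw [← hp] at hτ
    exact hτ
  | true =>
    obtain ⟨σd, k, tc, ha, hk, hp, t, σd', hr, ht, hfut, hpost⟩ := halive rfl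
    have hb := X.bud_le
    obtain ⟨b₁, b₂⟩ := hr.budget _ k ha (by omega) hW
    by_cases htk : t ≤ k
    · obtain ⟨t', τ, hr', ht', ha'⟩ := b₁ htk
      obtain ⟨σ', hr'', hp', ho, hf'⟩ := h.call hf hr'
      rw [← hp'] at ha'
      refine ⟨t', σ', true, 10 * (k - t), hr'', ho, ⟨fun _ => ⟨σd', k - t, tc + t, ha', hfut,
        by omega, rfl⟩, by simp, hf'⟩, by omega, fun _ => ⟨rfl, σd', _, ha', hpost⟩⟩
    -- Here the operation needs more than the `k` steps left. As its total `tc + t` is at most `KN +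
    -- (w + u)` and `k + tc` is the budget, the budget was less than `KN + (w + u)`.
    · obtain ⟨t', τ, hr', ht', hτ⟩ := b₂ (by omega)
      obtain ⟨σ', hr'', hp', ho, hf'⟩ := h.call hf hr'
      refine ⟨t', σ', false, 0, hr'', ho, ⟨by simp, fun _ => ⟨?_, by omega⟩, hf'⟩, by omega, by simp⟩
      rw [← hp'] at hτ
      exact hτ

end Ctx

/-- Insert the edge between `e₁` and `e₂` with weight `e₃`. -/
def insOp (DA : DynamicAlgorithm) (s : ℕ) (e₁ e₂ e₃ : Expr) : Prog :=
  .seq (asg (regVar s 3) e₁) (.seq (asg (regVar s 4) e₂) (.seq (asg (regVar s 5) e₃)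
    (call s DA.insert)))

/-- Delete the edge between `e₁` and `e₂`. -/
def delOp (DA : DynamicAlgorithm) (s : ℕ) (e₁ e₂ : Expr) : Prog :=
  .seq (asg (regVar s 3) e₁) (.seq (asg (regVar s 4) e₂) (call s DA.delete))

/-- Write the answer to a query to variable `x`. -/
def qryOp (DA : DynamicAlgorithm) (s x : ℕ) : Prog :=
  .seq (call s DA.query) (.cond (2 * regVar s 1) (asg x (.var (regVar s 3))) (asg x 0))

/-- Run `P` if there is budget left in region `s`. -/
def ifLive (s : ℕ) (P : Prog) : Prog := .cond (2 * regVar s 1) P .skip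

namespace Ctx
variable {X : Ctx} {s : State} {E : ℕ → Option ℕ} {al : Bool}
  {Q : State → (ℕ → Option ℕ) × Bool → Prop}

theorem w_gt (X : Ctx) : 1 < X.w := by have := X.hm; simp only [w]; omega

/-- The arguments go to registers 3, 4, 5 of the region, which are registers 0, 1, 2 of the
algorithm behind the three registers of the budget. The recorded slots change even if the budget
runs out, since a dead state makes no claim about them; so loops over operations need not
distinguish the two cases. -/
theorem wp_ins {e₁ e₂ e₃ : Expr} (h₁ : X.env.Adm e₁) (h₂ : X.env.Adm e₂) (h₃ : X.env.Adm e₃)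
    {e c : ℕ} (he : ValidSlot X.r X.m e) (v₁ : e₁.eval s = (e / 2 : ℕ))
    (v₂ : e₂.eval s = (slotEnd X.w e : ℕ)) (v₃ : e₃.eval s = c) (hE : E e = none)
    (hc : c ≤ X.N ^ X.cw)
    (hQ : ∀ al', (al' = true → al = true) → Q s (Function.update E e (some c), al')) :
    X.env.WP (insOp X.DA X.s e₁ e₂ e₃) X.κ X.U s (E, al) Q := by
  intro σ l p w hr hl
  obtain ⟨ha, hd, hf⟩ := hr.dyn
  have hκ := X.le_κ
  have hκ' : X.env.κ = X.κ := rfl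
  have hL : X.env.Lmax = X.Lmax := rfl
  obtain ⟨t₁, σ₁, r₁, l₁, o₁, u₁⟩ := (rep_own hr).arg h₁ 3
  obtain ⟨t₂, σ₂, r₂, l₂, o₂, u₂⟩ := o₁.arg h₂ 4
  obtain ⟨t₃, σ₃, r₃, l₃, o₃, u₃⟩ := o₂.arg h₃ 5
  rw [u₂, u₁] at u₃
  have hf₃ : Fresh X.s σ₃.vars := by
    rw [u₃]; exact ((hf.setReg _ _).setReg _ _).setReg _ _
  obtain ⟨t, σ', al', p', hrun, ho, hdyn, ht, hal⟩ := o₃.op (P := X.DA.insert)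
    (E' := Function.update E e (some c)) (al := al) (l := l) (p := p) (w := w) (u := X.U)
    (Post := fun _ => True) hf₃ (by simp only [DynamicAlgorithm.maxDead]; omega) (by
      intro hal
      obtain ⟨σd, k, tc, a₁, a₂, a₃, a₄⟩ := ha hal
      refine ⟨_, k, tc, ⟨rfl, ?_, ?_⟩, a₃, a₄, ?_⟩
      · rw [u₃, region_setReg, region_setReg, region_setReg]
        simpa using a₁.cnt
      · rw [u₃, region_setReg, region_setReg, region_setReg]
        simpa using a₁.live
      · rw [u₃, region_setReg, region_setReg, region_setReg, State.core_setReg _ 2,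
          State.core_setReg _ 1, State.core_setReg _ 0, a₁.core, v₁, v₂, v₃]
        obtain ⟨t, σ', b₁, b₂, b₃⟩ := a₂.insert (i := ⟨e / 2, he.fst_lt⟩)
          (j := ⟨slotEnd X.w e, he.1⟩) (c := c) he.adj (by rw [slotGraph_slot X.w_gt rfl rfl]; exact hE) hc
          (by have := X.le_S; omega)
        rw [slotGraph_update X.w_gt rfl rfl] at b₃
        exact ⟨t, σ', b₁, b₂, b₃, trivial⟩) (by
      intro hal
      refine ⟨?_, (hd hal).2⟩
      rw [u₃]
      simp [(regVar_inj X.s).eq_iff]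
      exact (hd hal).1)
  refine ⟨_, σ', s, (Function.update E e (some c), al'), l + 1, p', w + X.U,
    .seq r₁ (.seq r₂ (.seq r₃ hrun)), ⟨ho.reg, ho.arr, ho.bdd, hdyn⟩, ?_, ?_, le_rfl,
    hQ al' fun h => (hal h).1⟩
  · have := X.le_S; omega
  · omega

theorem wp_del {e₁ e₂ : Expr} (h₁ : X.env.Adm e₁) (h₂ : X.env.Adm e₂)
    {e : ℕ} (he : ValidSlot X.r X.m e) (v₁ : e₁.eval s = (e / 2 : ℕ))
    (v₂ : e₂.eval s = (slotEnd X.w e : ℕ)) (hE : E e ≠ none)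
    (hQ : ∀ al', (al' = true → al = true) → Q s (Function.update E e none, al')) :
    X.env.WP (delOp X.DA X.s e₁ e₂) X.κ X.U s (E, al) Q := by
  intro σ l p w hr hl
  obtain ⟨ha, hd, hf⟩ := hr.dyn
  have hκ := X.le_κ
  have hκ' : X.env.κ = X.κ := rfl
  have hL : X.env.Lmax = X.Lmax := rfl
  obtain ⟨t₁, σ₁, r₁, l₁, o₁, u₁⟩ := (rep_own hr).arg h₁ 3
  obtain ⟨t₂, σ₂, r₂, l₂, o₂, u₂⟩ := o₁.arg h₂ 4
  rw [u₁] at u₂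
  have hf₂ : Fresh X.s σ₂.vars := by
    rw [u₂]; exact (hf.setReg _ _).setReg _ _
  obtain ⟨t, σ', al', p', hrun, ho, hdyn, ht, hal⟩ := o₂.op (P := X.DA.delete)
    (E' := Function.update E e none) (al := al) (l := l) (p := p) (w := w) (u := X.U)
    (Post := fun _ => True) hf₂ (by simp only [DynamicAlgorithm.maxDead]; omega) (by
      intro hal
      obtain ⟨σd, k, tc, a₁, a₂, a₃, a₄⟩ := ha hal
      refine ⟨_, k, tc, ⟨rfl, ?_, ?_⟩, a₃, a₄, ?_⟩
      · rw [u₂, region_setReg, region_setReg]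
        simpa using a₁.cnt
      · rw [u₂, region_setReg, region_setReg]
        simpa using a₁.live
      · rw [u₂, region_setReg, region_setReg,
          State.core_setReg _ 1, State.core_setReg _ 0, a₁.core, v₁, v₂]
        obtain ⟨t, σ', b₁, b₂, b₃⟩ := a₂.delete (i := ⟨e / 2, he.fst_lt⟩)
          (j := ⟨slotEnd X.w e, he.1⟩) (by rw [slotGraph_slot X.w_gt rfl rfl]; exact hE)
          (by have := X.le_S; omega)
        rw [slotGraph_update X.w_gt rfl rfl] at b₃
        exact ⟨t, σ', b₁, b₂, b₃, trivial⟩) (by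
      intro hal
      refine ⟨?_, (hd hal).2⟩
      rw [u₂]
      simp [(regVar_inj X.s).eq_iff]
      exact (hd hal).1)
  refine ⟨_, σ', s, (Function.update E e none, al'), l + 1, p', w + X.U,
    .seq r₁ (.seq r₂ hrun), ⟨ho.reg, ho.arr, ho.bdd, hdyn⟩, ?_, ?_, le_rfl,
    hQ al' fun h => (hal h).1⟩
  · have := X.le_S; omega
  · omega

/-- Maximum weights are unique, so any certificate for `v` identifies the answer that was returned.
After exhaustion the answer is replaced by 0, which keeps the variable bounded. -/
theorem wp_qry {x : ℕ} (hx : x < ownVars) {v : ℤ}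
    (hv : (slotGraph X.N X.w E).IsMaxMatchingWeight v) (hvB : |v| ≤ X.B)
    (h₁ : al = true → Q (s.setReg x v) (E, true)) (h₂ : Q (s.setReg x 0) (E, false)) :
    X.env.WP (qryOp X.DA X.s x) X.κ X.Q s (E, al) Q := by
  intro σ l p w hr hl
  obtain ⟨ha, hd, hf⟩ := hr.dyn
  have hκ := X.le_κ
  have hκ' : X.env.κ = X.κ := rfl
  have hL : X.env.Lmax = X.Lmax := rfl
  have hS := X.le_S
  have hBW : X.B ≤ X.W := le_trans (Nat.le_self_pow (by omega) _) X.pow_le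
  obtain ⟨t, σ', al', p', hrun, ho, hdyn, ht, hal⟩ := (rep_own hr).op (P := X.DA.query)
    (E' := E) (al := al) (l := l) (p := p) (w := w) (u := X.Q)
    (Post := fun σ => (slotGraph X.N X.w E).IsMaxMatchingWeight (σ.reg 0)) hf
    (by simp only [DynamicAlgorithm.maxDead]; omega) (by
      intro hal
      obtain ⟨σd, k, tc, a₁, a₂, a₃, a₄⟩ := ha hal
      refine ⟨_, k, tc, a₁, a₃, a₄, ?_⟩
      obtain ⟨t, σ', b₁, b₂, b₃, b₄⟩ := a₂.query (by omega)
      exact ⟨t, σ', b₁, b₃, b₄, b₂⟩) hd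
  have hrep : X.env.Rep σ' s (E, al') (l + 1) p' (w + X.Q) := ⟨ho.reg, ho.arr, ho.bdd, hdyn⟩
  cases al' with
  | true =>
    obtain ⟨hal, σd, k, hA, hm⟩ := hal rfl
    have hans : σ'.reg (2 * regVar X.s 3) = v := by
      rw [hv.unique hm, ← hA.core]; rfl
    have hlive : σ'.reg (2 * regVar X.s 1) = 1 := hA.live
    have hvW : |v| ≤ X.W := hvB.trans (by exact_mod_cast hBW)
    obtain ⟨t₂, σ₂, r₂, l₂, u₂⟩ := asg_run (W := X.W) (x := x) (e := .var (regVar X.s 3)) (σ := σ')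
      (by change |σ'.vars.reg (regVar X.s 3)| ≤ X.W; rw [State.vars_reg, hans]; exact hvW)
      (by rw [Expr.eval_var, State.vars_reg, hans]; exact hvW)
    rw [Expr.eval_var, State.vars_reg, hans] at u₂
    have hsz : (Expr.var (regVar X.s 3)).size = 1 := rfl
    exact ⟨_, σ₂, _, (E, true), l + 1, p', w + X.Q,
      .seq hrun (.cond_true (by rw [hlive]; norm_num) r₂), hrep.setReg hx hvB u₂,
      by omega, by omega, le_rfl, h₁ hal⟩
  | false =>
    have hlive : σ'.reg (2 * regVar X.s 1) = 0 := (hdyn.2.1 rfl).1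
    obtain ⟨t₂, σ₂, r₂, l₂, u₂⟩ := asg_run (W := X.W) (x := x) (e := 0) (σ := σ')
      (by change |(0 : ℤ)| ≤ X.W; simp) (by simp)
    rw [Expr.eval_zero] at u₂
    have hsz : (0 : Expr).size = 1 := rfl
    exact ⟨_, σ₂, _, (E, false), l + 1, p', w + X.Q,
      .seq hrun (.cond_false hlive r₂), hrep.setReg hx (by simp) u₂,
      by omega, by omega, le_rfl, h₂⟩

theorem wp_ifLive {P : Prog} {c d : ℕ} (h₁ : al = true → X.env.WP P c d s (E, true) Q)
    (h₂ : al = false → Q s (E, false)) : X.env.WP (ifLive X.s P) (X.κ + c) d s (E, al) Q := by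
  intro σ l p w hr hl
  have hκ := X.le_κ
  obtain ⟨ha, hd, hf⟩ := hr.dyn
  cases al with
  | true =>
    obtain ⟨σd, k, tc, a₁, a₂, a₃, a₄⟩ := ha rfl
    have hlive : σ.reg (2 * regVar X.s 1) = 1 := a₁.live
    obtain ⟨t, σ', s', γ', l', p', w', q₁, q₂, q₃, q₄, q₅, q₆⟩ := h₁ rfl σ l p w hr (by omega)
    exact ⟨_, σ', s', γ', l', p', w', .cond_true (by rw [hlive]; norm_num) q₁, q₂, by omega,
      by omega, q₅, q₆⟩
  | false =>
    have hlive : σ.reg (2 * regVar X.s 1) = 0 := (hd rfl).1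
    exact ⟨_, σ, s, (E, false), l, p, w, .cond_false hlive (.skip σ), hr, by omega, by omega,
      by omega, h₂ rfl⟩

end Ctx
end FineGrained

namespace FineGrained

/-! ### Slots of the grid -/

theorem slot_even_iff {w y x e : ℕ} (hx : x < w) :
    e = 2 * (w * y + x) ↔ e % 2 = 0 ∧ e / 2 / w = y ∧ e / 2 % w = x := by
  constructor
  · rintro rfl
    rw [show 2 * (w * y + x) / 2 = w * y + x by omega]
    exact ⟨by omega, grid_div_mod hx⟩
  · rintro ⟨h, rfl, rfl⟩
    rw [Nat.div_add_mod]
    omega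

theorem slot_odd_iff {w y x e : ℕ} (hx : x < w) :
    e = 2 * (w * y + x) + 1 ↔ e % 2 = 1 ∧ e / 2 / w = y ∧ e / 2 % w = x := by
  constructor
  · rintro rfl
    rw [show (2 * (w * y + x) + 1) / 2 = w * y + x by omega]
    exact ⟨by omega, grid_div_mod hx⟩
  · rintro ⟨h, rfl, rfl⟩
    rw [Nat.div_add_mod]
    omega

section
variable {r m L : ℕ} {v : ℕ → ℕ} {hr hr' : ℕ → ℕ → Option ℕ} {src snk : Option ℕ}

theorem slotV_zero (x : ℕ) :
    slotV r L v src snk 0 x = if src = some x then some L else none := by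
  rw [slotV, if_neg (by omega), if_pos rfl]

theorem slotV_last {y : ℕ} (_ : 0 < r) (hy : y + 1 = 2 * r) (x : ℕ) :
    slotV r L v src snk y x = if snk = some x then some L else none := by
  rw [slotV, if_neg (by omega), if_neg (by omega), if_pos hy]

/-- Since `a` and `b` may each be present or absent, this covers both the insertion and the deletion
of the edge at the source. -/
theorem gridSlots_src (x : ℕ) (hx : x < 4 * m) (a b : Option ℕ) (ha : a = some x ∨ a = none)
    (hb : b = some x ∨ b = none) :
    Function.update (gridSlots r m L v hr a snk) (2 * x + 1) (if b = some x then some L else none) =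
      gridSlots r m L v hr b snk := by
  funext e
  have hs := slot_odd_iff (w := 4 * m) (y := 0) (e := e) hx
  rw [Nat.mul_zero, Nat.zero_add] at hs
  by_cases he : e = 2 * x + 1
  · obtain ⟨h1, h2, h3⟩ := hs.1 he
    subst he
    simp only [Function.update_self, gridSlots, h1, h2, h3, slotV_zero]
    simp
  · rw [Function.update_of_ne he]
    have hn : ¬ (e % 2 = 1 ∧ e / 2 / (4 * m) = 0 ∧ e / 2 % (4 * m) = x) := fun h => he (hs.2 h)
    simp only [gridSlots]
    split_ifs with h1
    · rfl
    · by_cases hy : e / 2 / (4 * m) = 0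
      · have hx' : x ≠ e / 2 % (4 * m) := fun h => hn ⟨by omega, hy, h.symm⟩
        have e1 : a ≠ some (e / 2 % (4 * m)) := by rcases ha with rfl | rfl <;> simp [hx']
        have e2 : b ≠ some (e / 2 % (4 * m)) := by rcases hb with rfl | rfl <;> simp [hx']
        rw [hy, slotV_zero, slotV_zero, if_neg e1, if_neg e2]
      · simp only [slotV, if_neg hy]

theorem gridSlots_snk (hr0 : 0 < r) (x : ℕ) (hx : x < 4 * m) (a b : Option ℕ) (ha : a = some x ∨ a = none)
    (hb : b = some x ∨ b = none) :
    Function.update (gridSlots r m L v hr src a) (2 * (4 * m * (2 * r - 1) + x) + 1)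
      (if b = some x then some L else none) = gridSlots r m L v hr src b := by
  funext e
  have hs := slot_odd_iff (w := 4 * m) (y := 2 * r - 1) (e := e) hx
  by_cases he : e = 2 * (4 * m * (2 * r - 1) + x) + 1
  · obtain ⟨h1, h2, h3⟩ := hs.1 he
    subst he
    simp only [Function.update_self, gridSlots, h1, h2, h3,
      slotV_last hr0 (show 2 * r - 1 + 1 = 2 * r by omega)]
    simp
  · rw [Function.update_of_ne he]
    have hn : ¬ (e % 2 = 1 ∧ e / 2 / (4 * m) = 2 * r - 1 ∧ e / 2 % (4 * m) = x) := fun h => he (hs.2 h)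
    simp only [gridSlots]
    split_ifs with h1
    · rfl
    · by_cases hy : e / 2 / (4 * m) = 2 * r - 1
      · have hx' : x ≠ e / 2 % (4 * m) := fun h => hn ⟨by omega, hy, h.symm⟩
        have e1 : a ≠ some (e / 2 % (4 * m)) := by rcases ha with rfl | rfl <;> simp [hx']
        have e2 : b ≠ some (e / 2 % (4 * m)) := by rcases hb with rfl | rfl <;> simp [hx']
        rw [hy, slotV_last hr0 (by omega), slotV_last hr0 (by omega), if_neg e1, if_neg e2]
      · have : ¬ e / 2 / (4 * m) + 1 = 2 * r := by omega
        simp only [slotV, if_neg this]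

/-- Changing the weight of one step. -/
theorem gridSlots_step {k i : ℕ} (hk : k < r) (hi : 2 * m ≤ 2 * i + 2) (hi' : 2 * i + 2 < 4 * m)
    {x : Option ℕ} (h : hr' k i = x)
    (h' : ∀ k' i', k' < r → ¬ (k' = k ∧ i' = i) → hr' k' i' = hr k' i') :
    Function.update (gridSlots r m L v hr src snk) (2 * (4 * m * (2 * k + 1) + (2 * i + 1))) x =
      gridSlots r m L v hr' src snk := by
  funext e
  have hs := slot_even_iff (w := 4 * m) (y := 2 * k + 1) (x := 2 * i + 1) (e := e) (by omega)
  by_cases he : e = 2 * (4 * m * (2 * k + 1) + (2 * i + 1))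
  · obtain ⟨h1, h2, h3⟩ := hs.1 he
    rw [he, Function.update_self, ← he, gridSlots, if_pos h1, h2, h3, slotH, if_pos (by omega),
      if_neg (by omega), if_pos (by omega), if_neg (by omega), if_pos (by omega),
      show (2 * k + 1) / 2 = k by omega, show (2 * i + 1) / 2 = i by omega, h]
  · rw [Function.update_of_ne he]
    have hn : ¬ (e % 2 = 0 ∧ e / 2 / (4 * m) = 2 * k + 1 ∧ e / 2 % (4 * m) = 2 * i + 1) :=
      fun h => he (hs.2 h)
    simp only [gridSlots]
    split_ifs with h1
    · simp only [slotH]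
      split_ifs with h2 h3 h4 h5 h6 <;> first | rfl | skip
      exact (h' _ _ (by omega) (by omega)).symm
    · rfl

theorem gridSlots_step_eq {k i : ℕ} (hk : k < r) (hi : 2 * m ≤ 2 * i + 2) (hi' : 2 * i + 2 < 4 * m) :
    gridSlots r m L v hr src snk (2 * (4 * m * (2 * k + 1) + (2 * i + 1))) = hr k i := by
  obtain ⟨h1, h2, h3⟩ := (slot_even_iff (w := 4 * m) (y := 2 * k + 1) (x := 2 * i + 1)
    (e := 2 * (4 * m * (2 * k + 1) + (2 * i + 1))) (by omega)).1 rfl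
  rw [gridSlots, if_pos h1, h2, h3, slotH, if_pos (by omega), if_neg (by omega), if_pos (by omega),
    if_neg (by omega), if_pos (by omega), show (2 * k + 1) / 2 = k by omega,
    show (2 * i + 1) / 2 = i by omega]

theorem gridSlots_src_eq {x : ℕ} (hx : x < 4 * m) :
    gridSlots r m L v hr src snk (2 * x + 1) = if src = some x then some L else none := by
  obtain ⟨h1, h2, h3⟩ := (slot_odd_iff (w := 4 * m) (y := 0) (x := x) (e := 2 * x + 1) hx).1 (by simp)
  rw [gridSlots, if_neg (by omega), h2, h3, slotV, if_neg (by omega), if_pos rfl]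

theorem gridSlots_snk_eq (hr0 : 0 < r) {x : ℕ} (hx : x < 4 * m) :
    gridSlots r m L v hr src snk (2 * (4 * m * (2 * r - 1) + x) + 1) =
      if snk = some x then some L else none := by
  obtain ⟨h1, h2, h3⟩ := (slot_odd_iff (w := 4 * m) (y := 2 * r - 1) (x := x)
    (e := 2 * (4 * m * (2 * r - 1) + x) + 1) hx).1 rfl
  rw [gridSlots, if_neg (by omega), h2, h3, slotV, if_neg (by omega), if_neg (by omega),
    if_pos (by omega)]

theorem validSlot_even {y x : ℕ} (hy : y < 3 * r) (hx : x + 1 < 4 * m) :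
    ValidSlot r m (2 * (4 * m * y + x)) := by
  have h : 4 * m * (y + 1) ≤ 4 * m * (3 * r) := Nat.mul_le_mul_left _ hy
  have e2 : 2 * (4 * m * y + x) / 2 = 4 * m * y + x := by omega
  refine ⟨?_, fun _ => ?_⟩
  · rw [slotEnd, if_pos (by omega), e2]
    rw [mul_comm (3 * r)]
    rw [Nat.mul_add, Nat.mul_one] at h
    omega
  · rw [e2, (grid_div_mod (by omega)).2]; exact hx

theorem validSlot_odd {y x : ℕ} (hy : y + 1 < 3 * r) (hx : x < 4 * m) :
    ValidSlot r m (2 * (4 * m * y + x) + 1) := by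
  have h : 4 * m * (y + 1 + 1) ≤ 4 * m * (3 * r) := Nat.mul_le_mul_left _ hy
  have e2 : (2 * (4 * m * y + x) + 1) / 2 = 4 * m * y + x := by omega
  refine ⟨?_, fun h => by omega⟩
  rw [slotEnd, if_neg (by omega), e2]
  rw [mul_comm (3 * r)]
  rw [Nat.mul_add, Nat.mul_add, Nat.mul_one] at h
  omega

end

/-- The vertical costs. -/
def tent (V m i : ℕ) : ℕ := 4 * V * (i * (2 * m - 1 - i))

/-- Half of the large weight. -/
def halfL (V r m : ℕ) : ℕ := 16 * V * r * m * m

/-- The costs of the first steps in row `k`. -/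
def stepSum (V m : ℕ) (a : ℕ → ℤ) (b : ℕ → ℕ → ℤ) (k i : ℕ) : ℤ :=
  if i < m then 0 else a k + b k (i - m) + 2 * V + 2 * V * (i - m : ℕ)

theorem tent_le (V r m i : ℕ) (hr : 0 < r) (hi : i < 2 * m) : tent V m i ≤ 2 * halfL V r m := by
  rw [tent, halfL]
  have h1 : i * (2 * m - 1 - i) ≤ (2 * m) * (2 * m) := Nat.mul_le_mul (by omega) (by omega)
  calc 4 * V * (i * (2 * m - 1 - i)) ≤ 4 * V * ((2 * m) * (2 * m)) := Nat.mul_le_mul_left _ h1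
    _ = 16 * V * 1 * m * m := by ring
    _ ≤ 16 * V * r * m * m := by gcongr; omega
    _ ≤ 2 * (16 * V * r * m * m) := by omega

/-- The gadget with `c0 = m - 1 - j` and `c1 = m + j`, columns that are symmetric about the middle
and hence have the same vertical price. Descending in a column between them could save at most `4V`
for every column that remains to be crossed, and the tent charges at least this much extra. So the
optimum pays all descents at the end columns and crosses in the cheapest row. -/
theorem block_isMax {r m V : ℕ} (hr0 : 0 < r) (hV : 0 < V) {a : ℕ → ℤ} {b : ℕ → ℕ → ℤ}
    (ha : ∀ k, |a k| ≤ V) (hb : ∀ k j, |b k j| ≤ V) {hr : ℕ → ℕ → Option ℕ}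
    (hhr : ∀ k i, k < r → m ≤ i + 1 → i + 1 < 2 * m → ∃ c : ℕ, hr k i = some c ∧
      (c : ℤ) = 2 * halfL V r m - (stepSum V m a b k (i + 1) - stepSum V m a b k i))
    {j : ℕ} (hj : j < m) :
    ∃ μ : ℤ, (∀ k < r, μ ≤ a k + b k j) ∧ (∃ k < r, μ = a k + b k j) ∧
      (slotGraph (3 * r * (4 * m)) (4 * m) (gridSlots r m (2 * halfL V r m) (tent V m) hr
        (some (2 * (m - 1 - j))) (some (2 * (m + j) + 1)))).IsMaxMatchingWeight
      (((2 * r - 1 : ℕ) * (2 * m) + 1) * (2 * halfL V r m) - (r - 1 : ℕ) * tent V m (m - 1 - j) -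
        (μ + 2 * V + 2 * V * j)) := by
  have hV' : (0 : ℤ) < V := by exact_mod_cast hV
  obtain ⟨ks, hks, hmin⟩ := Finset.exists_min_image (Finset.range r) (fun k => a k + b k j)
    ⟨0, by simpa using hr0⟩
  simp only [Finset.mem_range] at hks hmin
  have hsum (k : ℕ) : stepSum V m a b k (m + j) = a k + b k j + 2 * V + 2 * V * j := by
    rw [stepSum, if_neg (by omega), Nat.add_sub_cancel_left]
  -- The sum `a + b` and the differences of `b` are at least `-2V`; the added `2V` makes every step
  -- cost nonnegative, and at most `4V`.
  have hstep (k i : ℕ) : 0 ≤ stepSum V m a b k (i + 1) - stepSum V m a b k i ∧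
      (m ≤ i → stepSum V m a b k (i + 1) - stepSum V m a b k i ≤ 4 * V) := by
    have h1 := abs_le.1 (ha k)
    have h2 := abs_le.1 (hb k (i - m))
    have h3 := abs_le.1 (hb k (i + 1 - m))
    simp only [stepSum]
    split_ifs with h4 h5 h5
    · exact ⟨by simp, by omega⟩
    · omega
    · have : i + 1 - m = 0 := by omega
      rw [this] at h3 ⊢
      refine ⟨by push_cast; linarith, by omega⟩
    · have : i + 1 - m = i - m + 1 := by omega
      rw [this] at h3 ⊢
      push_cast
      refine ⟨by linarith, fun _ => by linarith⟩
  have hmono (k i i' : ℕ) (h : i ≤ i') : stepSum V m a b k i ≤ stepSum V m a b k i' := by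
    induction i', h using Nat.le_induction with
    | base => exact le_rfl
    | succ i' _ ih => have := (hstep k i').1; linarith
  have hlip (k i d : ℕ) (h : m ≤ i) :
      stepSum V m a b k (i + d) - stepSum V m a b k i ≤ d * (4 * V) := by
    induction d with
    | zero => simp
    | succ d ih =>
      have := (hstep k (i + d)).2 (by omega)
      rw [← add_assoc]
      push_cast
      linarith
  -- Reflecting the array exchanges `i` and `2m - 1 - i`, the two factors of the tent.
  have htent : tent V m (m + j) = tent V m (m - 1 - j) := by
    rw [tent, tent, mul_comm (m + j), show 2 * m - 1 - (m + j) = m - 1 - j by omega,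
      show 2 * m - 1 - (m - 1 - j) = m + j by omega]
  have htent_eq : (tent V m (m - 1 - j) : ℤ) = 4 * V * ((m - 1 - j) * (m + j)) := by
    rw [tent, show 2 * m - 1 - (m - 1 - j) = m + j by omega]
    push_cast [show j ≤ m - 1 by omega, show 1 ≤ m by omega]
    ring
  let G : Gadget :=
    { r := r, m := m, c0 := m - 1 - j, c1 := m + j, ks := ks, Lh := halfL V r m, v := tent V m
      Bt := stepSum V m a b
      hc := by omega
      hc0 := by omega
      hks := hks
      v_eq := htent
      v_left := by
        intro i h1 h2
        obtain ⟨d, rfl⟩ := Nat.exists_eq_add_of_le h1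
        rw [tent, tent]
        refine Nat.mul_le_mul_left _ ?_
        obtain ⟨e, he⟩ := Nat.exists_eq_add_of_le (show d ≤ j by omega)
        rw [show 2 * m - 1 - (m - 1 - j) = m + j by omega,
          show 2 * m - 1 - (m - 1 - j + d) = m + j - d by omega]
        have e1 : m + j - d = m + e := by omega
        rw [e1, he]
        obtain ⟨f, rfl⟩ := Nat.exists_eq_add_of_le (show d + e + 1 ≤ m by omega)
        rw [show d + e + 1 + f - 1 - (d + e) = f by omega]
        nlinarith
      v_right := by
        -- With `i = m + f` and `j = f + d`, the tent at `i` exceeds its value at the end columns by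
        -- `4V d (2f + d + 1)`. The rest of a row costs between 0 and `4V d`, so no two rows differ
        -- by more than that.
        intro k i _ h1 h2
        obtain ⟨d, hd⟩ := Nat.exists_eq_add_of_le h2
        have l1 := hlip k i d h1
        rw [← hd] at l1
        have l2 := hmono (k + 1) i (m + j) h2
        obtain ⟨f, hf⟩ := Nat.exists_eq_add_of_le h1
        have hv : (tent V m i : ℤ) = 4 * V * (i * (2 * m - 1 - i)) := by
          rw [tent]
          push_cast [show i ≤ 2 * m - 1 by omega, show 1 ≤ 2 * m by omega]
          ring
        have hj' : (j : ℤ) = f + d := by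
          have : m + j = m + f + d := by rw [hd, hf]
          have : j = f + d := by omega
          exact_mod_cast this
        have hi' : (i : ℤ) = m + f := by exact_mod_cast hf
        rw [hv, htent_eq, hi', hj']
        have : (d : ℤ) * (4 * V) + 4 * V * ((m - 1 - (f + d)) * (m + (f + d))) ≤
            4 * V * ((m + f) * (2 * m - 1 - (m + f))) := by
          have h0 : (0 : ℤ) ≤ d * (2 * f + d) := by positivity
          nlinarith
        linarith
      v_le := fun i hi => tent_le V r m i hr0 hi
      Bt_zero := fun k i h => by simp [stepSum, h]
      Bt_mono := fun k i i' _ h _ => hmono k i i' h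
      min := fun k hk => by
        have := hmin k hk
        rw [hsum, hsum]; linarith
      big := by
        -- The descents cost at most `8V m²` each, and a row at most `4V + 2V j`; the choice `16 V r
        -- m²` for half of the large weight leaves room for both.
        intro k _
        rw [hsum, htent_eq, halfL]
        have h1 := abs_le.1 (ha k)
        have h2 := abs_le.1 (hb k j)
        obtain ⟨r', rfl⟩ := Nat.exists_eq_add_of_le' hr0
        obtain ⟨f, rfl⟩ := Nat.exists_eq_add_of_le (show j + 1 ≤ m from hj)
        push_cast
        have e1 : ((j : ℤ) + 1 + f - 1 - j) = f := by ring
        rw [e1]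
        have p1 : (0 : ℤ) ≤ V * (r' : ℤ) * (f * (j + 1 + f + j)) := by positivity
        have p2 : (f : ℤ) * (j + 1 + f + j) ≤ 2 * ((j + 1 + f) * (j + 1 + f)) := by nlinarith
        have p3 : (j : ℤ) ≤ (j + 1 + f) * (j + 1 + f) := by nlinarith
        have p4 : (1 : ℤ) ≤ (j + 1 + f) * (j + 1 + f) := by nlinarith
        have p5 : 4 * (V : ℤ) * (f * (j + 1 + f + j)) ≤ 8 * V * ((j + 1 + f) * (j + 1 + f)) := by
          nlinarith
        have p6 : (r' : ℤ) * (4 * (V : ℤ) * (f * (j + 1 + f + j))) ≤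
            r' * (8 * V * ((j + 1 + f) * (j + 1 + f))) := by gcongr
        have p7 : (0 : ℤ) ≤ r' * (V * ((j + 1 + f) * (j + 1 + f))) := by positivity
        have p8 : (V : ℤ) * j ≤ V * ((j + 1 + f) * (j + 1 + f)) := by gcongr
        have p9 : (V : ℤ) * 1 ≤ V * ((j + 1 + f) * (j + 1 + f)) := by gcongr
        nlinarith }
  refine ⟨a ks + b ks j, hmin, ⟨ks, hks, rfl⟩, ?_⟩
  have := G.isMax (hr := hr) hhr
  have e : G.μ = a ks + b ks j + 2 * V + 2 * V * j := hsum ks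
  rw [e] at this
  exact this

end FineGrained

namespace FineGrained

/-! ### Loops that fill arrays and loops of operations -/

/-- The states have the same variables except for `x` and `y`. -/
def OffVars (x y : ℕ) (s s' : State) : Prop := ∀ z, z ≠ x → z ≠ y → s'.reg z = s.reg z

namespace Env
variable {E : Env} {s : State} {γ : E.Γ}

/-- The value expression only has to be correct in states that differ from the initial one in the
loop variables and in the array `A` that is being filled; it must not depend on `A`. -/
theorem wp_fill {x y A : ℕ} {ek ev : Expr} {k : ℕ} {f : ℕ → ℤ} (hx : E.ownR x) (hy : E.ownR y)
    (hxy : x ≠ y) (hA : E.ownA A) (hek : E.Adm ek) (hev : E.Adm ev) (hk : ek.eval s = k)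
    (hkB : k ≤ E.B)
    (hf : ∀ i < k, ∀ s', OffVars x y s s' → (∀ A', A' ≠ A → s'.arr A' = s.arr A') → s'.reg x = i →
      ev.eval s' = f i ∧ |f i| ≤ E.B) :
    E.WP (for' x y ek (sto A (.var x) ev)) (4 * E.κ + k * (3 * E.κ)) 0 s γ fun s' γ' =>
      γ' = γ ∧ OffVars x y s s' ∧ (∀ A', A' ≠ A → s'.arr A' = s.arr A') ∧
      (∀ i < k, s'.arr A (i : ℕ) = f i) ∧ ∀ a : ℤ, a < 0 ∨ k ≤ a → s'.arr A a = s.arr A a := by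
  have hS := E.le_S
  have hvx : E.Adm (.var x) := ⟨hx, by simp only [Expr.size]; omega⟩
  have h := WP.for (E := E) (P := sto A (.var x) ev) (c := E.κ) (d := 0) (s := s) (γ := γ)
    (I := fun i s' γ' => γ' = γ ∧ OffVars x y s s' ∧ (∀ A', A' ≠ A → s'.arr A' = s.arr A') ∧
      (∀ j < i, s'.arr A (j : ℕ) = f j) ∧ ∀ a : ℤ, a < 0 ∨ i ≤ a → s'.arr A a = s.arr A a)
    hx hy hxy hek hk hkB
    ⟨rfl, fun z h1 h2 => by simp [h1, h2], fun _ _ => rfl, fun _ h => absurd h (by omega), fun _ _ => rfl⟩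
    (fun i hi s' γ' ⟨h1, h2, h3, h4, h5⟩ hsx hsy => by
      obtain ⟨e1, e2⟩ := hf i hi s' h2 h3 hsx
      refine WP.sto hA hvx hev (by rw [e1]; exact e2) ?_
      rw [e1]
      simp only [Expr.eval_var, hsx]
      refine ⟨hsx, hsy, h1, fun z h1 h2' => by simp [h1, h2 z h1 h2'], fun A' hA' => ?_,
        fun j hj => ?_, fun a ha => ?_⟩
      · funext a; simp [hA', h3 A' hA']
      · rcases Nat.lt_succ_iff_lt_or_eq.1 hj with hj' | rfl
        · have : ¬ (j : ℤ) = i := by omega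
          simp [this, h4 j hj']
        · simp
      · have : ¬ a = i := by push_cast at ha; omega
        simp only [State.setReg_arr, State.setCell_arr, this, and_false, if_false]
        exact h5 a (by push_cast at ha; omega))
  exact h.weaken (by rw [show E.κ + 2 * E.κ = 3 * E.κ by ring]) (by simp) fun s' γ' h => h.2.2

end Env

namespace Ctx
variable {X : Ctx} {s : State}

/-- A loop of operations. -/
theorem wp_slotLoop {x y : ℕ} {ek : Expr} {k c d : ℕ} {P : Prog} {F : ℕ → ℕ → Option ℕ} {al : Bool}
    (hx : x < ownVars) (hy : y < ownVars) (hxy : x ≠ y) (hek : X.env.Adm ek) (hk : ek.eval s = k)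
    (hkB : k ≤ X.B)
    (hstep : ∀ i < k, ∀ s', OffVars x y s s' → s'.arr = s.arr → s'.reg x = i → ∀ al',
      X.env.WP P c d s' (F i, al') fun s'' γ => s'' = s' ∧ γ.1 = F (i + 1) ∧ (γ.2 = true → al' = true)) :
    X.env.WP (for' x y ek P) (4 * X.κ + k * (c + 2 * X.κ)) (k * d) s (F 0, al) fun s' γ =>
      OffVars x y s s' ∧ s'.arr = s.arr ∧ γ.1 = F k ∧ (γ.2 = true → al = true) := by
  have h := Env.WP.for (E := X.env) (P := P) (c := c) (d := d) (s := s) (γ := (F 0, al))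
    (I := fun i s' γ' => OffVars x y s s' ∧ s'.arr = s.arr ∧ γ'.1 = F i ∧ (γ'.2 = true → al = true))
    hx hy hxy hek hk hkB
    ⟨fun z h1 h2 => by simp [h1, h2], rfl, rfl, id⟩
    (fun i hi s' γ' ⟨h1, h2, h3, h4⟩ hsx hsy => by
      have := hstep i hi s' h1 h2 hsx γ'.2
      rw [← h3] at this
      refine this.mono ?_
      rintro _ γ'' ⟨rfl, e1, e2⟩
      exact ⟨hsx, hsy, fun z h h' => by simp [h, h1 z h h'], h2, e1, fun h => h4 (e2 h)⟩)
  exact h.mono fun s' γ' h => h.2.2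

end Ctx

/-- `if c then a else b`, where `c` is `0` or `1`. -/
def Expr.sel (c a b : Expr) : Expr := c * a + (1 - c) * b

theorem Expr.eval_sel {c a b : Expr} {s : State} {p : Prop} [Decidable p]
    (h : c.eval s = if p then 1 else 0) :
    (Expr.sel c a b).eval s = if p then a.eval s else b.eval s := by
  simp only [sel, eval_add, eval_mul, eval_sub, eval_one, h]
  split_ifs <;> ring

theorem ite_mul_ite {p q : Prop} [Decidable p] [Decidable q] :
    ((if p then 1 else 0) * (if q then 1 else 0) : ℤ) = if p ∧ q then 1 else 0 := by
  by_cases p <;> by_cases q <;> simp [*]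

/-- The weight in a slot as a word. -/
def slotCode (o : Option ℕ) : ℤ := o.elim (-1) (fun c => c)

/-! ### The base weights of the grid -/

/-- The steps from cell `(k, i)` with `m ≤ i` have weight `c k i` if their number is between `lo` and
`hi`, and those from cell `(k, m - 1)` have weight `a k` if `k` is between `lo'` and `hi'`. -/
def stepSlots (m : ℕ) (c : ℕ → ℕ → ℕ) (a : ℕ → ℕ) (lo hi lo' hi' k i : ℕ) : Option ℕ :=
  if i + 1 = m then if lo' ≤ k ∧ k < hi' then some (a k) else none
  else if m ≤ i ∧ i + 1 < 2 * m ∧ lo ≤ m * k + (i + 1 - m) ∧ m * k + (i + 1 - m) < hi then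
    some (c k i)
  else none

theorem stepSlots_empty (m : ℕ) (c : ℕ → ℕ → ℕ) (a : ℕ → ℕ) (lo lo' : ℕ) :
    stepSlots m c a lo lo lo' lo' = fun _ _ => none := by
  funext k i
  rw [stepSlots]
  split_ifs <;> first | rfl | omega

/-- While no step leaves column `m - 1`, the weights of such steps are irrelevant. This allows
passing from one row of the matrix to the next without touching the block. -/
theorem stepSlots_mids_empty (m : ℕ) (c : ℕ → ℕ → ℕ) (a a' : ℕ → ℕ) (lo hi lo' lo'' : ℕ) :
    stepSlots m c a lo hi lo' lo' = stepSlots m c a' lo hi lo'' lo'' := by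
  funext k i
  rw [stepSlots, stepSlots]
  split_ifs <;> first | rfl | omega

section
variable {r m L t : ℕ} {v : ℕ → ℕ} {c : ℕ → ℕ → ℕ} {a : ℕ → ℕ} {src snk : Option ℕ}
  {lo hi lo' hi' : ℕ}

/-- The slot of the `t`-th step. -/
def stepSlot (m t : ℕ) : ℕ := 2 * (4 * m * (2 * (t / m) + 1) + (2 * (m - 1 + t % m) + 1))

theorem stepSlot_valid (ht : t < r * m) : ValidSlot r m (stepSlot m t) := by
  have hm : 0 < m := Nat.pos_of_mul_pos_left (by omega : 0 < r * m)
  have := Nat.mod_lt t hm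
  have hk : t / m < r := (Nat.div_lt_iff_lt_mul hm).2 ht
  exact validSlot_even (by omega) (by omega)

theorem stepSlots_of_index {k i : ℕ} (hm : 0 < m) (h : m ≤ i ∧ i + 1 < 2 * m) :
    m * k + (i + 1 - m) = t ↔ k = t / m ∧ i = m - 1 + t % m := by
  constructor
  · rintro rfl
    obtain ⟨h1, h2⟩ := grid_div_mod (w := m) (y := k) (x := i + 1 - m) (by omega)
    rw [h1, h2]; omega
  · rintro ⟨rfl, rfl⟩
    have := Nat.div_add_mod t m
    omega

/-- The index `t = m k + j` runs over the entries of the block, and the step into entry `j` of row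
`k` leaves column `m - 1 + j`. For `j = 0` there is nothing to insert: that step also depends on the
row of the left factor and is handled by `midSlots_succ`. -/
theorem stepSlots_succ (ht : t < r * m) :
    (t % m ≠ 0 → gridSlots r m L v (stepSlots m c a 0 t lo' hi') src snk (stepSlot m t) = none ∧
      gridSlots r m L v (stepSlots m c a 0 (t + 1) lo' hi') src snk =
        Function.update (gridSlots r m L v (stepSlots m c a 0 t lo' hi') src snk) (stepSlot m t)
          (some (c (t / m) (m - 1 + t % m)))) ∧
    (t % m = 0 → gridSlots r m L v (stepSlots m c a 0 (t + 1) lo' hi') src snk =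
      gridSlots r m L v (stepSlots m c a 0 t lo' hi') src snk) := by
  have hm : 0 < m := Nat.pos_of_mul_pos_left (by omega : 0 < r * m)
  have hlt := Nat.mod_lt t hm
  have hk : t / m < r := (Nat.div_lt_iff_lt_mul hm).2 ht
  have hdm := Nat.div_add_mod t m
  refine ⟨fun h => ⟨?_, ?_⟩, fun h => ?_⟩
  · rw [stepSlot, gridSlots_step_eq hk (by omega) (by omega), stepSlots, if_neg (by omega),
      if_neg (by omega)]
  · symm
    refine gridSlots_step hk (by omega) (by omega) ?_ fun k' i' _ hne => ?_
    · rw [stepSlots, if_neg (by omega), if_pos ⟨by omega, by omega, by omega, by omega⟩]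
    · simp only [stepSlots]
      by_cases h1 : i' + 1 = m
      · simp [h1]
      · by_cases h2 : m ≤ i' ∧ i' + 1 < 2 * m
        · have := mt (stepSlots_of_index (t := t) hm h2).1 hne
          simp only [h1, if_false, h2, true_and]
          congr 1
          simp only [eq_iff_iff]; omega
        · simp only [h1, if_false]
          rw [if_neg (by tauto), if_neg (by tauto)]
  · congr 1
    funext k i
    simp only [stepSlots]
    by_cases h1 : i + 1 = m
    · simp [h1]
    · by_cases h2 : m ≤ i ∧ i + 1 < 2 * m
      · have := mt (stepSlots_of_index (t := t) (k := k) hm h2).1 (by omega)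
        simp only [h1, if_false, h2, true_and]
        congr 1
        simp only [eq_iff_iff]; omega
      · simp only [h1, if_false]
        rw [if_neg (by tauto), if_neg (by tauto)]

theorem stepSlots_del (ht : t < r * m) (hh : r * m ≤ hi) :
    (t % m ≠ 0 → gridSlots r m L v (stepSlots m c a t hi lo' hi') src snk (stepSlot m t) ≠ none ∧
      gridSlots r m L v (stepSlots m c a (t + 1) hi lo' hi') src snk =
        Function.update (gridSlots r m L v (stepSlots m c a t hi lo' hi') src snk) (stepSlot m t)
          none) ∧
    (t % m = 0 → gridSlots r m L v (stepSlots m c a (t + 1) hi lo' hi') src snk =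
      gridSlots r m L v (stepSlots m c a t hi lo' hi') src snk) := by
  have hm : 0 < m := Nat.pos_of_mul_pos_left (by omega : 0 < r * m)
  have hlt := Nat.mod_lt t hm
  have hk : t / m < r := (Nat.div_lt_iff_lt_mul hm).2 ht
  have hdm := Nat.div_add_mod t m
  refine ⟨fun h => ⟨?_, ?_⟩, fun h => ?_⟩
  · rw [stepSlot, gridSlots_step_eq hk (by omega) (by omega), stepSlots, if_neg (by omega),
      if_pos ⟨by omega, by omega, by omega, by omega⟩]
    simp
  · symm
    refine gridSlots_step hk (by omega) (by omega) ?_ fun k' i' _ hne => ?_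
    · rw [stepSlots, if_neg (by omega), if_neg (by omega)]
    · simp only [stepSlots]
      by_cases h1 : i' + 1 = m
      · simp [h1]
      · by_cases h2 : m ≤ i' ∧ i' + 1 < 2 * m
        · have := mt (stepSlots_of_index (t := t) hm h2).1 hne
          simp only [h1, if_false, h2, true_and]
          congr 1
          simp only [eq_iff_iff]; omega
        · simp only [h1, if_false]
          rw [if_neg (by tauto), if_neg (by tauto)]
  · congr 1
    funext k i
    simp only [stepSlots]
    by_cases h1 : i + 1 = m
    · simp [h1]
    · by_cases h2 : m ≤ i ∧ i + 1 < 2 * m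
      · have := mt (stepSlots_of_index (t := t) (k := k) hm h2).1 (by omega)
        simp only [h1, if_false, h2, true_and]
        congr 1
        simp only [eq_iff_iff]; omega
      · simp only [h1, if_false]
        rw [if_neg (by tauto), if_neg (by tauto)]

/-- The slot of the step from cell `(k, m - 1)`. -/
def midSlot (m k : ℕ) : ℕ := 2 * (4 * m * (2 * k + 1) + (2 * (m - 1) + 1))

theorem midSlot_valid {k : ℕ} (hm : 0 < m) (hk : k < r) : ValidSlot r m (midSlot m k) :=
  validSlot_even (by omega) (by omega)

theorem midSlots_succ {k : ℕ} (hm : 0 < m) (hk : k < r) :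
    gridSlots r m L v (stepSlots m c a lo hi 0 k) src snk (midSlot m k) = none ∧
      gridSlots r m L v (stepSlots m c a lo hi 0 (k + 1)) src snk =
        Function.update (gridSlots r m L v (stepSlots m c a lo hi 0 k) src snk) (midSlot m k)
          (some (a k)) := by
  constructor
  · rw [midSlot, gridSlots_step_eq hk (by omega) (by omega), stepSlots, if_pos (by omega),
      if_neg (by omega)]
  · symm
    refine gridSlots_step hk (by omega) (by omega) ?_ fun k' i' _ hne => ?_
    · rw [stepSlots, if_pos (by omega), if_pos (by omega)]
    · simp only [stepSlots]
      by_cases h1 : i' + 1 = m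
      · simp only [h1, if_true]
        congr 1
        simp only [eq_iff_iff]; omega
      · simp only [h1, if_false]

theorem midSlots_del {k : ℕ} (hm : 0 < m) (hk : k < r) (hh : r ≤ hi') :
    gridSlots r m L v (stepSlots m c a lo hi k hi') src snk (midSlot m k) ≠ none ∧
      gridSlots r m L v (stepSlots m c a lo hi (k + 1) hi') src snk =
        Function.update (gridSlots r m L v (stepSlots m c a lo hi k hi') src snk) (midSlot m k)
          none := by
  constructor
  · rw [midSlot, gridSlots_step_eq hk (by omega) (by omega), stepSlots, if_pos (by omega),
      if_pos (by omega)]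
    simp
  · symm
    refine gridSlots_step hk (by omega) (by omega) ?_ fun k' i' _ hne => ?_
    · rw [stepSlots, if_pos (by omega), if_neg (by omega)]
    · simp only [stepSlots]
      by_cases h1 : i' + 1 = m
      · simp only [h1, if_true]
        congr 1
        simp only [eq_iff_iff]; omega
      · simp only [h1, if_false]

end
end FineGrained

namespace FineGrained

/-! ### The main program -/

namespace Expr

@[simp] theorem eval_two (s : State) : (2 : Expr).eval s = 2 := rfl
@[simp] theorem eval_three (s : State) : (3 : Expr).eval s = 3 := rfl
@[simp] theorem eval_four (s : State) : (4 : Expr).eval s = 4 := rfl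

/-- A computable form of admissibility, so that it can be settled by `decide` for concrete
expressions. All literal constants are below 100, hence below `B`. -/
def check : Expr → Bool
  | var x => x < ownVars
  | cst k => k.natAbs ≤ 100
  | op o a b => (match o with
      | .add | .sub | .mul | .div | .mod | .lt | .eq => true
      | _ => false) && a.check && b.check
  | ld A e => A < ownArrs && e.check

theorem ok_of_check {E : Env} (hR : ∀ x < ownVars, E.ownR x) (hA : ∀ A < ownArrs, E.ownA A) {e : Expr}
    (h : e.check = true) : e.Ok E.ownR E.ownA E.B := by
  have hB := E.le_B
  induction e with
  | var x => exact hR x (by simpa [check] using h)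
  | cst k =>
    have : k.natAbs ≤ 100 := by simpa [check] using h
    change |k| ≤ E.B
    rw [Int.abs_eq_natAbs]
    exact_mod_cast this.trans hB
  | op o a b iha ihb =>
    simp only [check, Bool.and_eq_true] at h
    refine ⟨?_, iha h.1.2, ihb h.2⟩
    have := h.1.1
    cases o <;> simp_all [BinOp.Small]
  | ld A e ih =>
    simp only [check, Bool.and_eq_true] at h
    exact ⟨hA A (by simpa using h.1), ih h.2⟩

end Expr

abbrev sizeBound : ℕ := 2000

theorem Ctx.adm {X : Ctx} (hS : sizeBound ≤ X.S) {e : Expr}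
    (h : (e.check && decide (e.size ≤ sizeBound)) = true) : X.env.Adm e := by
  simp only [Bool.and_eq_true, decide_eq_true_eq] at h
  exact ⟨Expr.ok_of_check (E := X.env) (fun x hx => hx) (fun A hA => hA) h.1, h.2.trans hS⟩

/-- The problem that the main program solves with the dynamic algorithm of `X`. -/
structure Core (X : Ctx) where
  (n np V K z : ℕ)
  G : WDigraph n
  hz : 0 < z
  hnp : np = z * X.r * X.m
  n_le : n ≤ np
  hV : 0 < V
  hL : 2 * halfL V X.r X.m ≤ X.N ^ X.cw
  hS : sizeBound ≤ X.S
  B_L : 20 * (X.r * X.m) * (2 * halfL V X.r X.m) ≤ X.B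
  B_N : X.N * X.N ≤ X.B
  B_np : np * np ≤ X.B
  B_K : K ≤ X.B
  B_bud : X.bud ≤ X.B

/-- The states have the same variables below `k` and the same arrays except for array `5`. -/
structure Fr (k : ℕ) (s s' : State) : Prop where
  reg : ∀ x < k, s'.reg x = s.reg x
  arr : ∀ A, A ≠ 5 → s'.arr A = s.arr A

namespace Fr
variable {k : ℕ} {s s' s'' : State}

theorem refl (k : ℕ) (s : State) : Fr k s s := ⟨fun _ _ => rfl, fun _ _ => rfl⟩

theorem trans (h : Fr k s s') (h' : Fr k s' s'') : Fr k s s'' :=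
  ⟨fun x hx => (h'.reg x hx).trans (h.reg x hx), fun A hA => (h'.arr A hA).trans (h.arr A hA)⟩

theorem mono {k' : ℕ} (hk : k' ≤ k) (h : Fr k s s') : Fr k' s s' :=
  ⟨fun x hx => h.reg x (hx.trans_le hk), h.arr⟩

theorem setReg (h : Fr k s s') {x : ℕ} (hx : k ≤ x) (v : ℤ) : Fr k s (s'.setReg x v) :=
  ⟨fun y hy => by rw [State.setReg_reg, if_neg (by omega), h.reg y hy], h.arr⟩

theorem setCell (h : Fr k s s') (a v : ℤ) : Fr k s (s'.setCell 5 a v) :=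
  ⟨h.reg, fun A hA => by funext b; simp [hA, h.arr A hA]⟩

theorem of_off {x y : ℕ} (hx : k ≤ x) (hy : k ≤ y) (h : OffVars x y s s') (ha : s'.arr = s.arr) :
    Fr k s s' := ⟨fun z hz => h z (by omega) (by omega), fun A _ => by rw [ha]⟩

end Fr

namespace Core
variable {X : Ctx} (C : Core X)

abbrev L : ℕ := 2 * halfL C.V X.r X.m

/-- The parameters are in their variables, and the input is in its arrays. -/
structure Base (s : State) : Prop where
  r0 : s.reg 0 = C.n
  r1 : s.reg 1 = C.np
  r2 : s.reg 2 = C.V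
  r3 : s.reg 3 = C.K
  r4 : s.reg 4 = X.bud
  r6 : s.reg 6 = X.r
  r7 : s.reg 7 = X.m
  r8 : s.reg 8 = C.z
  r9 : s.reg 9 = X.N
  r10 : s.reg 10 = X.w
  r11 : s.reg 11 = C.L
  a0 : s.arr 0 = (apspInput C.G).arr 0
  a1 : s.arr 1 = (apspInput C.G).arr 1

variable {C}

theorem Base.fr {k : ℕ} {s s' : State} (h : C.Base s) (hk : 12 ≤ k) (hf : Fr k s s') : C.Base s' where
  r0 := by rw [hf.reg 0 (by omega), h.r0]
  r1 := by rw [hf.reg 1 (by omega), h.r1]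
  r2 := by rw [hf.reg 2 (by omega), h.r2]
  r3 := by rw [hf.reg 3 (by omega), h.r3]
  r4 := by rw [hf.reg 4 (by omega), h.r4]
  r6 := by rw [hf.reg 6 (by omega), h.r6]
  r7 := by rw [hf.reg 7 (by omega), h.r7]
  r8 := by rw [hf.reg 8 (by omega), h.r8]
  r9 := by rw [hf.reg 9 (by omega), h.r9]
  r10 := by rw [hf.reg 10 (by omega), h.r10]
  r11 := by rw [hf.reg 11 (by omega), h.r11]
  a0 := by rw [hf.arr 0 (by omega), h.a0]
  a1 := by rw [hf.arr 1 (by omega), h.a1]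

variable (C)

/-- Array `4` holds the matrix `D`. -/
def HasMat (D : ℕ → ℕ → ℤ) (s : State) : Prop :=
  ∀ i < C.np, ∀ j < C.np, s.arr 4 ((C.np * i + j : ℕ) : ℤ) = D i j

/-- The entries in array `5` are bounded. -/
def Small (s : State) : Prop := ∀ a < C.np * C.np, |s.arr 5 (a : ℕ)| ≤ C.V

/-- Array `5` holds the partial minima over the first `(kb + 1) * r` or `kb * r` nodes. -/
def Partial (D : ℕ → ℕ → ℤ) (kb : ℕ) (P : ℕ → ℕ → Prop) (s : State) : Prop :=
  ∀ i < C.np, ∀ j < C.np,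
    (P i j → s.arr 5 ((C.np * i + j : ℕ) : ℤ) = minSum D C.V i j (kb * X.r + X.r)) ∧
    (¬ P i j → s.arr 5 ((C.np * i + j : ℕ) : ℤ) = minSum D C.V i j (kb * X.r))

/-- Bounds for the matrix; the second holds as long as all answers were correct. -/
def Good (D : ℕ → ℕ → ℤ) : Prop := ∀ i j k, -(C.V : ℤ) ≤ D i k + D k j

variable {C}
theorem HasMat.fr {D : ℕ → ℕ → ℤ} {k : ℕ} {s s' : State} (h : C.HasMat D s) (hf : Fr k s s') :
    C.HasMat D s' := fun i hi j hj => by rw [hf.arr 4 (by omega), h i hi j hj]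

theorem Partial.congr {D : ℕ → ℕ → ℤ} {kb : ℕ} {P P' : ℕ → ℕ → Prop} {s : State}
    (h : C.Partial D kb P s) (hP : ∀ i < C.np, ∀ j < C.np, (P i j ↔ P' i j)) :
    C.Partial D kb P' s := fun i hi j hj => by
  rw [← hP i hi j hj]; exact h i hi j hj

theorem cell_lt {i j : ℕ} (hi : i < C.np) (hj : j < C.np) : C.np * i + j < C.np * C.np := by
  have : C.np * (i + 1) ≤ C.np * C.np := Nat.mul_le_mul_left _ hi
  rw [Nat.mul_add] at this
  omega

theorem cell_inj {i j i' j' : ℕ} (hj : j < C.np) (hj' : j' < C.np)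
    (h : C.np * i + j = C.np * i' + j') : i = i' ∧ j = j' := by
  obtain ⟨h1, h2⟩ := grid_div_mod (y := i) hj
  obtain ⟨h3, h4⟩ := grid_div_mod (y := i') hj'
  rw [h] at h1 h2
  exact ⟨h1.symm.trans h3, h2.symm.trans h4⟩

/-- Updating an entry. -/
theorem Partial.update {D : ℕ → ℕ → ℤ} {kb i₀ j₀ : ℕ} {P : ℕ → ℕ → Prop} {s : State} {μ : ℤ}
    (h : C.Partial D kb P s) (hi : i₀ < C.np) (hj : j₀ < C.np) (hP : ¬ P i₀ j₀)
    (h₁ : ∀ k < X.r, μ ≤ D i₀ (kb * X.r + k) + D (kb * X.r + k) j₀)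
    (h₂ : ∃ k < X.r, μ = D i₀ (kb * X.r + k) + D (kb * X.r + k) j₀) {s' : State}
    (hs : ∀ a : ℤ, s'.arr 5 a = if a = (C.np * i₀ + j₀ : ℕ) then min (s.arr 5 a) μ else s.arr 5 a) :
    C.Partial D kb (fun i j => P i j ∨ (i = i₀ ∧ j = j₀)) s' := by
  intro i hi' j hj'
  by_cases he : i = i₀ ∧ j = j₀
  · obtain ⟨rfl, rfl⟩ := he
    refine ⟨fun _ => ?_, fun h => absurd (.inr ⟨rfl, rfl⟩) h⟩
    rw [hs, if_pos rfl, (h i hi' j hj').2 hP, minSum_add h₁ h₂]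
  · have hne : ¬ ((C.np * i + j : ℕ) : ℤ) = (C.np * i₀ + j₀ : ℕ) := fun e =>
      he (cell_inj hj' hj (by exact_mod_cast e))
    rw [hs, if_neg hne]
    simp only [he, or_false]
    exact h i hi' j hj'

variable (C)

/-- The costs of the steps of block `kb`, `jb`. -/
def stepWt (D : ℕ → ℕ → ℤ) (kb jb k i : ℕ) : ℕ :=
  (C.L - (D (kb * X.r + k) (jb * X.m + (i + 1 - X.m)) - D (kb * X.r + k) (jb * X.m + (i - X.m)) +
    2 * C.V) : ℤ).toNat

def midWt (D : ℕ → ℕ → ℤ) (kb jb i k : ℕ) : ℕ :=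
  (C.L - (D i (kb * X.r + k) + D (kb * X.r + k) (jb * X.m) + 2 * C.V) : ℤ).toNat

/-- The slots when the steps from `lo` to `hi` and from `lo'` to `hi'` are present. -/
def slots (D : ℕ → ℕ → ℤ) (kb jb i lo hi lo' hi' : ℕ) (src snk : Option ℕ) : ℕ → Option ℕ :=
  gridSlots X.r X.m C.L (tent C.V X.m)
    (stepSlots X.m (C.stepWt D kb jb) (C.midWt D kb jb i) lo hi lo' hi') src snk

variable {C} {D : ℕ → ℕ → ℤ}

/-- Prices of steps are at most `4V`, so the large weight exceeds them and the truncation in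
`stepWt` and `midWt` never happens. -/
theorem V_le_L : 32 * C.V ≤ C.L := by
  have h1 := X.hr
  have h2 := X.hm
  have h3 : 1 * 1 * 1 ≤ X.r * X.m * X.m := Nat.mul_le_mul (Nat.mul_le_mul h1 h2) h2
  rw [L, halfL]
  calc 32 * C.V = 2 * (16 * C.V * (1 * 1 * 1)) := by ring
    _ ≤ 2 * (16 * C.V * (X.r * X.m * X.m)) := by gcongr
    _ = _ := by ring

theorem stepWt_eq (hD : ∀ i j, |D i j| ≤ C.V) (kb jb k i : ℕ) :
    ((C.stepWt D kb jb k i : ℕ) : ℤ) = C.L - (D (kb * X.r + k) (jb * X.m + (i + 1 - X.m)) -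
      D (kb * X.r + k) (jb * X.m + (i - X.m)) + 2 * C.V) ∧ C.stepWt D kb jb k i ≤ C.L := by
  have h1 := abs_le.1 (hD (kb * X.r + k) (jb * X.m + (i + 1 - X.m)))
  have h2 := abs_le.1 (hD (kb * X.r + k) (jb * X.m + (i - X.m)))
  have h3 := C.V_le_L
  have e : ((C.stepWt D kb jb k i : ℕ) : ℤ) = _ := Int.toNat_of_nonneg (by omega)
  exact ⟨e, by omega⟩

theorem midWt_eq (hD : ∀ i j, |D i j| ≤ C.V) (kb jb i k : ℕ) :
    ((C.midWt D kb jb i k : ℕ) : ℤ) =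
      C.L - (D i (kb * X.r + k) + D (kb * X.r + k) (jb * X.m) + 2 * C.V) ∧
      C.midWt D kb jb i k ≤ C.L := by
  have h1 := abs_le.1 (hD i (kb * X.r + k))
  have h2 := abs_le.1 (hD (kb * X.r + k) (jb * X.m))
  have h3 := C.V_le_L
  have e : ((C.midWt D kb jb i k : ℕ) : ℤ) = _ := Int.toNat_of_nonneg (by omega)
  exact ⟨e, by omega⟩

/-- Here `a` is a part of row `i` of the matrix and `b` a block of it. The last equation solves the
formula for the matching weight for the minimum; this is what `minE` evaluates. -/
theorem slots_isMax (hD : ∀ i j, |D i j| ≤ C.V) (kb jb i : ℕ) {j : ℕ} (hj : j < X.m) :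
    ∃ μ : ℤ, (∀ k < X.r, μ ≤ D i (kb * X.r + k) + D (kb * X.r + k) (jb * X.m + j)) ∧
      (∃ k < X.r, μ = D i (kb * X.r + k) + D (kb * X.r + k) (jb * X.m + j)) ∧
      ∃ v : ℤ, (slotGraph X.N X.w (C.slots D kb jb i 0 (X.r * X.m) 0 X.r (some (2 * (X.m - 1 - j)))
        (some (2 * (X.m + j) + 1)))).IsMaxMatchingWeight v ∧ |v| ≤ X.B ∧
      ((2 * X.r - 1) * (2 * X.m) + 1) * C.L - (X.r - 1) * (4 * C.V * ((X.m - 1 - j) * (X.m + j))) -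
        v - 2 * C.V - 2 * C.V * j = μ := by
  have hr := X.hr
  have hm := X.hm
  have hVL := C.V_le_L
  obtain ⟨μ, h1, h2, h3⟩ := block_isMax (r := X.r) (m := X.m) (V := C.V) hr C.hV
    (a := fun k => D i (kb * X.r + k)) (b := fun k j => D (kb * X.r + k) (jb * X.m + j))
    (hr := stepSlots X.m (C.stepWt D kb jb) (C.midWt D kb jb i) 0 (X.r * X.m) 0 X.r)
    (fun k => hD _ _) (fun k j => hD _ _) (by
      intro k i' hk h1 h2
      rw [stepSlots]
      by_cases h3 : i' + 1 = X.m
      · rw [if_pos h3, if_pos (by omega)]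
        refine ⟨_, rfl, ?_⟩
        rw [(midWt_eq hD kb jb i k).1, stepSum, stepSum, if_neg (by omega), if_pos (by omega), h3]
        simp [L]
      · have h4 : X.m * (k + 1) ≤ X.m * X.r := Nat.mul_le_mul_left _ hk
        rw [Nat.mul_add, mul_comm X.m X.r] at h4
        rw [if_neg h3, if_pos ⟨by omega, by omega, by omega, by omega⟩]
        refine ⟨_, rfl, ?_⟩
        rw [(stepWt_eq hD kb jb k i').1, stepSum, stepSum, if_neg (by omega), if_neg (by omega)]
        rw [show i' + 1 - X.m = i' - X.m + 1 by omega]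
        push_cast [L]
        ring) hj
  refine ⟨μ, h1, h2, _, h3, ?_, ?_⟩
  · obtain ⟨k, hk, e⟩ := h2
    have d1 := abs_le.1 (hD i (kb * X.r + k))
    have d2 := abs_le.1 (hD (kb * X.r + k) (jb * X.m + j))
    have ht := tent_le C.V X.r X.m (X.m - 1 - j) hr (by omega)
    have hB : ((20 * (X.r * X.m) * C.L : ℕ) : ℤ) ≤ X.B := by exact_mod_cast C.B_L
    refine le_trans ?_ hB
    change |_ * ((2 * halfL C.V X.r X.m : ℤ)) - _ - _| ≤ _
    have hr' : ((X.r - 1 : ℕ) : ℤ) = X.r - 1 := by push_cast [hr]; ring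
    have hr'' : ((2 * X.r - 1 : ℕ) : ℤ) = 2 * X.r - 1 := by
      push_cast [show 1 ≤ 2 * X.r by omega]; ring
    rw [hr', hr'']
    have hL : (2 * halfL C.V X.r X.m : ℤ) = C.L := by simp [L]
    rw [hL]
    have ht' : (tent C.V X.m (X.m - 1 - j) : ℤ) ≤ C.L := by exact_mod_cast ht
    have ht0 : (0 : ℤ) ≤ tent C.V X.m (X.m - 1 - j) := by positivity
    have hVL' : 32 * (C.V : ℤ) ≤ C.L := by exact_mod_cast hVL
    have hrz : (1 : ℤ) ≤ X.r := by exact_mod_cast hr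
    have hmz : (1 : ℤ) ≤ X.m := by exact_mod_cast hm
    have hjz : (j : ℤ) ≤ X.m := by exact_mod_cast hj.le
    have hV0 : (0 : ℤ) ≤ C.V := by positivity
    have q1 : (C.V : ℤ) * j ≤ C.V * X.m := by gcongr
    have q2 : 32 * (C.V : ℤ) * X.m ≤ C.L * X.m := by gcongr
    have q3 : (C.L : ℤ) * X.m * 1 ≤ C.L * X.m * X.r := by gcongr
    have q4 : ((X.r : ℤ) - 1) * tent C.V X.m (X.m - 1 - j) ≤ (X.r - 1) * C.L :=
      mul_le_mul_of_nonneg_left ht' (by linarith)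
    have q4' : 0 ≤ ((X.r : ℤ) - 1) * tent C.V X.m (X.m - 1 - j) := mul_nonneg (by linarith) ht0
    have q5 : (C.L : ℤ) * 1 * X.r ≤ C.L * X.m * X.r := by gcongr
    have q6 : (C.V : ℤ) * 1 ≤ C.V * X.m := by gcongr
    have q7 : (C.L : ℤ) * 1 ≤ C.L * X.m := by gcongr
    have q8 : 0 ≤ (C.V : ℤ) * j := by positivity
    push_cast
    rw [hL, abs_le]
    constructor <;> nlinarith
  · rw [tent, show 2 * X.m - 1 - (X.m - 1 - j) = X.m + j by omega]
    push_cast [show 1 ≤ X.r by omega, show 1 ≤ 2 * X.r by omega, show j ≤ X.m - 1 by omega,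
      show 1 ≤ X.m by omega, L]
    ring

end Core
end FineGrained

/-! ### One query, and the entry of the product that it improves -/

namespace FineGrained

open FineGrained.Expr (var ld)

/-- Ends of the edges at the source and at the sink. -/
def srcFst : Expr := 2 * (var 7 - 1 - var 20)
def srcSnd : Expr := srcFst + var 10
def snkFst : Expr := var 10 * (2 * var 6 - 1) + (2 * (var 7 + var 20) + 1)
def snkSnd : Expr := snkFst + var 10

/-- The minimum as determined by the answer to a query. -/
def minE : Expr := ((2 * var 6 - 1) * (2 * var 7) + 1) * var 11 -
  (var 6 - 1) * (4 * var 2 * ((var 7 - 1 - var 20) * (var 7 + var 20))) - var 22 - 2 * var 2 -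
  2 * var 2 * var 20

def cellE : Expr := var 1 * var 18 + (var 16 * var 7 + var 20)

/-- Compute the minimum for one pair of nodes. -/
def qryBody (DA : DynamicAlgorithm) (s : ℕ) : Prog :=
  .seq (insOp DA s srcFst srcSnd (var 11)) (.seq (insOp DA s snkFst snkSnd (var 11))
    (.seq (qryOp DA s 22) (.seq (ifLive s (.seq (asg 23 minE)
      (ite' (.op .lt (var 23) (ld 5 cellE)) (sto 5 cellE (var 23)) .skip)))
      (.seq (delOp DA s srcFst srcSnd) (delOp DA s snkFst snkSnd)))))

namespace Core
variable {X : Ctx} {C : Core X} {s : State} {D : ℕ → ℕ → ℤ} {al : Bool} {kb jb i j : ℕ}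
  {P : ℕ → ℕ → Prop}

theorem B_V : 20 * (C.V : ℤ) ≤ X.B := by
  have h1 := C.V_le_L
  have h2 : 1 * 1 ≤ X.r * X.m := Nat.mul_le_mul X.hr X.hm
  have h3 := C.B_L
  have : 20 * (1 * 1) * C.L ≤ 20 * (X.r * X.m) * C.L := by gcongr
  have : 20 * C.V ≤ X.B := by simp only [L] at *; omega
  exact_mod_cast this

theorem src_values (hb : C.Base s) (hj : j < X.m) (h20 : s.reg 20 = j) :
    srcFst.eval s = ((2 * (2 * (X.m - 1 - j)) + 1) / 2 : ℕ) ∧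
    srcSnd.eval s = (slotEnd X.w (2 * (2 * (X.m - 1 - j)) + 1) : ℕ) ∧
    ValidSlot X.r X.m (2 * (2 * (X.m - 1 - j)) + 1) := by
  have hr := X.hr
  have e : (2 * (2 * (X.m - 1 - j)) + 1) / 2 = 2 * (X.m - 1 - j) := by omega
  have h1 : srcFst.eval s = ((2 * (2 * (X.m - 1 - j)) + 1) / 2 : ℕ) := by
    rw [e]
    simp only [srcFst, Expr.eval_mul, Expr.eval_sub, Expr.eval_var, Expr.eval_two, Expr.eval_one,
      hb.r7, h20]
    push_cast [show j ≤ X.m - 1 by omega, show 1 ≤ X.m by omega]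
    ring
  refine ⟨h1, ?_, ?_⟩
  · rw [srcSnd, Expr.eval_add, h1, Expr.eval_var, hb.r10, slotEnd, if_neg (by omega)]
    push_cast; ring
  · have := validSlot_odd (r := X.r) (m := X.m) (y := 0) (x := 2 * (X.m - 1 - j)) (by omega) (by omega)
    rwa [Nat.mul_zero, Nat.zero_add] at this

theorem snk_values (hb : C.Base s) (hj : j < X.m) (h20 : s.reg 20 = j) :
    snkFst.eval s = ((2 * (4 * X.m * (2 * X.r - 1) + (2 * (X.m + j) + 1)) + 1) / 2 : ℕ) ∧
    snkSnd.eval s =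
      (slotEnd X.w (2 * (4 * X.m * (2 * X.r - 1) + (2 * (X.m + j) + 1)) + 1) : ℕ) ∧
    ValidSlot X.r X.m (2 * (4 * X.m * (2 * X.r - 1) + (2 * (X.m + j) + 1)) + 1) := by
  have hr := X.hr
  have e : (2 * (4 * X.m * (2 * X.r - 1) + (2 * (X.m + j) + 1)) + 1) / 2 =
    4 * X.m * (2 * X.r - 1) + (2 * (X.m + j) + 1) := by omega
  have h1 : snkFst.eval s =
      ((2 * (4 * X.m * (2 * X.r - 1) + (2 * (X.m + j) + 1)) + 1) / 2 : ℕ) := by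
    rw [e]
    simp only [snkFst, Expr.eval_add, Expr.eval_mul, Expr.eval_sub, Expr.eval_var, Expr.eval_two,
      Expr.eval_one, hb.r7, h20, hb.r6, hb.r10]
    push_cast [show 1 ≤ 2 * X.r by omega]
    ring
  refine ⟨h1, ?_, validSlot_odd (by omega) (by omega)⟩
  rw [snkSnd, Expr.eval_add, h1, Expr.eval_var, hb.r10, slotEnd, if_neg (by omega)]
  push_cast; ring

/-- Source and sink edges are inserted, the weight is asked for, the entry is lowered if necessary,
and the two edges are removed again, so that the next `j` finds the same graph. If the budget runs
out, the edge operations still go through formally and the entry is left alone. The hypothesis `hnP`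
says that the entry has not yet absorbed this range of indices. -/
theorem wp_qryBody (hb : C.Base s) (hsm : C.Small s) (hD : ∀ i j, |D i j| ≤ C.V)
    (hjb : jb < C.z * X.r) (hi : i < C.np) (hj : j < X.m) (h16 : s.reg 16 = jb) (h18 : s.reg 18 = i)
    (h20 : s.reg 20 = j) (hgood : al = true → C.Good D) (hP : al = true → C.Partial D kb P s)
    (hnP : ¬ P i (jb * X.m + j)) :
    X.env.WP (qryBody X.DA X.s) (9 * X.κ) (4 * X.U + X.Q) s
      (C.slots D kb jb i 0 (X.r * X.m) 0 X.r none none, al) fun s' γ =>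
      Fr 22 s s' ∧ C.Small s' ∧ γ.1 = C.slots D kb jb i 0 (X.r * X.m) 0 X.r none none ∧
      (γ.2 = true → al = true) ∧
      (γ.2 = true → C.Partial D kb (fun i' j' => P i' j' ∨ (i' = i ∧ j' = jb * X.m + j)) s') := by
  have hr := X.hr
  have hS := C.hS
  have hBV := C.B_V
  have hJ : jb * X.m + j < C.np := by
    rw [C.hnp]
    calc jb * X.m + j < (jb + 1) * X.m := by rw [add_mul]; omega
      _ ≤ (C.z * X.r) * X.m := Nat.mul_le_mul_right _ hjb
  obtain ⟨a1, a2, a3⟩ := src_values hb hj h20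
  obtain ⟨b1, b2, b3⟩ := snk_values hb hj h20
  set xs := 2 * (X.m - 1 - j) with hxs
  set xk := 2 * (X.m + j) + 1 with hxk
  have hxs' : xs < 4 * X.m := by omega
  have hxk' : xk < 4 * X.m := by omega
  set G := C.slots D kb jb i 0 (X.r * X.m) 0 X.r with hG
  -- The four edge operations in terms of slots: source in, sink in, source out, sink out. The facts
  -- `n1` to `n4` are the matching conditions for their legality.
  have u1 : Function.update (G none none) (2 * xs + 1) (some C.L) = G (some xs) none := by
    simpa [hG, slots] using gridSlots_src (r := X.r) (L := C.L) (v := tent C.V X.m) (snk := none) (hr :=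
      stepSlots X.m (C.stepWt D kb jb) (C.midWt D kb jb i) 0 (X.r * X.m) 0 X.r) xs hxs' none (some xs)
      (.inr rfl) (.inl rfl)
  have u2 : Function.update (G (some xs) none) (2 * (4 * X.m * (2 * X.r - 1) + xk) + 1) (some C.L) =
      G (some xs) (some xk) := by
    simpa [hG, slots] using gridSlots_snk (r := X.r) (L := C.L) (v := tent C.V X.m) (src := some xs) (hr :=
      stepSlots X.m (C.stepWt D kb jb) (C.midWt D kb jb i) 0 (X.r * X.m) 0 X.r) hr xk hxk' none
      (some xk) (.inr rfl) (.inl rfl)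
  have u3 : Function.update (G (some xs) (some xk)) (2 * xs + 1) none = G none (some xk) := by
    simpa [hG, slots] using gridSlots_src (r := X.r) (L := C.L) (v := tent C.V X.m) (snk := some xk) (hr :=
      stepSlots X.m (C.stepWt D kb jb) (C.midWt D kb jb i) 0 (X.r * X.m) 0 X.r) xs hxs' (some xs) none
      (.inl rfl) (.inr rfl)
  have u4 : Function.update (G none (some xk)) (2 * (4 * X.m * (2 * X.r - 1) + xk) + 1) none =
      G none none := by
    simpa [hG, slots] using gridSlots_snk (r := X.r) (L := C.L) (v := tent C.V X.m) (src := none) (hr :=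
      stepSlots X.m (C.stepWt D kb jb) (C.midWt D kb jb i) 0 (X.r * X.m) 0 X.r) hr xk hxk' (some xk)
      none (.inl rfl) (.inr rfl)
  have n1 : G none none (2 * xs + 1) = none := by
    simpa [hG, slots] using gridSlots_src_eq (r := X.r) (L := C.L) (v := tent C.V X.m) (src := none) (snk := none)
      (hr := stepSlots X.m (C.stepWt D kb jb) (C.midWt D kb jb i) 0 (X.r * X.m) 0 X.r) hxs'
  have n2 : G (some xs) none (2 * (4 * X.m * (2 * X.r - 1) + xk) + 1) = none := by
    simpa [hG, slots] using gridSlots_snk_eq (r := X.r) (L := C.L) (v := tent C.V X.m) (src := some xs)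
      (snk := none)
      (hr := stepSlots X.m (C.stepWt D kb jb) (C.midWt D kb jb i) 0 (X.r * X.m) 0 X.r) hr hxk'
  have n3 : G (some xs) (some xk) (2 * xs + 1) ≠ none := by
    rw [← u2, ← u1]
    intro h
    have : 2 * xs + 1 ≠ 2 * (4 * X.m * (2 * X.r - 1) + xk) + 1 := by
      have : 4 * X.m * 1 ≤ 4 * X.m * (2 * X.r - 1) := Nat.mul_le_mul_left _ (by omega)
      omega
    rw [Function.update_of_ne this, Function.update_self] at h
    exact absurd h (by simp)
  have n4 : G none (some xk) (2 * (4 * X.m * (2 * X.r - 1) + xk) + 1) ≠ none := by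
    have := gridSlots_snk_eq (r := X.r) (L := C.L) (v := tent C.V X.m) (src := none)
      (snk := some xk)
      (hr := stepSlots X.m (C.stepWt D kb jb) (C.midWt D kb jb i) 0 (X.r * X.m) 0 X.r) hr hxk'
    intro h
    rw [hG] at h
    simp only [slots] at h
    rw [this] at h
    simp at h
  obtain ⟨μ, m1, m2, v, m3, m4, m5⟩ := slots_isMax (C := C) hD kb jb i hj
  have hVar : ∀ {e : Expr}, (e.check && decide (e.size ≤ sizeBound)) = true → X.env.Adm e :=
    fun h => Ctx.adm hS h
  have hLE : (var 11).eval s = (C.L : ℕ) := by rw [Expr.eval_var, hb.r11]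
  have hκ : X.env.κ = X.κ := rfl
  have hcell : ∀ s', Fr 22 s s' → cellE.eval s' = ((C.np * i + (jb * X.m + j) : ℕ) : ℤ) := by
    intro s' hf
    simp only [cellE, Expr.eval_add, Expr.eval_mul, Expr.eval_var, hf.reg 1 (by omega),
      hf.reg 18 (by omega), hf.reg 16 (by omega), hf.reg 7 (by omega), hf.reg 20 (by omega), hb.r1,
      hb.r7, h16, h18, h20]
    push_cast; ring
  refine Env.WP.weaken (c := X.κ + (X.κ + (X.κ + ((X.κ + (X.κ + (X.κ + X.κ))) + (X.κ + X.κ)))))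
    (d := X.U + (X.U + (X.Q + (0 + (X.U + X.U)))))
    (Env.WP.seq (R := fun s' γ => s' = s ∧ γ.1 = G (some xs) none ∧ (γ.2 = true → al = true)) ?_ ?_)
    (by omega) (by omega) (fun _ _ h => h)
  · exact Ctx.wp_ins (hVar (by decide)) (hVar (by decide)) (hVar (by decide)) a3 a1 a2 hLE n1 C.hL
      fun al' h => ⟨rfl, u1, h⟩
  rintro s₁ ⟨E₁, al₁⟩ ⟨rfl, rfl, hal₁⟩
  refine Env.WP.seq (R := fun s' γ => s' = s₁ ∧ γ.1 = G (some xs) (some xk) ∧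
    (γ.2 = true → al = true)) ?_ ?_
  · exact Ctx.wp_ins (hVar (by decide)) (hVar (by decide)) (hVar (by decide)) b3 b1 b2 hLE n2 C.hL
      fun al' h => ⟨rfl, u2, fun h' => hal₁ (h h')⟩
  rintro s₂ ⟨E₂, al₂⟩ ⟨rfl, rfl, hal₂⟩
  refine Env.WP.seq (R := fun s' γ => γ.1 = G (some xs) (some xk) ∧
    (γ.2 = true → al = true) ∧ ((γ.2 = true ∧ s' = s₂.setReg 22 v) ∨ (γ.2 = false ∧
      s' = s₂.setReg 22 0))) ?_ ?_
  · exact Ctx.wp_qry (by norm_num) m3 m4 (fun h => ⟨rfl, fun _ => hal₂ h, .inl ⟨rfl, rfl⟩⟩)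
      ⟨rfl, by simp, .inr ⟨rfl, rfl⟩⟩
  rintro s₃ ⟨E₃, al₃⟩ ⟨rfl, hal₃, hs₃⟩
  have hf₃ : Fr 22 s₂ s₃ := by
    rcases hs₃ with ⟨-, rfl⟩ | ⟨-, rfl⟩ <;> exact (Fr.refl _ _).setReg le_rfl _
  have h5₃ : s₃.arr = s₂.arr := by rcases hs₃ with ⟨-, rfl⟩ | ⟨-, rfl⟩ <;> rfl
  refine Env.WP.seq (R := fun s' γ => Fr 22 s₂ s' ∧ C.Small s' ∧
    γ.1 = G (some xs) (some xk) ∧ (γ.2 = true → al = true) ∧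
    (γ.2 = true → C.Partial D kb (fun i' j' => P i' j' ∨ (i' = i ∧ j' = jb * X.m + j)) s')) ?_ ?_
  · refine Ctx.wp_ifLive (fun h => ?_) fun h => ⟨hf₃, fun a ha => by rw [h5₃]; exact hsm a ha, rfl,
      by simp, by simp⟩
    have hal := hal₃ h
    have hs₃ : s₃ = s₂.setReg 22 v := by
      rcases hs₃ with ⟨-, h'⟩ | ⟨h', -⟩
      · exact h'
      · exact absurd (h.symm.trans h') (by simp)
    have hμ : minE.eval s₃ = μ := by
      have h22 : s₃.reg 22 = v := by rw [hs₃]; simp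
      rw [← m5]
      simp only [minE, Expr.eval_add, Expr.eval_mul, Expr.eval_sub, Expr.eval_var, Expr.eval_two, Expr.eval_four,
        Expr.eval_one, hf₃.reg 6 (by norm_num), hf₃.reg 7 (by norm_num), hf₃.reg 11 (by norm_num),
        hf₃.reg 2 (by norm_num), hf₃.reg 20 (by norm_num), hb.r6, hb.r7, hb.r11, hb.r2, h20, h22]
    -- The upper bound follows from the bound on the entries, but the lower one does not: a sum of
    -- two entries could be `-2V`. It comes from `Good`, and thus from the absence of negative
    -- cycles.
    have hμV : -(C.V : ℤ) ≤ μ ∧ μ ≤ 2 * C.V := by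
      obtain ⟨k, hk, rfl⟩ := m2
      have d1 := abs_le.1 (hD i (kb * X.r + k))
      have d2 := abs_le.1 (hD (kb * X.r + k) (jb * X.m + j))
      exact ⟨hgood hal _ _ _, by linarith⟩
    have hf₄ : Fr 22 s₂ (s₃.setReg 23 μ) := hf₃.setReg (by norm_num) _
    refine Env.WP.weaken (c := X.env.κ + (X.env.κ + X.env.κ)) (d := 0 + 0)
      (Env.WP.seq (R := fun s' γ => s' = s₃.setReg 23 μ ∧ γ = (G (some xs) (some xk), true)) ?_ ?_)
      le_rfl le_rfl fun _ _ h => h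
    · refine Env.WP.asg (by change 23 < 40; norm_num) (hVar (by decide)) ?_ ⟨by rw [hμ], rfl⟩
      rw [hμ, abs_le]
      change -(X.B : ℤ) ≤ _ ∧ _ ≤ (X.B : ℤ)
      constructor <;> linarith
    rintro s₄ γ₄ ⟨rfl, rfl⟩
    have h23 : (var 23).eval (s₃.setReg 23 μ) = μ := by simp
    have hld : (ld 5 cellE).eval (s₃.setReg 23 μ) =
        s₂.arr 5 ((C.np * i + (jb * X.m + j) : ℕ) : ℤ) := by
      rw [Expr.eval_ld, hcell _ hf₄]
      change s₃.arr 5 _ = _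
      rw [h5₃]
    refine Env.WP.ite (hVar (by decide)) (fun ht => ?_) (fun ht => ?_)
    · have hlt : μ < s₂.arr 5 ((C.np * i + (jb * X.m + j) : ℕ) : ℤ) := by
        rw [Expr.eval_lt, h23, hld] at ht
        by_contra hc
        exact ht (if_neg hc)
      have hold := abs_le.1 (hsm _ (C.cell_lt hi hJ))
      refine Env.WP.sto (by change 5 < 10; norm_num) (hVar (by decide)) (hVar (by decide)) (by
        rw [h23, abs_le]; change -(X.B : ℤ) ≤ _ ∧ _ ≤ (X.B : ℤ); constructor <;> linarith) ?_
      rw [h23, hcell _ hf₄]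
      refine ⟨hf₄.setCell _ _, fun a ha => ?_, rfl, fun _ => hal, fun _ =>
        (hP hal).update hi hJ hnP m1 m2 fun a => ?_⟩
      · simp only [State.setCell_arr, State.setReg_arr, true_and, h5₃]
        split_ifs
        · rw [abs_le]; constructor <;> linarith
        · exact hsm a ha
      · simp only [State.setCell_arr, State.setReg_arr, true_and, h5₃]
        split_ifs with h
        · rw [h, min_eq_right hlt.le]
        · rfl
    · have hlt : ¬ μ < s₂.arr 5 ((C.np * i + (jb * X.m + j) : ℕ) : ℤ) := by
        rw [Expr.eval_lt, h23, hld] at ht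
        intro hc
        rw [if_pos hc] at ht
        exact one_ne_zero ht
      refine Env.WP.skip ⟨hf₄, fun a ha => ?_, rfl, fun _ => hal, fun _ =>
        (hP hal).update hi hJ hnP m1 m2 fun a => ?_⟩
      · simp only [State.setReg_arr, h5₃]; exact hsm a ha
      · simp only [State.setReg_arr, h5₃]
        split_ifs with h
        · rw [h, min_eq_left (not_lt.1 hlt)]
        · rfl
  rintro s₄ ⟨E₄, al₄⟩ ⟨hf₄, hsm₄, rfl, hal₄, hP₄⟩
  have hb₄ := hb.fr (by norm_num) hf₄
  have h20₄ : s₄.reg 20 = j := by rw [hf₄.reg 20 (by norm_num), h20]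
  obtain ⟨a1, a2, -⟩ := src_values hb₄ hj h20₄
  obtain ⟨b1, b2, -⟩ := snk_values hb₄ hj h20₄
  refine Env.WP.seq (R := fun s' γ => s' = s₄ ∧ γ.1 = G none (some xk) ∧
    (γ.2 = true → al₄ = true)) ?_ ?_
  · exact Ctx.wp_del (hVar (by decide)) (hVar (by decide)) a3 a1 a2 n3 fun al' h => ⟨rfl, u3, h⟩
  rintro s₅ ⟨E₅, al₅⟩ ⟨rfl, rfl, hal₅⟩
  exact Ctx.wp_del (hVar (by decide)) (hVar (by decide)) b3 b1 b2 n4 fun al' h =>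
    ⟨hf₄, hsm₄, u4, fun h' => hal₄ (hal₅ (h h')), fun h' => hP₄ (hal₅ (h h'))⟩

end Core
end FineGrained

/-! ### Rows and blocks of the min-plus product -/

namespace FineGrained
open FineGrained.Expr (var ld)

def midFst : Expr := var 10 * (2 * var 20 + 1) + (2 * (var 7 - 1) + 1)
def midE : Expr := var 11 - (ld 4 (var 1 * var 18 + (var 14 * var 6 + var 20)) +
  ld 4 (var 1 * (var 14 * var 6 + var 20) + var 16 * var 7) + 2 * var 2)

/-- Compute the minima of row `i` of a block. -/
def rowBody (DA : DynamicAlgorithm) (s : ℕ) : Prog :=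
  .seq (for' 20 21 (var 6) (insOp DA s midFst (midFst + 1) midE))
    (.seq (for' 20 21 (var 7) (qryBody DA s)) (for' 20 21 (var 6) (delOp DA s midFst (midFst + 1))))

def stepFst : Expr :=
  var 10 * (2 * (var 20 / var 7) + 1) + (2 * (var 7 - 1 + var 20 % var 7) + 1)
def stepE : Expr := var 11 -
  (ld 4 (var 1 * (var 14 * var 6 + var 20 / var 7) + (var 16 * var 7 + var 20 % var 7)) -
    ld 4 (var 1 * (var 14 * var 6 + var 20 / var 7) + (var 16 * var 7 + (var 20 % var 7 - 1))) +
    2 * var 2)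

/-- Compute the minima of a block. -/
def blockBody (DA : DynamicAlgorithm) (s : ℕ) : Prog :=
  .seq (for' 20 21 (var 6 * var 7) (ite' (var 20 % var 7) (insOp DA s stepFst (stepFst + 1) stepE) .skip))
    (.seq (for' 18 19 (var 1) (rowBody DA s))
      (for' 20 21 (var 6 * var 7) (ite' (var 20 % var 7) (delOp DA s stepFst (stepFst + 1)) .skip)))

namespace Core
variable {X : Ctx} {C : Core X} {s : State} {D : ℕ → ℕ → ℤ} {al : Bool} {kb jb i j : ℕ}
  {P : ℕ → ℕ → Prop}

theorem adm {e : Expr} (C : Core X) (h : (e.check && decide (e.size ≤ sizeBound)) = true) :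
    X.env.Adm e := Ctx.adm C.hS h

theorem row_lt (hkb : kb < C.z * X.m) {k : ℕ} (hk : k < X.r) : kb * X.r + k < C.np := by
  rw [C.hnp]
  calc kb * X.r + k < (kb + 1) * X.r := by rw [add_mul]; omega
    _ ≤ (C.z * X.m) * X.r := Nat.mul_le_mul_right _ hkb
    _ = _ := by ring

theorem col_lt (hjb : jb < C.z * X.r) (hj : j < X.m) : jb * X.m + j < C.np := by
  rw [C.hnp]
  calc jb * X.m + j < (jb + 1) * X.m := by rw [add_mul]; omega
    _ ≤ (C.z * X.r) * X.m := Nat.mul_le_mul_right _ hjb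

theorem mid_values (hb : C.Base s) {k : ℕ} (hk : k < X.r) (h20 : s.reg 20 = k) :
    midFst.eval s = (midSlot X.m k / 2 : ℕ) ∧ (midFst + 1).eval s = (slotEnd X.w (midSlot X.m k) : ℕ) ∧
      ValidSlot X.r X.m (midSlot X.m k) := by
  have hm := X.hm
  have e : midSlot X.m k / 2 = 4 * X.m * (2 * k + 1) + (2 * (X.m - 1) + 1) := by
    rw [midSlot]; omega
  have h1 : midFst.eval s = (midSlot X.m k / 2 : ℕ) := by
    rw [e]
    simp only [midFst, Expr.eval_add, Expr.eval_mul, Expr.eval_sub, Expr.eval_var, Expr.eval_two,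
      Expr.eval_one, hb.r7, h20, hb.r10]
    push_cast [show 1 ≤ X.m by omega]
    ring
  refine ⟨h1, ?_, midSlot_valid hm hk⟩
  rw [Expr.eval_add, h1, Expr.eval_one, slotEnd, if_pos (by rw [midSlot]; omega)]
  push_cast; ring

theorem step_values (hb : C.Base s) {t : ℕ} (ht : t < X.r * X.m) (h20 : s.reg 20 = t) :
    stepFst.eval s = (stepSlot X.m t / 2 : ℕ) ∧
      (stepFst + 1).eval s = (slotEnd X.w (stepSlot X.m t) : ℕ) ∧
      ValidSlot X.r X.m (stepSlot X.m t) := by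
  have hm := X.hm
  have e : stepSlot X.m t / 2 = 4 * X.m * (2 * (t / X.m) + 1) + (2 * (X.m - 1 + t % X.m) + 1) := by
    rw [stepSlot]; omega
  have h1 : stepFst.eval s = (stepSlot X.m t / 2 : ℕ) := by
    rw [e]
    simp only [stepFst, Expr.eval_add, Expr.eval_mul, Expr.eval_sub, Expr.eval_var, Expr.eval_two,
      Expr.eval_div, Expr.eval_mod, Expr.eval_one, hb.r7, h20, hb.r10]
    push_cast [show 1 ≤ X.m by omega]
    ring
  refine ⟨h1, ?_, stepSlot_valid ht⟩
  rw [Expr.eval_add, h1, Expr.eval_one, slotEnd, if_pos (by rw [stepSlot]; omega)]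
  push_cast; ring

theorem rm_le_B (C : Core X) : X.r * X.m ≤ X.B := by
  have h1 := C.V_le_L
  have hV := C.hV
  have h3 := C.B_L
  have h4 : 1 ≤ C.L := by omega
  have : 1 * (X.r * X.m) * 1 ≤ 20 * (X.r * X.m) * C.L := by gcongr; norm_num
  simp only [L] at *; omega

theorem r_le_B (C : Core X) : X.r ≤ X.B :=
  (Nat.le_mul_of_pos_right _ X.hm).trans C.rm_le_B
theorem m_le_B (C : Core X) : X.m ≤ X.B := (Nat.le_mul_of_pos_left _ X.hr).trans C.rm_le_B

theorem mid_weight (hb : C.Base s) (hM : C.HasMat D s) (hD : ∀ i j, |D i j| ≤ C.V)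
    (hkb : kb < C.z * X.m) (hjb : jb < C.z * X.r) (hi : i < C.np) (h14 : s.reg 14 = kb)
    (h16 : s.reg 16 = jb) (h18 : s.reg 18 = i) {k : ℕ} (hk : k < X.r) (h20 : s.reg 20 = k) :
    midE.eval s = C.midWt D kb jb i k := by
  have hk' := C.row_lt hkb hk
  have e1 := hM i hi _ hk'
  have e2 := hM _ hk' _ (C.col_lt (j := 0) hjb X.hm)
  push_cast at e1 e2
  rw [(midWt_eq hD kb jb i k).1]
  simp only [midE, Expr.eval_add, Expr.eval_mul, Expr.eval_sub, Expr.eval_var, Expr.eval_two,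
    Expr.eval_ld, hb.r1, hb.r2, hb.r6, hb.r7, h20, hb.r11, h14, h16, h18, e1]
  rw [add_zero] at e2
  rw [e2, add_zero]

theorem step_weight (hb : C.Base s) (hM : C.HasMat D s) (hD : ∀ i j, |D i j| ≤ C.V)
    (hkb : kb < C.z * X.m) (hjb : jb < C.z * X.r) (h14 : s.reg 14 = kb)
    (h16 : s.reg 16 = jb) {t : ℕ} (ht : t < X.r * X.m) (ht0 : t % X.m ≠ 0) (h20 : s.reg 20 = t) :
    stepE.eval s = C.stepWt D kb jb (t / X.m) (X.m - 1 + t % X.m) := by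
  have hm := X.hm
  have hk' := C.row_lt hkb ((Nat.div_lt_iff_lt_mul hm).2 ht)
  have hlt := Nat.mod_lt t hm
  have e1 := hM _ hk' _ (C.col_lt (j := t % X.m) hjb hlt)
  have e2 := hM _ hk' _ (C.col_lt (j := t % X.m - 1) hjb (by omega))
  push_cast [show 1 ≤ t % X.m by omega] at e1 e2
  rw [(stepWt_eq hD kb jb _ _).1, show X.m - 1 + t % X.m + 1 - X.m = t % X.m by omega,
    show X.m - 1 + t % X.m - X.m = t % X.m - 1 by omega]
  simp only [stepE, Expr.eval_add, Expr.eval_mul, Expr.eval_sub, Expr.eval_var, Expr.eval_two,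
    Expr.eval_ld, Expr.eval_div, Expr.eval_mod, Expr.eval_one, hb.r1, hb.r2, hb.r6, hb.r7, h20,
    hb.r11, h14, h16, e1, e2]

variable (X) in
def rowCost : ℕ := 12 * X.κ + 6 * X.r * X.κ + 11 * X.m * X.κ
-- For one row, `r` steps are inserted and deleted, and each of the `m` queries comes with four
-- updates.
variable (X) in
def rowWeight : ℕ := 2 * X.r * X.U + X.m * (4 * X.U + X.Q)

/-- Only the `r` steps out of column `m - 1` depend on `i`, so a row costs `2r` updates for them,
while the `r · m` entries of the block stay in the graph. -/
theorem wp_rowBody (hb : C.Base s) (hM : C.HasMat D s) (hsm : C.Small s) (hD : ∀ i j, |D i j| ≤ C.V)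
    (hkb : kb < C.z * X.m) (hjb : jb < C.z * X.r) (hi : i < C.np) (h14 : s.reg 14 = kb)
    (h16 : s.reg 16 = jb) (h18 : s.reg 18 = i)
    (hgood : al = true → C.Good D)
    (hP : al = true → C.Partial D kb (fun i' j' => j' < jb * X.m ∨ (j' < jb * X.m + X.m ∧ i' < i)) s) :
    X.env.WP (rowBody X.DA X.s) (rowCost X) (rowWeight X) s
      (C.slots D kb jb 0 0 (X.r * X.m) 0 0 none none, al) fun s' γ =>
      Fr 20 s s' ∧ C.Small s' ∧ γ.1 = C.slots D kb jb 0 0 (X.r * X.m) 0 0 none none ∧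
      (γ.2 = true → al = true) ∧ (γ.2 = true →
        C.Partial D kb (fun i' j' => j' < jb * X.m ∨ (j' < jb * X.m + X.m ∧ i' < i + 1)) s') := by
  have hr := X.hr
  have hm := X.hm
  have hslot0 : ∀ lo', C.slots D kb jb i 0 (X.r * X.m) lo' lo' none none =
      C.slots D kb jb 0 0 (X.r * X.m) 0 0 none none := fun lo' => by
    rw [slots, slots, stepSlots_mids_empty]
  rw [← hslot0 0]
  have hf0 : ∀ {s' : State}, OffVars 20 21 s s' → s'.arr = s.arr → Fr 20 s s' := fun h h' =>
    Fr.of_off (by norm_num) (by norm_num) h h'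
  refine Env.WP.weaken (c := (4 * X.κ + X.r * (X.κ + 2 * X.κ)) +
    ((4 * X.κ + X.m * (9 * X.κ + 2 * X.κ)) + (4 * X.κ + X.r * (X.κ + 2 * X.κ))))
    (d := X.r * X.U + (X.m * (4 * X.U + X.Q) + X.r * X.U))
    (Env.WP.seq (Ctx.wp_slotLoop (F := fun k => C.slots D kb jb i 0 (X.r * X.m) 0 k none none)
      (by norm_num) (by norm_num) (by norm_num) (C.adm (e := var 6) (by decide)) hb.r6 C.r_le_B ?_) ?_)
    (le_of_eq (by rw [rowCost]; ring)) (le_of_eq (by rw [rowWeight]; ring)) (fun _ _ h => h)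
  · intro k hk s' ho ha h20 al'
    have hf := hf0 ho ha
    obtain ⟨a1, a2, a3⟩ := mid_values (hb.fr (by norm_num) hf) hk h20
    obtain ⟨b1, b2⟩ := midSlots_succ (L := C.L) (v := tent C.V X.m) (c := C.stepWt D kb jb)
      (a := C.midWt D kb jb i) (src := none) (snk := none) (lo := 0) (hi := X.r * X.m) hm hk
    exact Ctx.wp_ins (C.adm (by decide)) (C.adm (by decide)) (C.adm (by decide)) a3 a1 a2
      (mid_weight (hb.fr (by norm_num) hf) (hM.fr hf) hD hkb hjb hi (by rw [hf.reg 14 (by norm_num), h14])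
        (by rw [hf.reg 16 (by norm_num), h16]) (by rw [hf.reg 18 (by norm_num), h18]) hk h20) b1
      ((midWt_eq hD kb jb i k).2.trans C.hL) fun al'' h => ⟨rfl, b2.symm, h⟩
  rintro s₁ ⟨E₁, al₁⟩ ⟨ho₁, ha₁, rfl, hal₁⟩
  have hf₁ := hf0 ho₁ ha₁
  have hb₁ := hb.fr (by norm_num) hf₁
  simp only at hal₁ ⊢
  -- Entries that have absorbed the indices of block row `kb` after `j` queries in row `i`: all
  -- earlier column blocks, the earlier rows of this block, and the first `j` entries of the present
  -- row.
  let Pj : ℕ → ℕ → ℕ → Prop := fun j i' j' =>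
    (j' < jb * X.m ∨ (j' < jb * X.m + X.m ∧ i' < i)) ∨ (i' = i ∧ j' < jb * X.m + j)
  refine Env.WP.seq (R := fun s' γ => Fr 20 s s' ∧ C.Small s' ∧
    γ.1 = C.slots D kb jb i 0 (X.r * X.m) 0 X.r none none ∧ (γ.2 = true → al = true) ∧
    (γ.2 = true → C.Partial D kb (Pj X.m) s')) ?_ ?_
  · refine (Env.WP.for (E := X.env) (c := 9 * X.κ) (d := 4 * X.U + X.Q) (I := fun j s' γ => Fr 20 s s' ∧ C.Small s' ∧
      γ.1 = C.slots D kb jb i 0 (X.r * X.m) 0 X.r none none ∧ (γ.2 = true → al = true) ∧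
      (γ.2 = true → C.Partial D kb (Pj j) s')) (k := X.m) (by change 20 < 40; norm_num)
      (by change 21 < 40; norm_num) (by norm_num) (C.adm (e := var 7) (by decide)) hb₁.r7 C.m_le_B ?_ ?_).mono ?_
    · refine ⟨(hf₁.setReg (by norm_num) _).setReg (by norm_num) _, ?_, rfl, hal₁, fun h => ?_⟩
      · intro a ha
        simp only [State.setReg_arr, ha₁]
        exact hsm a ha
      · refine Partial.congr (P := fun i' j' => j' < jb * X.m ∨ (j' < jb * X.m + X.m ∧ i' < i)) ?_ ?_
        · intro i' hi' j' hj'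
          simp only [State.setReg_arr, ha₁]
          exact hP (hal₁ h) i' hi' j' hj'
        · intro i' _ j' _
          simp only [Pj]; omega
    · rintro j hj s' ⟨E', al'⟩ ⟨h1, h2, rfl, h4, h5⟩ h20 h21
      have hf := h1
      refine (wp_qryBody (C := C) (hb.fr (by norm_num) hf) h2 hD hjb hi hj (by rw [hf.reg 16 (by norm_num), h16])
        (by rw [hf.reg 18 (by norm_num), h18]) h20 (fun h => hgood (h4 h)) h5 (by simp only [Pj]; omega)).mono ?_
      rintro s'' ⟨E'', al''⟩ ⟨k1, k2, k3, k4, k5⟩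
      refine ⟨by rw [k1.reg 20 (by norm_num), h20], by rw [k1.reg 21 (by norm_num), h21],
        (h1.trans (k1.mono (by norm_num))).setReg (by norm_num) _, k2, k3, fun h => h4 (k4 h), fun h => ?_⟩
      refine Partial.congr (s := s''.setReg 20 (j + 1)) (k5 h) ?_
      intro i' _ j' _
      simp only [Pj]; omega
    · rintro s' γ ⟨-, -, h⟩; exact h
  rintro s₂ ⟨E₂, al₂⟩ ⟨hf₂, hsm₂, rfl, hal₂, hP₂⟩
  have hb₂ := hb.fr (by norm_num) hf₂
  simp only at hal₂ hP₂ ⊢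
  refine (Ctx.wp_slotLoop (F := fun k => C.slots D kb jb i 0 (X.r * X.m) k X.r none none)
      (by norm_num) (by norm_num) (by norm_num) (C.adm (e := var 6) (by decide)) hb₂.r6 C.r_le_B ?_).mono ?_
  · intro k hk s' ho ha h20 al'
    have hf : Fr 20 s₂ s' := Fr.of_off (by norm_num) (by norm_num) ho ha
    obtain ⟨a1, a2, a3⟩ := mid_values (hb₂.fr (by norm_num) hf) hk h20
    obtain ⟨b1, b2⟩ := midSlots_del (L := C.L) (v := tent C.V X.m) (c := C.stepWt D kb jb)
      (a := C.midWt D kb jb i) (src := none) (snk := none) (lo := 0) (hi := X.r * X.m) hm hk le_rfl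
    exact Ctx.wp_del (C.adm (by decide)) (C.adm (by decide)) a3 a1 a2 b1 fun al'' h => ⟨rfl, b2.symm, h⟩
  · rintro s' ⟨E', al'⟩ ⟨ho, ha, rfl, h4⟩
    have hf : Fr 20 s₂ s' := Fr.of_off (by norm_num) (by norm_num) ho ha
    refine ⟨hf₂.trans hf, fun a h => by rw [ha]; exact hsm₂ a h, ?_, fun h => hal₂ (h4 h), fun h => ?_⟩
    · simp only; rw [hslot0, hslot0]
    · refine Partial.congr (P := Pj X.m) ?_ ?_
      · intro i' hi' j' hj'
        rw [ha]
        exact hP₂ (h4 h) i' hi' j' hj'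
      · intro i' _ j' _
        simp only [Pj]; omega

variable (C) in
def blockCost : ℕ := 12 * X.κ + 8 * (X.r * X.m) * X.κ + C.np * (rowCost X + 2 * X.κ)
variable (C) in
def blockWeight : ℕ := 2 * (X.r * X.m) * X.U + C.np * rowWeight X

variable (C) in
/-- The slots between blocks. -/
def baseSlots : ℕ → Option ℕ :=
  gridSlots X.r X.m C.L (tent C.V X.m) (fun _ _ => none) none none

theorem slots_empty (lo lo' : ℕ) : C.slots D kb jb i lo lo lo' lo' none none = C.baseSlots := by
  rw [slots, stepSlots_empty, baseSlots]

/-- The block is loaded once and used for all `np` rows of the left factor; this sharing keeps the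
number of updates per entry small. -/
theorem wp_blockBody (hb : C.Base s) (hM : C.HasMat D s) (hsm : C.Small s) (hD : ∀ i j, |D i j| ≤ C.V)
    (hkb : kb < C.z * X.m) (hjb : jb < C.z * X.r) (h14 : s.reg 14 = kb) (h16 : s.reg 16 = jb)
    (hgood : al = true → C.Good D)
    (hP : al = true → C.Partial D kb (fun _ j' => j' < jb * X.m) s) :
    X.env.WP (blockBody X.DA X.s) C.blockCost C.blockWeight s (C.baseSlots, al) fun s' γ =>
      Fr 18 s s' ∧ C.Small s' ∧ γ.1 = C.baseSlots ∧
      (γ.2 = true → al = true) ∧ (γ.2 = true →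
        C.Partial D kb (fun _ j' => j' < jb * X.m + X.m) s') := by
  have hr := X.hr
  have hm := X.hm
  rw [← C.slots_empty (D := D) (kb := kb) (jb := jb) (i := 0) 0 0]
  have hf0 : ∀ {s' : State}, OffVars 20 21 s s' → s'.arr = s.arr → Fr 20 s s' := fun h h' =>
    Fr.of_off (by norm_num) (by norm_num) h h'
  have hrm : ∀ {s' : State}, C.Base s' → (var 6 * var 7).eval s' = (X.r * X.m : ℕ) := fun h => by
    simp [h.r6, h.r7]
  have hmod : ∀ {s' : State} {t : ℕ}, C.Base s' → s'.reg 20 = t →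
      (var 20 % var 7).eval s' = (t % X.m : ℕ) := fun h h' => by simp [h.r7, h']
  refine Env.WP.weaken (c := (4 * X.κ + (X.r * X.m) * ((X.κ + X.κ) + 2 * X.κ)) +
    ((4 * X.κ + C.np * (rowCost X + 2 * X.κ)) + (4 * X.κ + (X.r * X.m) * ((X.κ + X.κ) + 2 * X.κ))))
    (d := (X.r * X.m) * X.U + (C.np * rowWeight X + (X.r * X.m) * X.U))
    (Env.WP.seq (Ctx.wp_slotLoop (F := fun k => C.slots D kb jb 0 0 k 0 0 none none)
      (by norm_num) (by norm_num) (by norm_num) (C.adm (by decide)) (hrm hb) C.rm_le_B ?_) ?_)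
    (le_of_eq (by rw [blockCost]; ring)) (le_of_eq (by rw [blockWeight]; ring)) (fun _ _ h => h)
  · intro t ht s' ho ha h20 al'
    have hf := hf0 ho ha
    have hb' := hb.fr (by norm_num) hf
    obtain ⟨a1, a2, a3⟩ := step_values hb' ht h20
    obtain ⟨b1, b2⟩ := stepSlots_succ (L := C.L) (v := tent C.V X.m) (c := C.stepWt D kb jb)
      (a := C.midWt D kb jb 0) (src := none) (snk := none) (lo' := 0) (hi' := 0) ht
    have ha' : X.env.Adm (var 20 % var 7) := C.adm (by decide)
    refine Env.WP.ite (E := X.env) (c := X.κ) ha' (fun h => ?_) (fun h => ?_)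
    · rw [hmod hb' h20] at h
      have h0 : t % X.m ≠ 0 := by exact_mod_cast h
      exact Ctx.wp_ins (C.adm (by decide)) (C.adm (by decide)) (C.adm (by decide)) a3 a1 a2
        (step_weight hb' (hM.fr hf) hD hkb hjb (by rw [hf.reg 14 (by norm_num), h14])
          (by rw [hf.reg 16 (by norm_num), h16]) ht h0 h20) (b1 h0).1
        ((stepWt_eq hD kb jb _ _).2.trans C.hL) fun al'' h => ⟨rfl, (b1 h0).2.symm, h⟩
    · rw [hmod hb' h20] at h
      have h0 : t % X.m = 0 := by exact_mod_cast h
      exact (Env.WP.skip (E := X.env) (Q := fun s'' γ => s'' = s' ∧ γ.1 = C.slots D kb jb 0 0 (t + 1) 0 0 none none ∧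
        (γ.2 = true → al' = true)) ⟨rfl, (b2 h0).symm, id⟩).weaken le_rfl (Nat.zero_le _) fun _ _ h => h
  rintro s₁ ⟨E₁, al₁⟩ ⟨ho₁, ha₁, rfl, hal₁⟩
  have hf₁ := hf0 ho₁ ha₁
  have hb₁ := hb.fr (by norm_num) hf₁
  simp only at hal₁ ⊢
  let Pi : ℕ → ℕ → ℕ → Prop := fun i i' j' => j' < jb * X.m ∨ (j' < jb * X.m + X.m ∧ i' < i)
  have hnpB : C.np ≤ X.B := (Nat.le_mul_self _).trans C.B_np
  refine Env.WP.seq (R := fun s' γ => Fr 18 s s' ∧ C.Small s' ∧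
    γ.1 = C.slots D kb jb 0 0 (X.r * X.m) 0 0 none none ∧ (γ.2 = true → al = true) ∧
    (γ.2 = true → C.Partial D kb (Pi C.np) s')) ?_ ?_
  · refine (Env.WP.for (E := X.env) (c := rowCost X) (d := rowWeight X) (I := fun i s' γ => Fr 18 s s' ∧ C.Small s' ∧
      γ.1 = C.slots D kb jb 0 0 (X.r * X.m) 0 0 none none ∧ (γ.2 = true → al = true) ∧
      (γ.2 = true → C.Partial D kb (Pi i) s')) (k := C.np) (by change 18 < 40; norm_num)
      (by change 19 < 40; norm_num) (by norm_num) (C.adm (e := var 1) (by decide)) hb₁.r1 hnpB ?_ ?_).mono ?_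
    · refine ⟨((hf₁.mono (by norm_num)).setReg (by norm_num) _).setReg (by norm_num) _, ?_, rfl, hal₁, fun h => ?_⟩
      · intro a ha
        simp only [State.setReg_arr, ha₁]
        exact hsm a ha
      · refine Partial.congr (P := fun _ j' => j' < jb * X.m) ?_ ?_
        · intro i' hi' j' hj'
          simp only [State.setReg_arr, ha₁]
          exact hP (hal₁ h) i' hi' j' hj'
        · intro i' _ j' _
          simp only [Pi]; omega
    · rintro i hi s' ⟨E', al'⟩ ⟨h1, h2, rfl, h4, h5⟩ h18 h19
      have hf := h1
      refine (wp_rowBody (C := C) (hb.fr (by norm_num) hf) (hM.fr hf) h2 hD hkb hjb hi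
        (by rw [hf.reg 14 (by norm_num), h14]) (by rw [hf.reg 16 (by norm_num), h16]) h18
        (fun h => hgood (h4 h)) h5).mono ?_
      rintro s'' ⟨E'', al''⟩ ⟨k1, k2, k3, k4, k5⟩
      refine ⟨by rw [k1.reg 18 (by norm_num), h18], by rw [k1.reg 19 (by norm_num), h19],
        (h1.trans (k1.mono (by norm_num))).setReg (by norm_num) _, k2, k3, fun h => h4 (k4 h), fun h => ?_⟩
      exact k5 h
    · rintro s' γ ⟨-, -, h⟩; exact h
  rintro s₂ ⟨E₂, al₂⟩ ⟨hf₂, hsm₂, rfl, hal₂, hP₂⟩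
  have hb₂ := hb.fr (by norm_num) hf₂
  simp only at hal₂ hP₂ ⊢
  refine (Ctx.wp_slotLoop (F := fun k => C.slots D kb jb 0 k (X.r * X.m) 0 0 none none)
      (by norm_num) (by norm_num) (by norm_num) (C.adm (by decide)) (hrm hb₂) C.rm_le_B ?_).mono ?_
  · intro t ht s' ho ha h20 al'
    have hf : Fr 20 s₂ s' := Fr.of_off (by norm_num) (by norm_num) ho ha
    have hb' := hb₂.fr (by norm_num) hf
    obtain ⟨a1, a2, a3⟩ := step_values hb' ht h20
    obtain ⟨b1, b2⟩ := stepSlots_del (L := C.L) (v := tent C.V X.m) (c := C.stepWt D kb jb)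
      (a := C.midWt D kb jb 0) (src := none) (snk := none) (lo' := 0) (hi' := 0) ht le_rfl
    have ha' : X.env.Adm (var 20 % var 7) := C.adm (by decide)
    refine Env.WP.ite (E := X.env) (c := X.κ) ha' (fun h => ?_) (fun h => ?_)
    · rw [hmod hb' h20] at h
      have h0 : t % X.m ≠ 0 := by exact_mod_cast h
      exact Ctx.wp_del (C.adm (by decide)) (C.adm (by decide)) a3 a1 a2 (b1 h0).1
        fun al'' h => ⟨rfl, (b1 h0).2.symm, h⟩
    · rw [hmod hb' h20] at h
      have h0 : t % X.m = 0 := by exact_mod_cast h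
      exact (Env.WP.skip (E := X.env) (Q := fun s'' γ => s'' = s' ∧
        γ.1 = C.slots D kb jb 0 (t + 1) (X.r * X.m) 0 0 none none ∧
        (γ.2 = true → al' = true)) ⟨rfl, (b2 h0).symm, id⟩).weaken le_rfl (Nat.zero_le _) fun _ _ h => h
  · rintro s' ⟨E', al'⟩ ⟨ho, ha, rfl, h4⟩
    have hf : Fr 20 s₂ s' := Fr.of_off (by norm_num) (by norm_num) ho ha
    refine ⟨hf₂.trans (hf.mono (by norm_num)), fun a h => by rw [ha]; exact hsm₂ a h, ?_, fun h => hal₂ (h4 h), fun h => ?_⟩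
    · simp only; rw [slots_empty, slots_empty]
    · refine Partial.congr (P := Pi C.np) ?_ ?_
      · intro i' hi' j' hj'
        rw [ha]
        exact hP₂ (h4 h) i' hi' j' hj'
      · intro i' hi' j' _
        simp only [Pi]; omega

end Core
end FineGrained

/-! ### Min-plus squaring of the padded matrix -/

namespace FineGrained
open FineGrained.Expr (var ld)

theorem minSum_congr {D D' : ℕ → ℕ → ℤ} {X : ℤ} {i j q : ℕ} (h₁ : ∀ k < q, D i k = D' i k)
    (h₂ : ∀ k < q, D k j = D' k j) : minSum D X i j q = minSum D' X i j q := by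
  induction q with
  | zero => rfl
  | succ q ih =>
    rw [minSum, minSum, ih (fun k hk => h₁ k (by omega)) (fun k hk => h₂ k (by omega)),
      h₁ q (by omega), h₂ q (by omega)]

/-- One squaring of the matrix. -/
def squareBody (DA : DynamicAlgorithm) (s : ℕ) : Prog :=
  .seq (for' 20 21 (var 1 * var 1) (sto 5 (var 20) (var 2)))
    (.seq (for' 14 15 (var 8 * var 7) (for' 16 17 (var 8 * var 6) (blockBody DA s)))
      (for' 20 21 (var 1 * var 1) (sto 4 (var 20) (ld 5 (var 20)))))

/-- The states have the same variables below `k` and the same arrays except for `4` and `5`. -/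
structure FrD (k : ℕ) (s s' : State) : Prop where
  reg : ∀ x < k, s'.reg x = s.reg x
  arr : ∀ A, A ≠ 4 → A ≠ 5 → s'.arr A = s.arr A

theorem FrD.refl (k : ℕ) (s : State) : FrD k s s := ⟨fun _ _ => rfl, fun _ _ _ => rfl⟩

theorem FrD.trans {k : ℕ} {s s' s'' : State} (h : FrD k s s') (h' : FrD k s' s'') : FrD k s s'' :=
  ⟨fun x hx => (h'.reg x hx).trans (h.reg x hx),
    fun A hA hA' => (h'.arr A hA hA').trans (h.arr A hA hA')⟩

theorem FrD.mono {k k' : ℕ} {s s' : State} (hk : k' ≤ k) (h : FrD k s s') : FrD k' s s' :=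
  ⟨fun x hx => h.reg x (hx.trans_le hk), h.arr⟩

theorem FrD.setReg {k : ℕ} {s s' : State} (h : FrD k s s') {x : ℕ} (hx : k ≤ x) (v : ℤ) :
    FrD k s (s'.setReg x v) :=
  ⟨fun y hy => by rw [State.setReg_reg, if_neg (by omega), h.reg y hy], h.arr⟩

theorem Fr.frD {k : ℕ} {s s' : State} (h : Fr k s s') : FrD k s s' := ⟨h.reg, fun A _ h' => h.arr A h'⟩

theorem FrD.of_off {k x y : ℕ} {s s' : State} (hx : k ≤ x) (hy : k ≤ y) (h : OffVars x y s s')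
    (ha : ∀ A, A ≠ 4 → A ≠ 5 → s'.arr A = s.arr A) : FrD k s s' :=
  ⟨fun z hz => h z (by omega) (by omega), ha⟩

namespace Core
variable {X : Ctx} {C : Core X} {s : State} {D : ℕ → ℕ → ℤ} {al : Bool} {kb jb i j : ℕ}

theorem Base.frD {k : ℕ} {s s' : State} (h : C.Base s) (hk : 12 ≤ k) (hf : FrD k s s') :
    C.Base s' where
  r0 := by rw [hf.reg 0 (by omega), h.r0]
  r1 := by rw [hf.reg 1 (by omega), h.r1]
  r2 := by rw [hf.reg 2 (by omega), h.r2]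
  r3 := by rw [hf.reg 3 (by omega), h.r3]
  r4 := by rw [hf.reg 4 (by omega), h.r4]
  r6 := by rw [hf.reg 6 (by omega), h.r6]
  r7 := by rw [hf.reg 7 (by omega), h.r7]
  r8 := by rw [hf.reg 8 (by omega), h.r8]
  r9 := by rw [hf.reg 9 (by omega), h.r9]
  r10 := by rw [hf.reg 10 (by omega), h.r10]
  r11 := by rw [hf.reg 11 (by omega), h.r11]
  a0 := by rw [hf.arr 0 (by omega) (by omega), h.a0]
  a1 := by rw [hf.arr 1 (by omega) (by omega), h.a1]

theorem np_pos (C : Core X) : 0 < C.np := by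
  rw [C.hnp]; exact Nat.mul_pos (Nat.mul_pos C.hz X.hr) X.hm

theorem np_le_B (C : Core X) : C.np ≤ X.B := (Nat.le_mul_self _).trans C.B_np

theorem zm_le_B (C : Core X) : C.z * X.m ≤ X.B := by
  refine le_trans ?_ C.np_le_B
  rw [C.hnp]
  exact Nat.mul_le_mul_right _ (Nat.le_mul_of_pos_right _ X.hr)

theorem zr_le_B (C : Core X) : C.z * X.r ≤ X.B := by
  refine le_trans ?_ C.np_le_B
  rw [C.hnp]
  exact Nat.le_mul_of_pos_right _ X.hm

theorem Partial.next (h : C.Partial D kb (fun _ j' => j' < C.z * X.r * X.m) s) :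
    C.Partial D (kb + 1) (fun _ _ => False) s := by
  intro i hi j hj
  refine ⟨False.elim, fun _ => ?_⟩
  rw [add_mul, one_mul]
  exact (h i hi j hj).1 (by rw [← C.hnp]; exact hj)

variable (C) in
def sweepCost : ℕ :=
  4 * X.κ + C.z * X.m * ((4 * X.κ + C.z * X.r * (C.blockCost + 2 * X.κ)) + 2 * X.κ)
variable (C) in
def sweepWeight : ℕ := C.z * X.m * (C.z * X.r * C.blockWeight)

/-- For fixed `kb` the blocks cover all columns, so afterwards every entry has absorbed one more
range of `r` indices and `minSum` has advanced by `r`. After `z · m` values of `kb` all `np` indices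
have been used. -/
theorem wp_sweep (hb : C.Base s) (hM : C.HasMat D s) (hsm : C.Small s) (hD : ∀ i j, |D i j| ≤ C.V)
    (hgood : al = true → C.Good D) (hP : C.Partial D 0 (fun _ _ => False) s) :
    X.env.WP (for' 14 15 (var 8 * var 7) (for' 16 17 (var 8 * var 6) (blockBody X.DA X.s)))
      C.sweepCost C.sweepWeight s (C.baseSlots, al) fun s' γ =>
      Fr 14 s s' ∧ C.Small s' ∧ γ.1 = C.baseSlots ∧ (γ.2 = true → al = true) ∧
      (γ.2 = true → C.Partial D (C.z * X.m) (fun _ _ => False) s') := by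
  refine (Env.WP.for (E := X.env) (e := var 8 * var 7) (k := C.z * X.m)
    (c := 4 * X.κ + C.z * X.r * (C.blockCost + 2 * X.κ)) (d := C.z * X.r * C.blockWeight)
    (I := fun kb s' γ => Fr 14 s s' ∧ C.Small s' ∧ γ.1 = C.baseSlots ∧ (γ.2 = true → al = true) ∧
      (γ.2 = true → C.Partial D kb (fun _ _ => False) s')) (by change 14 < 40; norm_num)
      (by change 15 < 40; norm_num) (by norm_num) (C.adm (by decide)) (by simp [hb.r7, hb.r8]) C.zm_le_B
      ?_ ?_).mono ?_
  · exact ⟨((Fr.refl _ _).setReg (by norm_num) _).setReg (by norm_num) _, hsm, rfl, id, fun _ => hP⟩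
  · rintro kb hkb s₁ ⟨E₁, al₁⟩ ⟨hf₁, hsm₁, rfl, hal₁, hP₁⟩ h14 h15
    have hb₁ := hb.fr (by norm_num) hf₁
    refine (Env.WP.for (E := X.env) (e := var 8 * var 6) (k := C.z * X.r)
      (c := C.blockCost) (d := C.blockWeight)
      (I := fun jb s' γ => Fr 16 s₁ s' ∧ C.Small s' ∧ γ.1 = C.baseSlots ∧ (γ.2 = true → al₁ = true) ∧
        (γ.2 = true → C.Partial D kb (fun _ j' => j' < jb * X.m) s')) (by change 16 < 40; norm_num)
        (by change 17 < 40; norm_num) (by norm_num) (C.adm (by decide)) (by simp [hb₁.r6, hb₁.r8]) C.zr_le_B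
        ?_ ?_).mono ?_
    · refine ⟨((Fr.refl _ _).setReg (by norm_num) _).setReg (by norm_num) _, hsm₁, rfl, id, fun h => ?_⟩
      refine Partial.congr (P := fun _ _ => False) (hP₁ h) fun i _ j _ => ?_
      simp
    · rintro jb hjb s₂ ⟨E₂, al₂⟩ ⟨hf₂, hsm₂, rfl, hal₂, hP₂⟩ h16 h17
      have hb₂ := hb₁.fr (by norm_num) hf₂
      refine (wp_blockBody (C := C) hb₂ ((hM.fr hf₁).fr hf₂) hsm₂ hD hkb hjb
        (by rw [hf₂.reg 14 (by norm_num), h14]) h16 (fun h => hgood (hal₁ (hal₂ h))) hP₂).mono ?_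
      rintro s₃ ⟨E₃, al₃⟩ ⟨k1, k2, k3, k4, k5⟩
      refine ⟨by rw [k1.reg 16 (by norm_num), h16], by rw [k1.reg 17 (by norm_num), h17],
        (hf₂.trans (k1.mono (by norm_num))).setReg (by norm_num) _, k2, k3, fun h => hal₂ (k4 h), fun h => ?_⟩
      refine Partial.congr (s := s₃.setReg 16 (jb + 1)) (k5 h) fun i _ j _ => ?_
      rw [add_mul, one_mul]
    · rintro s₂ ⟨E₂, al₂⟩ ⟨-, -, k1, k2, k3, k4, k5⟩
      exact ⟨by rw [k1.reg 14 (by norm_num), h14], by rw [k1.reg 15 (by norm_num), h15],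
        (hf₁.trans (k1.mono (by norm_num))).setReg (by norm_num) _, k2, k3, fun h => hal₁ (k4 h),
        fun h => Partial.next (s := s₂.setReg 14 (kb + 1)) (k5 h)⟩
  · rintro s' γ ⟨-, -, h⟩; exact h

variable (C) in
def SmallD (s : State) : Prop := ∀ a < C.np * C.np, |s.arr 4 (a : ℕ)| ≤ C.V

variable (C) in
def squareCost : ℕ := 8 * X.κ + 6 * (C.np * C.np) * X.κ + C.sweepCost

theorem wp_squareBody (hb : C.Base s) (hsm : C.SmallD s) {M : ℕ → ℕ → ℤ}
    (hM : al = true → C.HasMat M s) (hM' : ∀ i j k, -(C.V : ℤ) ≤ M i k + M k j) :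
    X.env.WP (squareBody X.DA X.s) C.squareCost C.sweepWeight s (C.baseSlots, al) fun s' γ =>
      FrD 14 s s' ∧ C.SmallD s' ∧ γ.1 = C.baseSlots ∧ (γ.2 = true → al = true) ∧
      (γ.2 = true → C.HasMat (fun i j => minSum M C.V i j C.np) s') := by
  have hVB : |(C.V : ℤ)| ≤ X.B := by
    have := C.B_V
    rw [abs_of_nonneg (by positivity)]
    have : (0 : ℤ) ≤ C.V := by positivity
    linarith
  have hnn : (var 1 * var 1).eval s = (C.np * C.np : ℕ) := by simp [hb.r1]
  refine Env.WP.weaken (c := (4 * X.κ + (C.np * C.np) * (3 * X.κ)) +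
    (C.sweepCost + (4 * X.κ + (C.np * C.np) * (3 * X.κ)))) (d := 0 + (C.sweepWeight + 0))
    (Env.WP.seq (Env.wp_fill (E := X.env) (f := fun _ => (C.V : ℤ)) (by change 20 < 40; norm_num)
      (by change 21 < 40; norm_num) (by norm_num) (by change 5 < 10; norm_num) (C.adm (by decide)) (C.adm (by decide))
      hnn C.B_np ?_) ?_) (le_of_eq (by rw [squareCost]; ring)) (by simp) (fun _ _ h => h)
  · intro i _ s' ho _ _
    exact ⟨by rw [Expr.eval_var, ho 2 (by norm_num) (by norm_num), hb.r2], hVB⟩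
  rintro s₁ _ ⟨rfl, ho, ha, h5, -⟩
  have hf₁ : Fr 14 s s₁ := ⟨fun z hz => ho z (by omega) (by omega), ha⟩
  have hb₁ := hb.fr (by norm_num) hf₁
  let D : ℕ → ℕ → ℤ := fun i j =>
    if i < C.np ∧ j < C.np then s.arr 4 ((C.np * i + j : ℕ) : ℤ) else C.V
  have hD : ∀ i j, |D i j| ≤ C.V := fun i j => by
    simp only [D]
    split_ifs with h
    · exact hsm _ (C.cell_lt h.1 h.2)
    · simp
  have hDM : C.HasMat D s₁ := fun i hi j hj => by
    simp only [D, hi, hj, true_and, if_true, ha 4 (by norm_num)]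
  have hDM' : al = true → ∀ i j, i < C.np → j < C.np → D i j = M i j := fun h i j hi hj => by
    simp only [D, hi, hj, true_and, if_true]; exact hM h i hi j hj
  -- Outside of the matrix one of the two summands is `V` and the other at least `-V`.
  have hgood : al = true → C.Good D := by
    intro h i j k
    by_cases h1 : i < C.np ∧ k < C.np
    · by_cases h2 : j < C.np
      · rw [hDM' h _ _ h1.1 h1.2, hDM' h _ _ h1.2 h2]
        exact hM' i j k
      · have := abs_le.1 (hD i k)
        have e : D k j = C.V := by simp only [D, h2, and_false, if_false]
        omega
    · have := abs_le.1 (hD k j)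
      have e : D i k = C.V := by simp only [D, h1, if_false]
      omega
  have hcell : ∀ {i j}, i < C.np → j < C.np → s₁.arr 5 ((C.np * i + j : ℕ) : ℤ) = C.V :=
    fun hi hj => h5 _ (C.cell_lt hi hj)
  refine Env.WP.seq (wp_sweep (C := C) hb₁ hDM (fun a ha => by rw [h5 a ha]; simp) hD hgood
    (fun i hi j hj => ⟨False.elim, fun _ => by rw [hcell hi hj, Nat.zero_mul]; rfl⟩)) ?_
  rintro s₂ ⟨E₂, al₂⟩ ⟨hf₂, hsm₂, rfl, hal₂, hP₂⟩
  have hf := hf₁.trans hf₂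
  have hb₂ := hb.fr (by norm_num) hf
  refine (Env.wp_fill (E := X.env) (f := fun a => s₂.arr 5 (a : ℕ)) (by change 20 < 40; norm_num)
      (by change 21 < 40; norm_num) (by norm_num) (by change 4 < 10; norm_num) (C.adm (by decide)) (C.adm (by decide))
      (k := C.np * C.np) (by simp [hb₂.r1]) C.B_np ?_).mono ?_
  · intro a ha s' ho ha' h20
    refine ⟨by rw [Expr.eval_ld, Expr.eval_var, h20, ha' 5 (by norm_num)], (hsm₂ a ha).trans ?_⟩
    rw [abs_of_nonneg (by positivity)] at hVB
    exact hVB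
  · rintro s₃ _ ⟨rfl, ho₃, ha₃, h4, -⟩
    refine ⟨hf.frD.trans ⟨fun z hz => ho₃ z (by omega) (by omega), fun A hA _ => ha₃ A hA⟩,
      fun a ha => by rw [h4 a ha]; exact hsm₂ a ha, rfl, hal₂, fun h i hi j hj => ?_⟩
    rw [h4 _ (C.cell_lt hi hj), (hP₂ h i hi j hj).2 id]
    have hz : C.z * X.m * X.r = C.np := by rw [C.hnp]; ring
    rw [hz]
    exact minSum_congr (fun k hk => hDM' (hal₂ h) _ _ hi hk) (fun k hk => hDM' (hal₂ h) _ _ hk hj)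

/-- The bound on the entries is preserved unconditionally, since all later expressions must still
fit into words; only the statement about their values depends on the remaining budget. -/
theorem wp_squares (hb : C.Base s) (hsm : C.SmallD s)
    (hM : C.HasMat (squares C.G C.V C.np 0) s)
    (hM' : ∀ q i j k, -(C.V : ℤ) ≤ squares C.G C.V C.np q i k + squares C.G C.V C.np q k j) :
    X.env.WP (for' 12 13 (var 3) (squareBody X.DA X.s)) (4 * X.κ + C.K * (C.squareCost + 2 * X.κ))
      (C.K * C.sweepWeight) s (C.baseSlots, al) fun s' γ =>
      FrD 12 s s' ∧ C.SmallD s' ∧ γ.1 = C.baseSlots ∧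
      (γ.2 = true → C.HasMat (squares C.G C.V C.np C.K) s') := by
  refine (Env.WP.for (E := X.env) (e := var 3) (k := C.K)
    (c := C.squareCost) (d := C.sweepWeight)
    (I := fun q s' γ => FrD 12 s s' ∧ C.SmallD s' ∧ γ.1 = C.baseSlots ∧
      (γ.2 = true → C.HasMat (squares C.G C.V C.np q) s')) (by change 12 < 40; norm_num)
      (by change 13 < 40; norm_num) (by norm_num) (C.adm (by decide)) (by simp [hb.r3]) C.B_K
      ?_ ?_).mono ?_
  · exact ⟨((FrD.refl _ _).setReg (by norm_num) _).setReg (by norm_num) _, hsm, rfl, fun _ => hM⟩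
  · rintro q hq s₁ ⟨E₁, al₁⟩ ⟨hf₁, hsm₁, rfl, hM₁⟩ h12 h13
    refine (wp_squareBody (C := C) (hb.frD (by norm_num) hf₁) hsm₁ hM₁ (hM' q)).mono ?_
    rintro s₂ ⟨E₂, al₂⟩ ⟨k1, k2, k3, k4, k5⟩
    exact ⟨by rw [k1.reg 12 (by norm_num), h12], by rw [k1.reg 13 (by norm_num), h13],
      (hf₁.trans (k1.mono (by norm_num))).setReg (by norm_num) _, k2, k3, k5⟩
  · rintro s' γ ⟨-, -, h⟩; exact h

end Core
end FineGrained

/-! ### Input matrix, base weights and output -/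

namespace FineGrained
open FineGrained.Expr (var ld)

theorem vecArr_apply {k : ℕ} (v : Fin k → ℤ) {a : ℕ} (h : a < k) : vecArr v (a : ℤ) = v ⟨a, h⟩ := by
  rw [vecArr, dif_pos ⟨by positivity, by simpa using h⟩]
  simp

theorem vecArr_of_not {k : ℕ} (v : Fin k → ℤ) {a : ℤ} (h : a < 0 ∨ (k : ℤ) ≤ a) : vecArr v a = 0 := by
  rw [vecArr, dif_neg (by omega)]

theorem matArr_apply {m n : ℕ} (M : Fin m → Fin n → ℤ) {i j : ℕ} (hi : i < m) (hj : j < n) :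
    matArr M ((n * i + j : ℕ) : ℤ) = M ⟨i, hi⟩ ⟨j, hj⟩ := by
  have h : n * i + j < m * n := by
    calc n * i + j < n * (i + 1) := by rw [Nat.mul_add]; omega
      _ ≤ n * m := Nat.mul_le_mul_left _ hi
      _ = _ := mul_comm _ _
  rw [matArr, vecArr_apply _ h]
  have : finProdFinEquiv.symm ⟨n * i + j, h⟩ = (⟨i, hi⟩, ⟨j, hj⟩) := by
    rw [Equiv.symm_apply_eq]
    ext
    simp [finProdFinEquiv, add_comm]
  rw [this]

theorem apspInput_arr_zero {n : ℕ} (w : WDigraph n) :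
    (apspInput w).arr 0 = matArr (fun i j => if (w i j).isSome then 1 else 0) := by simp [apspInput]

theorem apspInput_arr_one {n : ℕ} (w : WDigraph n) :
    (apspInput w).arr 1 = matArr (fun i j => (w i j).getD 0) := by simp [apspInput]

namespace Expr
variable {s : State} {a b : Expr} {x y : ℕ} {p q : Prop} [Decidable p] [Decidable q]

theorem eval_lt_nat (ha : a.eval s = x) (hb : b.eval s = y) :
    (op .lt a b).eval s = if x < y then 1 else 0 := by
  rw [eval_lt, ha, hb]; norm_cast

theorem eval_eq_nat (ha : a.eval s = x) (hb : b.eval s = y) :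
    (op .eq a b).eval s = if x = y then 1 else 0 := by
  rw [eval_eq, ha, hb]; norm_cast

theorem eval_and (ha : a.eval s = if p then 1 else 0) (hb : b.eval s = if q then 1 else 0) :
    (a * b).eval s = if p ∧ q then 1 else 0 := by
  rw [eval_mul, ha, hb, ite_mul_ite]

end Expr

/-- The matrix of the input. -/
def padE : Expr :=
  .sel (.op .eq (var 20 / var 1) (var 20 % var 1)) 0
    (.sel (.op .lt (var 20 / var 1) (var 0) * .op .lt (var 20 % var 1) (var 0))
      (.sel (ld 0 (var 0 * (var 20 / var 1) + var 20 % var 1))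
        (ld 1 (var 0 * (var 20 / var 1) + var 20 % var 1)) (var 2)) (var 2))

/-- The weight in a slot before the first block. -/
def baseE : Expr :=
  .sel (.op .eq (var 20 % 2) 0)
    (.sel (.op .lt 0 (var 20 / 2 / var 10) * .op .lt (var 20 / 2 / var 10) (2 * var 6))
      (.sel (.op .eq (var 20 / 2 % var 10 % 2) 0) (var 11)
        (.sel (.op .eq (var 20 / 2 / var 10 % 2) 1)
          (.sel (.op .lt (var 20 / 2 % var 10 + 1) (2 * var 7)) (var 11) (.cst (-1))) (.cst (-1))))
      (.cst (-1)))
    (.sel (.op .lt 0 (var 20 / 2 / var 10) * .op .lt (var 20 / 2 / var 10 + 1) (2 * var 6))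
      (.sel (.op .eq ((var 20 / 2 % var 10 + var 20 / 2 / var 10) % 2) 0)
        (.sel (.op .eq (var 20 / 2 / var 10 % 2) 1)
          (var 11 - 4 * var 2 * (var 20 / 2 % var 10 / 2 * (2 * var 7 - 1 - var 20 / 2 % var 10 / 2)))
          (var 11)) (.cst (-1)))
      (.cst (-1)))

def baseSnd : Expr := var 20 / 2 + .sel (.op .eq (var 20 % 2) 0) 1 (var 10)

/-- The main part of the program, after the preprocessing. -/
def mainPart (DA : DynamicAlgorithm) (s : ℕ) : Prog :=
  .seq (for' 20 21 (var 1 * var 1) (sto 4 (var 20) padE))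
    (.seq (for' 20 21 (2 * var 9) (ite' (.op .lt (.cst (-1)) baseE)
      (insOp DA s (var 20 / 2) baseSnd baseE) .skip))
    (.seq (for' 12 13 (var 3) (squareBody DA s))
    (ifLive s (.seq
      (for' 20 21 (var 0 * var 0)
        (sto 2 (var 20) (1 - .op .lt (var 2) (4 * ld 4 (var 1 * (var 20 / var 0) + var 20 % var 0)))))
      (for' 20 21 (var 0 * var 0)
        (sto 3 (var 20) (ld 4 (var 1 * (var 20 / var 0) + var 20 % var 0))))))))

namespace Core
variable {X : Ctx} {C : Core X} {s : State} {al : Bool}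

theorem eval_padE (hb : C.Base s) {a : ℕ} (h20 : s.reg 20 = a) :
    padE.eval s = padMat C.G C.V (a / C.np) (a % C.np) := by
  have hi : (var 20 / var 1).eval s = (a / C.np : ℕ) := by simp [h20, hb.r1]
  have hj : (var 20 % var 1).eval s = (a % C.np : ℕ) := by simp [h20, hb.r1]
  have hn : (var 0).eval s = C.n := hb.r0
  rw [padE, Expr.eval_sel (Expr.eval_eq_nat hi hj),
    Expr.eval_sel (Expr.eval_and (Expr.eval_lt_nat hi hn) (Expr.eval_lt_nat hj hn)), padMat]
  split_ifs with h1 h2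
  · rfl
  · have hc : (var 0 * (var 20 / var 1) + var 20 % var 1).eval s =
        ((C.n * (a / C.np) + a % C.np : ℕ) : ℤ) := by
      rw [Expr.eval_add, Expr.eval_mul, hi, hj, hn]; push_cast; ring
    have h0 : (ld 0 (var 0 * (var 20 / var 1) + var 20 % var 1)).eval s =
        if (C.G ⟨_, h2.1⟩ ⟨_, h2.2⟩).isSome then 1 else 0 := by
      rw [Expr.eval_ld, hc, hb.a0, apspInput_arr_zero]
      exact matArr_apply _ h2.1 h2.2
    have h1 : (ld 1 (var 0 * (var 20 / var 1) + var 20 % var 1)).eval s =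
        (C.G ⟨_, h2.1⟩ ⟨_, h2.2⟩).getD 0 := by
      rw [Expr.eval_ld, hc, hb.a1, apspInput_arr_one]
      exact matArr_apply _ h2.1 h2.2
    rw [Expr.eval_sel h0, h1]
    rcases C.G ⟨_, h2.1⟩ ⟨_, h2.2⟩ with _ | x <;> simp [hb.r2]
  · exact hb.r2

theorem baseSlots_valid {e c : ℕ} (h : C.baseSlots e = some c) : ValidSlot X.r X.m e ∧ c ≤ C.L := by
  have hr := X.hr
  have hm := X.hm
  have hmod := Nat.mod_lt (e / 2) (show 0 < 4 * X.m by omega)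
  rw [baseSlots, gridSlots] at h
  have hd := Nat.div_add_mod (e / 2) (4 * X.m)
  generalize e / 2 / (4 * X.m) = y at *
  generalize e / 2 % (4 * X.m) = x at *
  split_ifs at h with h0
  · rw [show e = 2 * (4 * X.m * y + x) by omega]
    rw [slotH] at h
    split_ifs at h with h1 h2 h3 h4 <;>
    · exact ⟨validSlot_even (by omega) (by omega), by simp at h; omega⟩
  · rw [show e = 2 * (4 * X.m * y + x) + 1 by omega]
    rw [slotV] at h
    simp only [reduceCtorEq, if_false, ite_self] at h
    split_ifs at h with h1 h2 h3 <;>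
    · refine ⟨validSlot_odd (by omega) (by omega), ?_⟩
      simp at h
      omega

/-- The nested selections follow the case distinctions of `slotH` and `slotV`. Weights are natural
numbers, so `-1` can stand for an empty slot. -/
theorem eval_baseE (hb : C.Base s) {e : ℕ} (h20 : s.reg 20 = e) :
    baseE.eval s = slotCode (C.baseSlots e) := by
  have hm := X.hm
  have hmod := Nat.mod_lt (e / 2) (show 0 < 4 * X.m by omega)
  have he : (var 20 % 2).eval s = (e % 2 : ℕ) := by simp [h20]
  have hy : (var 20 / 2 / var 10).eval s = (e / 2 / (4 * X.m) : ℕ) := by simp [h20, hb.r10]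
  have hx : (var 20 / 2 % var 10).eval s = (e / 2 % (4 * X.m) : ℕ) := by simp [h20, hb.r10]
  have hL : (var 11).eval s = C.L := hb.r11
  rw [baseE, baseSlots, gridSlots]
  generalize hY : e / 2 / (4 * X.m) = y at *
  generalize hX : e / 2 % (4 * X.m) = x at *
  have h0 : (0 : Expr).eval s = (0 : ℕ) := rfl
  have h1 : (1 : Expr).eval s = (1 : ℕ) := rfl
  have h2r : (2 * var 6).eval s = (2 * X.r : ℕ) := by simp [hb.r6]
  have h2m : (2 * var 7).eval s = (2 * X.m : ℕ) := by simp [hb.r7]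
  have hx2 : (var 20 / 2 % var 10 % 2).eval s = (x % 2 : ℕ) := by rw [Expr.eval_mod, hx]; simp
  have hy2 : (var 20 / 2 / var 10 % 2).eval s = (y % 2 : ℕ) := by rw [Expr.eval_mod, hy]; simp
  have hx1 : (var 20 / 2 % var 10 + 1).eval s = (x + 1 : ℕ) := by rw [Expr.eval_add, hx]; simp
  have hy1 : (var 20 / 2 / var 10 + 1).eval s = (y + 1 : ℕ) := by rw [Expr.eval_add, hy]; simp
  have hxy : ((var 20 / 2 % var 10 + var 20 / 2 / var 10) % 2).eval s = ((x + y) % 2 : ℕ) := by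
    rw [Expr.eval_mod, Expr.eval_add, hx, hy]; simp
  have ht : (var 11 - 4 * var 2 * (var 20 / 2 % var 10 / 2 *
      (2 * var 7 - 1 - var 20 / 2 % var 10 / 2))).eval s = (C.L - tent C.V X.m (x / 2) : ℕ) := by
    rw [Nat.cast_sub (tent_le C.V X.r X.m (x / 2) X.hr (by omega)), tent]
    simp only [Expr.eval_sub, Expr.eval_mul, Expr.eval_div, hx, hL, Expr.eval_four, Expr.eval_two,
      Expr.eval_one, Expr.eval_var, hb.r2, hb.r7]
    push_cast [show x / 2 ≤ 2 * X.m - 1 by omega, show 1 ≤ 2 * X.m by omega]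
    ring
  rw [Expr.eval_sel (Expr.eval_eq_nat he h0),
    Expr.eval_sel (Expr.eval_and (Expr.eval_lt_nat h0 hy) (Expr.eval_lt_nat hy h2r)),
    Expr.eval_sel (Expr.eval_eq_nat hx2 h0), Expr.eval_sel (Expr.eval_eq_nat hy2 h1),
    Expr.eval_sel (Expr.eval_lt_nat hx1 h2m),
    Expr.eval_sel (Expr.eval_and (Expr.eval_lt_nat h0 hy) (Expr.eval_lt_nat hy1 h2r)),
    Expr.eval_sel (Expr.eval_eq_nat hxy h0), Expr.eval_sel (Expr.eval_eq_nat hy2 h1), ht, hL,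
    Expr.eval_cst, slotH, slotV]
  simp only [reduceCtorEq, if_false, ite_self]
  split_ifs <;> rfl

variable (C) in
def mainCost : ℕ := 21 * X.κ + 3 * (C.np * C.np) * X.κ + 8 * X.N * X.κ +
  C.K * (C.squareCost + 2 * X.κ) + 6 * (C.n * C.n) * X.κ
variable (C) in
def mainWeight : ℕ := 2 * X.N * X.U + C.K * C.sweepWeight

/-- The correct output for the matrix `M`. -/
def Result (C : Core X) (M : ℕ → ℕ → ℤ) (s : State) : Prop :=
  ∀ i < C.n, ∀ j < C.n, s.arr 2 ((C.n * i + j : ℕ) : ℤ) = (if (C.V : ℤ) < 4 * M i j then 0 else 1) ∧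
    s.arr 3 ((C.n * i + j : ℕ) : ℤ) = M i j

/-- Arrays other than `4` and `5` are unchanged, except that the result is written if there is
budget left. -/
theorem wp_mainPart (hb : C.Base s) (hG : ∀ i j a, C.G i j = some a → |a| ≤ (C.V : ℤ))
    (hM' : ∀ q i j k, -(C.V : ℤ) ≤ squares C.G C.V C.np q i k + squares C.G C.V C.np q k j) :
    X.env.WP (mainPart X.DA X.s) C.mainCost C.mainWeight s (fun _ => none, al) fun s' γ =>
      (∀ x < 12, s'.reg x = s.reg x) ∧ (∀ A < 2, s'.arr A = s.arr A) ∧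
      ((γ.2 = true ∧ C.Result (squares C.G C.V C.np C.K) s') ∨
       (γ.2 = false ∧ s'.arr 2 = s.arr 2 ∧ s'.arr 3 = s.arr 3)) := by
  have hVB : (C.V : ℤ) ≤ X.B := by
    have := C.B_V
    have : (0 : ℤ) ≤ C.V := by positivity
    linarith
  have hNB : 2 * X.N ≤ X.B := by
    have h1 := C.B_N
    have h2 : 12 * 1 ≤ X.N := by
      have := Nat.mul_le_mul (Nat.mul_le_mul_left 3 X.hr) (Nat.mul_le_mul_left 4 X.hm)
      exact this
    exact (Nat.mul_le_mul_right _ (by omega)).trans h1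
  have hnB : C.n * C.n ≤ X.B := (Nat.mul_le_mul C.n_le C.n_le).trans C.B_np
  refine Env.WP.weaken (c := (4 * X.κ + (C.np * C.np) * (3 * X.κ)) +
    ((4 * X.κ + (2 * X.N) * ((X.κ + X.κ) + 2 * X.κ)) +
    ((4 * X.κ + C.K * (C.squareCost + 2 * X.κ)) + (X.κ + ((4 * X.κ + (C.n * C.n) * (3 * X.κ)) +
      (4 * X.κ + (C.n * C.n) * (3 * X.κ)))))))
    (d := 0 + ((2 * X.N) * X.U + (C.K * C.sweepWeight + (0 + 0))))
    (Env.WP.seq (Env.wp_fill (E := X.env) (f := fun a => padMat C.G C.V (a / C.np) (a % C.np))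
      (by change 20 < 40; norm_num) (k := C.np * C.np)
      (by change 21 < 40; norm_num) (by norm_num) (by change 4 < 10; norm_num) (C.adm (by decide)) (C.adm (by decide))
      (by simp [hb.r1]) C.B_np ?_) ?_) (by rw [mainCost]; apply le_of_eq; ring) (by rw [mainWeight]; omega)
      (fun _ _ h => h)
  · intro a _ s' ho ha h20
    have hf : FrD 20 s s' := FrD.of_off (by norm_num) (by norm_num) ho fun A hA _ => ha A hA
    refine ⟨eval_padE (hb.frD (by norm_num) hf) h20, le_trans ?_ hVB⟩
    rw [padMat]
    split_ifs with h1 h2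
    · simp
    · rcases hw : C.G ⟨_, h2.1⟩ ⟨_, h2.2⟩ with _ | x
      · simp
      · simpa using hG _ _ _ hw
    · simp
  rintro s₁ _ ⟨rfl, ho₁, ha₁, h4₁, -⟩
  have hf₁ : FrD 20 s s₁ := FrD.of_off (by norm_num) (by norm_num) ho₁ fun A hA _ => ha₁ A hA
  have hb₁ := hb.frD (by norm_num) hf₁
  -- After `e₀` rounds exactly the base slots below `e₀` have been filled.
  refine Env.WP.seq (Ctx.wp_slotLoop (F := fun e₀ e => if e < e₀ then C.baseSlots e else none)
      (by norm_num) (by norm_num) (by norm_num) (C.adm (by decide)) (k := 2 * X.N) (by simp [hb₁.r9]) hNB ?_) ?_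
  · intro e he s' ho ha h20 al'
    have hf : Fr 20 s₁ s' := Fr.of_off (by norm_num) (by norm_num) ho ha
    have hb' := hb₁.fr (by norm_num) hf
    have hE := eval_baseE hb' h20
    have hA : X.env.Adm (.op .lt (.cst (-1)) baseE) := C.adm (by decide)
    have hF : ∀ o, C.baseSlots e = o → (fun e' => if e' < e + 1 then C.baseSlots e' else none) =
        Function.update (fun e' => if e' < e then C.baseSlots e' else none) e o := by
      rintro o rfl
      funext e'
      by_cases h : e' = e
      · subst h; simp
      · rw [Function.update_of_ne h]
        congr 1
        simp only [eq_iff_iff]; omega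
    rcases ho' : C.baseSlots e with _ | c
    · refine Env.WP.ite (E := X.env) (c := X.κ) hA (fun h => absurd ?_ h) (fun _ => ?_)
      · rw [Expr.eval_lt, hE, ho']; rfl
      · refine (Env.WP.skip (E := X.env) (Q := fun s'' γ => s'' = s' ∧
          γ.1 = (fun e' => if e' < e + 1 then C.baseSlots e' else none) ∧
          (γ.2 = true → al' = true)) ⟨rfl, ?_, id⟩).weaken le_rfl (Nat.zero_le _) fun _ _ h => h
        rw [hF _ ho']
        simp only
        rw [eq_comm, Function.update_eq_self_iff]
        simp
    · obtain ⟨v1, v2⟩ := baseSlots_valid ho'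
      refine Env.WP.ite (E := X.env) (c := X.κ) hA (fun _ => ?_) (fun h => absurd h ?_)
      · refine Ctx.wp_ins (C.adm (by decide)) (C.adm (by decide)) (C.adm (by decide)) v1 (by simp [h20]) ?_
          (hE.trans (by rw [ho']; rfl)) (by simp) (v2.trans C.hL) fun al'' h => ⟨rfl, (hF _ ho').symm, h⟩
        have he2 : (var 20 % 2).eval s' = (e % 2 : ℕ) := by simp [h20]
        rw [baseSnd, Expr.eval_add, Expr.eval_sel (Expr.eval_eq_nat he2 (y := 0) rfl), slotEnd]
        simp only [Expr.eval_div, Expr.eval_var, h20, Expr.eval_two, Expr.eval_one, hb'.r10]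
        split_ifs <;> push_cast <;> ring
      · have : (-1 : ℤ) < c := by omega
        rw [Expr.eval_lt, hE, ho']
        simp [slotCode, this]
  rintro s₂ ⟨E₂, al₂⟩ ⟨ho₂, ha₂, hE₂, -⟩
  -- Slots from `2N` on belong to no node of the grid and are empty in `baseSlots`, so the loop has
  -- reached all of them.
  have hE₂' : E₂ = C.baseSlots := by
    rw [show E₂ = _ from hE₂]
    funext e
    split_ifs with h
    · rfl
    · rcases ho' : C.baseSlots e with _ | c
      · rfl
      · exact absurd (baseSlots_valid ho').1.fst_lt (by change ¬ e / 2 < X.N; omega)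
  subst hE₂'
  have hf₂ : FrD 20 s s₂ := hf₁.trans (FrD.of_off (by norm_num) (by norm_num) ho₂ fun A _ _ => by rw [ha₂])
  have hb₂ := hb.frD (by norm_num) hf₂
  have hnp := C.np_pos
  have h4₂ : ∀ a < C.np * C.np, s₂.arr 4 (a : ℕ) = padMat C.G C.V (a / C.np) (a % C.np) :=
    fun a ha => by rw [ha₂]; exact h4₁ a ha
  refine Env.WP.seq (wp_squares (C := C) hb₂ ?_ ?_ hM') ?_
  · intro a ha
    rw [h4₂ a ha, padMat]
    split_ifs with h1 h2
    · simp
    · rcases hw : C.G ⟨_, h2.1⟩ ⟨_, h2.2⟩ with _ | x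
      · simp
      · simpa using hG _ _ _ hw
    · simp
  · intro i hi j hj
    rw [h4₂ _ (C.cell_lt hi hj), (grid_div_mod hj).1, (grid_div_mod hj).2]
    rfl
  rintro s₃ ⟨E₃, al₃⟩ ⟨hf₃, hsm₃, rfl, hM₃⟩
  have hf₃ : FrD 12 s s₃ := (hf₂.mono (by norm_num)).trans hf₃
  have hb₃ := hb.frD (by norm_num) hf₃
  refine Ctx.wp_ifLive (fun h => ?_) fun h => ⟨hf₃.reg, fun A hA => hf₃.arr A (by omega) (by omega),
    .inr ⟨rfl, hf₃.arr 2 (by norm_num) (by norm_num), hf₃.arr 3 (by norm_num) (by norm_num)⟩⟩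
  have hM₃ := hM₃ h
  have hidx : ∀ a < C.n * C.n, a / C.n < C.np ∧ a % C.n < C.np := fun a ha => by
    have hn : 0 < C.n := Nat.pos_of_mul_pos_left (by omega : 0 < C.n * C.n)
    have h1 := Nat.mod_lt a hn
    have h2 : a / C.n < C.n := (Nat.div_lt_iff_lt_mul hn).2 ha
    have := C.n_le
    omega
  have hld : ∀ s' : State, (∀ z < 20, s'.reg z = s₃.reg z) → s'.arr 4 = s₃.arr 4 → ∀ a : ℕ, a < C.n * C.n → s'.reg 20 = (a : ℤ) →
      (ld 4 (var 1 * (var 20 / var 0) + var 20 % var 0)).eval s' =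
        squares C.G C.V C.np C.K (a / C.n) (a % C.n) := by
    intro s' hr h4 a ha h20
    obtain ⟨h1, h2⟩ := hidx a ha
    rw [← hM₃ _ h1 _ h2, Expr.eval_ld, h4]
    congr 1
    simp only [Expr.eval_add, Expr.eval_mul, Expr.eval_div, Expr.eval_mod, Expr.eval_var, h20,
      hr 0 (by norm_num), hr 1 (by norm_num), hb₃.r0, hb₃.r1]
    push_cast; ring
  refine Env.WP.seq (Env.wp_fill (E := X.env) (s := s₃) (f := fun a =>
      if (C.V : ℤ) < 4 * squares C.G C.V C.np C.K (a / C.n) (a % C.n) then 0 else 1)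
      (by change 20 < 40; norm_num) (k := C.n * C.n)
      (by change 21 < 40; norm_num) (by norm_num) (by change 2 < 10; norm_num)
      (C.adm (e := var 0 * var 0) (by decide)) (C.adm (e := 1 - .op .lt (var 2) (4 * ld 4
        (var 1 * (var 20 / var 0) + var 20 % var 0))) (by decide))
      (by simp [hb₃.r0]) hnB ?_) ?_
  · intro a ha s' ho ha' h20
    have hr : ∀ z < 20, s'.reg z = s₃.reg z := fun z hz => ho z (by omega) (by omega)
    refine ⟨?_, ?_⟩
    · rw [Expr.eval_sub, Expr.eval_lt, Expr.eval_mul, hld s' hr (ha' 4 (by norm_num)) a ha h20,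
        Expr.eval_one, Expr.eval_four, Expr.eval_var, hr 2 (by norm_num), hb₃.r2]
      split_ifs <;> rfl
    · have := X.le_B
      change _ ≤ (X.B : ℤ)
      split_ifs
      · simp
      · simp; omega
  rintro s₄ _ ⟨rfl, ho₄, ha₄, h2₄, -⟩
  have hr₄ : ∀ z < 20, s₄.reg z = s₃.reg z := fun z hz => ho₄ z (by omega) (by omega)
  refine (Env.wp_fill (E := X.env) (s := s₄) (f := fun a => squares C.G C.V C.np C.K (a / C.n) (a % C.n))
      (by change 20 < 40; norm_num) (k := C.n * C.n)
      (by change 21 < 40; norm_num) (by norm_num) (by change 3 < 10; norm_num)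
      (C.adm (e := var 0 * var 0) (by decide)) (C.adm (e := ld 4
        (var 1 * (var 20 / var 0) + var 20 % var 0)) (by decide))
      (by simp [hr₄, hb₃.r0]) hnB ?_).mono ?_
  · intro a ha s' ho ha' h20
    obtain ⟨h1, h2⟩ := hidx a ha
    refine ⟨hld s' (fun z hz => (ho z (by omega) (by omega)).trans (hr₄ z hz))
      ((ha' 4 (by norm_num)).trans (ha₄ 4 (by norm_num))) a ha h20, ?_⟩
    rw [← hM₃ _ h1 _ h2]
    exact (hsm₃ _ (C.cell_lt h1 h2)).trans hVB
  · rintro s₅ _ ⟨rfl, ho₅, ha₅, h3₅, -⟩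
    refine ⟨fun x hx => by rw [ho₅ x (by omega) (by omega), hr₄ x (by omega), hf₃.reg x hx],
      fun A hA => by rw [ha₅ A (by omega), ha₄ A (by omega), hf₃.arr A (by omega) (by omega)],
      .inl ⟨rfl, fun i hi j hj => ?_⟩⟩
    have hlt : C.n * i + j < C.n * C.n := by
      have : C.n * (i + 1) ≤ C.n * C.n := Nat.mul_le_mul_left _ hi
      rw [Nat.mul_add] at this
      omega
    have e1 := h2₄ _ hlt
    have e2 := h3₅ _ hlt
    simp only [(grid_div_mod hj).1, (grid_div_mod hj).2] at e1 e2
    exact ⟨by rw [ha₅ 2 (by norm_num), e1], e2⟩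

end Core
end FineGrained

/-! ### Preparing the memory region and running the preprocessing -/

namespace FineGrained
open FineGrained.Expr (var ld)

/-- The environment without abstract memory: everything outside of the own part is as in `m₀`. -/
def plainEnv (W B S κ Lmax : ℕ) (ownR ownA : ℕ → Prop) (m₀ : State) (hB : 100 ≤ B) (hS : 10 ≤ S)
    (hκ : 10 * S + 20 ≤ κ) (hW : B ^ S ≤ W) : Env where
  W := W
  B := B
  S := S
  κ := κ
  ownR := ownR
  ownA := ownA
  Γ := Unit
  Dyn m _ _ p _ := p = 0 ∧ (∀ x, ¬ ownR x → m.reg x = m₀.reg x) ∧ ∀ A, ¬ ownA A → m.arr A = m₀.arr A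
  Lmax := Lmax
  le_B := hB
  le_S := hS
  le_κ := hκ
  pow_le := hW
  frame := fun ⟨h₀, h₁, h₂⟩ h₃ h₄ =>
    ⟨h₀, fun x hx => (h₃ x hx).trans (h₁ x hx), fun A hA => (h₄ A hA).trans (h₂ A hA)⟩

/-- This is the condition that defines adjacency in `gridDrawing`: squared distance 1, which needs
multiplication but no absolute values. -/
def adjE : Expr :=
  .op .eq ((var 20 / var 9 / var 10 - var 20 % var 9 / var 10) *
    (var 20 / var 9 / var 10 - var 20 % var 9 / var 10) +
    (var 20 / var 9 % var 10 - var 20 % var 9 % var 10) *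
    (var 20 / var 9 % var 10 - var 20 % var 9 % var 10)) 1

/-- Write the input of the preprocessing. -/
def setup (s : ℕ) : Prog :=
  .seq (asg (regVar s 0) (var 4)) (.seq (asg (regVar s 1) 1) (.seq (asg (regVar s 3) (var 9))
    (.seq (for' 20 21 (var 9) (sto (regArr s 0) (var 20) (var 20 / var 10)))
    (.seq (for' 20 21 (var 9) (sto (regArr s 1) (var 20) (var 20 % var 10)))
      (for' 20 21 (var 9 * var 9) (sto (regArr s 2) (var 20) adjE))))))

/-- All shortest path lengths with the dynamic algorithm in region `s`. -/
def coreProg (DA : DynamicAlgorithm) (s : ℕ) : Prog :=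
  .seq (setup s) (.seq (call s DA.init) (mainPart DA s))

namespace Core
variable {X : Ctx} {C : Core X}

/-- Besides the variables of the main program: the counter, the flag, and register 0 of the dynamic
algorithm, which lies at 3 behind the registers of the budget. -/
def SetupVar (s x : ℕ) : Prop := x < ownVars ∨ x = regVar s 0 ∨ x = regVar s 1 ∨ x = regVar s 3
def SetupArr (s A : ℕ) : Prop := A < ownArrs ∨ A = regArr s 0 ∨ A = regArr s 1 ∨ A = regArr s 2

variable (X) in
def setupEnv (m₀ : State) (Lmax : ℕ) : Env :=
  plainEnv X.W X.B X.S X.κ Lmax (SetupVar X.s) (SetupArr X.s) m₀ X.le_B X.le_S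
    (by have := X.le_κ; omega) X.pow_le

theorem setup_adm (C : Core X) {m₀ : State} {l : ℕ} {e : Expr}
    (h : (e.check && decide (e.size ≤ sizeBound)) = true) : (setupEnv X m₀ l).Adm e := by
  simp only [Bool.and_eq_true, decide_eq_true_eq] at h
  exact ⟨Expr.ok_of_check (E := setupEnv X m₀ l) (fun x hx => .inl hx) (fun A hA => .inl hA) h.1,
    h.2.trans C.hS⟩

theorem eval_adjE {s : State} {r m a : ℕ} (h9 : s.reg 9 = (3 * r * (4 * m) : ℕ)) (h10 : s.reg 10 = (4 * m : ℕ))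
    (h20 : s.reg 20 = a) (ha : a < 3 * r * (4 * m) * (3 * r * (4 * m))) :
    adjE.eval s = (gridDrawing r m).input.arr 2 a := by
  classical
  have hN : 0 < 3 * r * (4 * m) := Nat.pos_of_mul_pos_left (by omega :
    0 < 3 * r * (4 * m) * (3 * r * (4 * m)))
  have h1 : a / (3 * r * (4 * m)) < 3 * r * (4 * m) := (Nat.div_lt_iff_lt_mul hN).2 ha
  have h2 := Nat.mod_lt a hN
  have e : (gridDrawing r m).input.arr 2 (a : ℤ) =
      if (gridDrawing r m).graph.Adj ⟨_, h1⟩ ⟨_, h2⟩ then 1 else 0 := by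
    have := matArr_apply (fun i j => if (gridDrawing r m).graph.Adj i j then (1 : ℤ) else 0) h1 h2
    rw [Nat.div_add_mod] at this
    simpa [Drawing.input] using this
  rw [e, adjE, Expr.eval_eq]
  simp only [Expr.eval_add, Expr.eval_mul, Expr.eval_sub, Expr.eval_div, Expr.eval_mod,
    Expr.eval_var, Expr.eval_one, h9, h10, h20]
  refine if_congr (Iff.trans ?_ Iff.rfl) rfl rfl
  change _ ↔ ((((a / (3 * r * (4 * m)) / (4 * m) : ℕ) : ℤ) - ((a % (3 * r * (4 * m)) / (4 * m) : ℕ) : ℤ)) * _ + _ * _ = 1)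
  push_cast
  rfl

variable (C) in
def setupCost (_ : Core X) : ℕ := 15 * X.κ + 6 * X.N * X.κ + 3 * (X.N * X.N) * X.κ

/-- The memory is ready for the preprocessing. -/
structure Ready (X : Ctx) (m : State) : Prop where
  cnt : m.reg (regVar X.s 0) = X.bud
  live : m.reg (regVar X.s 1) = 1
  size : m.reg (regVar X.s 3) = X.N
  pos₁ : m.arr (regArr X.s 0) = (gridDrawing X.r X.m).input.arr 0
  pos₂ : m.arr (regArr X.s 1) = (gridDrawing X.r X.m).input.arr 1
  adj : m.arr (regArr X.s 2) = (gridDrawing X.r X.m).input.arr 2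

theorem N_le_B (C : Core X) : X.N ≤ X.B := (Nat.le_mul_self _).trans C.B_N

theorem wp_setup {m₀ s : State} {l : ℕ} (hb : C.Base s)
    (h0 : ∀ A a, m₀.arr (regArr X.s A) a = 0) (hs : ∀ A, s.arr (regArr X.s A) = m₀.arr (regArr X.s A)) :
    (setupEnv X m₀ l).WP (setup X.s) C.setupCost 0 s () fun s' _ =>
      (∀ x < 20, s'.reg x = s.reg x) ∧ (∀ A < ownArrs, s'.arr A = s.arr A) ∧ Ready X s' := by
  have hκ : (setupEnv X m₀ l).κ = X.κ := rfl
  have hB : (setupEnv X m₀ l).B = X.B := rfl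
  have hw : 0 < X.w := by have := X.w_gt; omega
  have hV : ∀ {r}, r = 0 ∨ r = 1 ∨ r = 3 → (setupEnv X m₀ l).ownR (regVar X.s r) := by
    rintro r (rfl | rfl | rfl)
    · exact .inr (.inl rfl)
    · exact .inr (.inr (.inl rfl))
    · exact .inr (.inr (.inr rfl))
  have h20 : (setupEnv X m₀ l).ownR 20 := .inl (by norm_num)
  have h21 : (setupEnv X m₀ l).ownR 21 := .inl (by norm_num)
  have hle : ∀ r, 40 ≤ regVar X.s r := le_regVar X.s
  have hle' : ∀ A, 10 ≤ regArr X.s A := le_regArr X.s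
  have hneR : ∀ {r r'}, r ≠ r' → regVar X.s r ≠ regVar X.s r' := fun h h' => h (regVar_inj _ h')
  have hneA : ∀ {r r'}, r ≠ r' → regArr X.s r ≠ regArr X.s r' := fun h h' => h (regArr_inj _ h')
  have hNB := C.N_le_B
  have hB1 := X.le_B
  refine Env.WP.weaken (c := X.κ + (X.κ + (X.κ + ((4 * X.κ + X.N * (3 * X.κ)) +
      ((4 * X.κ + X.N * (3 * X.κ)) + (4 * X.κ + (X.N * X.N) * (3 * X.κ)))))))
    (d := 0 + (0 + (0 + (0 + (0 + 0))))) (Env.WP.seq (R := fun s' _ => s' = s.setReg (regVar X.s 0) X.bud) ?_ ?_)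
    (by rw [setupCost]; apply le_of_eq; ring) (by simp) (fun _ _ h => h)
  · exact Env.WP.asg (hV (.inl rfl)) (C.setup_adm (by decide)) (by
      rw [Expr.eval_var, hb.r4, hB]; simpa using C.B_bud) (by rw [Expr.eval_var, hb.r4])
  rintro s₁ ⟨⟩ rfl
  refine Env.WP.seq (R := fun s' _ => s' = (s.setReg (regVar X.s 0) X.bud).setReg (regVar X.s 1) 1) ?_ ?_
  · exact Env.WP.asg (hV (.inr (.inl rfl))) (C.setup_adm (by decide)) (by
      rw [Expr.eval_one, hB]; simp; omega) rfl
  rintro s₂ ⟨⟩ rfl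
  have h9 : ∀ {s' : State}, (∀ x < 20, s'.reg x = s.reg x) → s'.reg 9 = X.N := fun h => by
    rw [h 9 (by norm_num), hb.r9]
  have h10 : ∀ {s' : State}, (∀ x < 20, s'.reg x = s.reg x) → s'.reg 10 = X.w := fun h => by
    rw [h 10 (by norm_num), hb.r10]
  have hs₂ : ∀ x < 20, ((s.setReg (regVar X.s 0) X.bud).setReg (regVar X.s 1) 1).reg x = s.reg x := by
    intro x hx
    rw [State.setReg_reg, State.setReg_reg, if_neg (by have := hle 1; omega), if_neg (by have := hle 0; omega)]
  refine Env.WP.seq (R := fun s' _ => s' = ((s.setReg (regVar X.s 0) X.bud).setReg (regVar X.s 1) 1).setReg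
    (regVar X.s 3) X.N) ?_ ?_
  · exact Env.WP.asg (hV (.inr (.inr rfl))) (C.setup_adm (by decide)) (by
      rw [Expr.eval_var, h9 hs₂, hB]; rw [Nat.abs_cast]; exact_mod_cast hNB) (by rw [Expr.eval_var, h9 hs₂])
  rintro s₃ ⟨⟩ hs₃'
  have hs₃ : ∀ x < 20, s₃.reg x = s.reg x := by
    intro x hx
    rw [hs₃', State.setReg_reg, if_neg (by have := hle 3; omega), hs₂ x hx]
  have ha₃ : s₃.arr = s.arr := by rw [hs₃']; rfl
  have c₃ : s₃.reg (regVar X.s 0) = X.bud := by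
    rw [hs₃', State.setReg_reg, State.setReg_reg, State.setReg_reg, if_neg (hneR (by norm_num)),
      if_neg (hneR (by norm_num)), if_pos rfl]
  have l₃ : s₃.reg (regVar X.s 1) = 1 := by
    rw [hs₃', State.setReg_reg, State.setReg_reg, if_neg (hneR (by norm_num)), if_pos rfl]
  have n₃ : s₃.reg (regVar X.s 3) = X.N := by
    rw [hs₃', State.setReg_reg, if_pos rfl]
  clear hs₃'
  refine Env.WP.seq (Env.wp_fill (E := setupEnv X m₀ l) (s := s₃) (k := X.N) (f := fun a => ((a / X.w : ℕ) : ℤ)) h20 h21 (by norm_num)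
    (.inr (.inl rfl)) (C.setup_adm (e := var 9) (by decide)) (C.setup_adm (e := var 20 / var 10) (by decide))
    (h9 hs₃) hNB ?_) ?_
  · intro a ha s' ho _ h20
    have hr : ∀ x < 20, s'.reg x = s.reg x := fun x hx => (ho x (by omega) (by omega)).trans (hs₃ x hx)
    refine ⟨by rw [Expr.eval_div, Expr.eval_var, Expr.eval_var, h10 hr, h20]; push_cast; rfl, ?_⟩
    rw [hB, Nat.abs_cast]
    exact_mod_cast ((Nat.div_le_self _ _).trans ha.le).trans hNB
  rintro s₄ ⟨⟩ ⟨-, ho₄, ha₄, f₄, g₄⟩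
  have hs₄ : ∀ x < 20, s₄.reg x = s.reg x := fun x hx => (ho₄ x (by omega) (by omega)).trans (hs₃ x hx)
  refine Env.WP.seq (Env.wp_fill (E := setupEnv X m₀ l) (s := s₄) (k := X.N) (f := fun a => ((a % X.w : ℕ) : ℤ)) h20 h21 (by norm_num)
    (.inr (.inr (.inl rfl))) (C.setup_adm (e := var 9) (by decide)) (C.setup_adm (e := var 20 % var 10) (by decide))
    (h9 hs₄) hNB ?_) ?_
  · intro a ha s' ho _ h20
    have hr : ∀ x < 20, s'.reg x = s.reg x := fun x hx => (ho x (by omega) (by omega)).trans (hs₄ x hx)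
    refine ⟨by rw [Expr.eval_mod, Expr.eval_var, Expr.eval_var, h10 hr, h20]; push_cast; rfl, ?_⟩
    rw [hB, Nat.abs_cast]
    exact_mod_cast ((Nat.mod_le _ _).trans ha.le).trans hNB
  rintro s₅ ⟨⟩ ⟨-, ho₅, ha₅, f₅, g₅⟩
  have hs₅ : ∀ x < 20, s₅.reg x = s.reg x := fun x hx => (ho₅ x (by omega) (by omega)).trans (hs₄ x hx)
  refine (Env.wp_fill (E := setupEnv X m₀ l) (s := s₅) (k := X.N * X.N)
    (f := fun a => (gridDrawing X.r X.m).input.arr 2 a) h20 h21 (by norm_num)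
    (.inr (.inr (.inr rfl))) (C.setup_adm (e := var 9 * var 9) (by decide)) (C.setup_adm (e := adjE) (by decide))
    (by rw [Expr.eval_mul, Expr.eval_var, h9 hs₅]; push_cast; rfl) C.B_N ?_).mono ?_
  · intro a ha s' ho _ h20
    have hr : ∀ x < 20, s'.reg x = s.reg x := fun x hx => (ho x (by omega) (by omega)).trans (hs₅ x hx)
    have e := eval_adjE (h9 hr) (h10 hr) h20 ha
    refine ⟨e, ?_⟩
    rw [← e, adjE, Expr.eval_eq, hB]
    split_ifs
    · simp; omega
    · simp
  rintro s₆ ⟨⟩ ⟨-, ho₆, ha₆, f₆, g₆⟩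
  have hv : ∀ r, s₆.reg (regVar X.s r) = s₃.reg (regVar X.s r) := fun r => by
    have := hle r
    rw [ho₆ _ (by omega) (by omega), ho₅ _ (by omega) (by omega), ho₄ _ (by omega) (by omega)]
  -- An array agrees with `vecArr` if its first cells were filled correctly and all others still
  -- contain the initial 0.
  have hvec : ∀ {k : ℕ} {v : Fin k → ℤ} {g : ℤ → ℤ} {f : ℕ → ℤ}, (∀ a < k, g (a : ℕ) = f a) →
      (∀ a : ℤ, a < 0 ∨ k ≤ a → g a = 0) → (∀ a : Fin k, f a = v a) → g = vecArr v := by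
    intro k v g f h1 h2 h3
    funext a
    by_cases h : a < 0 ∨ (k : ℤ) ≤ a
    · rw [h2 a h, vecArr_of_not v h]
    · obtain ⟨b, rfl⟩ := Int.eq_ofNat_of_zero_le (show 0 ≤ a by omega)
      have hb' : b < k := by omega
      rw [h1 b hb', vecArr_apply v hb', ← h3 ⟨b, hb'⟩]
  refine ⟨fun x hx => (ho₆ x (by omega) (by omega)).trans (hs₅ x hx), fun A hA => ?_,
    ⟨by rw [hv, c₃], by rw [hv, l₃], by rw [hv, n₃], ?_, ?_, ?_⟩⟩
  · change A < 10 at hA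
    have h1 := hle' 0
    have h2 := hle' 1
    have h3 := hle' 2
    rw [ha₆ _ (by omega), ha₅ _ (by omega), ha₄ _ (by omega), ha₃]
  · have e : (gridDrawing X.r X.m).input.arr 0 =
        vecArr (fun i => (((gridDrawing X.r X.m).pos i).1 : ℤ)) := by simp [Drawing.input]
    rw [e]
    refine hvec (f := fun a => ((a / X.w : ℕ) : ℤ)) (fun a ha => ?_) (fun a ha => ?_) fun a => rfl
    · rw [ha₆ _ (hneA (by norm_num)), ha₅ _ (hneA (by norm_num)), f₄ a ha]
    · rw [ha₆ _ (hneA (by norm_num)), ha₅ _ (hneA (by norm_num)), g₄ a ha, ha₃, hs, h0]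
  · have e : (gridDrawing X.r X.m).input.arr 1 =
        vecArr (fun i => (((gridDrawing X.r X.m).pos i).2 : ℤ)) := by simp [Drawing.input]
    rw [e]
    refine hvec (f := fun a => ((a % X.w : ℕ) : ℤ)) (fun a ha => ?_) (fun a ha => ?_) fun a => rfl
    · rw [ha₆ _ (hneA (by norm_num)), f₅ a ha]
    · rw [ha₆ _ (hneA (by norm_num)), g₅ a ha, ha₄ _ (hneA (by norm_num)), ha₃, hs, h0]
  · classical
    have e : (gridDrawing X.r X.m).input.arr 2 = matArr (fun i j =>
        if (gridDrawing X.r X.m).graph.Adj i j then 1 else 0) := by simp [Drawing.input]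
    funext a
    by_cases h : a < 0 ∨ ((X.N * X.N : ℕ) : ℤ) ≤ a
    · rw [g₆ a h, ha₅ _ (hneA (by norm_num)), ha₄ _ (hneA (by norm_num)), ha₃, hs, h0, e, matArr,
        vecArr_of_not _ h]
    · obtain ⟨b, rfl⟩ := Int.eq_ofNat_of_zero_le (show 0 ≤ a by omega)
      exact f₆ b (by omega)

/-- The regions from the `s`-th one on are empty. -/
def Clean (s : ℕ) (m : State) : Prop :=
  ∀ s' ≥ s, (∀ r, m.reg (regVar s' r) = 0) ∧ ∀ A a, m.arr (regArr s' A) a = 0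

/-- Whatever the preparation did not write is still 0, as it is in the input of the preprocessing.
So the region holds exactly that input, with the full budget. -/
theorem Ready.alive {σ s₁ m₀ : State} {l l' p w : ℕ} (h : Ready X s₁) (hc : Clean X.s m₀)
    (hr : (setupEnv X m₀ l).Rep σ s₁ () l' p w) :
    Alive (region X.s σ.vars) (gridDrawing X.r X.m).input X.bud where
  core := by
    obtain ⟨-, hR, hA⟩ := hr.dyn
    refine State.ext' (fun r => ?_) fun A a => ?_
    · change σ.reg (2 * regVar X.s (r + 3)) = _
      rcases r with _ | r
      · rw [hr.reg _ (.inr (.inr (.inr rfl)))]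
        exact h.size.trans (by simp [Drawing.input])
      · have : ¬ SetupVar X.s (regVar X.s (r + 1 + 3)) := by
          have hle : 40 ≤ regVar X.s (r + 1 + 3) := le_regVar X.s _
          rintro (h | h | h | h)
          · change _ < 40 at h; omega
          all_goals · have := regVar_inj X.s h; omega
        rw [← State.vars_reg, hR _ this, (hc X.s le_rfl).1]
        simp [Drawing.input]
    · change σ.arr (regArr X.s A) a = _
      rcases A with _ | _ | _ | A
      · rw [hr.arr _ (.inr (.inl rfl)), h.pos₁]
      · rw [hr.arr _ (.inr (.inr (.inl rfl))), h.pos₂]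
      · rw [hr.arr _ (.inr (.inr (.inr rfl))), h.adj]
      · have : ¬ SetupArr X.s (regArr X.s (A + 1 + 1 + 1)) := by
          have hle : 10 ≤ regArr X.s (A + 1 + 1 + 1) := le_regArr X.s _
          rintro (h | h | h | h)
          · change _ < 10 at h; omega
          all_goals · have := regArr_inj X.s h; omega
        rw [← State.vars_arr, hA _ this, (hc X.s le_rfl).2]
        simp [Drawing.input]
  cnt := by
    change σ.reg (2 * regVar X.s 0) = _
    rw [hr.reg _ (.inr (.inl rfl)), h.cnt]
  live := by
    change σ.reg (2 * regVar X.s 1) = _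
    rw [hr.reg _ (.inr (.inr (.inl rfl))), h.live]

theorem Base.congr {s s' : State} (h : C.Base s) (hr : ∀ x < 12, s'.reg x = s.reg x)
    (ha : ∀ A < 2, s'.arr A = s.arr A) : C.Base s' where
  r0 := by rw [hr 0 (by omega), h.r0]
  r1 := by rw [hr 1 (by omega), h.r1]
  r2 := by rw [hr 2 (by omega), h.r2]
  r3 := by rw [hr 3 (by omega), h.r3]
  r4 := by rw [hr 4 (by omega), h.r4]
  r6 := by rw [hr 6 (by omega), h.r6]
  r7 := by rw [hr 7 (by omega), h.r7]
  r8 := by rw [hr 8 (by omega), h.r8]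
  r9 := by rw [hr 9 (by omega), h.r9]
  r10 := by rw [hr 10 (by omega), h.r10]
  r11 := by rw [hr 11 (by omega), h.r11]
  a0 := by rw [ha 0 (by omega), h.a0]
  a1 := by rw [ha 1 (by omega), h.a1]

/-- The result is written, unless the dynamic algorithm exceeds the budget. -/
theorem run {σ : State} (hb : C.Base σ.vars) (hB : X.env.Bounded σ.vars) (hc : Clean X.s σ.vars)
    (hl : 1 + C.mainCost ≤ X.Lmax) (hG : ∀ i j a, C.G i j = some a → |a| ≤ (C.V : ℤ))
    (hM' : ∀ q i j k, -(C.V : ℤ) ≤ squares C.G C.V C.np q i k + squares C.G C.V C.np q k j) :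
    ∃ t σ', Run X.W (coreProg X.DA X.s) σ t σ' ∧
      t ≤ C.setupCost + 10 * X.bud + X.DA.maxDead + C.mainCost ∧
      (∀ x < 12, σ'.vars.reg x = σ.vars.reg x) ∧ (∀ A < 2, σ'.arr A = σ.arr A) ∧
      X.env.Bounded σ'.vars ∧ Clean (X.s + 1) σ'.vars ∧
      (C.Result (squares C.G C.V C.np C.K) σ'.vars ∨
        (X.bud < X.KN + C.mainWeight ∧ σ'.arr 2 = σ.arr 2 ∧ σ'.arr 3 = σ.arr 3)) := by
  have h0 : (0 : ℤ) ≤ X.B := by positivity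
  have hrep : (setupEnv X σ.vars C.setupCost).Rep σ σ.vars () 0 0 0 := by
    refine ⟨fun _ _ => rfl, fun _ _ => rfl, ⟨fun x hx => ?_, fun A hA a => ?_⟩, rfl, fun _ _ => rfl,
      fun _ _ => rfl⟩
    · rcases hx with h | rfl | rfl | rfl
      · exact hB.1 x h
      all_goals rw [(hc X.s le_rfl).1, abs_zero]; exact h0
    · rcases hA with h | rfl | rfl | rfl
      · exact hB.2 A h a
      all_goals rw [(hc X.s le_rfl).2, abs_zero]; exact h0
  obtain ⟨t₁, σ₁, s₁, ⟨⟩, l₁, p₁, w₁, r₁, rep₁, -, ht₁, -, hr₁, ha₁, rdy⟩ :=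
    wp_setup (C := C) (l := C.setupCost) hb (fun A a => (hc X.s le_rfl).2 A a) (fun _ => rfl) σ 0 0 0 hrep
      (by rw [Nat.zero_add]; exact le_rfl)
  have halive := rdy.alive hc rep₁
  obtain ⟨hp₁, hR, hA⟩ := rep₁.dyn
  have hf₁ : Ctx.Fresh X.s σ₁.vars := by
    refine fun s' hs' => ⟨fun r => ?_, fun A a => ?_⟩
    · rw [hR, (hc s' (by omega)).1]
      have hle : 40 ≤ regVar s' r := le_regVar s' _
      rintro (h | h | h | h)
      · change _ < 40 at h; omega
      all_goals exact regVar_ne (by omega) _ _ h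
    · rw [hA, (hc s' (by omega)).2]
      have hle : 10 ≤ regArr s' A := le_regArr s' _
      rintro (h | h | h | h)
      · change _ < 10 at h; omega
      all_goals exact regArr_ne (by omega) _ _ h
  have hown : X.Own σ₁ s₁ := ⟨fun x hx => rep₁.reg x (.inl hx), fun A hA => rep₁.arr A (.inl hA),
    fun x hx => rep₁.bdd.1 x (.inl hx), fun A hA => rep₁.bdd.2 A (.inl hA)⟩
  -- The preprocessing is treated as an operation of weight 0 that lengthens the history by one; its
  -- time is at most `KN`. This is the 1 in `1 + C.mainCost`.
  obtain ⟨t₂, σ₂, al, p₂, r₂, o₂, d₂, ht₂, -⟩ := hown.op (P := X.DA.init) (E' := fun _ => none)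
    (al := true) (l := 0) (p := 10 * X.bud) (w := 0) (u := 0) (Post := fun _ => True) hf₁
    (by simp only [DynamicAlgorithm.maxDead]; omega) (fun _ => by
      obtain ⟨t, τ, h₁, h₂, h₃⟩ := Ctx.exists_init (X := X) (Nat.zero_le _)
      refine ⟨_, X.bud, 0, halive, rfl, rfl, t, τ, h₁, by omega, ?_, trivial⟩
      rw [slotGraph_none, Nat.zero_add]
      intro ops hops hlen
      obtain ⟨t', h₄, h₅⟩ := h₃ ops hops (by omega)
      exact ⟨t', h₄, by omega⟩) (by simp)
  have hb₁ : C.Base s₁ := hb.congr (fun x hx => hr₁ x (by omega)) fun A hA => ha₁ A (by change A < 10; omega)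
  obtain ⟨t₃, σ₃, s₃, ⟨E₃, al₃⟩, l₃, p₃, w₃, r₃, rep₃, -, ht₃, hw₃, hr₃, ha₃, hres⟩ :=
    wp_mainPart hb₁ hG hM' σ₂ 1 p₂ 0 ⟨o₂.reg, o₂.arr, o₂.bdd, d₂⟩ hl
  have hv : ∀ x < 40, σ₃.vars.reg x = s₃.reg x := fun x hx => rep₃.reg x hx
  have hv' : ∀ A < 10, σ₃.vars.arr A = s₃.arr A := fun A hA => rep₃.arr A hA
  refine ⟨_, σ₃, .seq r₁ (.seq r₂ r₃), by omega, fun x hx => ?_, fun A hA => ?_,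
    ⟨fun x hx => ?_, fun A hA a => ?_⟩, fun s' hs' => rep₃.dyn.2.2 s' (by omega), ?_⟩
  · rw [hv x (by omega), hr₃ x hx, hr₁ x (by omega)]
  · rw [← State.vars_arr, hv' A (by omega), ha₃ A hA, ha₁ A (by change A < 10; omega), State.vars_arr]
  · rw [hv x hx]; exact rep₃.bdd.1 x hx
  · rw [hv' A hA]; exact rep₃.bdd.2 A hA a
  · have e2 : s₁.arr 2 = σ.arr 2 := ha₁ 2 (by change 2 < 10; omega)
    have e3 : s₁.arr 3 = σ.arr 3 := ha₁ 3 (by change 3 < 10; omega)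
    have e2' : σ₃.vars.arr 2 = s₃.arr 2 := hv' 2 (by omega)
    have e3' : σ₃.vars.arr 3 = s₃.arr 3 := hv' 3 (by omega)
    rcases hres with ⟨-, h⟩ | ⟨hal, h2, h3⟩
    · left
      intro i hi j hj
      rw [e2', e3']
      exact h i hi j hj
    · right
      have := (rep₃.dyn.2.1 hal).2
      rw [State.vars_arr] at e2' e3'
      exact ⟨by omega, by rw [e2', h2, e2], by rw [e3', h3, e3]⟩

end Core
end FineGrained

namespace FineGrained

/-! ### The grid is in both classes -/

section Grid
variable {r m : ℕ}

theorem gridDrawing_placed : (gridDrawing r m).Placed := by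
  refine ⟨fun i j h => ?_, fun i => ⟨?_, ?_⟩⟩
  · have h1 : (i : ℕ) / (4 * m) = j / (4 * m) := congrArg Prod.fst h
    have h2 : (i : ℕ) % (4 * m) = j % (4 * m) := congrArg Prod.snd h
    ext
    rw [← Nat.div_add_mod i (4 * m), h1, h2, Nat.div_add_mod]
  · exact (Nat.div_le_self _ _).trans i.2.le
  · exact (Nat.mod_le _ _).trans i.2.le

theorem int_sq_add_sq_eq_one {x y : ℤ} (h : x * x + y * y = 1) :
    (x = 0 ∧ (y = 1 ∨ y = -1)) ∨ (y = 0 ∧ (x = 1 ∨ x = -1)) := by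
  have hx1 : x ≤ 1 := by nlinarith
  have hx2 : -1 ≤ x := by nlinarith
  have hy1 : y ≤ 1 := by nlinarith
  have hy2 : -1 ≤ y := by nlinarith
  interval_cases x <;> interval_cases y <;> simp_all

theorem gridDrawing_adj {i j : Fin (3 * r * (4 * m))} (h : (gridDrawing r m).graph.Adj i j) :
    (((gridDrawing r m).pos i).1 = ((gridDrawing r m).pos j).1 ∧
      (((gridDrawing r m).pos i).2 = ((gridDrawing r m).pos j).2 + 1 ∨
       ((gridDrawing r m).pos j).2 = ((gridDrawing r m).pos i).2 + 1)) ∨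
    (((gridDrawing r m).pos i).2 = ((gridDrawing r m).pos j).2 ∧
      (((gridDrawing r m).pos i).1 = ((gridDrawing r m).pos j).1 + 1 ∨
       ((gridDrawing r m).pos j).1 = ((gridDrawing r m).pos i).1 + 1)) := by
  have := int_sq_add_sq_eq_one (x := ((gridDrawing r m).pos i).1 - ((gridDrawing r m).pos j).1)
    (y := ((gridDrawing r m).pos i).2 - ((gridDrawing r m).pos j).2) h
  omega

theorem gridDrawing_mem_gridGraphs :
    gridGraphs _ (gridDrawing r m) := by
  refine ⟨gridDrawing_placed, fun i j h => ?_⟩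
  have := gridDrawing_adj h
  rcases this with ⟨h1, h2⟩ | ⟨h1, h2⟩
  · rw [h1, sub_self, abs_zero, zero_add]
    rcases h2 with h2 | h2 <;> rw [h2] <;> simp
  · rw [h1, sub_self, abs_zero, add_zero]
    rcases h2 with h2 | h2 <;> rw [h2] <;> simp

/-- A point strictly between two adjacent integer points. -/
theorem mem_openSegment_cases {N : ℕ} {D : Drawing N} {i j : Fin N} {p : ℝ × ℝ}
    (h : ((D.pos i).1 = (D.pos j).1 ∧ ((D.pos i).2 = (D.pos j).2 + 1 ∨ (D.pos j).2 = (D.pos i).2 + 1)) ∨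
      ((D.pos i).2 = (D.pos j).2 ∧ ((D.pos i).1 = (D.pos j).1 + 1 ∨ (D.pos j).1 = (D.pos i).1 + 1)))
    (hp : p ∈ openSegment ℝ (D.pt i) (D.pt j)) :
    ∃ a b : ℕ, (p.1 = a ∧ b < p.2 ∧ p.2 < b + 1 ∧ Sym2.map D.pos s(i, j) = s((a, b), (a, b + 1))) ∨
      (p.2 = b ∧ a < p.1 ∧ p.1 < a + 1 ∧ Sym2.map D.pos s(i, j) = s((a, b), (a + 1, b))) := by
  obtain ⟨s, t, hs, ht, hst, rfl⟩ := hp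
  obtain rfl : s = 1 - t := by linarith
  simp only [Drawing.pt, Prod.fst_add, Prod.smul_fst, Prod.snd_add, Prod.smul_snd, smul_eq_mul,
    Sym2.map_mk]
  rcases hi : D.pos i with ⟨xi, yi⟩
  rcases hj : D.pos j with ⟨xj, yj⟩
  rw [hi, hj] at h
  simp only at h
  rcases h with ⟨rfl, rfl | rfl⟩ | ⟨rfl, rfl | rfl⟩
  · refine ⟨xi, yj, .inl ⟨by ring, ?_, ?_, Sym2.eq_swap⟩⟩ <;> push_cast <;> nlinarith
  · refine ⟨xi, yi, .inl ⟨by ring, ?_, ?_, rfl⟩⟩ <;> push_cast <;> nlinarith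
  · refine ⟨xj, yi, .inr ⟨by ring, ?_, ?_, Sym2.eq_swap⟩⟩ <;> push_cast <;> nlinarith
  · refine ⟨xi, yi, .inr ⟨by ring, ?_, ?_, rfl⟩⟩ <;> push_cast <;> nlinarith

theorem nat_eq_of_between {a b : ℕ} {x : ℝ} (h1 : a < x) (h2 : x < a + 1) (h3 : b < x)
    (h4 : x < b + 1) : a = b := by
  have h5 : (a : ℝ) < b + 1 := h1.trans h4
  have h6 : (b : ℝ) < a + 1 := h3.trans h2
  norm_cast at h5 h6
  omega

theorem nat_not_between {a b : ℕ} {x : ℝ} (h1 : x = a) (h3 : b < x) (h4 : x < b + 1) : False := by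
  subst h1
  norm_cast at h3 h4
  omega

/-- A point inside a unit edge has one integer coordinate and one strictly between consecutive
integers. So it is no node, and it determines the edge. -/
theorem gridDrawing_planar : (gridDrawing r m).Planar := by
  refine ⟨fun i j k h hk => ?_, fun i j k l h h' hne => ?_⟩
  · obtain ⟨a, b, ⟨-, h1, h2, -⟩ | ⟨-, h1, h2, -⟩⟩ := mem_openSegment_cases (gridDrawing_adj h) hk
    · exact nat_not_between rfl h1 h2
    · exact nat_not_between rfl h1 h2
  · rw [Set.disjoint_left]
    intro p hp hp'
    refine hne (Sym2.map.injective gridDrawing_placed.1 ?_)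
    obtain ⟨a, b, ⟨h0, h1, h2, h3⟩ | ⟨h0, h1, h2, h3⟩⟩ := mem_openSegment_cases (gridDrawing_adj h) hp <;>
    obtain ⟨a', b', ⟨h0', h1', h2', h3'⟩ | ⟨h0', h1', h2', h3'⟩⟩ :=
      mem_openSegment_cases (gridDrawing_adj h') hp'
    · obtain rfl := nat_eq_of_between h1 h2 h1' h2'
      obtain rfl : a = a' := by rw [h0] at h0'; exact_mod_cast h0'
      rw [h3, h3']
    · exact (nat_not_between h0 h1' h2').elim
    · exact (nat_not_between h0 h1' h2').elim
    · obtain rfl := nat_eq_of_between h1 h2 h1' h2'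
      obtain rfl : b = b' := by rw [h0] at h0'; exact_mod_cast h0'
      rw [h3, h3']

/-- The chessboard colouring: neighbours differ in the parity of the sum of their coordinates. -/
theorem gridDrawing_isBipartite : (gridDrawing r m).graph.IsBipartite := by
  refine ⟨SimpleGraph.Coloring.mk (fun v => (⟨(((gridDrawing r m).pos v).1 +
    ((gridDrawing r m).pos v).2) % 2, Nat.mod_lt _ two_pos⟩ : Fin 2)) fun {i j} h => ?_⟩
  have := gridDrawing_adj h
  rw [Ne, Fin.mk.injEq]
  omega

theorem gridDrawing_mem {𝒞 : DrawingClass} (h𝒞 : 𝒞 ∈ ({bipartitePlane, gridGraphs} : Set DrawingClass)) :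
    𝒞 _ (gridDrawing r m) := by
  rcases h𝒞 with rfl | rfl
  · exact ⟨gridDrawing_placed, gridDrawing_planar, gridDrawing_isBipartite⟩
  · exact gridDrawing_mem_gridGraphs

end Grid
end FineGrained

namespace FineGrained

/-! ### Bounds on the running time -/

namespace Core
variable {X : Ctx} (C : Core X) {b g : ℕ}

theorem outer_mul : C.z * C.z * (X.r * X.m) * (X.r * X.m) = C.np ^ 2 := by rw [C.hnp]; ring

/-- There are `z m · z r` blocks, so a cost of at most `r m` for each of them amounts to at most
`np²`. -/
theorem outer_mul_le {x : ℕ} (hx : x ≤ X.r * X.m) : C.z * C.z * (X.r * X.m) * x ≤ C.np ^ 2 := by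
  rw [← C.outer_mul]; exact Nat.mul_le_mul_left _ hx

theorem prod_le_np : X.r * X.m ≤ C.np := by
  rw [C.hnp, mul_assoc]; exact Nat.le_mul_of_pos_left _ C.hz

theorem pow_le_cube {k : ℕ} (hk : k ≤ 3) : C.np ^ k ≤ C.np ^ 3 := Nat.pow_le_pow_right C.np_pos hk

/-- The reduction itself spends on each pair of a block and a row a multiple of `r + m` steps.
Multiplied by `b²`, this is still at most a multiple of `r m`, because both sides are at least `b²`.
-/
theorem sweepCost_mul_le (hr : b ^ 2 ≤ X.r) (hm : b ^ 2 ≤ X.m) :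
    C.sweepCost * b ^ 2 ≤ 63 * X.κ * C.np ^ 3 := by
  have hr0 := X.hr
  have hm0 := X.hm
  have hb : b ^ 2 ≤ X.r * X.m := hr.trans (Nat.le_mul_of_pos_right _ hm0)
  have hb' : b ^ 2 ≤ C.np := hb.trans C.prod_le_np
  have e1 : C.z * X.m * b ^ 2 ≤ C.np := by
    rw [C.hnp, mul_assoc, mul_assoc, mul_comm X.r]; gcongr
  have e2 := C.outer_mul_le hb
  have e3 : C.z * C.z * (X.r * X.m) * (X.r * b ^ 2) ≤ C.np ^ 2 := C.outer_mul_le (by gcongr)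
  have e4 : C.z * C.z * (X.r * X.m) * (X.m * b ^ 2) ≤ C.np ^ 2 := C.outer_mul_le (by
    rw [mul_comm X.r]; gcongr)
  have f1 : C.np ≤ C.np ^ 3 := by simpa using C.pow_le_cube (k := 1) (by norm_num)
  have f2 : C.np ^ 2 ≤ C.np ^ 3 := C.pow_le_cube (by norm_num)
  have g1 := hb'.trans f1
  have g2 := e1.trans f1
  have g3 := e2.trans f2
  calc C.sweepCost * b ^ 2 = X.κ * (4 * b ^ 2 + 6 * (C.z * X.m * b ^ 2) +
        14 * (C.z * C.z * (X.r * X.m) * b ^ 2) + 8 * (C.z * C.z * (X.r * X.m) * (X.r * X.m) * b ^ 2) +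
        C.np * (14 * (C.z * C.z * (X.r * X.m) * b ^ 2) + 6 * (C.z * C.z * (X.r * X.m) * (X.r * b ^ 2))
          + 11 * (C.z * C.z * (X.r * X.m) * (X.m * b ^ 2)))) := by
        rw [sweepCost, blockCost, rowCost]; ring
    _ ≤ X.κ * (4 * C.np ^ 3 + 6 * C.np ^ 3 + 14 * C.np ^ 3 + 8 * (C.np ^ 2 * C.np) +
        C.np * (14 * C.np ^ 2 + 6 * C.np ^ 2 + 11 * C.np ^ 2)) := by
        rw [C.outer_mul]
        gcongr
    _ = _ := by ring

/-- There are `g b` squarings, so one of the two factors `b` saved in a sweep is left over. -/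
theorem mainCost_mul_le (hK : C.K = g * b) (hr : b ^ 2 ≤ X.r) (hm : b ^ 2 ≤ X.m) :
    C.mainCost * b ≤ (126 + 79 * g) * X.κ * C.np ^ 3 := by
  have hr0 := X.hr
  have hb : b ^ 2 ≤ X.r * X.m := hr.trans (Nat.le_mul_of_pos_right _ X.hm)
  have hb2 : b ^ 2 ≤ C.np := hb.trans C.prod_le_np
  have hb1 : b ≤ C.np := (Nat.le_self_pow (by norm_num) b).trans hb2
  have hρ := C.prod_le_np
  have hn := C.n_le
  have hs := C.sweepCost_mul_le hr hm
  have f1 : C.np ≤ C.np ^ 3 := by simpa using C.pow_le_cube (k := 1) (by norm_num)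
  have f2 : C.np * C.np ≤ C.np ^ 3 := by rw [← sq]; exact C.pow_le_cube (by norm_num)
  have g1 := hb2.trans f1
  calc C.mainCost * b = X.κ * (21 * b + 3 * (C.np * C.np * b) + 96 * (X.r * X.m * b) +
        6 * (C.n * C.n * b)) + g * (X.κ * (10 * b ^ 2 + 6 * (C.np * C.np * b ^ 2)) +
          C.sweepCost * b ^ 2) := by
        rw [mainCost, squareCost, hK]; ring
    _ ≤ X.κ * (21 * C.np ^ 3 + 3 * (C.np * C.np * C.np) + 96 * C.np ^ 3 +
        6 * (C.np * C.np * C.np)) + g * (X.κ * (10 * C.np ^ 3 + 6 * (C.np * C.np * C.np)) +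
          63 * X.κ * C.np ^ 3) := by
        gcongr
        · exact hb1.trans f1
        · exact (Nat.mul_le_mul hρ hb1).trans f2
    _ = _ := by ring

theorem setupCost_mul_le (hb : X.r * X.m * b ≤ C.np) : C.setupCost * b ≤ 519 * X.κ * C.np ^ 3 := by
  have hr0 := X.hr
  have hm0 := X.hm
  have hρ := C.prod_le_np
  have hb' : b ≤ C.np := le_trans (Nat.le_mul_of_pos_left _ (Nat.mul_pos hr0 hm0)) hb
  have f1 : C.np ≤ C.np ^ 3 := by simpa using C.pow_le_cube (k := 1) (by norm_num)
  have f2 : C.np * C.np ≤ C.np ^ 3 := by rw [← sq]; exact C.pow_le_cube (by norm_num)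
  calc C.setupCost * b = X.κ * (15 * b + 72 * (X.r * X.m * b) + 432 * (X.r * X.m * (X.r * X.m * b))) := by
        rw [setupCost]; ring
    _ ≤ X.κ * (15 * C.np ^ 3 + 72 * C.np ^ 3 + 432 * C.np ^ 3) := by
        gcongr
        · exact hb'.trans f1
        · exact hb.trans f1
        · exact (Nat.mul_le_mul hρ hb).trans f2
    _ = _ := by ring

/-- The central count. Per block and row there are `2r + 4m` updates and `m` queries. After
multiplication by `b³`, the assumptions on `U` and `Q` turn `r U`, `m U` and `m Q` into at most `r
m`; for `m U` this uses `U ≤ Q`. -/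
theorem sweepWeight_mul_le (hU : X.U * b ^ 3 ≤ X.m) (hQ : X.Q * b ^ 3 ≤ X.r) (hUQ : X.U ≤ X.Q) :
    C.sweepWeight * b ^ 3 ≤ 9 * C.np ^ 3 := by
  have hm : X.m ≤ C.np := (Nat.le_mul_of_pos_left _ X.hr).trans C.prod_le_np
  have e3 : C.z * C.z * (X.r * X.m) * (X.r * (X.U * b ^ 3)) ≤ C.np ^ 2 := C.outer_mul_le (by gcongr)
  have e4 : C.z * C.z * (X.r * X.m) * (X.m * (X.Q * b ^ 3)) ≤ C.np ^ 2 := C.outer_mul_le (by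
    rw [mul_comm X.r]; gcongr)
  have hU' : X.U * b ^ 3 ≤ C.np := hU.trans hm
  calc C.sweepWeight * b ^ 3 = 2 * (C.z * C.z * (X.r * X.m) * (X.r * X.m) * (X.U * b ^ 3)) +
        C.np * (2 * (C.z * C.z * (X.r * X.m) * (X.r * (X.U * b ^ 3))) +
          4 * (C.z * C.z * (X.r * X.m) * (X.m * (X.U * b ^ 3))) +
          C.z * C.z * (X.r * X.m) * (X.m * (X.Q * b ^ 3))) := by
        rw [sweepWeight, blockWeight, rowWeight]; ring
    _ ≤ 2 * (C.np ^ 2 * C.np) + C.np * (2 * C.np ^ 2 + 4 * C.np ^ 2 + C.np ^ 2) := by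
        rw [C.outer_mul]
        gcongr
        exact le_trans (by gcongr) e4
    _ = _ := by ring

/-- The budget suffices. -/
theorem weight_mul_le (hU : X.U * b ^ 3 ≤ X.m) (hQ : X.Q * b ^ 3 ≤ X.r) (hUQ : X.U ≤ X.Q)
    (hK : C.K = g * b) (hbg : 9 * g + 25 ≤ b)
    (hKN : X.KN * b ^ 2 ≤ C.np ^ 3) : (X.KN + C.mainWeight) * b ≤ C.np ^ 3 := by
  have hr0 := X.hr
  have hρ := C.prod_le_np
  have hb0 : 0 < b := by omega
  have hm : X.m ≤ X.r * X.m := Nat.le_mul_of_pos_left _ hr0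
  have hUb : X.U * b ^ 2 ≤ X.m := le_trans (Nat.mul_le_mul_left _ (Nat.pow_le_pow_right hb0 (by norm_num))) hU
  have hs := C.sweepWeight_mul_le hU hQ hUQ
  have f1 : C.np ≤ C.np ^ 3 := by simpa using C.pow_le_cube (k := 1) (by norm_num)
  have f2 : C.np * C.np ≤ C.np ^ 3 := by rw [← sq]; exact C.pow_le_cube (by norm_num)
  have e : X.r * X.m * (X.U * b ^ 2) ≤ C.np ^ 3 := (Nat.mul_le_mul hρ (hUb.trans (hm.trans hρ))).trans f2
  -- With one more factor `b`, the preprocessing contributes 1, the base weights 24 and the `g b`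
  -- sweeps `9g` times `np³`; a factor `b` exceeding their sum is cancelled.
  refine Nat.le_of_mul_le_mul_right ?_ hb0
  calc (X.KN + C.mainWeight) * b * b = X.KN * b ^ 2 + 24 * (X.r * X.m * (X.U * b ^ 2)) +
        g * (C.sweepWeight * b ^ 3) := by rw [mainWeight, hK]; ring
    _ ≤ C.np ^ 3 + 24 * C.np ^ 3 + g * (9 * C.np ^ 3) := by gcongr
    _ = C.np ^ 3 * (9 * g + 25) := by ring
    _ ≤ C.np ^ 3 * b := by gcongr

end Core

/-! ### The side length -/

/-- The `g`-th root of `n`, rounded down. -/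
structure IsBase (g n b : ℕ) : Prop where
  pos : 1 ≤ b
  pow_le : b ^ g ≤ max n 1
  lt_pow : n < (b + 1) ^ g

theorem exists_isBase {g : ℕ} (hg : 1 ≤ g) (n : ℕ) : ∃ b, IsBase g n b := by
  have h : ∃ b, max n 1 < (b + 1) ^ g := ⟨max n 1, (Nat.lt_succ_self _).trans_le (Nat.le_self_pow (by omega) _)⟩
  classical
  refine ⟨Nat.find h, ?_, ?_, lt_of_le_of_lt (le_max_left _ _) (Nat.find_spec h)⟩
  · by_contra h0
    have := Nat.find_spec h
    rw [show Nat.find h = 0 by omega] at this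
    simp at this
  · rcases hb : Nat.find h with _ | b
    · rw [zero_pow (by omega)]; exact Nat.zero_le _
    · have := Nat.find_min h (m := b) (by omega)
      omega

/-- The program finds the root by search; uniqueness identifies the result with the number used in
the analysis. -/
theorem IsBase.unique {g n b b' : ℕ} (hg : 1 ≤ g) (h : IsBase g n b) (h' : IsBase g n b') : b = b' := by
  have key : ∀ {b b'}, IsBase g n b → IsBase g n b' → b' ≤ b := fun {b b'} h h' => by
    by_contra hlt
    have h1 : (b + 1) ^ g ≤ b' ^ g := Nat.pow_le_pow_left (by omega) _
    have h2 := h.lt_pow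
    have h3 := h'.pow_le
    have h4 : 2 ^ g ≤ (b + 1) ^ g := Nat.pow_le_pow_left (by have := h.pos; omega) _
    have h5 : 2 ≤ 2 ^ g := Nat.le_self_pow (by omega) 2
    rcases Nat.eq_zero_or_pos n with rfl | hn
    · simp at h3; omega
    · rw [max_eq_left hn] at h3; omega
  exact le_antisymm (key h' h) (key h h')

end FineGrained

namespace FineGrained
open FineGrained.Expr (var ld)

/-! ### The whole program -/

namespace Expr

def npow (e : Expr) : ℕ → Expr
  | 0 => 1
  | k + 1 => npow e k * e

theorem eval_npow (e : Expr) (s : State) (k : ℕ) : (npow e k).eval s = e.eval s ^ k := by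
  induction k with
  | zero => rw [npow, eval_one, pow_zero]
  | succ k ih => rw [npow, eval_mul, ih, pow_succ]

theorem size_npow (e : Expr) (k : ℕ) : (npow e k).size = k * (e.size + 1) + 1 := by
  induction k with
  | zero => simp [npow, OfNat.ofNat, size]
  | succ k ih =>
    change (npow e k).size + e.size + 1 = _
    rw [ih]; ring

theorem ok_npow {R A : ℕ → Prop} {B : ℕ} {e : Expr} (hB : 1 ≤ B) (he : e.Ok R A B) (k : ℕ) :
    (npow e k).Ok R A B := by
  induction k with
  | zero => exact show |(1 : ℤ)| ≤ B by simpa using hB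
  | succ k ih => exact ⟨trivial, ih, he⟩

end Expr

open FineGrained.Expr (npow)

/-- Compute the parameters. -/
def prelude (g d c Z : ℕ) : Prog :=
  .seq (asg 5 1)
    (.seq (for' 20 21 (var 0) (ite' (.op .lt (var 0) (npow (var 5 + 1) g)) .skip
      (asg 5 (var 5 + 1))))
    (.seq (asg 8 (var 0 / npow (var 5) (d + 4) + 1))
    (.seq (asg 1 (var 8 * npow (var 5) (d + 4)))
    (.seq (asg 2 (4 * npow (var 1) (c + 1)))
    (.seq (asg 3 (.cst g * var 5))
    (.seq (asg 4 (npow (var 1) 3 / var 5 + .cst Z))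
      (asg 9 (12 * npow (var 5) (d + 4)))))))))

/-- Run the main program on the grid with `3 * b ^ (k + 2)` rows. -/
def shape (DA : DynamicAlgorithm) (d k : ℕ) : Prog :=
  .seq (.seq (asg 6 (npow (var 5) (k + 2)))
    (.seq (asg 7 (npow (var 5) (d + 2 - k)))
    (.seq (asg 10 (4 * var 7))
      (asg 11 (2 * (16 * var 2 * var 6 * var 7 * var 7)))))) (coreProg DA k)

def shapes (DA : DynamicAlgorithm) (d : ℕ) : ℕ → Prog
  | 0 => .skip
  | k + 1 => .seq (shapes DA d k) (shape DA d k)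

def apspProg (DA : DynamicAlgorithm) (g d c Z : ℕ) : Prog :=
  .seq (prelude g d c Z) (shapes DA d (d + 1))

/-- Every shape has `r · m = b ^ (d + 4)`, so one padded size fits all of them. Adding 1 after the
division makes it exceed `n`, also for `n = 0`. -/
abbrev outerOf (d n b : ℕ) : ℕ := n / b ^ (d + 4) + 1
abbrev paddedSize (d n b : ℕ) : ℕ := outerOf d n b * b ^ (d + 4)

/-- A run of the whole program. -/
structure Setting where
  DA : DynamicAlgorithm
  (g d c cw Z n b KN U Q W Lmax B S κ : ℕ)
  G : WDigraph n
  inst : APSPInstance c G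
  base : IsBase g n b
  le_g : 2 * (d + 4) + 1 ≤ g
  le_S : sizeBound + 10 * (g + d + c + 10) ≤ S
  le_κ : 10 * S + 40 + DA.maxDead ≤ κ
  pow_le : B ^ S ≤ W
  hL : ∀ k ≤ d, 2 * halfL (4 * paddedSize d n b ^ (c + 1)) (b ^ (k + 2)) (b ^ (d + 2 - k)) ≤
    (3 * b ^ (k + 2) * (4 * b ^ (d + 2 - k))) ^ cw
  B_L : ∀ k ≤ d, 20 * (b ^ (k + 2) * b ^ (d + 2 - k)) *
    (2 * halfL (4 * paddedSize d n b ^ (c + 1)) (b ^ (k + 2)) (b ^ (d + 2 - k))) ≤ B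
  B_N : 12 * b ^ (d + 4) * (12 * b ^ (d + 4)) ≤ B
  B_np : paddedSize d n b * paddedSize d n b ≤ B
  B_K : g * b ≤ B
  B_bud : paddedSize d n b ^ 3 / b + Z ≤ B
  B_const : 100 ≤ B
  le_Lmax : 1 + (126 + 79 * g) * κ * paddedSize d n b ^ 3 ≤ Lmax
  solves : ∀ k ≤ d, ∀ ops : List (Op (3 * b ^ (k + 2) * (4 * b ^ (d + 2 - k)))),
    Legal (gridDrawing (b ^ (k + 2)) (b ^ (d + 2 - k))).graph cw (fun _ => none) ops →
    ops.length ≤ Lmax →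
    ∃ t₀ t σ, Run W DA.init (gridDrawing (b ^ (k + 2)) (b ^ (d + 2 - k))).input t₀ σ ∧
      Serves W DA σ (fun _ => none) ops t ∧ t₀ + t ≤ KN + opsWeight U Q ops

namespace Setting
variable (T : Setting)

abbrev z : ℕ := outerOf T.d T.n T.b
abbrev np : ℕ := paddedSize T.d T.n T.b
abbrev V : ℕ := 4 * T.np ^ (T.c + 1)
abbrev K : ℕ := T.g * T.b
abbrev bud : ℕ := T.np ^ 3 / T.b + T.Z

theorem b_pow_pos (k : ℕ) : 0 < T.b ^ k := Nat.pow_pos T.base.pos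

theorem pow_mul_pow {k : ℕ} (hk : k ≤ T.d) : T.b ^ (k + 2) * T.b ^ (T.d + 2 - k) = T.b ^ (T.d + 4) := by
  rw [← pow_add]; congr 1; omega

theorem n_lt_np : T.n < T.np := by
  have := Nat.lt_div_mul_add (a := T.n) (T.b_pow_pos (T.d + 4))
  change T.n < (T.n / T.b ^ (T.d + 4) + 1) * T.b ^ (T.d + 4)
  rw [Nat.add_mul, one_mul]; omega

theorem np_pos : 0 < T.np := (Nat.zero_le _).trans_lt T.n_lt_np

theorem np_le_B : T.np ≤ T.B := (Nat.le_mul_self _).trans T.B_np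

theorem V_le_B : T.V ≤ T.B := by
  refine le_trans ?_ (T.B_L 0 (Nat.zero_le _))
  have h1 := T.b_pow_pos (0 + 2)
  have h2 := T.b_pow_pos (T.d + 2 - 0)
  rw [halfL]
  calc T.V = 1 * (1 * 1) * (1 * (1 * T.V * 1 * 1 * 1)) := by ring
    _ ≤ _ := by gcongr <;> omega

theorem bud_le_W : T.bud ≤ T.W := by
  refine (T.B_bud.trans (Nat.le_self_pow ?_ _)).trans T.pow_le
  have := T.le_S
  omega

/-- The setting of the `k`-th shape. -/
def ctx {k : ℕ} (hk : k ≤ T.d) : Ctx where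
  DA := T.DA
  r := T.b ^ (k + 2)
  m := T.b ^ (T.d + 2 - k)
  cw := T.cw
  KN := T.KN
  U := T.U
  Q := T.Q
  W := T.W
  Lmax := T.Lmax
  bud := T.bud
  B := T.B
  S := T.S
  κ := T.κ
  s := k
  hr := T.b_pow_pos _
  hm := T.b_pow_pos _
  le_B := T.B_const
  le_S := by have := T.le_S; omega
  le_κ := T.le_κ
  pow_le := T.pow_le
  bud_le := T.bud_le_W
  solves := T.solves k hk

theorem ctx_N {k : ℕ} (hk : k ≤ T.d) : (T.ctx hk).N = 12 * T.b ^ (T.d + 4) := by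
  rw [← T.pow_mul_pow hk]
  change 3 * T.b ^ (k + 2) * (4 * T.b ^ (T.d + 2 - k)) = _
  ring

def core {k : ℕ} (hk : k ≤ T.d) : Core (T.ctx hk) where
  n := T.n
  np := T.np
  V := T.V
  K := T.K
  z := T.z
  G := T.G
  hz := Nat.succ_pos _
  hnp := by
    rw [mul_assoc]
    exact congrArg (T.z * ·) (T.pow_mul_pow hk).symm
  n_le := T.n_lt_np.le
  hV := Nat.mul_pos (by norm_num) (Nat.pow_pos T.np_pos)
  hL := T.hL k hk
  hS := by have := T.le_S; change sizeBound ≤ T.S; omega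
  B_L := T.B_L k hk
  B_N := by rw [T.ctx_N hk]; exact T.B_N
  B_np := T.B_np
  B_K := T.B_K
  B_bud := T.B_bud

/-- The part of the state that the main program works with is bounded. -/
def Bdd (s : State) : Prop :=
  (∀ x < ownVars, |s.reg x| ≤ (T.B : ℤ)) ∧ ∀ A < ownArrs, ∀ a, |s.arr A a| ≤ (T.B : ℤ)

/-- The parameters that do not depend on the shape are in their variables, the input is in its
arrays, and the regions from the `k`-th one on are empty. -/
structure Inv (k : ℕ) (s : State) : Prop where
  r0 : s.reg 0 = T.n
  r1 : s.reg 1 = T.np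
  r2 : s.reg 2 = T.V
  r3 : s.reg 3 = T.K
  r4 : s.reg 4 = T.bud
  r5 : s.reg 5 = T.b
  r8 : s.reg 8 = T.z
  r9 : s.reg 9 = (12 * T.b ^ (T.d + 4) : ℕ)
  a0 : s.arr 0 = (apspInput T.G).arr 0
  a1 : s.arr 1 = (apspInput T.G).arr 1
  bdd : T.Bdd s
  clean : Core.Clean k s

def env (m₀ : State) (l : ℕ) : Env :=
  plainEnv T.W T.B T.S T.κ l (· < ownVars) (· < ownArrs) m₀ T.B_const
    (by have := T.le_S; omega) (by have := T.le_κ; omega) T.pow_le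

variable {T}

theorem run_of_wp {P : Prog} {c : ℕ} {σ : State} {Q : State → Prop}
    (hb : T.Bdd σ.vars)
    (h : (T.env σ.vars c).WP P c 0 σ.vars () fun s _ => Q s) :
    ∃ t σ' s', Run T.W P σ t σ' ∧ t ≤ c ∧ (∀ x < ownVars, σ'.vars.reg x = s'.reg x) ∧
      (∀ A < ownArrs, σ'.vars.arr A = s'.arr A) ∧
      T.Bdd σ'.vars ∧
      (∀ k, Core.Clean k σ.vars → Core.Clean k σ'.vars) ∧ Q s' := by
  obtain ⟨t, σ', s', ⟨⟩, l', p', w', h₁, h₂, -, h₃, -, h₄⟩ := h σ 0 0 0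
    ⟨fun _ _ => rfl, fun _ _ => rfl, hb, rfl, fun _ _ => rfl, fun _ _ => rfl⟩
    (by rw [Nat.zero_add]; exact le_rfl)
  refine ⟨t, σ', s', h₁, by omega, h₂.reg, h₂.arr, ⟨fun x hx => ?_, fun A hA a => ?_⟩, fun k hk s hs => ⟨fun r => ?_,
    fun A a => ?_⟩, h₄⟩
  · rw [State.vars_reg, h₂.reg x hx]; exact h₂.bdd.1 x hx
  · rw [State.vars_arr, h₂.arr A hA]; exact h₂.bdd.2 A hA a
  · rw [h₂.dyn.2.1 _ (not_lt.2 (le_regVar s r)), (hk s hs).1]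
  · rw [h₂.dyn.2.2 _ (not_lt.2 (le_regArr s A)), (hk s hs).2]

theorem ok_var {x : ℕ} (hx : x < ownVars) : (var x).Ok (· < ownVars) (· < ownArrs) T.B := hx

theorem ok_ofNat {k : ℕ} (hk : k ≤ T.B) : (Expr.cst k).Ok (· < ownVars) (· < ownArrs) T.B := by
  change |(k : ℤ)| ≤ T.B
  rw [Nat.abs_cast]; exact_mod_cast hk

theorem one_le_B : 1 ≤ T.B := le_trans (by norm_num) T.B_const

theorem wp_asg {m₀ s : State} {l x v : ℕ} {e : Expr} {R : State → Prop} (hx : x < ownVars)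
    (hok : e.Ok (· < ownVars) (· < ownArrs) T.B) (hsz : e.size ≤ T.S) (hv : e.eval s = v)
    (hvB : v ≤ T.B) (hR : R (s.setReg x v)) :
    (T.env m₀ l).WP (asg x e) T.κ 0 s () fun s' _ => R s' := by
  refine Env.WP.asg (E := T.env m₀ l) hx ⟨hok, hsz⟩ ?_ ?_
  · rw [hv, Nat.abs_cast]; exact_mod_cast hvB
  · rw [hv]; exact hR

theorem Inv.congr {k : ℕ} {s s' : State} (h : T.Inv k s)
    (hr : ∀ x < 12, x ≠ 6 → x ≠ 7 → x ≠ 10 → x ≠ 11 → s'.reg x = s.reg x)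
    (ha : ∀ A < 2, s'.arr A = s.arr A)
    (hb : T.Bdd s') {k' : ℕ}
    (hc : Core.Clean k' s') : T.Inv k' s' where
  r0 := by rw [hr 0 (by omega) (by omega) (by omega) (by omega) (by omega), h.r0]
  r1 := by rw [hr 1 (by omega) (by omega) (by omega) (by omega) (by omega), h.r1]
  r2 := by rw [hr 2 (by omega) (by omega) (by omega) (by omega) (by omega), h.r2]
  r3 := by rw [hr 3 (by omega) (by omega) (by omega) (by omega) (by omega), h.r3]
  r4 := by rw [hr 4 (by omega) (by omega) (by omega) (by omega) (by omega), h.r4]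
  r5 := by rw [hr 5 (by omega) (by omega) (by omega) (by omega) (by omega), h.r5]
  r8 := by rw [hr 8 (by omega) (by omega) (by omega) (by omega) (by omega), h.r8]
  r9 := by rw [hr 9 (by omega) (by omega) (by omega) (by omega) (by omega), h.r9]
  a0 := by rw [ha 0 (by omega), h.a0]
  a1 := by rw [ha 1 (by omega), h.a1]
  bdd := hb
  clean := hc

theorem wp_shapeParams {m₀ s : State} {k l : ℕ} (hk : k ≤ T.d) (h : T.Inv k s) :
    (T.env m₀ l).WP (.seq (asg 6 (npow (var 5) (k + 2))) (.seq (asg 7 (npow (var 5) (T.d + 2 - k)))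
      (.seq (asg 10 (4 * var 7)) (asg 11 (2 * (16 * var 2 * var 6 * var 7 * var 7))))))
      (T.κ + (T.κ + (T.κ + T.κ))) (0 + (0 + (0 + 0))) s () fun s' _ =>
      (∀ x < 12, x ≠ 6 → x ≠ 7 → x ≠ 10 → x ≠ 11 → s'.reg x = s.reg x) ∧ s'.arr = s.arr ∧
      s'.reg 6 = (T.b ^ (k + 2) : ℕ) ∧ s'.reg 7 = (T.b ^ (T.d + 2 - k) : ℕ) ∧
      s'.reg 10 = (4 * T.b ^ (T.d + 2 - k) : ℕ) ∧
      s'.reg 11 = (2 * halfL T.V (T.b ^ (k + 2)) (T.b ^ (T.d + 2 - k)) : ℕ) := by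
  have hS := T.le_S
  have hL := (Nat.le_mul_of_pos_left _ (Nat.mul_pos (by norm_num : 0 < 20)
    (Nat.mul_pos (T.b_pow_pos (k + 2)) (T.b_pow_pos (T.d + 2 - k))))).trans (T.B_L k hk)
  have hρ : T.b ^ (T.d + 4) ≤ T.np := Nat.le_mul_of_pos_left _ (Nat.succ_pos _)
  have hρ' := T.pow_mul_pow hk
  have h1 : T.b ^ (k + 2) ≤ T.B := ((Nat.le_mul_of_pos_right _ (T.b_pow_pos _)).trans hρ'.le).trans
    (hρ.trans T.np_le_B)
  have hN : 12 * T.b ^ (T.d + 4) ≤ T.B := (Nat.le_mul_self _).trans T.B_N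
  have h3 : T.b ^ (T.d + 2 - k) ≤ T.b ^ (T.d + 4) :=
    (Nat.le_mul_of_pos_left _ (T.b_pow_pos _)).trans hρ'.le
  refine Env.WP.seq (E := T.env m₀ l) (wp_asg (by norm_num) (Expr.ok_npow one_le_B (ok_var (by norm_num)) _)
    (by rw [Expr.size_npow, Expr.size]; omega) (v := T.b ^ (k + 2))
    (by rw [Expr.eval_npow, Expr.eval_var, h.r5]; push_cast; rfl) h1
    (R := fun s' => s' = s.setReg 6 (T.b ^ (k + 2) : ℕ)) rfl) ?_
  rintro s₁ ⟨⟩ rfl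
  refine Env.WP.seq (E := T.env m₀ l) (wp_asg (by norm_num) (Expr.ok_npow one_le_B (ok_var (by norm_num)) _)
    (by rw [Expr.size_npow, Expr.size]; omega) (v := T.b ^ (T.d + 2 - k))
    (by rw [Expr.eval_npow, Expr.eval_var, State.setReg_reg, if_neg (by norm_num), h.r5]; push_cast; rfl) (by omega)
    (R := fun s' => s' = (s.setReg 6 (T.b ^ (k + 2) : ℕ)).setReg 7 (T.b ^ (T.d + 2 - k) : ℕ)) rfl) ?_
  rintro s₂ ⟨⟩ rfl
  refine Env.WP.seq (E := T.env m₀ l) (wp_asg (by norm_num) ⟨trivial, ok_ofNat (k := 4)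
      (by have := T.B_const; omega), ok_var (by norm_num)⟩
    (by change 1 + 1 + 1 ≤ _; omega) (v := 4 * T.b ^ (T.d + 2 - k))
    (by rw [Expr.eval_mul, Expr.eval_four, Expr.eval_var, State.setReg_reg, if_pos rfl]; push_cast; rfl) (by omega)
    (R := fun s' => s' = ((s.setReg 6 (T.b ^ (k + 2) : ℕ)).setReg 7 (T.b ^ (T.d + 2 - k) : ℕ)).setReg 10
      (4 * T.b ^ (T.d + 2 - k) : ℕ)) rfl) ?_
  rintro s₃ ⟨⟩ rfl
  refine wp_asg (by norm_num) ⟨trivial, ok_ofNat (k := 2) (by have := T.B_const; omega), trivial,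
    ⟨trivial, ⟨trivial, ⟨trivial, ok_ofNat (k := 16) (by have := T.B_const; omega), ok_var (by norm_num)⟩,
      ok_var (by norm_num)⟩, ok_var (by norm_num)⟩, ok_var (by norm_num)⟩
    (by change 1 + (1 + 1 + 1 + 1 + 1 + 1 + 1 + 1 + 1) + 1 ≤ _; omega)
    (v := 2 * halfL T.V (T.b ^ (k + 2)) (T.b ^ (T.d + 2 - k))) ?_ hL ?_
  · simp only [Expr.eval_mul, Expr.eval_var, State.setReg_reg, halfL, h.r2, Expr.eval_two]
    norm_num [Expr.eval, OfNat.ofNat, h.r2]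
  · refine ⟨fun x _ h6 h7 h10 h11 => ?_, rfl, ?_, ?_, ?_, ?_⟩
    · simp [h6, h7, h10, h11]
    all_goals simp

end Setting
end FineGrained

/-! ### Correctness and running time of the whole program -/

namespace FineGrained
open FineGrained.Expr (var ld npow)

namespace Setting
variable {T : Setting}

theorem n_pow_le : T.n ^ T.c ≤ T.np ^ (T.c + 1) :=
  (Nat.pow_le_pow_left T.n_lt_np.le _).trans (Nat.pow_le_pow_right T.np_pos (by omega))

theorem n_mul_pow_le : T.n * T.n ^ T.c ≤ T.np ^ (T.c + 1) := by
  rw [pow_succ']; exact Nat.mul_le_mul T.n_lt_np.le (Nat.pow_le_pow_left T.n_lt_np.le _)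

theorem abs_weight_le {i j : Fin T.n} {a : ℤ} (h : T.G i j = some a) : |a| ≤ (T.V : ℤ) := by
  refine (T.inst.1 i j a h).trans ?_
  have := T.n_pow_le
  have h2 : T.n ^ T.c ≤ T.V := by
    change _ ≤ 4 * T.np ^ (T.c + 1)
    omega
  exact_mod_cast h2

/-- The potential telescopes: the sum is at least `ψ j - ψ i`, hence at least minus a quarter of
`V`. This provides `Good` for every intermediate matrix. -/
theorem squares_add_ge (q i j k : ℕ) :
    -(T.V : ℤ) ≤ squares T.G T.V T.np q i k + squares T.G T.V T.np q k j := by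
  obtain ⟨ψ, hψ, hs⟩ := squares_spec T.inst n_mul_pow_le (Nat.pow_pos T.np_pos) n_pow_le T.np
  have e : (T.V : ℤ) = 4 * ((T.np ^ (T.c + 1) : ℕ) : ℤ) := by push_cast; rfl
  rw [e]
  have h1 := (hs q i k).2.1
  have h2 := (hs q k j).2.1
  have h3 := hψ i
  have h4 := hψ j
  linarith

/-- The output is correct. -/
def Correct (T : Setting) (s : State) : Prop :=
  ∀ i < T.n, ∀ j < T.n, s.arr 2 ((T.n * i + j : ℕ) : ℤ) =
      (if (T.V : ℤ) < 4 * squares T.G T.V T.np T.K i j then 0 else 1) ∧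
    s.arr 3 ((T.n * i + j : ℕ) : ℤ) = squares T.G T.V T.np T.K i j

/-- Since `n < (b + 1) ^ g` and `b + 1 ≤ 2 ^ b`, `g b` squarings suffice. This is far more than a
logarithm, but it is easy to compute and the factor `b` has been allowed for. -/
theorem n_le_two_pow : T.n ≤ 2 ^ T.K := by
  refine T.base.lt_pow.le.trans ?_
  rw [show T.K = T.b * T.g from mul_comm _ _, pow_mul]
  exact Nat.pow_le_pow_left Nat.lt_two_pow_self _

theorem Correct.output {σ : State} (h : T.Correct σ.vars) : APSPOutput T.G σ := by
  intro i j
  obtain ⟨h2, h3⟩ := h i i.2 j j.2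
  obtain ⟨c₁, c₂⟩ := squares_correct T.inst n_mul_pow_le (Nat.pow_pos T.np_pos) n_pow_le
    (N := T.np) T.n_lt_np.le T.n_le_two_pow i j
  have e : (T.V : ℤ) = 4 * ((T.np ^ (T.c + 1) : ℕ) : ℤ) := by push_cast; rfl
  rw [State.vars_arr] at h2 h3
  push_cast at h2 h3
  rw [← e] at c₁ c₂
  -- As `V = 4Y`, the test `V < 4M` of the program asks whether the entry exceeds `Y`, that is,
  -- whether the node is unreachable.
  by_cases hV : (T.V : ℤ) < 4 * squares T.G T.V T.np T.K i j
  · left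
    refine ⟨?_, c₂ (by omega)⟩
    rw [h2]; exact if_pos hV
  · right
    refine ⟨?_, ?_⟩
    · rw [h2]; exact if_neg hV
    · rw [h3]; exact c₁ (by omega)

theorem b_le_n : T.b ≤ max T.n 1 := by
  refine (Nat.le_self_pow ?_ _).trans T.base.pow_le
  have := T.le_g
  omega

theorem max_le_np : max T.n 1 ≤ T.np := max_le T.n_lt_np.le T.np_pos

theorem b_le_np : T.b ≤ T.np := b_le_n.trans max_le_np

theorem np_le : T.np ≤ 2 * max T.n 1 := by
  have h : T.b ^ (T.d + 4) ≤ max T.n 1 :=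
    (Nat.pow_le_pow_right T.base.pos (by have := T.le_g; omega)).trans T.base.pow_le
  have h2 : T.n / T.b ^ (T.d + 4) * T.b ^ (T.d + 4) ≤ T.n := Nat.div_mul_le_self _ _
  change (T.n / T.b ^ (T.d + 4) + 1) * T.b ^ (T.d + 4) ≤ _
  rw [Nat.add_mul, one_mul]
  have := le_max_left T.n 1
  omega

theorem side_mul_le : T.b ^ (T.d + 4) * T.b ≤ T.np := by
  rw [← pow_succ]
  exact ((Nat.pow_le_pow_right T.base.pos (by have := T.le_g; omega)).trans T.base.pow_le).trans
    max_le_np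

theorem mainCost_mul_le {k : ℕ} (hk : k ≤ T.d) :
    (T.core hk).mainCost * T.b ≤ (126 + 79 * T.g) * T.κ * T.np ^ 3 :=
  (T.core hk).mainCost_mul_le (b := T.b) (g := T.g) rfl
    (Nat.pow_le_pow_right T.base.pos (by omega)) (Nat.pow_le_pow_right T.base.pos (by omega))

theorem setupCost_mul_le {k : ℕ} (hk : k ≤ T.d) :
    (T.core hk).setupCost * T.b ≤ 519 * T.κ * T.np ^ 3 := by
  refine (T.core hk).setupCost_mul_le (b := T.b) ?_
  change T.b ^ (k + 2) * T.b ^ (T.d + 2 - k) * T.b ≤ _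
  rw [T.pow_mul_pow hk]
  exact side_mul_le

/-- The preparation, ten times the budget, and the overhead of the reduction are each at most a
constant times `np³ / b`. The time does not depend on whether the budget lasts. -/
theorem run_shape {k : ℕ} (hk : k ≤ T.d) {σ : State} (h : T.Inv k σ.vars) :
    ∃ t σ', Run T.W (shape T.DA T.d k) σ t σ' ∧
      t * T.b ≤ ((650 + 79 * T.g) * T.κ + 10 * (T.Z + 1)) * T.np ^ 3 ∧ T.Inv (k + 1) σ'.vars ∧
      (T.Correct σ'.vars ∨ (T.bud < T.KN + (T.core hk).mainWeight ∧
        σ'.arr 2 = σ.arr 2 ∧ σ'.arr 3 = σ.arr 3)) := by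
  obtain ⟨t₁, σ₁, s₁, r₁, ht₁, hr₁, ha₁, hb₁, hc₁, e₁, e₂, e6, e7, e10, e11⟩ :=
    run_of_wp h.bdd (wp_shapeParams hk h)
  have hI : T.Inv k σ₁.vars := by
    refine h.congr (fun x hx h6 h7 h10 h11 => ?_) (fun A hA => ?_) hb₁ (hc₁ k h.clean)
    · rw [hr₁ x (by change x < 40; omega), e₁ x hx h6 h7 h10 h11]
    · rw [ha₁ A (by change A < 10; omega), e₂]
  have hbase : (T.core hk).Base σ₁.vars := {
    r0 := hI.r0
    r1 := hI.r1
    r2 := hI.r2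
    r3 := hI.r3
    r4 := hI.r4
    r6 := (hr₁ 6 (by norm_num)).trans e6
    r7 := (hr₁ 7 (by norm_num)).trans e7
    r8 := hI.r8
    r9 := by rw [hI.r9, T.ctx_N]
    r10 := (hr₁ 10 (by norm_num)).trans e10
    r11 := (hr₁ 11 (by norm_num)).trans e11
    a0 := hI.a0
    a1 := hI.a1 }
  have hb0 := T.base.pos
  have hm := T.mainCost_mul_le hk
  obtain ⟨t₂, σ₂, r₂, ht₂, hr₂, ha₂, hb₂, hc₂, hres⟩ := (T.core hk).run hbase hb₁ hI.clean (by
      have h1 := Nat.le_mul_of_pos_right (T.core hk).mainCost hb0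
      have h2 : 1 + (126 + 79 * T.g) * T.κ * T.np ^ 3 ≤ T.Lmax := T.le_Lmax
      change 1 + (T.core hk).mainCost ≤ T.Lmax
      omega) (fun i j a => abs_weight_le) squares_add_ge
  refine ⟨_, σ₂, .seq r₁ r₂, ?_, hI.congr (fun x hx _ _ _ _ => hr₂ x hx) (fun A hA => ha₂ A hA)
    hb₂ hc₂, ?_⟩
  · have hs := T.setupCost_mul_le hk
    have hnp := T.np_pos
    have f1 : T.b ≤ T.np ^ 3 := b_le_np.trans (Nat.le_self_pow (by norm_num) _)
    have f0 : T.np ^ 3 / T.b * T.b ≤ T.np ^ 3 := Nat.div_mul_le_self _ _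
    have hd : T.DA.maxDead ≤ T.κ := by have := T.le_κ; omega
    have ht : t₁ + t₂ ≤ 4 * T.κ + ((T.core hk).setupCost + 10 * (T.np ^ 3 / T.b + T.Z) + T.κ +
        (T.core hk).mainCost) := by
      have : t₂ ≤ (T.core hk).setupCost + 10 * (T.np ^ 3 / T.b + T.Z) + T.DA.maxDead +
        (T.core hk).mainCost := ht₂
      omega
    calc (t₁ + t₂) * T.b ≤ (4 * T.κ + ((T.core hk).setupCost + 10 * (T.np ^ 3 / T.b + T.Z) + T.κ +
        (T.core hk).mainCost)) * T.b := Nat.mul_le_mul_right _ ht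
      _ = 5 * T.κ * T.b + (T.core hk).setupCost * T.b + (T.core hk).mainCost * T.b +
        10 * (T.np ^ 3 / T.b * T.b + T.Z * T.b) := by ring
      _ ≤ 5 * T.κ * T.np ^ 3 + 519 * T.κ * T.np ^ 3 + (126 + 79 * T.g) * T.κ * T.np ^ 3 +
        10 * (T.np ^ 3 + T.Z * T.np ^ 3) := by gcongr
      _ = _ := by ring
  · have e2 : σ₁.arr 2 = σ.arr 2 := (ha₁ 2 (by norm_num)).trans (congrFun e₂ 2)
    have e3 : σ₁.arr 3 = σ.arr 3 := (ha₁ 3 (by norm_num)).trans (congrFun e₂ 3)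
    rcases hres with h | ⟨h1, h2, h3⟩
    · exact .inl h
    · exact .inr ⟨h1, h2.trans e2, h3.trans e3⟩

/-- A shape that fails leaves the output arrays alone, and one that succeeds writes the correct
result, so an output once correct remains so. -/
theorem run_shapes {k : ℕ} (hk : k ≤ T.d + 1) {σ : State} (h : T.Inv 0 σ.vars) :
    ∃ t σ', Run T.W (shapes T.DA T.d k) σ t σ' ∧
      t * T.b ≤ (1 + k * ((650 + 79 * T.g) * T.κ + 10 * (T.Z + 1))) * T.np ^ 3 ∧ T.Inv k σ'.vars ∧
      (∀ k' < k, ∀ hk' : k' ≤ T.d, T.KN + (T.core hk').mainWeight ≤ T.bud → T.Correct σ'.vars) := by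
  induction k with
  | zero =>
    refine ⟨1, σ, .skip σ, ?_, h, fun k' hk' => absurd hk' (by omega)⟩
    have : T.b ≤ T.np ^ 3 := b_le_np.trans (Nat.le_self_pow (by norm_num) _)
    omega
  | succ k ih =>
    obtain ⟨t₁, σ₁, r₁, h₁, i₁, c₁⟩ := ih (by omega)
    obtain ⟨t₂, σ₂, r₂, h₂, i₂, c₂⟩ := run_shape (k := k) (by omega) i₁
    refine ⟨_, σ₂, .seq r₁ r₂, ?_, i₂, fun k' hk' hd hw => ?_⟩
    · calc (t₁ + t₂) * T.b = t₁ * T.b + t₂ * T.b := by ring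
        _ ≤ _ := Nat.add_le_add h₁ h₂
        _ = _ := by ring
    · rcases c₂ with c₂ | ⟨c₂, e2, e3⟩
      · exact c₂
      · have hne : k' ≠ k := by
          rintro rfl
          omega
        have := c₁ k' (by omega) hd hw
        intro i hi j hj
        have e := this i hi j hj
        rw [State.vars_arr] at e ⊢
        rw [e2, e3]
        exact e

/-- The loop that computes the root. -/
theorem wp_root {m₀ s : State} {l : ℕ} (h0 : s.reg 0 = T.n) (h5 : s.reg 5 = 1) :
    (T.env m₀ l).WP (for' 20 21 (var 0) (ite' (.op .lt (var 0) (npow (var 5 + 1) T.g)) .skip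
      (asg 5 (var 5 + 1)))) (4 * T.κ + T.n * (2 * T.κ + 2 * T.κ)) (T.n * 0) s () fun s' _ =>
      (∀ x < 5, s'.reg x = s.reg x) ∧ s'.arr = s.arr ∧ s'.reg 5 = T.b := by
  have hS := T.le_S
  have hB := T.B_const
  have hg : T.g ≠ 0 := by have := T.le_g; omega
  have hn1 : T.n + 1 ≤ T.B := T.n_lt_np.trans_le T.np_le_B
  have h21 : ∀ x, x < 5 → x ≠ 20 ∧ x ≠ 21 ∧ x ≠ 5 := fun x hx => by omega
  -- Either the candidate `b` is already the root, or it has been increased in every round so far.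
  refine (Env.WP.for (E := T.env m₀ l) (I := fun i s' _ => (∀ x < 5, s'.reg x = s.reg x) ∧ s'.arr = s.arr ∧
    ∃ b : ℕ, s'.reg 5 = b ∧ 1 ≤ b ∧ b ^ T.g ≤ max T.n 1 ∧ (T.n < (b + 1) ^ T.g ∨ b = i + 1))
    (show 20 < 40 by norm_num) (show 21 < 40 by norm_num) (by norm_num) ⟨ok_var (by norm_num), by
      change 1 ≤ T.S; omega⟩ (k := T.n) (by simp [h0]) (by change T.n ≤ T.B; omega) ?_ ?_).mono ?_
  · refine ⟨fun x hx => ?_, rfl, 1, by simp [h5], le_rfl, by simp, .inr rfl⟩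
    simp [(h21 x hx).1, (h21 x hx).2.1]
  · rintro i hi s₁ ⟨⟩ ⟨hr, ha, b, hb5, hb1, hbp, hor⟩ h20 hk21
    have he : (Expr.op .lt (var 0) (npow (var 5 + 1) T.g)).eval s₁ = if T.n < (b + 1) ^ T.g then 1 else 0 :=
      Expr.eval_lt_nat (by simp [hr, h0]) (by rw [Expr.eval_npow]; simp [hb5])
    have hok : (Expr.op .lt (var 0) (npow (var 5 + 1) T.g)).Ok (· < ownVars) (· < ownArrs) T.B :=
      ⟨trivial, ok_var (by norm_num), Expr.ok_npow T.one_le_B (e := var 5 + 1) ⟨trivial, ok_var (by norm_num),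
        ok_ofNat (k := 1) (by omega)⟩ _⟩
    have hsz : (Expr.op .lt (var 0) (npow (var 5 + 1) T.g)).size ≤ T.S := by
      change 1 + Expr.size _ + 1 ≤ _
      rw [Expr.size_npow]
      change 1 + (T.g * (1 + 1 + 1 + 1) + 1) + 1 ≤ _
      omega
    rw [two_mul]
    refine Env.WP.ite (E := T.env m₀ l) ⟨hok, hsz⟩ (fun h => Env.WP.skip ?_) fun h => ?_
    · rw [he] at h
      have hlt : T.n < (b + 1) ^ T.g := by
        by_contra hc
        exact h (if_neg hc)
      refine ⟨h20, hk21, fun x hx => ?_, ha, b, ?_, hb1, hbp, .inl hlt⟩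
      · rw [State.setReg_reg, if_neg (h21 x hx).1, hr x hx]
      · simp [hb5]
    · rw [he] at h
      have hle : (b + 1) ^ T.g ≤ T.n := by
        by_contra hc
        rw [if_pos (not_le.1 hc)] at h
        exact one_ne_zero h
      have hbn : b + 1 ≤ T.n := (Nat.le_self_pow hg _).trans hle
      refine wp_asg (R := fun s' => s'.reg 20 = i ∧ s'.reg 21 = T.n ∧ (∀ x < 5, (s'.setReg 20 (i + 1)).reg x = s.reg x) ∧
        (s'.setReg 20 (i + 1)).arr = s.arr ∧ ∃ b : ℕ, (s'.setReg 20 (i + 1)).reg 5 = b ∧ 1 ≤ b ∧ b ^ T.g ≤ max T.n 1 ∧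
        (T.n < (b + 1) ^ T.g ∨ b = i + 1 + 1)) (by norm_num) ⟨trivial, ok_var (by norm_num),
        ok_ofNat (k := 1) (by omega)⟩ (by change 1 + 1 + 1 ≤ _; omega) (v := b + 1) (by simp [hb5]) (by omega)
        ⟨by simp [h20], by simp [hk21], fun x hx => ?_, ha, b + 1, by simp, by omega,
          hle.trans (le_max_left _ _), .inr ?_⟩
      · simp [(h21 x hx).1, (h21 x hx).2.2, hr x hx]
      · rcases hor with hor | hor
        · omega
        · omega
  · rintro s₁ ⟨⟩ ⟨-, -, hr, ha, b, hb5, hb1, hbp, hor⟩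
    refine ⟨hr, ha, ?_⟩
    rw [hb5, IsBase.unique (by omega) T.base ⟨hb1, hbp, ?_⟩]
    rcases hor with h | rfl
    · exact h
    -- A candidate that grew in all `n` rounds is `n + 1`, and then `n < (b + 1) ^ g` holds
    -- trivially.
    · exact lt_of_lt_of_le (by omega) (Nat.le_self_pow hg _)

theorem wp_prelude {m₀ s : State} {l : ℕ} (h0 : s.reg 0 = T.n) :
    (T.env m₀ l).WP (prelude T.g T.d T.c T.Z) ((11 + 4 * T.n) * T.κ) 0 s () fun s' _ =>
      s'.reg 0 = T.n ∧ s'.reg 1 = T.np ∧ s'.reg 2 = T.V ∧ s'.reg 3 = T.K ∧ s'.reg 4 = T.bud ∧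
      s'.reg 5 = T.b ∧ s'.reg 8 = T.z ∧ s'.reg 9 = (12 * T.b ^ (T.d + 4) : ℕ) ∧ s'.arr = s.arr := by
  have hS := T.le_S
  have hB := T.B_const
  have hg : T.g ≠ 0 := by have := T.le_g; omega
  have hb := T.base.pos
  have hn := T.n_lt_np
  have hnp := T.np_le_B
  have hz : T.z ≤ T.np := Nat.le_mul_of_pos_right _ (T.b_pow_pos _)
  have hN : 12 * T.b ^ (T.d + 4) ≤ T.B := (Nat.le_mul_self _).trans T.B_N
  have okp : ∀ {x : ℕ} (k : ℕ), x < ownVars → (npow (var x) k).Ok (· < ownVars) (· < ownArrs) T.B :=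
    fun k hx => Expr.ok_npow one_le_B (ok_var hx) k
  have sz : ∀ x k, (npow (var x) k).size = k * 2 + 1 := fun x k => Expr.size_npow _ k
  refine Env.WP.weaken (c := T.κ + ((4 * T.κ + T.n * (2 * T.κ + 2 * T.κ)) + (T.κ + (T.κ + (T.κ + (T.κ +
    (T.κ + T.κ))))))) (d := 0 + (T.n * 0 + (0 + (0 + (0 + (0 + (0 + 0))))))) (Env.WP.seq (E := T.env m₀ l)
    (wp_asg (by norm_num) (ok_ofNat (k := 1) (by omega)) (by change 1 ≤ _; omega) (v := 1) rfl (by omega)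
    (R := fun s' => s' = s.setReg 5 (1 : ℕ)) rfl) ?_) (by apply le_of_eq; ring) (by simp) fun _ _ h => h
  rintro s₁ ⟨⟩ rfl
  refine Env.WP.seq (wp_root (T := T) (by simp [h0]) (by simp)) ?_
  rintro s₂ ⟨⟩ ⟨hr₂, ha₂, hb₂⟩
  have h0₂ : s₂.reg 0 = T.n := by rw [hr₂ 0 (by norm_num)]; simp [h0]
  refine Env.WP.seq (E := T.env m₀ l) (wp_asg (by norm_num) ⟨trivial, ⟨trivial, ok_var (by norm_num),
      okp _ (by norm_num)⟩, ok_ofNat (k := 1) (by omega)⟩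
    (by change 1 + Expr.size _ + 1 + 1 + 1 ≤ _; rw [sz]; omega) (v := T.z)
    (by rw [Expr.eval_add, Expr.eval_div, Expr.eval_npow, Expr.eval_var, Expr.eval_var, Expr.eval_one, h0₂, hb₂]
        push_cast; rfl) (by omega)
    (R := fun s' => s' = s₂.setReg 8 T.z) rfl) ?_
  rintro s₃ ⟨⟩ rfl
  refine Env.WP.seq (E := T.env m₀ l) (wp_asg (by norm_num) ⟨trivial, ok_var (by norm_num),
      okp _ (by norm_num)⟩
    (by change 1 + Expr.size _ + 1 ≤ _; rw [sz]; omega) (v := T.np)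
    (by simp [Expr.eval_npow, hb₂]) hnp
    (R := fun s' => s' = (s₂.setReg 8 T.z).setReg 1 T.np) rfl) ?_
  rintro s₄ ⟨⟩ rfl
  refine Env.WP.seq (E := T.env m₀ l) (wp_asg (by norm_num) ⟨trivial, ok_ofNat (k := 4) (by omega),
      okp _ (by norm_num)⟩
    (by change 1 + Expr.size _ + 1 ≤ _; rw [sz]; omega) (v := T.V)
    (by simp [Expr.eval_npow]) T.V_le_B
    (R := fun s' => s' = ((s₂.setReg 8 T.z).setReg 1 T.np).setReg 2 T.V) rfl) ?_
  rintro s₅ ⟨⟩ rfl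
  refine Env.WP.seq (E := T.env m₀ l) (wp_asg (by norm_num) ⟨trivial, ok_ofNat (k := T.g)
      (le_trans (Nat.le_mul_of_pos_right _ hb) T.B_K), ok_var (by norm_num)⟩
    (by change 1 + 1 + 1 ≤ _; omega) (v := T.K)
    (by simp [hb₂]) T.B_K
    (R := fun s' => s' = (((s₂.setReg 8 T.z).setReg 1 T.np).setReg 2 T.V).setReg 3 T.K) rfl) ?_
  rintro s₆ ⟨⟩ rfl
  refine Env.WP.seq (E := T.env m₀ l) (wp_asg (by norm_num) ⟨trivial, ⟨trivial, okp _ (by norm_num),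
      ok_var (by norm_num)⟩, ok_ofNat (k := T.Z) ((Nat.le_add_left _ _).trans T.B_bud)⟩
    (by change Expr.size _ + 1 + 1 + 1 + 1 ≤ _; rw [sz]; omega) (v := T.bud)
    (by simp [Expr.eval_npow, hb₂]) T.B_bud
    (R := fun s' => s' = ((((s₂.setReg 8 T.z).setReg 1 T.np).setReg 2 T.V).setReg 3 T.K).setReg 4 T.bud)
    rfl) ?_
  rintro s₇ ⟨⟩ rfl
  refine wp_asg (by norm_num) ⟨trivial, ok_ofNat (k := 12) (by omega), okp _ (by norm_num)⟩
    (by change 1 + Expr.size _ + 1 ≤ _; rw [sz]; omega) (v := 12 * T.b ^ (T.d + 4))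
    (by
      change (12 : ℤ) * Expr.eval _ _ = _
      rw [Expr.eval_npow]
      simp [hb₂]) hN ?_
  simp [h0₂, hb₂, ha₂]

theorem apspInput_bdd (T : Setting) : T.Bdd (apspInput T.G).vars := by
  have hn : T.n ≤ T.B := T.n_lt_np.le.trans T.np_le_B
  have hB : (0 : ℤ) ≤ T.B := by positivity
  have hB1 := T.one_le_B
  have hV := T.V_le_B
  have vec : ∀ {k : ℕ} (v : Fin k → ℤ), (∀ i, |v i| ≤ T.B) → ∀ a, |vecArr v a| ≤ T.B := fun v hv a => by
    rw [vecArr]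
    split_ifs
    · exact hv _
    · simp
  refine ⟨fun x _ => ?_, fun A _ a => ?_⟩
  · rw [State.vars_reg]
    by_cases h : 2 * x = 0
    · simp only [h, apspInput, Function.update_self, Nat.abs_cast]
      exact_mod_cast hn
    · simp [apspInput, h]
  · rw [State.vars_arr]
    simp only [apspInput]
    split_ifs
    · refine vec _ (fun i => ?_) a
      dsimp only
      split_ifs
      · simpa using hB1
      · simp
    · refine vec _ (fun i => ?_) a
      rcases h : T.G (finProdFinEquiv.symm i).1 (finProdFinEquiv.symm i).2 with _ | x
      · simp only [h, Option.getD_none, abs_zero]; exact hB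
      · simp only [h, Option.getD_some]
        exact (abs_weight_le h).trans (Int.ofNat_le.2 hV)
    · simp

theorem apspInput_clean (T : Setting) : Core.Clean 0 (apspInput T.G).vars := by
  refine fun s _ => ⟨fun r => ?_, fun A a => ?_⟩
  · have h : 40 ≤ regVar s r := le_regVar s r
    have h0 : regVar s r ≠ 0 := by omega
    simp [apspInput, h0]
  · have h : 10 ≤ regArr s A := le_regArr s A
    have h0 : regArr s A ≠ 0 := by omega
    have h1 : regArr s A ≠ 1 := by omega
    simp [apspInput, h0, h1]

def timeConst (g d κ Z : ℕ) : ℕ := 16 * κ + 1 + (d + 1) * ((650 + 79 * g) * κ + 10 * (Z + 1))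

/-- The program is fast, and it is correct if the budget suffices for one of the shapes. -/
theorem run (T : Setting) : ∃ t σ', Run T.W (apspProg T.DA T.g T.d T.c T.Z) (apspInput T.G) t σ' ∧
    t * T.b ≤ timeConst T.g T.d T.κ T.Z * T.np ^ 3 ∧
    ∀ k, ∀ hk : k ≤ T.d, T.KN + (T.core hk).mainWeight ≤ T.bud → APSPOutput T.G σ' := by
  obtain ⟨t₁, σ₁, s₁, r₁, ht₁, hr₁, ha₁, hb₁, hc₁, e0, e1, e2, e3, e4, e5, e8, e9, ea⟩ :=
    run_of_wp T.apspInput_bdd (wp_prelude (by simp [apspInput]))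
  have hI : T.Inv 0 σ₁.vars := {
    r0 := (hr₁ 0 (by norm_num)).trans e0
    r1 := (hr₁ 1 (by norm_num)).trans e1
    r2 := (hr₁ 2 (by norm_num)).trans e2
    r3 := (hr₁ 3 (by norm_num)).trans e3
    r4 := (hr₁ 4 (by norm_num)).trans e4
    r5 := (hr₁ 5 (by norm_num)).trans e5
    r8 := (hr₁ 8 (by norm_num)).trans e8
    r9 := (hr₁ 9 (by norm_num)).trans e9
    a0 := (ha₁ 0 (by norm_num)).trans (by rw [ea]; rfl)
    a1 := (ha₁ 1 (by norm_num)).trans (by rw [ea]; rfl)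
    bdd := hb₁
    clean := hc₁ 0 T.apspInput_clean }
  obtain ⟨t₂, σ₂, r₂, ht₂, -, hc⟩ := run_shapes le_rfl hI
  refine ⟨_, σ₂, .seq r₁ r₂, ?_, fun k hk hw => (hc k (by omega) hk hw).output⟩
  have hn := T.n_lt_np.le
  have hb := T.b_le_np
  have h3 : T.np ≤ T.np ^ 3 := Nat.le_self_pow (by norm_num) _
  have h2 : T.np * T.np ≤ T.np ^ 3 := by rw [← sq]; exact Nat.pow_le_pow_right T.np_pos (by norm_num)
  calc (t₁ + t₂) * T.b ≤ ((11 + 4 * T.n) * T.κ + t₂) * T.b := by gcongr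
    _ = 11 * T.κ * T.b + 4 * T.κ * (T.n * T.b) + t₂ * T.b := by ring
    _ ≤ 11 * T.κ * T.np ^ 3 + 4 * T.κ * T.np ^ 3 + (1 + (T.d + 1) * ((650 + 79 * T.g) * T.κ +
      10 * (T.Z + 1))) * T.np ^ 3 := by
        gcongr
        · exact hb.trans h3
        · exact (Nat.mul_le_mul hn hb).trans h2
    _ ≤ _ := by
        rw [timeConst, ← Nat.add_mul, ← Nat.add_mul]
        refine Nat.mul_le_mul_right _ ?_
        omega

end Setting
end FineGrained

namespace FineGrained

/-! ### Consequences of a fast dynamic algorithm -/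

/-- Every operation takes at least one step. This forces amortized times of at least 1, which the
choice of a shape relies on. -/
theorem Serves.length_le {W N : ℕ} {P : DynamicAlgorithm} {σ : State} {G : WGraph N}
    {ops : List (Op N)} {t : ℕ} (h : Serves W P σ G ops t) : ops.length ≤ t := by
  induction h with
  | nil => exact le_rfl
  | insert r _ ih => have := r.one_le; simp only [List.length_cons]; omega
  | delete r _ ih => have := r.one_le; simp only [List.length_cons]; omega
  | query r _ _ ih => have := r.one_le; simp only [List.length_cons]; omega

/-- Insert and delete an edge, over and over. -/
def toggles {N : ℕ} (i j : Fin N) : ℕ → List (Op N)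
  | 0 => []
  | a + 1 => .insert i j 0 :: .delete i j :: toggles i j a

theorem legal_toggles {N : ℕ} {H : SimpleGraph (Fin N)} {c : ℕ} {i j : Fin N} (h : H.Adj i j) (a : ℕ) :
    Legal H c (fun _ => none) (toggles i j a) := by
  induction a with
  | zero => trivial
  | succ a ih =>
    refine ⟨h, rfl, Nat.zero_le _, by simp, ?_⟩
    rw [Function.update_idem, Function.update_eq_self_iff.2 rfl]
    exact ih

theorem countP_toggles {N : ℕ} (i j : Fin N) (a : ℕ) :
    (toggles i j a).countP (fun o => !o.isQuery) = 2 * a ∧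
    (toggles i j a).countP (fun o => o.isQuery) = 0 ∧ (toggles i j a).length = 2 * a := by
  induction a with
  | zero => simp [toggles]
  | succ a ih =>
    obtain ⟨h₁, h₂, h₃⟩ := ih
    rw [toggles, List.countP_cons, List.countP_cons, List.countP_cons, List.countP_cons, h₁, h₂,
      List.length_cons, List.length_cons, h₃]
    simp [Op.isQuery]
    omega

theorem legal_queries {N : ℕ} {H : SimpleGraph (Fin N)} {c : ℕ} {G : WGraph N} (a : ℕ) :
    Legal H c G (List.replicate a .query) := by
  induction a with
  | zero => trivial
  | succ a ih => exact ih

/-- Otherwise the left side would outgrow the right one as `a` tends to infinity. -/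
theorem one_le_of_forall_mul_le {x C : ℝ} (h : ∀ a : ℕ, (a : ℝ) ≤ C + a * x) : 1 ≤ x := by
  by_contra hx
  obtain ⟨a, ha⟩ := exists_nat_gt (C / (1 - x))
  rw [div_lt_iff₀ (by linarith)] at ha
  have := h a
  linarith

theorem gridDrawing_exists_adj {r m : ℕ} (hr : 0 < r) (hm : 0 < m) :
    ∃ i j, (gridDrawing r m).graph.Adj i j := by
  refine ⟨_, _, ValidSlot.adj (e := 0) ⟨?_, fun _ => ?_⟩⟩
  · have : 12 * 1 ≤ 12 * (r * m) := Nat.mul_le_mul_left _ (Nat.mul_pos hr hm)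
    have e : 3 * r * (4 * m) = 12 * (r * m) := by ring
    simp only [slotEnd]
    norm_num
    omega
  · simp; omega

theorem SolvesDynamicMWM.mono {𝒞 : DrawingClass} {c p : ℕ} {P : DynamicAlgorithm} {q u q' u' : ℕ → ℝ}
    (h : SolvesDynamicMWM 𝒞 c p P q u) (hq : ∀ N, q N ≤ q' N) (hu : ∀ N, u N ≤ u' N) :
    SolvesDynamicMWM 𝒞 c p P q' u' := by
  obtain ⟨K, C, h⟩ := h
  refine ⟨K, C, fun N D hD ops ho => ?_⟩
  obtain ⟨t₀, t, σ, h₁, h₂, h₃⟩ := h N D hD ops ho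
  refine ⟨t₀, t, σ, h₁, h₂, h₃.trans ?_⟩
  gcongr
  · exact hu N
  · exact hq N

section Bounds
variable {𝒞 : DrawingClass} (h𝒞 : 𝒞 ∈ ({bipartitePlane, gridGraphs} : Set DrawingClass))
  {c p K C : ℕ} {P : DynamicAlgorithm} {q u : ℕ → ℝ}
  (h : ∀ (N : ℕ) (D : Drawing N), 𝒞 N D →
    ∀ ops : List (Op N), Legal D.graph c (fun _ => none) ops →
      ∃ (t₀ t : ℕ) (σ : State),
        Run ((N + ops.length + 2) ^ C) P.init D.input t₀ σ ∧
        Serves ((N + ops.length + 2) ^ C) P σ (fun _ => none) ops t ∧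
        ((t₀ + t : ℕ) : ℝ) ≤ K * (N + 1 : ℝ) ^ p +
          ops.countP (fun o => !o.isQuery) * u N + ops.countP (fun o => o.isQuery) * q N)
include h𝒞 h

theorem one_le_query (r m : ℕ) : 1 ≤ q (3 * r * (4 * m)) := by
  refine one_le_of_forall_mul_le (C := K * ((3 * r * (4 * m) : ℕ) + 1 : ℝ) ^ p) fun a => ?_
  obtain ⟨t₀, t, σ, -, hs, ht⟩ := h _ _ (gridDrawing_mem h𝒞) (List.replicate a .query) (legal_queries a)
  have hl := hs.length_le
  simp only [List.length_replicate, List.countP_replicate, Op.isQuery, Bool.not_true, if_true,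
    Bool.false_eq_true, if_false, Nat.cast_zero, zero_mul, add_zero] at hl ht
  refine le_trans ?_ ht
  exact_mod_cast (by omega : a ≤ t₀ + t)

/-- Inserting and deleting a single edge forever is a legal sequence without queries, and the
preprocessing term is constant along it. -/
theorem one_le_update {r m : ℕ} (hr : 0 < r) (hm : 0 < m) : 1 ≤ u (3 * r * (4 * m)) := by
  obtain ⟨i, j, hij⟩ := gridDrawing_exists_adj hr hm
  refine one_le_of_forall_mul_le (C := K * ((3 * r * (4 * m) : ℕ) + 1 : ℝ) ^ p / 2) fun a => ?_
  obtain ⟨t₀, t, σ, -, hs, ht⟩ := h _ _ (gridDrawing_mem h𝒞) (toggles i j a) (legal_toggles hij a)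
  have hl := hs.length_le
  obtain ⟨e₁, e₂, e₃⟩ := countP_toggles i j a
  rw [e₁, e₂, Nat.cast_zero, zero_mul, add_zero] at ht
  rw [e₃] at hl
  have : ((2 * a : ℕ) : ℝ) ≤ (t₀ + t : ℕ) := by exact_mod_cast (by omega : 2 * a ≤ t₀ + t)
  push_cast at this ht ⊢
  linarith

/-- Rounding the amortized times up gives a bound in natural numbers, and one word bound serves all
sequences of length at most `L`. -/
theorem grid_solves (r m : ℕ) (ops : List (Op (3 * r * (4 * m))))
    (ho : Legal (gridDrawing r m).graph c (fun _ => none) ops) {W L : ℕ}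
    (hW : (3 * r * (4 * m) + L + 2) ^ C ≤ W) (hL : ops.length ≤ L) :
    ∃ t₀ t σ, Run W P.init (gridDrawing r m).input t₀ σ ∧ Serves W P σ (fun _ => none) ops t ∧
      t₀ + t ≤ K * (3 * r * (4 * m) + 1) ^ p +
        opsWeight ⌈u (3 * r * (4 * m))⌉₊ ⌈q (3 * r * (4 * m))⌉₊ ops := by
  obtain ⟨t₀, t, σ, h₁, h₂, h₃⟩ := h _ _ (gridDrawing_mem h𝒞) ops ho
  have hle : (3 * r * (4 * m) + ops.length + 2) ^ C ≤ W :=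
    (Nat.pow_le_pow_left (by omega) _).trans hW
  refine ⟨t₀, t, σ, h₁.mono hle, h₂.mono hle, ?_⟩
  have h₄ : ((t₀ + t : ℕ) : ℝ) ≤ ((K * (3 * r * (4 * m) + 1) ^ p +
        opsWeight ⌈u (3 * r * (4 * m))⌉₊ ⌈q (3 * r * (4 * m))⌉₊ ops : ℕ) : ℝ) := by
    refine h₃.trans ?_
    rw [opsWeight]
    push_cast
    rw [add_assoc]
    gcongr
    · exact Nat.le_ceil _
    · exact Nat.le_ceil _
  exact_mod_cast h₄

end Bounds

/-- The update and query times leave room for a shape, for all large side lengths. -/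
theorem eventually_mul_le {q u : ℕ → ℝ} {ε : ℝ} {h : ℕ} (hε : 0 < ε) (hh : 8 ≤ h * ε) (h0 : h ≠ 0)
    (hu1 : ∀ b > 0, 1 ≤ u (12 * b ^ h)) (hq1 : ∀ b > 0, 1 ≤ q (12 * b ^ h))
    (hO : (fun N : ℕ => q N * u N) =O[atTop] fun N : ℕ => (N : ℝ) ^ (1 - ε)) :
    ∀ᶠ b : ℕ in atTop, ⌈u (12 * b ^ h)⌉₊ * ⌈q (12 * b ^ h)⌉₊ * b ^ 7 ≤ b ^ h := by
  obtain ⟨c, hc0, hc⟩ := hO.exists_pos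
  have hN : Tendsto (fun b : ℕ => 12 * b ^ h) atTop atTop :=
    (tendsto_pow_atTop h0).const_mul_atTop' (by norm_num)
  filter_upwards [hN.eventually hc.bound, eventually_gt_atTop 0, eventually_ge_atTop ⌈48 * c⌉₊]
    with b hb hb0 hbc
  have hbR : (1 : ℝ) ≤ b := by exact_mod_cast hb0
  have hbc' : 48 * c ≤ b := Nat.ceil_le.1 hbc
  have hu := hu1 b hb0
  have hq := hq1 b hb0
  have hU : (⌈u (12 * b ^ h)⌉₊ : ℝ) ≤ 2 * u (12 * b ^ h) := by
    have := (Nat.ceil_lt_add_one (by linarith : 0 ≤ u (12 * b ^ h))).le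
    linarith
  have hQ : (⌈q (12 * b ^ h)⌉₊ : ℝ) ≤ 2 * q (12 * b ^ h) := by
    have := (Nat.ceil_lt_add_one (by linarith : 0 ≤ q (12 * b ^ h))).le
    linarith
  have hbh : (0 : ℝ) < (b : ℝ) ^ h := by positivity
  -- The saving `N ^ ε` is at least `b ^ 8`, because `h ε ≥ 8`.
  have hpow : ((12 * b ^ h : ℕ) : ℝ) ^ (1 - ε) * (b : ℝ) ^ 8 ≤ 12 * (b : ℝ) ^ h := by
    have h1 : (b : ℝ) ^ 8 ≤ ((12 * b ^ h : ℕ) : ℝ) ^ ε := by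
      calc (b : ℝ) ^ 8 = (b : ℝ) ^ ((8 : ℕ) : ℝ) := (Real.rpow_natCast _ _).symm
        _ ≤ (b : ℝ) ^ (h * ε) := Real.rpow_le_rpow_of_exponent_le hbR (by exact_mod_cast hh)
        _ = ((b : ℝ) ^ h) ^ ε := by rw [Real.rpow_mul (by positivity), Real.rpow_natCast]
        _ ≤ _ := by
          refine Real.rpow_le_rpow (by positivity) ?_ hε.le
          push_cast
          linarith
    calc _ ≤ ((12 * b ^ h : ℕ) : ℝ) ^ (1 - ε) * ((12 * b ^ h : ℕ) : ℝ) ^ ε := by gcongr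
      _ = ((12 * b ^ h : ℕ) : ℝ) := by
        rw [← Real.rpow_add (by push_cast; positivity)]; simp
      _ = _ := by push_cast; rfl
  have hqu : q (12 * b ^ h) * u (12 * b ^ h) ≤ c * ((12 * b ^ h : ℕ) : ℝ) ^ (1 - ε) := by
    have := hb
    rw [Real.norm_of_nonneg (by positivity), Real.norm_of_nonneg (by positivity)] at this
    exact this
  -- Seven of the eight factors `b` are needed for the claim; the last one absorbs the constant `48
  -- c`.
  have key : (((⌈u (12 * b ^ h)⌉₊ * ⌈q (12 * b ^ h)⌉₊ * b ^ 7 : ℕ) : ℝ)) * b ≤ ((b ^ h : ℕ) : ℝ) * b := by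
    push_cast
    calc (⌈u (12 * b ^ h)⌉₊ : ℝ) * ⌈q (12 * b ^ h)⌉₊ * (b : ℝ) ^ 7 * b
        ≤ (2 * u (12 * b ^ h)) * (2 * q (12 * b ^ h)) * (b : ℝ) ^ 7 * b := by gcongr
      _ = 4 * (q (12 * b ^ h) * u (12 * b ^ h)) * (b : ℝ) ^ 8 := by ring
      _ ≤ 4 * (c * ((12 * b ^ h : ℕ) : ℝ) ^ (1 - ε)) * (b : ℝ) ^ 8 := by gcongr
      _ = 4 * c * (((12 * b ^ h : ℕ) : ℝ) ^ (1 - ε) * (b : ℝ) ^ 8) := by ring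
      _ ≤ 4 * c * (12 * (b : ℝ) ^ h) := by gcongr
      _ = (b : ℝ) ^ h * (48 * c) := by ring
      _ ≤ (b : ℝ) ^ h * b := by gcongr
  exact_mod_cast le_of_mul_le_mul_right key (by linarith)

/-- There is a shape that suits the update and query times. -/
theorem exists_shape {U Q b d : ℕ} (hb : 2 ≤ b) (hU : 1 ≤ U) (hUQ : U ≤ Q) (h : U * Q * b ^ 7 ≤ b ^ (d + 4)) :
    ∃ k ≤ d, U * b ^ 3 ≤ b ^ (d + 2 - k) ∧ Q * b ^ 3 ≤ b ^ (k + 2) := by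
  classical
  have hb0 : 0 < b := by omega
  have hex : ∃ s, Q * b ^ 3 ≤ b ^ s := ⟨Q * b ^ 3, (Nat.lt_pow_self (by omega)).le⟩
  -- The least power of `b` that gives the queries enough room. By minimality it overshoots by less
  -- than a factor `b`, so that `U b³ · b ^ s ≤ U Q b⁷`: three factors for each of the two
  -- conditions and one for rounding.
  obtain ⟨s, hs, hmin⟩ : ∃ s, Q * b ^ 3 ≤ b ^ s ∧ ∀ s' < s, ¬ Q * b ^ 3 ≤ b ^ s' :=
    ⟨Nat.find hex, Nat.find_spec hex, fun s' h' => Nat.find_min hex h'⟩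
  have h3 : 3 ≤ s := by
    have : b ^ 3 ≤ b ^ s := (Nat.le_mul_of_pos_left _ (by omega)).trans hs
    exact (Nat.pow_le_pow_iff_right (by omega)).1 this
  have hlt : b ^ (s - 1) < Q * b ^ 3 := not_le.1 (hmin _ (by omega))
  have hle : U * b ^ 3 * b ^ s ≤ b ^ (d + 4) := by
    refine le_trans ?_ h
    calc U * b ^ 3 * b ^ s = U * b ^ 4 * b ^ (s - 1) := by
          rw [show s = s - 1 + 1 by omega]; simp only [Nat.add_sub_cancel]; ring
      _ ≤ U * b ^ 4 * (Q * b ^ 3) := by gcongr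
      _ = _ := by ring
  have hs' : s + 3 ≤ d + 4 := by
    refine (Nat.pow_le_pow_iff_right (a := b) (by omega)).1 (le_trans ?_ hle)
    rw [pow_add, mul_comm]
    gcongr
    exact Nat.le_mul_of_pos_left _ (by omega)
  refine ⟨s - 2, by omega, ?_, by rwa [show s - 2 + 2 = s by omega]⟩
  refine Nat.le_of_mul_le_mul_right (c := b ^ s) ?_ (by positivity)
  rw [← pow_add, show d + 2 - (s - 2) + s = d + 4 by omega]
  exact hle

end FineGrained

namespace FineGrained

/-! ### The choice of the parameters -/

theorem side_le_size (d n b : ℕ) : b ^ (d + 4) ≤ paddedSize d n b :=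
  Nat.le_mul_of_pos_left _ (Nat.succ_pos _)

theorem IsBase.one_le_size {g n b : ℕ} (hb : IsBase g n b) (d : ℕ) : 1 ≤ paddedSize d n b :=
  Nat.mul_pos (Nat.succ_pos _) (Nat.pow_pos hb.pos)

theorem base_le_size (d n b : ℕ) : b ≤ paddedSize d n b :=
  (Nat.le_self_pow (by omega) _).trans (side_le_size d n b)

section Sizes
variable {g d n b : ℕ} (hb : IsBase g n b) (hg : 2 * (d + 4) + 1 ≤ g)
include hb hg

theorem IsBase.side_le : b ^ (d + 4) ≤ max n 1 :=
  (Nat.pow_le_pow_right hb.pos (by omega)).trans hb.pow_le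

theorem IsBase.size_le : paddedSize d n b ≤ 2 * max n 1 := by
  have h2 : n / b ^ (d + 4) * b ^ (d + 4) ≤ n := Nat.div_mul_le_self _ _
  have h := hb.side_le hg
  change (n / b ^ (d + 4) + 1) * b ^ (d + 4) ≤ _
  rw [Nat.add_mul, one_mul]
  have := le_max_left n 1
  omega

/-- Although the grid is much smaller than the shortest path instance, `n` is polynomial in the
number of grid nodes, which is at least `b + 1`. So weights polynomial in `n` are polynomial in the
size of the grid. -/
theorem IsBase.size_le_pow (k : ℕ) :
    paddedSize d n b ≤ (3 * b ^ (k + 2) * (4 * b ^ (d + 2 - k))) ^ (g + 1) := by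
  have hb0 := hb.pos
  have h1 : 1 ≤ b ^ (k + 2) := Nat.pow_pos hb0
  have h2 : 1 ≤ b ^ (d + 2 - k) := Nat.pow_pos hb0
  have h3 : b ≤ b ^ (k + 2) := Nat.le_self_pow (by omega) _
  have h4 : b + 1 ≤ 3 * b ^ (k + 2) * (4 * b ^ (d + 2 - k)) := by nlinarith
  have h5 : 2 ≤ 3 * b ^ (k + 2) * (4 * b ^ (d + 2 - k)) := by omega
  have h6 : max n 1 ≤ (b + 1) ^ g := max_le hb.lt_pow.le (Nat.one_le_pow _ _ (by omega))
  calc paddedSize d n b ≤ 2 * max n 1 := hb.size_le hg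
    _ ≤ 2 * (b + 1) ^ g := by omega
    _ ≤ _ := by rw [pow_succ']; gcongr

theorem IsBase.halfL_le (c k : ℕ) :
    2 * halfL (4 * paddedSize d n b ^ (c + 1)) (b ^ (k + 2)) (b ^ (d + 2 - k)) ≤
      (3 * b ^ (k + 2) * (4 * b ^ (d + 2 - k))) ^ ((g + 1) * (c + 1) + 4) := by
  have hs := hb.size_le_pow hg k
  have hb0 := hb.pos
  have h1 : 1 ≤ b ^ (k + 2) := Nat.pow_pos hb0
  have h2 : 1 ≤ b ^ (d + 2 - k) := Nat.pow_pos hb0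
  generalize b ^ (k + 2) = r at *
  generalize b ^ (d + 2 - k) = m at *
  have e1 : 12 ≤ 3 * r * (4 * m) := by nlinarith
  have e2 : r * m ≤ 3 * r * (4 * m) := by nlinarith
  have e3 : m ≤ 3 * r * (4 * m) := by nlinarith
  rw [halfL, pow_add _ _ 4, pow_mul]
  calc 2 * (16 * (4 * paddedSize d n b ^ (c + 1)) * r * m * m) =
        paddedSize d n b ^ (c + 1) * (128 * (r * m) * m) := by ring
    _ ≤ ((3 * r * (4 * m)) ^ (g + 1)) ^ (c + 1) * (3 * r * (4 * m)) ^ 4 := by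
      gcongr
      calc 128 * (r * m) * m ≤ (12 * 12) * (3 * r * (4 * m)) * (3 * r * (4 * m)) := by gcongr; norm_num
        _ ≤ ((3 * r * (4 * m)) * (3 * r * (4 * m))) * (3 * r * (4 * m)) * (3 * r * (4 * m)) := by gcongr
        _ = _ := by ring

/-- Constants times powers of the size are at most a power of `n + 2`. -/
theorem IsBase.le_word {x M j β : ℕ} (hx : x ≤ M * paddedSize d n b ^ j) (hβ : M + 2 * j ≤ β) :
    x ≤ (n + 2) ^ β := by
  have hs : paddedSize d n b ≤ (n + 2) ^ 2 := by
    refine (hb.size_le hg).trans ?_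
    have : max n 1 ≤ n + 2 := max_le (by omega) (by omega)
    nlinarith
  calc x ≤ M * paddedSize d n b ^ j := hx
    _ ≤ (n + 2) ^ M * ((n + 2) ^ 2) ^ j := by
      gcongr
      exact Nat.lt_two_pow_self.le.trans (Nat.pow_le_pow_left (by omega) _)
    _ = (n + 2) ^ (M + 2 * j) := by rw [← pow_mul, ← pow_add]
    _ ≤ _ := Nat.pow_le_pow_right (by omega) hβ

end Sizes

/-- The exponent of the bound for the values of the variables. -/
def valueExp (g c Z κ : ℕ) : ℕ := 2560 + 2 * (c + 4) + g + Z + (15 + (126 + 79 * g) * κ) + 10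

/-- A run of the whole program, from a dynamic algorithm. -/
def mkSetting (DA : DynamicAlgorithm) {g d c n b KN U Q κ : ℕ} (Z S C : ℕ) (G : WDigraph n)
    (inst : APSPInstance c G) (hb : IsBase g n b) (hg : 2 * (d + 4) + 1 ≤ g)
    (hS : sizeBound + 10 * (g + d + c + 10) ≤ S) (hκ : 10 * S + 40 + DA.maxDead ≤ κ)
    (solves : ∀ k ≤ d, ∀ ops : List (Op (3 * b ^ (k + 2) * (4 * b ^ (d + 2 - k)))),
      Legal (gridDrawing (b ^ (k + 2)) (b ^ (d + 2 - k))).graph ((g + 1) * (c + 1) + 4)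
        (fun _ => none) ops → ∀ W L : ℕ,
      (3 * b ^ (k + 2) * (4 * b ^ (d + 2 - k)) + L + 2) ^ C ≤ W → ops.length ≤ L →
      ∃ t₀ t σ, Run W DA.init (gridDrawing (b ^ (k + 2)) (b ^ (d + 2 - k))).input t₀ σ ∧
        Serves W DA σ (fun _ => none) ops t ∧ t₀ + t ≤ KN + opsWeight U Q ops) : Setting where
  DA := DA
  g := g
  d := d
  c := c
  cw := (g + 1) * (c + 1) + 4
  Z := Z
  n := n
  b := b
  KN := KN
  U := U
  Q := Q
  W := (n + 2) ^ (valueExp g c Z κ * (S + C))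
  Lmax := 1 + (126 + 79 * g) * κ * paddedSize d n b ^ 3
  B := (n + 2) ^ valueExp g c Z κ
  S := S
  κ := κ
  G := G
  inst := inst
  base := hb
  le_g := hg
  le_S := hS
  le_κ := hκ
  pow_le := by rw [← pow_mul]; exact Nat.pow_le_pow_right (by omega) (Nat.mul_le_mul_left _ (by omega))
  hL k _ := hb.halfL_le hg c k
  B_L k hk := by
    refine hb.le_word hg (M := 2560) (j := c + 4) ?_ (by rw [valueExp]; omega)
    have hm : b ^ (d + 2 - k) ≤ b ^ (d + 4) := Nat.pow_le_pow_right hb.pos (by omega)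
    have hs := side_le_size d n b
    have e : b ^ (k + 2) * b ^ (d + 2 - k) = b ^ (d + 4) := by rw [← pow_add]; congr 1; omega
    rw [halfL]
    calc _ = 2560 * (paddedSize d n b ^ (c + 1) * (b ^ (k + 2) * b ^ (d + 2 - k)) *
          (b ^ (k + 2) * b ^ (d + 2 - k)) * b ^ (d + 2 - k)) := by ring
      _ ≤ 2560 * (paddedSize d n b ^ (c + 1) * paddedSize d n b * paddedSize d n b * paddedSize d n b) := by
        rw [e]; gcongr; exact hm.trans hs
      _ = _ := by ring
  B_N := by
    refine hb.le_word hg (M := 144) (j := 2) ?_ (by rw [valueExp]; omega)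
    have hs := side_le_size d n b
    calc _ = 144 * (b ^ (d + 4)) ^ 2 := by ring
      _ ≤ _ := by gcongr
  B_np := hb.le_word hg (M := 1) (j := 2) (by rw [one_mul, sq]) (by rw [valueExp]; omega)
  B_K := hb.le_word hg (M := g) (j := 1) (by rw [pow_one]; exact Nat.mul_le_mul_left _ (base_le_size d n b))
    (by rw [valueExp]; omega)
  B_bud := by
    refine hb.le_word hg (M := Z + 1) (j := 3) ?_ (by rw [valueExp]; omega)
    have h1 : 1 ≤ paddedSize d n b ^ 3 := Nat.one_le_pow _ _ (hb.one_le_size d)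
    have h2 : paddedSize d n b ^ 3 / b ≤ paddedSize d n b ^ 3 := Nat.div_le_self _ _
    nlinarith
  B_const := hb.le_word hg (M := 100) (j := 0) (by simp) (by rw [valueExp]; omega)
  le_Lmax := le_rfl
  solves k hk ops ho hl := by
    refine solves k hk ops ho _ _ ?_ hl
    rw [pow_mul]
    refine (Nat.pow_le_pow_left ?_ C).trans (Nat.pow_le_pow_right (Nat.pow_pos (by omega)) (by omega))
    refine hb.le_word hg (M := 15 + (126 + 79 * g) * κ) (j := 3) ?_ (by rw [valueExp]; omega)
    have e : 3 * b ^ (k + 2) * (4 * b ^ (d + 2 - k)) = 12 * b ^ (d + 4) := by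
      rw [show d + 4 = k + 2 + (d + 2 - k) by omega, pow_add]; ring
    have h1 : 1 ≤ paddedSize d n b ^ 3 := Nat.one_le_pow _ _ (hb.one_le_size d)
    have h2 : b ^ (d + 4) ≤ paddedSize d n b ^ 3 := (side_le_size d n b).trans (Nat.le_self_pow (by norm_num) _)
    rw [e, Nat.add_mul 15]
    omega

/-- What the budget has to be for the first shape. -/
def firstNeed (g d n b KN U Q : ℕ) : ℕ :=
  KN + (2 * (3 * b ^ (0 + 2) * (4 * b ^ (d + 2 - 0))) * U + g * b * (outerOf d n b * b ^ (d + 2 - 0) *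
    (outerOf d n b * b ^ (0 + 2) * (2 * (b ^ (0 + 2) * b ^ (d + 2 - 0)) * U +
      paddedSize d n b * (2 * b ^ (0 + 2) * U + b ^ (d + 2 - 0) * (4 * U + Q))))))

/-- The constant `Z` of the program is fixed before any setting exists, so the need is written out
in numbers; it agrees by definition. -/
theorem Setting.firstNeed_eq (T : Setting) : T.KN + (T.core (Nat.zero_le T.d)).mainWeight =
    firstNeed T.g T.d T.n T.b T.KN T.U T.Q := rfl

/-- The budget suffices for large side lengths. -/
theorem Setting.le_bud (T : Setting) {p K : ℕ} (hg : T.d * p + 4 * p + 3 ≤ T.g)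
    (hKN : T.KN = K * (12 * T.b ^ (T.d + 4) + 1) ^ p) (hK : K * 13 ^ p ≤ T.b) (hbg : 9 * T.g + 25 ≤ T.b)
    (hU : 1 ≤ T.U) (hUQ : T.U ≤ T.Q) (h : T.U * T.Q * T.b ^ 7 ≤ T.b ^ (T.d + 4)) :
    ∃ k, ∃ hk : k ≤ T.d, T.KN + (T.core hk).mainWeight ≤ T.bud := by
  obtain ⟨k, hk, h1, h2⟩ := exists_shape (by omega) hU hUQ h
  have hb := T.base.pos
  refine ⟨k, hk, le_trans ((Nat.le_div_iff_mul_le hb).2 ?_) (Nat.le_add_right _ _)⟩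
  refine (T.core hk).weight_mul_le (b := T.b) (g := T.g) h1 h2 hUQ rfl hbg ?_
  · change T.KN * T.b ^ 2 ≤ T.np ^ 3
    -- The preprocessing is polynomial in `b`, of degree `(d + 4) p`; since `b ^ g` is at most `np`,
    -- a large `g` makes it negligible.
    rw [hKN]
    have h0 : 1 ≤ T.b ^ (T.d + 4) := Nat.pow_pos hb
    calc K * (12 * T.b ^ (T.d + 4) + 1) ^ p * T.b ^ 2 ≤ K * (13 * T.b ^ (T.d + 4)) ^ p * T.b ^ 2 := by
          gcongr; omega
      _ = K * 13 ^ p * T.b ^ (T.d * p + 4 * p + 2) := by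
          rw [mul_pow, ← pow_mul, pow_add _ _ 2, show T.d * p + 4 * p = (T.d + 4) * p by ring]; ring
      _ ≤ T.b * T.b ^ (T.d * p + 4 * p + 2) := by gcongr
      _ = T.b ^ (T.d * p + 4 * p + 3) := by rw [← pow_succ']
      _ ≤ T.b ^ T.g := Nat.pow_le_pow_right hb hg
      _ ≤ T.np := T.base.pow_le.trans T.max_le_np
      _ ≤ _ := Nat.le_self_pow (by norm_num) _

/-- From `n < (b + 1) ^ g ≤ (2b) ^ g`, dividing by `b` saves a factor `n ^ (1/g)` up to a constant.
-/
theorem isBigO_time {g : ℕ} (hg : 1 ≤ g) {b : ℕ → ℕ} (hb : ∀ n, IsBase g n (b n)) (A : ℝ) :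
    (fun n : ℕ => A * ((max n 1 : ℕ) : ℝ) ^ 3 / b n) =O[atTop] fun n : ℕ => (n : ℝ) ^ (3 - 1 / (g : ℝ)) := by
  refine IsBigO.of_bound (2 * |A|) ?_
  filter_upwards [eventually_ge_atTop 1] with n hn
  have hn' : (1 : ℝ) ≤ n := by exact_mod_cast hn
  have hg' : (0 : ℝ) < g := by exact_mod_cast hg
  have hb1 : (1 : ℝ) ≤ b n := by exact_mod_cast (hb n).pos
  have hroot : (n : ℝ) ^ (1 / (g : ℝ)) ≤ 2 * b n := by
    have h1 : (n : ℝ) ≤ (2 * b n : ℝ) ^ g := by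
      have h2 := (hb n).lt_pow.le.trans (Nat.pow_le_pow_left (show b n + 1 ≤ 2 * b n by
        have := (hb n).pos; omega) g)
      exact_mod_cast h2
    calc (n : ℝ) ^ (1 / (g : ℝ)) ≤ ((2 * b n : ℝ) ^ g) ^ (1 / (g : ℝ)) :=
          Real.rpow_le_rpow (by positivity) h1 (by positivity)
      _ = 2 * b n := by
        rw [one_div, Real.pow_rpow_inv_natCast (by positivity) (by omega)]
  rw [max_eq_left hn, norm_div, norm_mul, Real.norm_eq_abs, Real.norm_of_nonneg (by positivity),
    Real.norm_of_nonneg (by positivity), Real.norm_of_nonneg (by positivity),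
    Real.rpow_sub (by positivity), div_le_iff₀ (by positivity)]
  have hpos : 0 < (n : ℝ) ^ (1 / (g : ℝ)) := by positivity
  have h3 : (n : ℝ) ^ (3 : ℝ) = (n : ℝ) ^ 3 := by exact_mod_cast Real.rpow_natCast (n : ℝ) 3
  rw [h3, ← mul_div_assoc, div_mul_eq_mul_div, le_div_iff₀ hpos]
  calc |A| * (n : ℝ) ^ 3 * (n : ℝ) ^ (1 / (g : ℝ)) ≤ |A| * (n : ℝ) ^ 3 * (2 * b n) := by gcongr
    _ = _ := by ring

end FineGrained

/-! ### The reduction from shortest paths -/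

namespace FineGrained

/-- A fast dynamic algorithm gives a fast algorithm for shortest paths. -/
theorem not_solvesDynamicMWM (hAPSP : APSPConjecture) {𝒞 : DrawingClass}
    (h𝒞 : 𝒞 ∈ ({bipartitePlane, gridGraphs} : Set DrawingClass)) {ε : ℝ} (hε : 0 < ε) (p : ℕ) :
    ∃ c : ℕ, ∀ (P : DynamicAlgorithm) (q u : ℕ → ℝ), SolvesDynamicMWM 𝒞 c p P q u →
      (∀ᶠ N in atTop, u N ≤ q N) →
      ¬ (fun N : ℕ => q N * u N) =O[atTop] fun N : ℕ => (N : ℝ) ^ (1 - ε) := by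
  classical
  -- The exponent `d + 4` of `b` in the size of the grid is chosen so large that the saving `N ^ ε`
  -- covers eight factors `b`.
  obtain ⟨d, hd⟩ : ∃ d : ℕ, 8 ≤ ((d + 4 : ℕ) : ℝ) * ε := by
    refine ⟨⌈8 / ε⌉₊, ?_⟩
    rw [← div_le_iff₀ hε]
    exact (Nat.le_ceil _).trans (by push_cast; linarith)
  -- The first bound makes the grid small compared with `n`; the second does the same for the
  -- preprocessing time.
  obtain ⟨g, hg1, hg2⟩ : ∃ g : ℕ, 2 * (d + 4) + 1 ≤ g ∧ d * p + 4 * p + 3 ≤ g :=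
    ⟨2 * (d + 4) + 1 + (d * p + 4 * p + 3), by omega, by omega⟩
  have hg0 : 1 ≤ g := by omega
  obtain ⟨c, hc⟩ := hAPSP (1 / (g : ℝ)) (by positivity)
  refine ⟨(g + 1) * (c + 1) + 4, fun P q u hP huq hO => ?_⟩
  obtain ⟨K, C, h⟩ := hP
  choose b hb using exists_isBase hg0
  have hsz : ∀ {b k : ℕ}, k ≤ d → 3 * b ^ (k + 2) * (4 * b ^ (d + 2 - k)) = 12 * b ^ (d + 4) := by
    intro b k hk
    rw [show d + 4 = k + 2 + (d + 2 - k) by omega, pow_add]; ring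
  have hu1 : ∀ b > 0, 1 ≤ u (12 * b ^ (d + 4)) := fun b hb => by
    rw [← hsz (Nat.zero_le d)]
    exact one_le_update h𝒞 h (Nat.pow_pos hb) (Nat.pow_pos hb)
  have hq1 : ∀ b > 0, 1 ≤ q (12 * b ^ (d + 4)) := fun b _ => by
    rw [← hsz (Nat.zero_le d)]
    exact one_le_query h𝒞 h _ _
  have hN : Tendsto (fun b : ℕ => 12 * b ^ (d + 4)) atTop atTop :=
    (tendsto_pow_atTop (by omega)).const_mul_atTop' (by norm_num)
  obtain ⟨b₀, hb₀⟩ := eventually_atTop.1 ((eventually_mul_le hε hd (by omega) hu1 hq1 hO).and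
    ((hN.eventually huq).and ((eventually_ge_atTop (K * 13 ^ p)).and (eventually_ge_atTop (9 * g + 25)))))
  let KN : ℕ → ℕ := fun n => K * (12 * b n ^ (d + 4) + 1) ^ p
  let U : ℕ → ℕ := fun n => ⌈u (12 * b n ^ (d + 4))⌉₊
  let Q : ℕ → ℕ := fun n => ⌈q (12 * b n ^ (d + 4))⌉₊
  -- The asymptotic assumptions say nothing about `b < b₀`, that is, about finitely many `n`. A
  -- constant added to the budget lets the shape `k = 0` succeed for these.
  let Z : ℕ := ∑ n ∈ Finset.range ((b₀ + 1) ^ g), firstNeed g d n (b n) (KN n) (U n) (Q n)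
  let S : ℕ := sizeBound + 10 * (g + d + c + 10)
  let κ : ℕ := 10 * S + 40 + P.maxDead
  refine hc (apspProg P g d c Z) (fun n => (8 * Setting.timeConst g d κ Z : ℕ) * ((max n 1 : ℕ) : ℝ) ^ 3 / b n)
    ⟨valueExp g c Z κ * (S + C), fun n w hw => ?_⟩ (isBigO_time hg0 hb _)
  let T : Setting := mkSetting P (d := d) (κ := κ) (KN := KN n) (U := U n) (Q := Q n) Z S C w hw (hb n)
    hg1 le_rfl le_rfl fun k hk ops ho W L hW hL => by
      have := grid_solves h𝒞 h _ _ ops ho hW hL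
      simp only [hsz hk] at this ⊢
      exact this
  obtain ⟨t, σ, hr, ht, hout⟩ := T.run
  have hbn := (hb n).pos
  refine ⟨t, σ, hr, ?_, ?_⟩
  · have h1 : t * b n ≤ 8 * Setting.timeConst g d κ Z * (max n 1) ^ 3 := by
      refine ht.trans ?_
      calc Setting.timeConst g d κ Z * T.np ^ 3 ≤ Setting.timeConst g d κ Z * (2 * max n 1) ^ 3 := by
            gcongr
            exact T.np_le
        _ = _ := by ring
    rw [le_div_iff₀ (by exact_mod_cast hbn)]
    exact_mod_cast h1
  · have hex : ∃ k, ∃ hk : k ≤ T.d, T.KN + (T.core hk).mainWeight ≤ T.bud := by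
      by_cases hlt : n < (b₀ + 1) ^ g
      · refine ⟨0, Nat.zero_le _, ?_⟩
        rw [T.firstNeed_eq]
        refine le_trans ?_ (Nat.le_add_left _ _)
        exact Finset.single_le_sum (f := fun n => firstNeed g d n (b n) (KN n) (U n) (Q n))
          (fun _ _ => Nat.zero_le _) (Finset.mem_range.2 hlt)
      · have hbb : b₀ ≤ b n := by
          by_contra hlt'
          exact hlt ((hb n).lt_pow.trans_le (Nat.pow_le_pow_left (by omega) _))
        obtain ⟨k1, k2, k3, k4⟩ := hb₀ _ hbb
        exact T.le_bud (p := p) (K := K) hg2 rfl k3 k4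
          (Nat.one_le_iff_ne_zero.2 (Nat.ceil_pos.2 (by have := hu1 _ hbn; linarith)).ne')
          (Nat.ceil_mono k2) k1
    obtain ⟨k, hk, hle⟩ := hex
    exact hout k hk hle

end FineGrained

theorem theorem3 (hAPSP : APSPConjecture) :
    ∀ 𝒞 ∈ ({bipartitePlane, gridGraphs} : Set DrawingClass), ∀ ε : ℝ, 0 < ε → ∀ p : ℕ,
      ∃ c : ℕ, ∀ (P : DynamicAlgorithm) (q u : ℕ → ℝ), SolvesDynamicMWM 𝒞 c p P q u →
        ¬ ((fun N : ℕ => max (q N) (u N)) =O[atTop] fun N : ℕ => (N : ℝ) ^ (1 / 2 - ε)) ∧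
        ¬ ((∀ᶠ N in atTop, u N ≤ q N) ∧
          (fun N : ℕ => q N * u N) =O[atTop] fun N : ℕ => (N : ℝ) ^ (1 - ε)) := by
  intro 𝒞 h𝒞 ε hε p
  obtain ⟨c, hc⟩ := not_solvesDynamicMWM hAPSP h𝒞 hε p
  refine ⟨c, fun P q u hP => ⟨fun hO => ?_, fun ⟨h₁, h₂⟩ => hc P q u hP h₁ h₂⟩⟩
  -- Both times are replaced by their maximum, so that the condition `u ≤ q` is trivial and the
  -- product is `O(N ^ (1 - 2ε))`.
  refine hc P _ _ (hP.mono (fun N => le_max_left (q N) (u N)) fun N => le_max_right (q N) (u N))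
    (Eventually.of_forall fun _ => le_rfl) ((hO.mul hO).trans (IsBigO.of_bound 1 ?_))
  filter_upwards [eventually_ge_atTop 1] with N hN
  have hN' : (1 : ℝ) ≤ N := by exact_mod_cast hN
  rw [one_mul, ← Real.rpow_add (by linarith), Real.norm_of_nonneg (by positivity),
    Real.norm_of_nonneg (by positivity)]
  exact Real.rpow_le_rpow_of_exponent_le hN' (by linarith)
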